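/- **Notation.** Write $X=(R,Z)\in\mathbb R^2$, $\rho=|X|=\sqrt{R^2+Z^2}$, $\{f,g\}=\partial_Rf\,\partial_Zg-\partial_Zf\,\partial_Rg$, $\mathcal L=\partial_R^2+\partial_Z^2+\frac12(R\partial_R+Z\partial_Z)+1$; $\mathcal P_0f$ is the average of $f$ over circles centred at $0$. For a function of $\beta$ (or $\delta$), $[\beta^k]$, $[\delta^k]$ denote coefficients of powers. $\mathcal Z$ is the set of $\eta:\mathbb R^2\to\mathbb R$ such that $e^{|X|^2/4}\eta$ is smooth and grows at most polynomially together with each of its derivatives. Let $\Omega_\epsilon=\{1+\epsilon R>0\}$, $F(s)=\int_0^{\pi/2}\frac{1-2\sin^2\psi}{\sqrt{\sin^2\psi+s/4}}\,d\psi$, $D^2=(R-R')^2+(Z-Z')^2$, and $$\mathrm{BS}^\epsilon[\eta](R,Z)=\frac1{2\pi}\int_{\Omega_\epsilon}K_\epsilon\,\eta(R',Z')\,dR'dZ',\qquad K_\epsilon=\sqrt{(1+\epsilon R)(1+\epsilon R')}\;F\Bigl(\frac{\epsilon^2D^2}{(1+\epsilon R)(1+\epsilon R')}\Bigr).$$ As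 $\epsilon\to0$ one has $K_\epsilon=(\log\frac1\epsilon+\log\frac8D)\sum_m\epsilon^mP_m+\sum_m\epsilon^mQ_m$, where $P_m,Q_m$ are homogeneous polynomials of degree $m$ in $R,R',Z-Z'$ (e.g. $P_1=-Q_1=\frac12(R+R')$, $P_2=\frac1{16}(R-R')^2+\frac3{16}(Z-Z')^2$, $Q_2=\frac14(R^2+R'^2)-\frac1{16}D^2$). Let $\mathrm{BS}_0$ be the integral operator on $\mathbb R^2$ with kernel $\frac1{2\pi}\log\frac8D$, and for $m\ge1$ let $\mathrm{BS}_m$ (depending on $\beta$) have kernel $\frac1{2\pi}\bigl((\beta+\log\frac8D)P_m+Q_m\bigr)$. Let $\eta_0=\frac1{4\pi}e^{-\rho^2/4}$, $\phi_0=\mathrm{BS}_0[\eta_0]$, $\Lambda\eta=\{\phi_0,\eta\}+\{\mathrm{BS}_0[\eta],\eta_0\}$. Denote by $\Lambda^{-1}f$ the unique $\eta\in\mathcal Z$ with $\mathcal P_0\eta=0$, $\int R\eta=\int Z\eta=0$, $\Lambda\eta=f$, and by $(\kappa-\mathcal L)^{-1}g$, $\kappa>0$, the unique solution in $\mathcal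 Z$ of $\kappa\eta-\mathcal L\eta=g$. Put $v=\frac34\log2+\frac14\gamma_E+\frac14$ ($\gamma_E$ is Euler's constant) and $b_0=\omega=\frac1{4\pi}(\beta-1+2v)$. **Profiles** (polynomials in $\beta$ and $\delta$); in what follows $\phi_m=\sum_{k=0}^m\mathrm{BS}_k[\eta_{m-k}]$. * $\eta_1=\eta_{10}+\delta\eta_{11}$ with $\eta_{10}=\Lambda^{-1}\bigl(\frac v{2\pi}\partial_Z\eta_0-\frac32(\partial_Z\phi_0)\eta_0-\frac12\phi_0\partial_Z\eta_0\bigr)$, $\eta_{11}=\Lambda^{-1}(\mathcal L-\frac12)\eta_{10}$. * $\mathcal R_2=\{\mathrm{BS}_1[\eta_1]+\mathrm{BS}_2[\eta_0],\eta_0\}+\{\phi_1,\eta_1\}+(\partial_Z\phi_1)\eta_0+(\partial_Z\phi_0)\eta_1-R\bigl(\{\phi_1,\eta_0\}+\{\phi_0,\eta_1\}+2(\partial_Z\phi_0)\eta_0\bigr)+\delta\partial_R(R\eta_0)-b_0\partial_Z\eta_1$, which equals $\frac{3\beta}{16\pi}RZ\eta_0$ plus a term $\mathcal R_2'$ independent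 of $\beta$. Then $\eta_2=\beta(\eta_{200}+\delta\eta_{201})+\eta_{210}+\delta\eta_{211}+\eta_{22}$ with $\eta_{200}=-\frac{3}{16\pi}\Lambda^{-1}(RZ\eta_0)$, $\eta_{201}=\Lambda^{-1}(\mathcal L-1)\eta_{200}$, $\eta_{210}=-\Lambda^{-1}[\delta^0]\mathcal R_2'$, $\eta_{211}=\Lambda^{-1}\bigl((\mathcal L-1)\eta_{210}+\frac12\eta_{200}-(1-\mathcal P_0)[\delta^1]\mathcal R_2'\bigr)$, $\eta_{22}=-(1-\mathcal L)^{-1}\mathcal P_0[\delta^1]\mathcal R_2'$. * $\mathcal R_3=\{\mathrm{BS}_1[\eta_2]+\mathrm{BS}_2[\eta_1]+\mathrm{BS}_3[\eta_0],\eta_0\}+\{\phi_2,\eta_1-R\eta_0\}+\{\phi_1,\eta_2-R\eta_1+R^2\eta_0\}-\{\phi_0,R\eta_2-R^2\eta_1+R^3\eta_0\}-(a_2+\delta)\partial_R\eta_0-(b_2-b_0)\partial_Z\eta_0-b_0\partial_Z\eta_2+\delta\partial_R(R\eta_1-R^2\eta_0)+\delta\eta_1$, where $a_2,b_2$ (functions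 of $\beta,\delta$) are determined by $\int R\,\mathcal R_3=\int Z\,\mathcal R_3=0$; and $\eta_3=-\sum_{k=0}^1\beta^k\Lambda^{-1}[\beta^k]\mathcal R_3|_{\delta=0}$. * $\mathcal R_4=\{\mathrm{BS}_1[\eta_3]+\mathrm{BS}_2[\eta_2]+\mathrm{BS}_3[\eta_1]+\mathrm{BS}_4[\eta_0],\eta_0\}+\{\phi_3,\eta_1-R\eta_0\}+\{\phi_2,\eta_2-R\eta_1+R^2\eta_0\}+\{\phi_1,\eta_3-R\eta_2+R^2\eta_1-R^3\eta_0\}-\{\phi_0,R\eta_3-R^2\eta_2+R^3\eta_1-R^4\eta_0\}-(a_2+\delta)\partial_R\eta_1-(b_2-b_0)\partial_Z\eta_1-b_0\partial_Z\eta_3+\delta\partial_R(R\eta_2-R^2\eta_1+R^3\eta_0)+2\delta\eta_2$, and $\eta_4=-\sum_{k=0}^2\beta^k\Lambda^{-1}[\beta^k]\mathcal R_4|_{\delta=0}+u$, where $u=\sum_{k=0}^2\beta^k\eta_{6k}$, $\eta_{6k}\in\mathcal Z$, solves $(2-\mathcal L-\frac12\partial_\beta)u+[\delta^1]\mathcal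 P_0\mathcal R_4=0$. **Approximate solution.** Fix $\sigma_0\in(0,1)$ and a smooth cut-off $\chi_0$ with values in $[0,1]$, $\chi_0(r)=1$ for $r\le1$, $\chi_0(r)=0$ for $r\ge2$. Below, $\beta=\log(1/\epsilon)$. Let $\eta_{\rm app}=\sum_{m=0}^4\epsilon^m\eta_m$, $\eta_*=\chi_0(\epsilon^{\sigma_0}\rho)\,\eta_{\rm app}$ and $\phi_*=\mathrm{BS}^\epsilon[\eta_*]$. For $\Gamma,r_0,\nu>0$ put $\delta=\nu/\Gamma$; let $\bar r(t)>0$, on an interval $[0,T)$, be the solution of $\dot{\bar r}=\frac{\Gamma}{r_0}\bigl(-\delta+\epsilon^2a_2\bigr)$, $\bar r(0)=r_0$, where $\epsilon=\epsilon(t)=\sqrt{\nu t}/\bar r(t)$, and let $\dot{\bar z}_*=\frac{\Gamma}{r_0}(b_0+\epsilon^2b_2)$. **The function $\Phi_\epsilon$.** Let $\mathrm{Ein}(x)=\int_0^x\frac{1-e^{-\tau}}\tau\,d\tau$ and, for $s>0$, $$\Phi_\epsilon(s)=\Phi_0(s)+\epsilon^2\Phi_2(s),\qquad \Phi_0(s)=\phi_0(0)-\frac\omega2-\frac1{4\pi}\mathrm{Ein}\Bigl(\log\frac1{4\pi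 s}\Bigr),$$ where $\Phi_2=\beta\Phi_{2a}+\Phi_{2b}$ and $\Phi_{2a},\Phi_{2b}:(0,\infty)\to\mathbb R$ are $C^2$ functions, independent of $\beta$, such that for all $\beta$, with $\delta=0$, $$\Phi_2(\eta_0)=\mathcal P_0\Bigl(\phi_2-\frac\omega2R^2-\Phi_0'(\eta_0)\bigl(\eta_2-R\eta_1+R^2\eta_0\bigr)-\frac12\Phi_0''(\eta_0)(\eta_1-R\eta_0)^2\Bigr)\qquad\text{on }\mathbb R^2.$$ (This determines $\Phi_2$ on $(0,\frac1{4\pi}]$, the range of $\eta_0$.) Finally let $$\Theta=\phi_*-\frac{\bar r\,\dot{\bar z}_*}{2\Gamma}(1+\epsilon R)^2-\Phi_\epsilon\Bigl(\frac{\eta_*}{1+\epsilon R}\Bigr).$$ **Proposition.** Functions $\Phi_{2a},\Phi_{2b}$ as above exist. Moreover there exist $\sigma_1\in(0,\sigma_0)$ and $N\in\mathbb N$ such that, for any choice of $\Phi_{2a},\Phi_{2b}$ as above and any $\gamma_3<3$, there are $C,\epsilon_0,\delta_0>0$ with the following property. For all $\Gamma,r_0,\nu>0$ and all $t\in(0,T)$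 such that $\delta<\delta_0$ and $\epsilon=\epsilon(t)<\epsilon_0$, the function $\Theta$ is differentiable at every point with $\rho\le\epsilon^{-\sigma_1}$, and $$|\partial_R\Theta|+|\partial_Z\Theta|\;\le\;C\bigl(\epsilon\delta+\epsilon^{\gamma_3}\bigr)(1+\rho)^N\qquad\text{for }\rho\le\epsilon^{-\sigma_1}.$$ -/

import Mathlib

open Real Set MeasureTheory
open scoped ContDiff

noncomputable section

namespace VortexRing

/-! ### Calculus in the plane, with coordinates `X = (R, Z)` -/

/-- `R`-coordinate, as a function on the plane. -/
def cR : ℝ × ℝ → ℝ := fun X => X.1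

/-- `Z`-coordinate, as a function on the plane. -/
def cZ : ℝ × ℝ → ℝ := fun X => X.2

/-- `ρ = (R² + Z²)^{1/2}` (the norm of the type `ℝ × ℝ` is the sup norm, so it is not used). -/
def rho (X : ℝ × ℝ) : ℝ := √(X.1 ^ 2 + X.2 ^ 2)

/-- `∂_R f`. -/
def dR (f : ℝ × ℝ → ℝ) : ℝ × ℝ → ℝ := fun X => deriv (fun r => f (r, X.2)) X.1

/-- `∂_Z f`. -/
def dZ (f : ℝ × ℝ → ℝ) : ℝ × ℝ → ℝ := fun X => deriv (fun z => f (X.1, z)) X.2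

/-- Poisson bracket `{f, g} = ∂_R f ∂_Z g - ∂_Z f ∂_R g`. -/
def pb (f g : ℝ × ℝ → ℝ) : ℝ × ℝ → ℝ := dR f * dZ g - dZ f * dR g

/-- Fokker-Planck operator `∂_R² + ∂_Z² + (R ∂_R + Z ∂_Z) / 2 + 1`. -/
def fokkerPlanck (f : ℝ × ℝ → ℝ) : ℝ × ℝ → ℝ :=
  dR (dR f) + dZ (dZ f) + (1 / 2 : ℝ) • (cR * dR f + cZ * dZ f) + f

/-- Average of `f` over circles centred at the origin: the projection `𝒫₀` onto radially
symmetric functions. -/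
def angMean (f : ℝ × ℝ → ℝ) : ℝ × ℝ → ℝ := fun X =>
  (1 / (2 * π)) * ∫ α in (0 : ℝ)..(2 * π),
    f (X.1 * cos α - X.2 * sin α, X.1 * sin α + X.2 * cos α)

/-- The space `𝒵`: functions `η` such that `e^{|X|²/4} η` is smooth and slowly growing
together with all its derivatives. -/
def InZ (η : ℝ × ℝ → ℝ) : Prop :=
  Function.HasTemperateGrowth fun X : ℝ × ℝ => exp ((X.1 ^ 2 + X.2 ^ 2) / 4) * η X

/-! ### The Biot-Savart law and its expansion -/

/-- `F(s) = ∫_0^{π/2} (1 - 2 sin² ψ) / (sin² ψ + s/4)^{1/2} dψ`. -/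
def kerF (s : ℝ) : ℝ :=
  ∫ ψ in (0 : ℝ)..(π / 2), (1 - 2 * sin ψ ^ 2) / √(sin ψ ^ 2 + s / 4)

/-- `D² = (R - R')² + (Z - Z')²`. -/
def distSq (X Y : ℝ × ℝ) : ℝ := (X.1 - Y.1) ^ 2 + (X.2 - Y.2) ^ 2

/-- The half-plane `Ω_ε = {1 + ε R > 0}`. -/
def halfPlane (ε : ℝ) : Set (ℝ × ℝ) := {X | 0 < 1 + ε * X.1}

/-- The rescaled Biot-Savart operator `BS^ε`. -/
def BSeps (ε : ℝ) (η : ℝ × ℝ → ℝ) : ℝ × ℝ → ℝ := fun X =>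
  (1 / (2 * π)) * ∫ Y in halfPlane ε,
    √((1 + ε * X.1) * (1 + ε * Y.1))
      * kerF (ε ^ 2 * distSq X Y / ((1 + ε * X.1) * (1 + ε * Y.1))) * η Y

/-- The polynomials `P_m`, `m ≤ 4`, of the expansion
`K_ε = (β_ε + log (8/D)) ∑ ε^m P_m + ∑ ε^m Q_m` of the Biot-Savart kernel.
Only the values for `m ≤ 4` are used. -/
def polP : ℕ → ℝ × ℝ → ℝ × ℝ → ℝ
  | 0, _, _ => 1
  | 1, (R, _), (R', _) => (R + R') / 2
  | 2, (R, Z), (R', Z') => (R - R') ^ 2 / 16 + 3 / 16 * (Z - Z') ^ 2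
  | 3, (R, Z), (R', Z') => -(1 / 32) * (R + R') * ((R - R') ^ 2 + 3 * (Z - Z') ^ 2)
  | 4, (R, Z), (R', Z') =>
      -(15 / 1024) * (Z - Z') ^ 4 + 21 / 512 * (R - R') ^ 2 * (Z - Z') ^ 2
        + 3 / 16 * (R * R') * (Z - Z') ^ 2 + 17 / 1024 * (R ^ 2 - R' ^ 2) ^ 2
        - 1 / 256 * (R * R') * (R - R') ^ 2
  | _, _, _ => 0

/-- The polynomials `Q_m`, `m ≤ 4`, of the same expansion. -/
def polQ : ℕ → ℝ × ℝ → ℝ × ℝ → ℝ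
  | 0, _, _ => -2
  | 1, (R, _), (R', _) => -((R + R') / 2)
  | 2, (R, Z), (R', Z') => (R ^ 2 + R' ^ 2) / 4 - ((R - R') ^ 2 + (Z - Z') ^ 2) / 16
  | 3, (R, Z), (R', Z') => -(1 / 48) * (R + R') * ((R + R') ^ 2 - 6 * (Z - Z') ^ 2)
  | 4, (R, Z), (R', Z') =>
      31 / 2048 * (Z - Z') ^ 4 - 89 / 1024 * (R + R') ^ 2 * (Z - Z') ^ 2
        + 1 / 256 * (R * R') * (Z - Z') ^ 2 - 19 / 6144 * (R ^ 2 - R' ^ 2) ^ 2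
        + 35 / 1536 * (R * R') * (R + R') ^ 2 - 1 / 128 * R ^ 2 * R' ^ 2
  | _, _, _ => 0

/-- `BS_0 = L / (2π)`, with the kernel `log (8/D)` on the whole plane. -/
def BS0 (η : ℝ × ℝ → ℝ) : ℝ × ℝ → ℝ := fun X =>
  (1 / (2 * π)) * ∫ Y, log (8 / √(distSq X Y)) * η Y

/-- `BS_m = (β P_m + L P_m + Q_m) / (2π)` for `1 ≤ m ≤ 4`; here `β` stands for
`β_ε = log (1/ε)`. -/
def BS (β : ℝ) (m : ℕ) (η : ℝ × ℝ → ℝ) : ℝ × ℝ → ℝ := fun X =>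
  (1 / (2 * π)) * ∫ Y,
    ((β + log (8 / √(distSq X Y))) * polP m X Y + polQ m X Y) * η Y

/-! ### The leading order and the linear operators -/

/-- `η₀`. -/
def eta0 : ℝ × ℝ → ℝ := fun X => 1 / (4 * π) * exp (-(X.1 ^ 2 + X.2 ^ 2) / 4)

/-- `φ₀`. -/
def phi0 : ℝ × ℝ → ℝ := BS0 eta0

/-- `Λ η = {φ₀, η} + {BS_0 η, η₀}`. -/
def Lam (η : ℝ × ℝ → ℝ) : ℝ × ℝ → ℝ := pb phi0 η + pb (BS0 η) eta0

/-- `η ∈ 𝒵 ∩ Ker(Λ)^⊥` and `Λ η = f`. As `Ker Λ` consists of the radially symmetric functions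
and of the combinations of `∂_R η₀`, `∂_Z η₀`, orthogonality (in the weighted space with
weight `e^{|X|²/4}`) means zero angular averages and zero first order moments. -/
def IsLamSol (f η : ℝ × ℝ → ℝ) : Prop :=
  InZ η ∧ angMean η = 0 ∧ (∫ X, cR X * η X) = 0 ∧ (∫ X, cZ X * η X) = 0 ∧ Lam η = f

open Classical in
/-- The inverse of `Λ` on `𝒵 ∩ Ker(Λ)^⊥` (the solution is unique; value `0` if there is none). -/
def lamInv (f : ℝ × ℝ → ℝ) : ℝ × ℝ → ℝ :=
  if h : ∃ η, IsLamSol f η then h.choose else 0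

open Classical in
/-- `(κ - ℒ)⁻¹` in `𝒵`, for `κ > 0` (the solution is unique; value `0` if there is none). -/
def fpInv (κ : ℝ) (g : ℝ × ℝ → ℝ) : ℝ × ℝ → ℝ :=
  if h : ∃ η, InZ η ∧ κ • η - fokkerPlanck η = g then h.choose else 0

/-! ### The approximate solution

The profiles `η_m`, `φ_m` are polynomials in `β = log (1/ε)` and `δ`, with coefficients that
are functions on the plane; `t ∂_t` acts on them, to leading order, as `-(1/2) ∂_β`.
For `m ≥ 1` the profile `η_m` solves `Λ η_m + δ (t ∂_t + m/2 - ℒ) η_m + ℛ_m = 0` up to the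
relevant power of `δ`. The velocities are normalized by the factor `Γ / r₀`. -/

/-- The constant `v`. -/
def cv : ℝ := 3 / 4 * log 2 + 1 / 4 * eulerMascheroniConstant + 1 / 4

/-- Leading order vertical speed `r₀ ż₀ / Γ = (β - 1 + 2v) / (4π)`, also denoted by `ω`. -/
def b0 (β : ℝ) : ℝ := (β - 1 + 2 * cv) / (4 * π)

/-! First order: `η₁ = η₁₀ + δ η₁₁`. -/

def eta10 : ℝ × ℝ → ℝ :=
  lamInv ((cv / (2 * π)) • dZ eta0 - (3 / 2 : ℝ) • (dZ phi0 * eta0)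
    - (1 / 2 : ℝ) • (phi0 * dZ eta0))

def eta11 : ℝ × ℝ → ℝ := lamInv (fokkerPlanck eta10 - (1 / 2 : ℝ) • eta10)

def eta1 (δ : ℝ) : ℝ × ℝ → ℝ := eta10 + δ • eta11

def phi1 (β δ : ℝ) : ℝ × ℝ → ℝ := BS0 (eta1 δ) + BS β 1 eta0

/-! Second order. -/

/-- `ℛ₂`. -/
def source2 (β δ : ℝ) : ℝ × ℝ → ℝ :=
  pb (BS β 1 (eta1 δ) + BS β 2 eta0) eta0
    + pb (phi1 β δ) (eta1 δ) + dZ (phi1 β δ) * eta0 + dZ phi0 * eta1 δ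
    - cR * (pb (phi1 β δ) eta0 + pb phi0 (eta1 δ) + (2 : ℝ) • (dZ phi0 * eta0))
    + δ • dR (cR * eta0) - b0 β • dZ (eta1 δ)

/-- Coefficient of `δ` in `ℛ₂ - (3β/16π) R Z η₀`, a quantity that does not depend on `β` and
is therefore evaluated at `β = 0`. -/
def source2δ : ℝ × ℝ → ℝ := fun X => deriv (fun δ => source2 0 δ X) 0

/-- Coefficient of `β` in `η₂`, at order `δ⁰`. -/
def eta200 : ℝ × ℝ → ℝ := lamInv (-((3 / (16 * π)) • (cR * cZ * eta0)))

/-- Coefficient of `β` in `η₂`, at order `δ¹`. -/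
def eta201 : ℝ × ℝ → ℝ := lamInv (fokkerPlanck eta200 - eta200)

/-- Coefficient of `β⁰` in `η₂`, nonradial part, at order `δ⁰`. -/
def eta210 : ℝ × ℝ → ℝ := lamInv (-source2 0 0)

/-- Coefficient of `β⁰` in `η₂`, nonradial part, at order `δ¹`. -/
def eta211 : ℝ × ℝ → ℝ :=
  lamInv (fokkerPlanck eta210 - eta210 + (1 / 2 : ℝ) • eta200 - (source2δ - angMean source2δ))

/-- Radially symmetric part of `η₂`. -/
def eta22 : ℝ × ℝ → ℝ := fpInv 1 (-angMean source2δ)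

def eta2 (β δ : ℝ) : ℝ × ℝ → ℝ :=
  β • (eta200 + δ • eta201) + (eta210 + δ • eta211) + eta22

def phi2 (β δ : ℝ) : ℝ × ℝ → ℝ := BS0 (eta2 β δ) + BS β 1 (eta1 δ) + BS β 2 eta0

/-! Third order. -/

/-- `ℛ₃` without the terms that involve `ṙ₂ - ṙ₀` and `ż₂ - ż₀`. -/
def source3pre (β δ : ℝ) : ℝ × ℝ → ℝ :=
  pb (BS β 1 (eta2 β δ) + BS β 2 (eta1 δ) + BS β 3 eta0) eta0
    + pb (phi2 β δ) (eta1 δ - cR * eta0)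
    + pb (phi1 β δ) (eta2 β δ - cR * eta1 δ + cR ^ 2 * eta0)
    - pb phi0 (cR * eta2 β δ - cR ^ 2 * eta1 δ + cR ^ 3 * eta0)
    - b0 β • dZ (eta2 β δ)
    + δ • dR (cR * eta1 δ - cR ^ 2 * eta0) + δ • eta1 δ

/-- Normalized radial velocity `r₀ ṙ₂ / Γ`; together with `b2` it is the value for which `ℛ₃`
has vanishing first order moments. Recall that `r₀ ṙ₀ / Γ = -δ`. -/
def a2 (β δ : ℝ) : ℝ := -δ - ∫ X, cR X * source3pre β δ X

/-- Normalized vertical velocity `r₀ ż₂ / Γ`. -/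
def b2 (β δ : ℝ) : ℝ := b0 β - ∫ X, cZ X * source3pre β δ X

/-- `ℛ₃`. -/
def source3 (β δ : ℝ) : ℝ × ℝ → ℝ :=
  source3pre β δ - ((a2 β δ + δ) • dR eta0 + (b2 β δ - b0 β) • dZ eta0)

/-- Coefficient of `β^k` in a function of `β` that is polynomial. -/
def coeffβ (k : ℕ) (G : ℝ → ℝ × ℝ → ℝ) : ℝ × ℝ → ℝ := fun X =>
  iteratedDeriv k (fun β => G β X) 0 / (k.factorial : ℝ)

def eta3 (β : ℝ) : ℝ × ℝ → ℝ :=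
  β • lamInv (-coeffβ 1 fun β' => source3 β' 0) + lamInv (-coeffβ 0 fun β' => source3 β' 0)

def phi3 (β δ : ℝ) : ℝ × ℝ → ℝ :=
  BS0 (eta3 β) + BS β 1 (eta2 β δ) + BS β 2 (eta1 δ) + BS β 3 eta0

/-! Fourth order. -/

/-- `ℛ₄`. -/
def source4 (β δ : ℝ) : ℝ × ℝ → ℝ :=
  pb (BS β 1 (eta3 β) + BS β 2 (eta2 β δ) + BS β 3 (eta1 δ) + BS β 4 eta0) eta0
    + pb (phi3 β δ) (eta1 δ - cR * eta0)
    + pb (phi2 β δ) (eta2 β δ - cR * eta1 δ + cR ^ 2 * eta0)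
    + pb (phi1 β δ) (eta3 β - cR * eta2 β δ + cR ^ 2 * eta1 δ - cR ^ 3 * eta0)
    - pb phi0 (cR * eta3 β - cR ^ 2 * eta2 β δ + cR ^ 3 * eta1 δ - cR ^ 4 * eta0)
    - ((a2 β δ + δ) • dR (eta1 δ) + (b2 β δ - b0 β) • dZ (eta1 δ) + b0 β • dZ (eta3 β))
    + δ • dR (cR * eta2 β δ - cR ^ 2 * eta1 δ + cR ^ 3 * eta0)
    + (2 * δ) • eta2 β δ

/-- The coefficient of `δ` in `𝒫₀ ℛ₄`, as a function of `β`. -/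
def source4rad (β : ℝ) : ℝ × ℝ → ℝ := angMean fun X => deriv (fun δ => source4 β δ X) 0

/-! The radial part `∑ β^k η_{6k}` of `η₄` solves `(2 - ℒ - (1/2) ∂_β) u + S = 0`, where `S` is
the coefficient of `δ` in `𝒫₀ ℛ₄`. -/

def eta62 : ℝ × ℝ → ℝ := fpInv 2 (-coeffβ 2 source4rad)

def eta61 : ℝ × ℝ → ℝ := fpInv 2 (eta62 - coeffβ 1 source4rad)

def eta60 : ℝ × ℝ → ℝ := fpInv 2 ((1 / 2 : ℝ) • eta61 - coeffβ 0 source4rad)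

def eta4 (β : ℝ) : ℝ × ℝ → ℝ :=
  (∑ k ∈ Finset.range 3, β ^ k • lamInv (-coeffβ k fun β' => source4 β' 0))
    + (eta60 + β • eta61 + β ^ 2 • eta62)

/-! The full approximation. -/

/-- `η_app`, of order `M = 4`. -/
def etaApp (ε δ : ℝ) : ℝ × ℝ → ℝ :=
  eta0 + ε • eta1 δ + ε ^ 2 • eta2 (log (1 / ε)) δ + ε ^ 3 • eta3 (log (1 / ε))
    + ε ^ 4 • eta4 (log (1 / ε))

/-- Cut-off functions: smooth, with values in `[0,1]`, equal to `1` for `r ≤ 1` and to `0`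
for `r ≥ 2`. -/
structure IsCutoff (χ : ℝ → ℝ) : Prop where
  smooth : ContDiff ℝ ∞ χ
  mem_Icc : ∀ r, χ r ∈ Icc (0 : ℝ) 1
  eq_one : ∀ r, r ≤ 1 → χ r = 1
  eq_zero : ∀ r, 2 ≤ r → χ r = 0

/-- `η_* = χ₀(ε^{σ₀} ρ) η_app`. -/
def etaStar (σ₀ : ℝ) (χ₀ : ℝ → ℝ) (ε δ : ℝ) : ℝ × ℝ → ℝ := fun X =>
  χ₀ (ε ^ σ₀ * rho X) * etaApp ε δ X

/-- `φ_* = BS^ε[η_*]`. -/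
def phiStar (σ₀ : ℝ) (χ₀ : ℝ → ℝ) (ε δ : ℝ) : ℝ × ℝ → ℝ := BSeps ε (etaStar σ₀ χ₀ ε δ)

/-- The radial velocity `ṙ₀ + ε² ṙ₂(β_ε)`. -/
def rDot (Γ r₀ δ ε : ℝ) : ℝ := Γ / r₀ * (-δ + ε ^ 2 * a2 (log (1 / ε)) δ)

/-- The vertical velocity `ż_* = ż₀(β_ε) + ε² ż₂(β_ε)`. -/
def zDotStar (Γ r₀ δ ε : ℝ) : ℝ :=
  Γ / r₀ * (b0 (log (1 / ε)) + ε ^ 2 * b2 (log (1 / ε)) δ)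

/-- `rbar` is the radius of the vortex ring on the time interval `[0, T)`: the positive solution
of `r̄' = ṙ₀ + ε² ṙ₂(β_ε)` with `ε(t) = (ν t)^{1/2} / r̄(t)` and `r̄(0) = r₀`. -/
structure IsRadius (Γ r₀ ν T : ℝ) (rbar : ℝ → ℝ) : Prop where
  cont : ContinuousOn rbar (Ico 0 T)
  init : rbar 0 = r₀
  pos : ∀ t ∈ Ioo 0 T, 0 < rbar t
  ode : ∀ t ∈ Ioo 0 T, HasDerivAt rbar (rDot Γ r₀ (ν / Γ) (√(ν * t) / rbar t)) t

/-! ### The function `Φ_ε` and the remainder `Θ` -/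

/-- `Ein(x) = ∫_0^x (1 - e^{-t}) / t dt`. -/
def Ein (x : ℝ) : ℝ := ∫ t in (0 : ℝ)..x, (1 - exp (-t)) / t

/-- `Φ₀(s) = φ₀(0) - ω/2 - Ein(log(1/(4πs))) / (4π)`, for `s > 0`, with `ω = b0 β`. -/
def Phi0 (β s : ℝ) : ℝ := phi0 0 - b0 β / 2 - 1 / (4 * π) * Ein (log (1 / (4 * π * s)))

/-- The terms of order `ε²`, without `Φ₂(η₀)`, in the relation between the stream function and
the potential vorticity when `δ = 0`:
`φ₂ - (ω/2) R² - Φ₀'(η₀) (η₂ - R η₁ + R² η₀) - (1/2) Φ₀''(η₀) (η₁ - R η₀)²`. -/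
def secondOrder (β : ℝ) : ℝ × ℝ → ℝ := fun X =>
  phi2 β 0 X - b0 β / 2 * X.1 ^ 2
    - deriv (Phi0 β) (eta0 X) * (eta2 β 0 X - X.1 * eta1 0 X + X.1 ^ 2 * eta0 X)
    - 1 / 2 * deriv (deriv (Phi0 β)) (eta0 X) * (eta1 0 X - X.1 * eta0 X) ^ 2

/-- `Φ₂(s) = β Φ₂ₐ(s) + Φ₂ᵦ(s)` is a correction of order `ε²`: `Φ₂(η₀)` is the radially symmetric
part of the terms of order `ε²`. This determines `Φ₂` on `(0, 1/(4π)]`, the range of `η₀`; for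
larger `s` (where the argument of `Φ_ε` may fall, when it slightly exceeds the maximum of `η₀`)
it is any `C²` continuation, affine in `β`. -/
structure IsPhi2 (Φa Φb : ℝ → ℝ) : Prop where
  regA : ContDiffOn ℝ 2 Φa (Ioi 0)
  regB : ContDiffOn ℝ 2 Φb (Ioi 0)
  eq : ∀ (β : ℝ) (X : ℝ × ℝ),
    β * Φa (eta0 X) + Φb (eta0 X) = angMean (secondOrder β) X

/-- `Φ_ε = Φ₀ + ε² Φ₂`. -/
def PhiEps (Φa Φb : ℝ → ℝ) (ε s : ℝ) : ℝ :=
  Phi0 (log (1 / ε)) s + ε ^ 2 * (log (1 / ε) * Φa s + Φb s)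

/-- `Θ = φ_* - (r̄ ż_* / 2Γ) (1 + ε R)² - Φ_ε(η_* / (1 + ε R))`, where `rb` is the value of `r̄`
at the time under consideration. -/
def Theta (σ₀ : ℝ) (χ₀ Φa Φb : ℝ → ℝ) (Γ r₀ δ ε rb : ℝ) : ℝ × ℝ → ℝ := fun X =>
  phiStar σ₀ χ₀ ε δ X - rb * zDotStar Γ r₀ δ ε / (2 * Γ) * (1 + ε * X.1) ^ 2
    - PhiEps Φa Φb ε (etaStar σ₀ χ₀ ε δ X / (1 + ε * X.1))

end VortexRing

end

open Real Set MeasureTheory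
open scoped ContDiff

local notation "ℝ²" => ℝ × ℝ
local notation "⟪" X "⟫" => 1 + ‖X‖
local notation "polar[" r "; " θ "]" => (r * cos θ, r * sin θ)

noncomputable section

namespace VortexRing

variable {f g η : ℝ² → ℝ} {X : ℝ²}

/-! ### Partial derivatives -/

lemma hasDerivAt_slice_fst {f' : ℝ² →L[ℝ] ℝ}
    (h : HasFDerivAt f f' X) : HasDerivAt (fun r => f (r, X.2)) (f' (1, 0)) X.1 :=
  HasFDerivAt.comp_hasDerivAt (f := fun r : ℝ => (r, X.2)) X.1 h
    ((hasDerivAt_id X.1).prodMk (hasDerivAt_const X.1 X.2))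

lemma hasDerivAt_slice_snd {f' : ℝ² →L[ℝ] ℝ}
    (h : HasFDerivAt f f' X) : HasDerivAt (fun z => f (X.1, z)) (f' (0, 1)) X.2 :=
  HasFDerivAt.comp_hasDerivAt (f := fun z : ℝ => (X.1, z)) X.2 h
    ((hasDerivAt_const X.2 X.1).prodMk (hasDerivAt_id X.2))

lemma dR_of_hasFDerivAt {f' : ℝ² →L[ℝ] ℝ}
    (h : HasFDerivAt f f' X) : dR f X = f' (1, 0) := (hasDerivAt_slice_fst h).deriv

lemma dZ_of_hasFDerivAt {f' : ℝ² →L[ℝ] ℝ}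
    (h : HasFDerivAt f f' X) : dZ f X = f' (0, 1) := (hasDerivAt_slice_snd h).deriv

/-- The linear form with the given coefficients. -/
def lin (a b : ℝ) : ℝ² →L[ℝ] ℝ := a • ContinuousLinearMap.fst ℝ ℝ ℝ + b • ContinuousLinearMap.snd ℝ ℝ ℝ

@[simp] lemma lin_apply (a b : ℝ) (v : ℝ²) : lin a b v = a * v.1 + b * v.2 := by simp [lin]

lemma clm_eq_lin (L : ℝ² →L[ℝ] ℝ) : L = lin (L (1, 0)) (L (0, 1)) := by ext <;> simp

lemma hasFDerivAt_lin (h : DifferentiableAt ℝ f X) :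
    HasFDerivAt f (lin (dR f X) (dZ f X)) X := by
  rw [dR_of_hasFDerivAt h.hasFDerivAt, dZ_of_hasFDerivAt h.hasFDerivAt, ← clm_eq_lin]
  exact h.hasFDerivAt

lemma fderiv_eq_lin (h : Differentiable ℝ f) :
    fderiv ℝ f = fun X => lin (dR f X) (dZ f X) :=
  funext fun X => (hasFDerivAt_lin (h X)).fderiv

lemma norm_lin_le (a b : ℝ) : ‖lin a b‖ ≤ |a| + |b| := by
  refine ContinuousLinearMap.opNorm_le_bound _ (by positivity) fun v => ?_
  rw [lin_apply, Real.norm_eq_abs]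
  calc |a * v.1 + b * v.2| ≤ |a| * |v.1| + |b| * |v.2| := by rw [← abs_mul, ← abs_mul]; exact abs_add_le _ _
    _ ≤ |a| * ‖v‖ + |b| * ‖v‖ := by
        gcongr
        · exact norm_fst_le v
        · exact norm_snd_le v
    _ = _ := by ring

lemma abs_le_norm_lin (a b : ℝ) : |a| ≤ ‖lin a b‖ ∧ |b| ≤ ‖lin a b‖ := by
  constructor
  · have := (lin a b).le_opNorm (1, 0); simpa using this
  · have := (lin a b).le_opNorm (0, 1); simpa using this

section rules

lemma dR_add (hf : Differentiable ℝ f) (hg : Differentiable ℝ g) : dR (f + g) = dR f + dR g := by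
  ext X; rw [dR_of_hasFDerivAt ((hasFDerivAt_lin (hf X)).add (hasFDerivAt_lin (hg X)))]; simp
lemma dZ_add (hf : Differentiable ℝ f) (hg : Differentiable ℝ g) : dZ (f + g) = dZ f + dZ g := by
  ext X; rw [dZ_of_hasFDerivAt ((hasFDerivAt_lin (hf X)).add (hasFDerivAt_lin (hg X)))]; simp
lemma dR_sub (hf : Differentiable ℝ f) (hg : Differentiable ℝ g) : dR (f - g) = dR f - dR g := by
  ext X; rw [dR_of_hasFDerivAt ((hasFDerivAt_lin (hf X)).sub (hasFDerivAt_lin (hg X)))]; simp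
lemma dZ_sub (hf : Differentiable ℝ f) (hg : Differentiable ℝ g) : dZ (f - g) = dZ f - dZ g := by
  ext X; rw [dZ_of_hasFDerivAt ((hasFDerivAt_lin (hf X)).sub (hasFDerivAt_lin (hg X)))]; simp
lemma dR_neg : dR (-f) = -dR f := by ext X; simp [dR, deriv.fun_neg]
lemma dZ_neg : dZ (-f) = -dZ f := by ext X; simp [dZ, deriv.fun_neg]
lemma dR_smul (c : ℝ) : dR (c • f) = c • dR f := by ext X; simp [dR]
lemma dZ_smul (c : ℝ) : dZ (c • f) = c • dZ f := by ext X; simp [dZ]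
lemma dR_mul (hf : Differentiable ℝ f) (hg : Differentiable ℝ g) :
    dR (f * g) = dR f * g + f * dR g := by
  ext X; rw [dR_of_hasFDerivAt ((hasFDerivAt_lin (hf X)).mul (hasFDerivAt_lin (hg X)))]
  simp; ring
lemma dZ_mul (hf : Differentiable ℝ f) (hg : Differentiable ℝ g) :
    dZ (f * g) = dZ f * g + f * dZ g := by
  ext X; rw [dZ_of_hasFDerivAt ((hasFDerivAt_lin (hf X)).mul (hasFDerivAt_lin (hg X)))]
  simp; ring
end rules

@[simp] lemma dR_cR : dR cR = 1 := by ext X; simp [dR, cR]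
@[simp] lemma dZ_cR : dZ cR = 0 := by ext X; simp [dZ, cR]
@[simp] lemma dR_cZ : dR cZ = 0 := by ext X; simp [dR, cZ]
@[simp] lemma dZ_cZ : dZ cZ = 1 := by ext X; simp [dZ, cZ]

/-! ### Temperate growth through partial derivatives -/

/-- Polynomially bounded functions. -/
def PB (f : ℝ² → ℝ) : Prop := ∃ (k : ℕ) (C : ℝ), 0 ≤ C ∧ ∀ X, |f X| ≤ C * ⟪X⟫ ^ k

lemma one_le_jb (X : ℝ²) : 1 ≤ 1 + ‖X‖ := by linarith [norm_nonneg X]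

lemma PB.of_le {k : ℕ} {C : ℝ} (h : ∀ X, |f X| ≤ C * ⟪X⟫ ^ k) : PB f := ⟨k, |C|, abs_nonneg _, fun X => (h X).trans (by gcongr; exact le_abs_self C)⟩

lemma PB.add (hf : PB f) (hg : PB g) : PB (f + g) := by
  obtain ⟨k, C, hC, h⟩ := hf
  obtain ⟨l, D, hD, h'⟩ := hg
  refine ⟨k + l, C + D, by positivity, fun X => ?_⟩
  have h1 := one_le_jb X
  calc |(f + g) X| ≤ |f X| + |g X| := abs_add_le _ _
    _ ≤ C * ⟪X⟫ ^ k + D * ⟪X⟫ ^ l := add_le_add (h X) (h' X)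
    _ ≤ C * ⟪X⟫ ^ (k + l) + D * ⟪X⟫ ^ (k + l) := by gcongr <;> first | exact h1 | omega
    _ = _ := by ring

lemma PB.mul (hf : PB f) (hg : PB g) : PB (f * g) := by
  obtain ⟨k, C, hC, h⟩ := hf
  obtain ⟨l, D, hD, h'⟩ := hg
  refine ⟨k + l, C * D, by positivity, fun X => ?_⟩
  rw [Pi.mul_apply, abs_mul, pow_add]
  calc |f X| * |g X| ≤ (C * ⟪X⟫ ^ k) * (D * ⟪X⟫ ^ l) := mul_le_mul (h X) (h' X) (abs_nonneg _) (by positivity)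
    _ = _ := by ring

/-- `n` times differentiable functions, with all derivatives up to order `n` continuous and
polynomially bounded. -/
def Tmp : ℕ → (ℝ² → ℝ) → Prop
  | 0, f => Continuous f ∧ PB f
  | n + 1, f => Differentiable ℝ f ∧ PB f ∧ Tmp n (dR f) ∧ Tmp n (dZ f)

lemma Tmp.pb : ∀ {n : ℕ} {f : ℝ² → ℝ}, Tmp n f → PB f
  | 0, _, h => h.2
  | _ + 1, _, h => h.2.1

lemma Tmp.continuous : ∀ {n : ℕ} {f : ℝ² → ℝ}, Tmp n f → Continuous f
  | 0, _, h => h.1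
  | _ + 1, _, h => h.1.continuous

lemma Tmp.of_succ : ∀ {n : ℕ} {f : ℝ² → ℝ}, Tmp (n + 1) f → Tmp n f
  | 0, _, h => ⟨h.1.continuous, h.2.1⟩
  | _ + 1, _, h => ⟨h.1, h.2.1, h.2.2.1.of_succ, h.2.2.2.of_succ⟩

lemma Tmp.add : ∀ {n : ℕ} {f g : ℝ² → ℝ}, Tmp n f → Tmp n g → Tmp n (f + g)
  | 0, _, _, h, h' => ⟨h.1.add h'.1, h.2.add h'.2⟩
  | n + 1, f, g, h, h' => by
    refine ⟨h.1.add h'.1, h.2.1.add h'.2.1, ?_, ?_⟩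
    · rw [dR_add h.1 h'.1]; exact h.2.2.1.add h'.2.2.1
    · rw [dZ_add h.1 h'.1]; exact h.2.2.2.add h'.2.2.2

lemma Tmp.mul : ∀ {n : ℕ} {f g : ℝ² → ℝ}, Tmp n f → Tmp n g → Tmp n (f * g)
  | 0, _, _, h, h' => ⟨h.1.mul h'.1, h.2.mul h'.2⟩
  | n + 1, f, g, h, h' => by
    refine ⟨h.1.mul h'.1, h.2.1.mul h'.2.1, ?_, ?_⟩
    · rw [dR_mul h.1 h'.1]; exact (h.2.2.1.mul h'.of_succ).add (h.of_succ.mul h'.2.2.1)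
    · rw [dZ_mul h.1 h'.1]; exact (h.2.2.2.mul h'.of_succ).add (h.of_succ.mul h'.2.2.2)

lemma Tmp.of_hasTemperateGrowth : ∀ {n : ℕ} {f : ℝ² → ℝ}, f.HasTemperateGrowth → Tmp n f
  | n, f, h => by
    have hd : Differentiable ℝ f := h.1.differentiable (by simp)
    have hpb : PB f := by
      obtain ⟨k, C, hC⟩ := h.2 0
      exact PB.of_le (k := k) (C := C) fun X => by simpa using hC X
    cases n with
    | zero => exact ⟨hd.continuous, hpb⟩
    | succ n =>
      have hfd : (fderiv ℝ f).HasTemperateGrowth := by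
        refine ⟨(contDiff_infty_iff_fderiv.1 h.1).2, fun n => ?_⟩
        obtain ⟨k, C, hC⟩ := h.2 (n + 1)
        exact ⟨k, C, fun X => by simpa [norm_iteratedFDeriv_fderiv] using hC X⟩
      have key (v : ℝ²) : (fun X => fderiv ℝ f X v).HasTemperateGrowth := (ContinuousLinearMap.apply ℝ ℝ v).hasTemperateGrowth.comp hfd
      refine ⟨hd, hpb, .of_hasTemperateGrowth ?_, .of_hasTemperateGrowth ?_⟩
      · convert key (1, 0) using 2 with X
        exact dR_of_hasFDerivAt (hd X).hasFDerivAt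
      · convert key (0, 1) using 2 with X
        exact dZ_of_hasFDerivAt (hd X).hasFDerivAt

lemma Tmp.contDiff_bound : ∀ {n : ℕ} {f : ℝ² → ℝ}, Tmp n f → ContDiff ℝ n f ∧ ∃ (k : ℕ) (C : ℝ), ∀ X, ‖iteratedFDeriv ℝ n f X‖ ≤ C * ⟪X⟫ ^ k
  | 0, f, h => by
    obtain ⟨k, C, -, hC⟩ := h.2
    exact ⟨contDiff_zero.2 h.1, k, C, fun X => by simpa using hC X⟩
  | n + 1, f, h => by
    obtain ⟨h1, k1, C1, hC1⟩ := h.2.2.1.contDiff_bound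
    obtain ⟨h2, k2, C2, hC2⟩ := h.2.2.2.contDiff_bound
    have e : fderiv ℝ f = fun X =>
        ((ContinuousLinearMap.id ℝ ℝ).smulRight (ContinuousLinearMap.fst ℝ ℝ ℝ)) (dR f X)
        + ((ContinuousLinearMap.id ℝ ℝ).smulRight (ContinuousLinearMap.snd ℝ ℝ ℝ)) (dZ f X) := by
      rw [fderiv_eq_lin h.1]; rfl
    set L1 := (ContinuousLinearMap.id ℝ ℝ).smulRight (ContinuousLinearMap.fst ℝ ℝ ℝ)
    set L2 := (ContinuousLinearMap.id ℝ ℝ).smulRight (ContinuousLinearMap.snd ℝ ℝ ℝ)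
    have c1 : ContDiff ℝ n fun X => L1 (dR f X) := L1.contDiff.comp h1
    have c2 : ContDiff ℝ n fun X => L2 (dZ f X) := L2.contDiff.comp h2
    refine ⟨?_, k1 + k2, ‖L1‖ * |C1| + ‖L2‖ * |C2|, fun X => ?_⟩
    · push_cast
      rw [contDiff_succ_iff_fderiv]
      refine ⟨h.1, by simp, ?_⟩
      rw [e]; exact c1.add c2
    · rw [← norm_iteratedFDeriv_fderiv, e]
      have := iteratedFDeriv_add_apply (i := n) (x := X) c1.contDiffAt c2.contDiffAt
      erw [this]
      have hX := one_le_jb X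
      calc _ ≤ ‖iteratedFDeriv ℝ n (fun X => L1 (dR f X)) X‖ + ‖iteratedFDeriv ℝ n (fun X => L2 (dZ f X)) X‖ := norm_add_le _ _
        _ ≤ ‖L1‖ * ‖iteratedFDeriv ℝ n (dR f) X‖ + ‖L2‖ * ‖iteratedFDeriv ℝ n (dZ f) X‖ :=
            add_le_add (L1.norm_iteratedFDeriv_comp_left h1.contDiffAt le_rfl)
              (L2.norm_iteratedFDeriv_comp_left h2.contDiffAt le_rfl)
        _ ≤ ‖L1‖ * (|C1| * ⟪X⟫ ^ (k1 + k2)) + ‖L2‖ * (|C2| * ⟪X⟫ ^ (k1 + k2)) := by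
            gcongr
            · refine (hC1 X).trans ?_
              gcongr
              · exact le_abs_self _
              · omega
            · refine (hC2 X).trans ?_
              gcongr
              · exact le_abs_self _
              · omega
        _ = _ := by ring

lemma hasTemperateGrowth_iff_tmp : f.HasTemperateGrowth ↔ ∀ n, Tmp n f := ⟨fun h _ => .of_hasTemperateGrowth h, fun h =>
    ⟨contDiff_infty.2 fun n => (h n).contDiff_bound.1, fun n => (h n).contDiff_bound.2⟩⟩

/-- Abbreviation: smooth functions on the plane with polynomially bounded derivatives. -/
abbrev TG (f : ℝ² → ℝ) : Prop := Function.HasTemperateGrowth f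

namespace TG
lemma diff (h : TG f) : Differentiable ℝ f := h.1.differentiable (by simp)
lemma pb (h : TG f) : PB f := (Tmp.of_hasTemperateGrowth (n := 0) h).2
lemma cont (h : TG f) : Continuous f := h.1.continuous
lemma dR (h : TG f) : TG (dR f) := hasTemperateGrowth_iff_tmp.2 fun n => (Tmp.of_hasTemperateGrowth (n := n + 1) h).2.2.1
lemma dZ (h : TG f) : TG (dZ f) := hasTemperateGrowth_iff_tmp.2 fun n => (Tmp.of_hasTemperateGrowth (n := n + 1) h).2.2.2
lemma add (hf : TG f) (hg : TG g) : TG (f + g) := Function.HasTemperateGrowth.add hf hg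
lemma sub (hf : TG f) (hg : TG g) : TG (f - g) := Function.HasTemperateGrowth.sub hf hg
lemma neg (hf : TG f) : TG (-f) := Function.HasTemperateGrowth.neg hf
lemma mul (hf : TG f) (hg : TG g) : TG (f * g) := Function.HasTemperateGrowth.mul hf hg
lemma pow (hf : TG f) (n : ℕ) : TG (f ^ n) := Function.HasTemperateGrowth.pow hf n
lemma const (c : ℝ) : TG (fun _ => c) := Function.HasTemperateGrowth.const c
lemma smul (hf : TG f) (c : ℝ) : TG (c • f) := (const c).mul hf
lemma cR : TG cR := (ContinuousLinearMap.fst ℝ ℝ ℝ).hasTemperateGrowth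
lemma cZ : TG cZ := (ContinuousLinearMap.snd ℝ ℝ ℝ).hasTemperateGrowth
lemma zero : TG 0 := const 0
lemma one : TG 1 := const 1
end TG

/-! ### The Gaussian and the space `𝒵` -/

/-- `e^{-|X|²/4}`. -/
def gauss : ℝ² → ℝ := fun X => exp (-(X.1 ^ 2 + X.2 ^ 2) / 4)

lemma gauss_pos (X : ℝ²) : 0 < gauss X := exp_pos _

lemma hasFDerivAt_cR (X : ℝ²) : HasFDerivAt (fun X : ℝ² => X.1) (lin 1 0) X := hasFDerivAt_fst.congr_fderiv (by ext <;> simp)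

lemma hasFDerivAt_cZ (X : ℝ²) : HasFDerivAt (fun X : ℝ² => X.2) (lin 0 1) X := hasFDerivAt_snd.congr_fderiv (by ext <;> simp)

lemma hasFDerivAt_gauss (X : ℝ²) :
    HasFDerivAt gauss (lin (-(X.1 / 2) * gauss X) (-(X.2 / 2) * gauss X)) X := by
  have := ((((hasFDerivAt_cR X).pow 2).add ((hasFDerivAt_cZ X).pow 2)).const_mul (-1 / 4 : ℝ)).exp
  have e : gauss = fun X : ℝ² => exp (-1 / 4 * ((fun x : ℝ² => x.1 ^ 2) + fun x : ℝ² => x.2 ^ 2) X) := by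
    ext X; simp only [gauss, Pi.add_apply]; congr 1; ring
  rw [← e] at this
  refine this.congr_fderiv ?_
  have e' : exp (-1 / 4 * ((fun x : ℝ² => x.1 ^ 2) + fun x : ℝ² => x.2 ^ 2) X) = gauss X := by rw [e]
  rw [e']
  ext <;> simp <;> ring

lemma differentiable_gauss : Differentiable ℝ gauss := fun X => (hasFDerivAt_gauss X).differentiableAt

lemma dR_gauss : dR gauss = (-(1 / 2) : ℝ) • (cR * gauss) := by ext X; rw [dR_of_hasFDerivAt (hasFDerivAt_gauss X)]; simp [cR]; ring

lemma dZ_gauss : dZ gauss = (-(1 / 2) : ℝ) • (cZ * gauss) := by ext X; rw [dZ_of_hasFDerivAt (hasFDerivAt_gauss X)]; simp [cZ]; ring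

lemma exp_mul_gauss (X : ℝ²) : exp ((X.1 ^ 2 + X.2 ^ 2) / 4) * gauss X = 1 := by rw [gauss, ← exp_add]; simp; ring

lemma inZ_iff : InZ η ↔ ∃ g, TG g ∧ η = gauss * g := by
  constructor
  · intro h
    refine ⟨_, h, ?_⟩
    ext X
    have := exp_mul_gauss X
    simp only [Pi.mul_apply]
    linear_combination (-η X) * this
  · rintro ⟨g, hg, rfl⟩
    rw [InZ]
    convert hg using 2 with X
    have := exp_mul_gauss X
    simp only [Pi.mul_apply]
    linear_combination g X * this

namespace InZ
variable {η ξ g : ℝ² → ℝ}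
lemma gauss_mul (hg : TG g) : InZ (gauss * g) := inZ_iff.2 ⟨g, hg, rfl⟩
lemma diff (h : InZ η) : Differentiable ℝ η := by obtain ⟨g, hg, rfl⟩ := inZ_iff.1 h; exact differentiable_gauss.mul hg.diff
lemma cont (h : InZ η) : Continuous η := h.diff.continuous
lemma dR (h : InZ η) : InZ (dR η) := by
  obtain ⟨g, hg, rfl⟩ := inZ_iff.1 h
  refine inZ_iff.2 ⟨VortexRing.dR g - (1 / 2 : ℝ) • (VortexRing.cR * g), hg.dR.sub ((TG.cR.mul hg).smul _), ?_⟩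
  rw [dR_mul differentiable_gauss hg.diff, dR_gauss]
  ext X; simp; ring
lemma dZ (h : InZ η) : InZ (dZ η) := by
  obtain ⟨g, hg, rfl⟩ := inZ_iff.1 h
  refine inZ_iff.2 ⟨VortexRing.dZ g - (1 / 2 : ℝ) • (VortexRing.cZ * g), hg.dZ.sub ((TG.cZ.mul hg).smul _), ?_⟩
  rw [dZ_mul differentiable_gauss hg.diff, dZ_gauss]
  ext X; simp; ring
lemma mul_left (hg : TG g) (h : InZ η) : InZ (g * η) := by
  obtain ⟨k, hk, rfl⟩ := inZ_iff.1 h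
  exact inZ_iff.2 ⟨g * k, hg.mul hk, by ring⟩
lemma add (h : InZ η) (h' : InZ ξ) : InZ (η + ξ) := by
  obtain ⟨k, hk, rfl⟩ := inZ_iff.1 h
  obtain ⟨l, hl, rfl⟩ := inZ_iff.1 h'
  exact inZ_iff.2 ⟨k + l, hk.add hl, by ring⟩
lemma smul (h : InZ η) (c : ℝ) : InZ (c • η) := h.mul_left (TG.const c)
lemma neg (h : InZ η) : InZ (-η) := by simpa using h.smul (-1)
lemma sub (h : InZ η) (h' : InZ ξ) : InZ (η - ξ) := by rw [sub_eq_add_neg]; exact h.add h'.neg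
lemma zero : InZ 0 := inZ_iff.2 ⟨0, TG.zero, by simp⟩
lemma pbr_right (hg : TG g) (h : InZ η) : InZ (pb g η) := (h.dZ.mul_left hg.dR).sub (h.dR.mul_left hg.dZ)
end InZ

lemma eta0_eq : eta0 = (1 / (4 * π)) • gauss := rfl
lemma inZ_gauss : InZ gauss := inZ_iff.2 ⟨1, TG.one, by simp⟩
lemma inZ_eta0 : InZ eta0 := inZ_gauss.smul _

lemma gauss_le (m : ℕ) : ∃ C, 0 ≤ C ∧ ∀ X, gauss X * ⟪X⟫ ^ m ≤ C := by
  refine ⟨(m.factorial * exp 5), by positivity, fun X => ?_⟩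
  have h1 : gauss X ≤ exp (-‖X‖ ^ 2 / 4) := by
    apply exp_le_exp.2
    have : ‖X‖ ^ 2 ≤ X.1 ^ 2 + X.2 ^ 2 := by
      rcases le_total |X.1| |X.2| with h | h
      · rw [Prod.norm_def]; simp only [Real.norm_eq_abs, max_eq_right h, sq_abs]; nlinarith
      · rw [Prod.norm_def]; simp only [Real.norm_eq_abs, max_eq_left h, sq_abs]; nlinarith
    linarith
  have h2 : ⟪X⟫ ^ m ≤ m.factorial * exp ⟪X⟫ := by
    have := Real.pow_div_factorial_le_exp ⟪X⟫ (by positivity) m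
    rw [div_le_iff₀ (by positivity)] at this
    linarith
  calc gauss X * ⟪X⟫ ^ m ≤ exp (-‖X‖ ^ 2 / 4) * (m.factorial * exp ⟪X⟫) := by gcongr
    _ = m.factorial * exp (-‖X‖ ^ 2 / 4 + ⟪X⟫) := by rw [exp_add (-‖X‖ ^ 2 / 4)]; ring
    _ ≤ _ := by gcongr; nlinarith [sq_nonneg (‖X‖ - 2)]

/-- Elements of `𝒵` decay faster than any power. -/
lemma InZ.decay (h : InZ η) (m : ℕ) :
    ∃ C, 0 ≤ C ∧ ∀ X, |η X| * ⟪X⟫ ^ m ≤ C := by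
  obtain ⟨g, hg, rfl⟩ := inZ_iff.1 h
  obtain ⟨k, D, hD, hg⟩ := hg.pb
  obtain ⟨C, hC, hb⟩ := gauss_le (k + m)
  refine ⟨D * C, by positivity, fun X => ?_⟩
  rw [Pi.mul_apply, abs_mul, abs_of_pos (gauss_pos X)]
  calc gauss X * |g X| * ⟪X⟫ ^ m ≤ gauss X * (D * ⟪X⟫ ^ k) * ⟪X⟫ ^ m := by
        gcongr
        · exact (gauss_pos X).le
        · exact hg X
    _ = D * (gauss X * ⟪X⟫ ^ (k + m)) := by rw [pow_add]; ring
    _ ≤ D * C := by gcongr; exact hb X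

/-! ### Convolution with weakly singular kernels -/

lemma jb_le_mul (X V : ℝ²) : 1 + ‖V‖ ≤ ⟪X⟫ * ⟪X - V⟫ := by
  have h : ‖V‖ ≤ ‖X‖ + ‖X - V‖ := by
    calc ‖V‖ = ‖X - (X - V)‖ := by rw [sub_sub_cancel]
      _ ≤ _ := norm_sub_le _ _
  nlinarith [norm_nonneg X, norm_nonneg (X - V)]

lemma jb_inv_pow_le (X V : ℝ²) (m : ℕ) :
    (⟪X - V⟫ ^ m)⁻¹ ≤ ⟪X⟫ ^ m * (⟪V⟫ ^ m)⁻¹ := by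
  have := pow_le_pow_left₀ (by positivity) (jb_le_mul X V) m
  rw [mul_pow] at this
  rw [inv_le_iff_one_le_mul₀ (by positivity)]
  calc (1:ℝ) = ⟪V⟫ ^ m * (⟪V⟫ ^ m)⁻¹ := by field_simp
    _ ≤ (⟪X⟫ ^ m * ⟪X - V⟫ ^ m) * (⟪V⟫ ^ m)⁻¹ := by gcongr
    _ = _ := by ring

/-- `|f| ≤ M (1 + |X|)^{-m}`. -/
def Dk (m : ℕ) (M : ℝ) (f : ℝ² → ℝ) : Prop := ∀ X, |f X| ≤ M * (⟪X⟫ ^ m)⁻¹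

lemma Dk.nonneg {m : ℕ} {M : ℝ} (h : Dk m M f) : 0 ≤ M := by
  have := (abs_nonneg _).trans (h 0)
  simpa using this

lemma Dk.of_mul_le {m : ℕ} {M : ℝ} (h : ∀ X, |f X| * ⟪X⟫ ^ m ≤ M) :
    Dk m M f := fun X => by
  rw [← div_eq_mul_inv, le_div_iff₀ (by positivity)]; exact h X

lemma InZ.dk (h : InZ η) (m : ℕ) : ∃ M, 0 ≤ M ∧ Dk m M η := by
  obtain ⟨C, hC, h⟩ := h.decay m
  exact ⟨C, hC, .of_mul_le h⟩

/-- The kernel `k` is integrable against `(1 + |V|)^{-m}`. -/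
def KI (m : ℕ) (k : ℝ² → ℝ) : Prop := Integrable fun V => k V * (⟪V⟫ ^ m)⁻¹

/-- Convolution. -/
def conv (k η : ℝ² → ℝ) : ℝ² → ℝ := fun X => ∫ V, k V * η (X - V)

/-- Weighted norm of a kernel. -/
def kNorm (m : ℕ) (k : ℝ² → ℝ) : ℝ := ∫ V, |k V| * (⟪V⟫ ^ m)⁻¹

lemma KI.abs {m : ℕ} {k : ℝ² → ℝ} (hk : KI m k) :
    Integrable fun V => |k V| * (⟪V⟫ ^ m)⁻¹ := by
  refine hk.norm.congr (.of_forall fun V => ?_)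
  simp only [norm_mul, Real.norm_eq_abs]
  congr 1
  exact abs_of_nonneg (by positivity)

lemma continuous_jb_inv (m : ℕ) : Continuous fun V : ℝ² => (⟪V⟫ ^ m)⁻¹ := Continuous.inv₀ (by fun_prop) fun V => by positivity

lemma KI.meas {m : ℕ} {k : ℝ² → ℝ} (hk : KI m k) : AEStronglyMeasurable k := by
  have := hk.aestronglyMeasurable.mul
    (by fun_prop : Continuous fun V : ℝ² => ⟪V⟫ ^ m).aestronglyMeasurable
  refine this.congr (.of_forall fun V => ?_)
  have : ⟪V⟫ ^ m ≠ 0 := by positivity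
  simp only [Pi.mul_apply]
  field_simp

section conv
variable {m : ℕ} {k η : ℝ² → ℝ} {M : ℝ}

lemma Dk.shift_le (h : Dk m M η) (X V : ℝ²) :
    |η (X - V)| ≤ M * ⟪X⟫ ^ m * (⟪V⟫ ^ m)⁻¹ := by
  refine (h _).trans ?_
  rw [mul_assoc]
  exact mul_le_mul_of_nonneg_left (jb_inv_pow_le X V m) h.nonneg

lemma Dk.conv_le (h : Dk m M η) (X V : ℝ²) :
    |k V * η (X - V)| ≤ (M * ⟪X⟫ ^ m) * (|k V| * (⟪V⟫ ^ m)⁻¹) := by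
  rw [abs_mul]
  calc _ ≤ |k V| * (M * ⟪X⟫ ^ m * (⟪V⟫ ^ m)⁻¹) := by gcongr; exact h.shift_le X V
    _ = _ := by ring

lemma conv_integrable (hk : KI m k) (hc : Continuous η) (h : Dk m M η) (X : ℝ²) :
    Integrable fun V => k V * η (X - V) :=
  (hk.abs.const_mul (M * ⟪X⟫ ^ m)).mono'
    (hk.meas.mul (by fun_prop : Continuous fun V => η (X - V)).aestronglyMeasurable)
    (.of_forall fun V => h.conv_le X V)

lemma conv_abs_le (hk : KI m k) (h : Dk m M η) (X : ℝ²) :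
    |conv k η X| ≤ M * kNorm m k * ⟪X⟫ ^ m := by
  have := norm_integral_le_of_norm_le (f := fun V => k V * η (X - V)) (hk.abs.const_mul _)
    (.of_forall fun V => h.conv_le X V)
  calc |conv k η X| ≤ ∫ V, (M * ⟪X⟫ ^ m) * (|k V| * (⟪V⟫ ^ m)⁻¹) := this
    _ = _ := by rw [integral_const_mul, kNorm]; ring

lemma conv_continuous (hk : KI m k) (hc : Continuous η) (h : Dk m M η) : Continuous (conv k η) := by
  refine continuous_iff_continuousAt.2 fun X₀ => ?_
  refine continuousAt_of_dominated (bound := fun V => (M * (2 + ‖X₀‖) ^ m) * (|k V| * (⟪V⟫ ^ m)⁻¹))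
    (.of_forall fun X => (conv_integrable hk hc h X).aestronglyMeasurable) ?_ (hk.abs.const_mul _)
    (.of_forall fun V => by fun_prop)
  filter_upwards [Metric.ball_mem_nhds X₀ one_pos] with X hX
  refine .of_forall fun V => (h.conv_le X V).trans ?_
  have : ‖X‖ ≤ ‖X₀‖ + 1 := by
    have := norm_sub_norm_le X X₀
    rw [mem_ball_iff_norm] at hX; linarith
  have := h.nonneg
  have hp : ⟪X⟫ ^ m ≤ (2 + ‖X₀‖) ^ m := pow_le_pow_left₀ (by positivity) (by linarith) m
  gcongr

lemma conv_hasFDerivAt (hk : KI m k) (hd : Differentiable ℝ η) (hcR : Continuous (dR η))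
    (hcZ : Continuous (dZ η)) (h : Dk m M η) (hR : Dk m M (dR η)) (hZ : Dk m M (dZ η)) (X₀ : ℝ²) :
    HasFDerivAt (conv k η) (lin (conv k (dR η) X₀) (conv k (dZ η) X₀)) X₀ := by
  have hM := h.nonneg
  have key := hasFDerivAt_integral_of_dominated_of_fderiv_le (𝕜 := ℝ) (μ := volume)
    (F := fun X V => k V * η (X - V)) (F' := fun X V => k V • lin (dR η (X - V)) (dZ η (X - V)))
    (s := Metric.ball X₀ 1) (x₀ := X₀)
    (bound := fun V => (2 * M * (2 + ‖X₀‖) ^ m) * (|k V| * (⟪V⟫ ^ m)⁻¹))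
    (Metric.ball_mem_nhds X₀ one_pos)
    (.of_forall fun X => (conv_integrable hk hd.continuous h X).aestronglyMeasurable)
    (conv_integrable hk hd.continuous h X₀)
    (hk.meas.smul (by unfold lin; fun_prop : Continuous fun V => lin (dR η (X₀ - V)) (dZ η (X₀ - V))).aestronglyMeasurable)
    (.of_forall fun V X hX => ?_) (hk.abs.const_mul _) (.of_forall fun V X _ => ?_)
  · refine key.congr_fderiv ?_
    have hint : Integrable fun V => k V • lin (dR η (X₀ - V)) (dZ η (X₀ - V)) := by
      have h1 := (conv_integrable hk hcR hR X₀).smul_const (ContinuousLinearMap.fst ℝ ℝ ℝ)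
      have h2 := (conv_integrable hk hcZ hZ X₀).smul_const (ContinuousLinearMap.snd ℝ ℝ ℝ)
      refine (h1.add h2).congr (.of_forall fun V => ?_)
      simp [lin, mul_smul]
    rw [clm_eq_lin (∫ V, k V • lin (dR η (X₀ - V)) (dZ η (X₀ - V)))]
    congr 1
    · rw [ContinuousLinearMap.integral_apply hint]; simp [conv]
    · rw [ContinuousLinearMap.integral_apply hint]; simp [conv]
  · rw [norm_smul, Real.norm_eq_abs]
    have hX' : ‖X‖ ≤ ‖X₀‖ + 1 := by
      have := norm_sub_norm_le X X₀
      rw [mem_ball_iff_norm] at hX; linarith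
    have hl : ‖lin (dR η (X - V)) (dZ η (X - V))‖ ≤ 2 * (M * ⟪X⟫ ^ m * (⟪V⟫ ^ m)⁻¹) := by
      refine (norm_lin_le _ _).trans ?_
      linarith [hR.shift_le X V, hZ.shift_le X V]
    calc _ ≤ |k V| * (2 * (M * ⟪X⟫ ^ m * (⟪V⟫ ^ m)⁻¹)) := by gcongr
      _ = (2 * M * ⟪X⟫ ^ m) * (|k V| * (⟪V⟫ ^ m)⁻¹) := by ring
      _ ≤ _ := by
        have hp : ⟪X⟫ ^ m ≤ (2 + ‖X₀‖) ^ m := pow_le_pow_left₀ (by positivity) (by linarith) m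
        gcongr
  · have h1 : HasFDerivAt (fun X : ℝ² => X - V) (ContinuousLinearMap.id ℝ ℝ²) X := (hasFDerivAt_id X).sub_const V
    have := ((hasFDerivAt_lin (hd (X - V))).comp X h1).const_mul (k V)
    simpa using! this

end conv

/-! ### Integrability of the kernels -/

lemma integrable_abs_rpow_neg {a : ℝ} (ha : a < 1) (ha0 : 0 ≤ a) :
    Integrable fun x : ℝ => |x| ^ (-a) * ((1 + |x|) ^ 2)⁻¹ := by
  have h1 : IntegrableOn (fun x : ℝ => |x| ^ (-a)) (Ioc (-1) 1) := by
    have e : IntervalIntegrable (fun x : ℝ => |x| ^ (-a)) volume 0 1 := by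
      refine (intervalIntegral.intervalIntegrable_rpow' (r := -a) (by linarith)).congr ?_
      intro x hx
      rw [uIoc_of_le zero_le_one] at hx
      simp [abs_of_pos hx.1]
    have e' : IntervalIntegrable (fun x : ℝ => |x| ^ (-a)) volume (-1) 0 := by
      have := (IntervalIntegrable.iff_comp_neg).1 e
      simpa using this.symm
    have := e'.trans e
    rwa [intervalIntegrable_iff_integrableOn_Ioc_of_le (by norm_num)] at this
  have h2 : Integrable fun x : ℝ => ((1 + |x|) ^ 2)⁻¹ := by
    have := integrable_one_add_norm (E := ℝ) (μ := volume) (r := 2) (by simp)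
    refine this.congr (.of_forall fun x => ?_)
    simp only [Real.norm_eq_abs]
    rw [rpow_neg (by positivity)]; norm_num
  refine ((h1.integrable_indicator measurableSet_Ioc).add h2).mono'
    (Measurable.aestronglyMeasurable (by fun_prop)) (.of_forall fun x => ?_)
  rw [Real.norm_of_nonneg (by positivity)]
  have h3 : ((1 + |x|) ^ 2)⁻¹ ≤ 1 := inv_le_one_of_one_le₀ (one_le_pow₀ (by linarith [abs_nonneg x]))
  simp only [Pi.add_apply]
  by_cases hx : x ∈ Ioc (-1 : ℝ) 1
  · rw [indicator_of_mem hx]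
    have : |x| ^ (-a) * ((1 + |x|) ^ 2)⁻¹ ≤ |x| ^ (-a) * 1 := by gcongr
    have h4 : 0 ≤ ((1 + |x|) ^ 2)⁻¹ := by positivity
    linarith
  · rw [indicator_of_notMem hx]
    have hx1 : 1 ≤ |x| := by
      by_contra hlt
      push Not at hlt
      rw [abs_lt] at hlt
      exact hx ⟨hlt.1, hlt.2.le⟩
    have : |x| ^ (-a) ≤ 1 := rpow_le_one_of_one_le_of_nonpos hx1 (by linarith)
    have h4 : 0 ≤ ((1 + |x|) ^ 2)⁻¹ := by positivity
    nlinarith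

lemma ki_rpow {a b : ℝ} (ha : a < 1) (ha0 : 0 ≤ a) (hb : b < 1) (hb0 : 0 ≤ b) :
    KI 4 fun V : ℝ² => |V.1| ^ (-a) * |V.2| ^ (-b) := by
  refine ((integrable_abs_rpow_neg ha ha0).mul_prod (integrable_abs_rpow_neg hb hb0)).mono'
    (Measurable.aestronglyMeasurable (by fun_prop)) (.of_forall fun V => ?_)
  rw [Real.norm_of_nonneg (by positivity)]
  have h : (⟪V⟫ ^ 4)⁻¹ ≤ ((1 + |V.1|) ^ 2)⁻¹ * ((1 + |V.2|) ^ 2)⁻¹ := by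
    rw [← mul_inv]
    apply inv_anti₀ (by positivity)
    calc (1 + |V.1|) ^ 2 * (1 + |V.2|) ^ 2 ≤ ⟪V⟫ ^ 2 * ⟪V⟫ ^ 2 := by
          gcongr
          · exact norm_fst_le V
          · exact norm_snd_le V
      _ = _ := by ring
  calc _ ≤ (|V.1| ^ (-a) * |V.2| ^ (-b)) * (((1 + |V.1|) ^ 2)⁻¹ * ((1 + |V.2|) ^ 2)⁻¹) := by gcongr
    _ = _ := by ring

lemma KI.mono {m m' : ℕ} {k k' : ℝ² → ℝ} (hk : KI m k) (hm : AEStronglyMeasurable k')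
    (hmm : m ≤ m') (h : ∀ᵐ V, |k' V| ≤ |k V|) : KI m' k' := by
  refine hk.abs.mono' (hm.mul (continuous_jb_inv m').aestronglyMeasurable) ?_
  filter_upwards [h] with V hV
  rw [norm_mul, Real.norm_eq_abs, Real.norm_of_nonneg (by positivity)]
  gcongr
  · exact one_le_jb V

lemma KI.mul_pow {m : ℕ} {k : ℝ² → ℝ} (hk : KI m k) (j : ℕ) :
    KI (m + j) fun V => k V * ⟪V⟫ ^ j := by
  refine Integrable.congr hk (.of_forall fun V => ?_)
  have : ⟪V⟫ ≠ 0 := by positivity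
  simp only [pow_add]
  field_simp

lemma KI.const_mul {m : ℕ} {k : ℝ² → ℝ} (hk : KI m k) (c : ℝ) : KI m fun V => c * k V := by
  refine (Integrable.const_mul hk c).congr (.of_forall fun V => ?_)
  simp only; ring

lemma KI.add {m : ℕ} {k k' : ℝ² → ℝ} (hk : KI m k) (hk' : KI m k') : KI m (k + k') := by
  refine (Integrable.add hk hk').congr (.of_forall fun V => ?_)
  simp only [Pi.add_apply]; ring

lemma ki_one : KI 4 fun _ => 1 := by
  have := ki_rpow (a := 0) (b := 0) (by norm_num) le_rfl (by norm_num) le_rfl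
  simpa using this

/-- `log (8 / |V|)`. -/
def lk (V : ℝ²) : ℝ := log (8 / √(V.1 ^ 2 + V.2 ^ 2))

/-- Components of the gradient of `lk`. -/
def lkR (V : ℝ²) : ℝ := -V.1 / (V.1 ^ 2 + V.2 ^ 2)
def lkZ (V : ℝ²) : ℝ := -V.2 / (V.1 ^ 2 + V.2 ^ 2)

lemma ae_fst_ne_zero : ∀ᵐ V : ℝ², V.1 ≠ 0 := by
  have : ∀ᵐ x : ℝ, x ≠ 0 := by simp [ae_iff]
  exact Measure.quasiMeasurePreserving_fst.ae this

lemma ae_snd_ne_zero : ∀ᵐ V : ℝ², V.2 ≠ 0 := by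
  have : ∀ᵐ x : ℝ, x ≠ 0 := by simp [ae_iff]
  exact Measure.quasiMeasurePreserving_snd.ae this

lemma abs_log_le {x : ℝ} (hx : 0 < x) : |log x| ≤ x + 2 * x ^ (-(1 / 2) : ℝ) := by
  have h1 := Real.log_le_sub_one_of_pos hx
  have h2 := Real.log_le_sub_one_of_pos (rpow_pos_of_pos hx (-(1 / 2)))
  rw [Real.log_rpow hx] at h2
  have := rpow_pos_of_pos hx (-(1 / 2))
  rw [abs_le]; constructor <;> linarith

lemma measurable_lk : Measurable lk := by unfold lk; fun_prop

lemma norm_sq_le (V : ℝ²) : √(V.1 ^ 2 + V.2 ^ 2) ≤ 2 * ‖V‖ := by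
  rw [Real.sqrt_le_left (by positivity)]
  have h1 := norm_fst_le V
  have h2 := norm_snd_le V
  rw [Real.norm_eq_abs] at h1 h2
  nlinarith [sq_abs V.1, sq_abs V.2, abs_nonneg V.1, abs_nonneg V.2]

lemma norm_le_rho (V : ℝ²) : ‖V‖ ≤ √(V.1 ^ 2 + V.2 ^ 2) := by
  rw [Prod.norm_def, max_le_iff]
  constructor
  · exact Real.abs_le_sqrt (by nlinarith [sq_nonneg V.2])
  · exact Real.abs_le_sqrt (by nlinarith [sq_nonneg V.1])

lemma ki_lk : KI 5 lk := by
  have h1 := (ki_one.mul_pow 1).const_mul 5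
  have h2 : KI 5 _ := ((ki_rpow (a := 1 / 2) (b := 0) (by norm_num) (by norm_num) (by norm_num)
    (by norm_num)).const_mul 2).mono (m' := 5) (Measurable.aestronglyMeasurable (by fun_prop)) (by norm_num) (.of_forall fun V => le_rfl)
  refine (h1.add h2).mono measurable_lk.aestronglyMeasurable le_rfl ?_
  filter_upwards [ae_fst_ne_zero] with V hV
  simp only [Pi.add_apply, neg_zero, rpow_zero, mul_one, one_mul, pow_one]
  have hs : 0 < √(V.1 ^ 2 + V.2 ^ 2) := by positivity
  have h3 : lk V = log 8 - log √(V.1 ^ 2 + V.2 ^ 2) := Real.log_div (by norm_num) hs.ne'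
  have h8 : log 8 ≤ 5 := by
    have := Real.log_le_sub_one_of_pos (show (0:ℝ) < 2 by norm_num)
    rw [show (8:ℝ) = 2 ^ 3 by norm_num, Real.log_pow]; push_cast; linarith
  have h80 : 0 ≤ log 8 := Real.log_nonneg (by norm_num)
  have h4 := abs_log_le hs
  have h5 := norm_sq_le V
  have h6 : √(V.1 ^ 2 + V.2 ^ 2) ^ (-(1 / 2) : ℝ) ≤ |V.1| ^ (-(1 / 2) : ℝ) := by
    apply rpow_le_rpow_of_nonpos (by positivity) _ (by norm_num)
    exact Real.abs_le_sqrt (by nlinarith [sq_nonneg V.2])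
  rw [h3]
  have h7 : |log 8 - log √(V.1 ^ 2 + V.2 ^ 2)| ≤ |log 8| + |log √(V.1 ^ 2 + V.2 ^ 2)| := abs_sub _ _
  rw [abs_of_nonneg h80] at h7
  rw [abs_of_nonneg (a := 5 * ⟪V⟫ + _) (by positivity)]
  nlinarith [norm_nonneg V]

/-- `|V|^{-1-2c}` is controlled by a product of one-dimensional powers. -/
lemma rpow_rho_le {V : ℝ²} (h1 : V.1 ≠ 0) (h2 : V.2 ≠ 0) {c : ℝ} (hc : 0 ≤ c) :
    √(V.1 ^ 2 + V.2 ^ 2) ^ (-(2 * c)) ≤ |V.1| ^ (-c) * |V.2| ^ (-c) := by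
  have a1 := abs_pos.2 h1
  have a2 := abs_pos.2 h2
  rw [← mul_rpow a1.le a2.le, show -(2 * c) = 2 * (-c) by ring, rpow_mul (by positivity)]
  apply rpow_le_rpow_of_nonpos (by positivity) _ (by linarith)
  rw [rpow_two, Real.sq_sqrt (by positivity)]
  nlinarith [sq_abs V.1, sq_abs V.2, sq_nonneg (|V.1| - |V.2|)]

lemma abs_div_rho_sq_le {V : ℝ²} (a : ℝ) (ha : |a| ≤ √(V.1 ^ 2 + V.2 ^ 2)) :
    |(-a) / (V.1 ^ 2 + V.2 ^ 2)| ≤ √(V.1 ^ 2 + V.2 ^ 2) ^ (-1 : ℝ) := by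
  rcases eq_or_ne (V.1 ^ 2 + V.2 ^ 2) 0 with h | h
  · simp [h]
  have hp : 0 < V.1 ^ 2 + V.2 ^ 2 := lt_of_le_of_ne (by positivity) h.symm
  rw [rpow_neg_one, abs_div, abs_neg, abs_of_pos hp, div_le_iff₀ hp]
  calc |a| ≤ √(V.1 ^ 2 + V.2 ^ 2) := ha
    _ = _ := by nth_rewrite 3 [← Real.sq_sqrt hp.le]; field_simp

lemma ki_of_rho_inv {k : ℝ² → ℝ} (hm : Measurable k)
    (h : ∀ V, |k V| ≤ √(V.1 ^ 2 + V.2 ^ 2) ^ (-1 : ℝ)) : KI 4 k := by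
  refine (ki_rpow (a := 1 / 2) (b := 1 / 2) (by norm_num) (by norm_num) (by norm_num)
    (by norm_num)).mono hm.aestronglyMeasurable le_rfl ?_
  filter_upwards [ae_fst_ne_zero, ae_snd_ne_zero] with V h1 h2
  rw [abs_of_nonneg (a := |V.1| ^ (-(1 / 2) : ℝ) * _) (by positivity)]
  refine (h V).trans ?_
  have := rpow_rho_le h1 h2 (c := 1 / 2) (by norm_num)
  simpa using this

lemma abs_lkR_le (V : ℝ²) : |lkR V| ≤ √(V.1 ^ 2 + V.2 ^ 2) ^ (-1 : ℝ) := abs_div_rho_sq_le _ (Real.abs_le_sqrt (by nlinarith [sq_nonneg V.2]))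
lemma abs_lkZ_le (V : ℝ²) : |lkZ V| ≤ √(V.1 ^ 2 + V.2 ^ 2) ^ (-1 : ℝ) := abs_div_rho_sq_le _ (Real.abs_le_sqrt (by nlinarith [sq_nonneg V.1]))
lemma ki_lkR : KI 4 lkR := ki_of_rho_inv (by unfold lkR; fun_prop) abs_lkR_le
lemma ki_lkZ : KI 4 lkZ := ki_of_rho_inv (by unfold lkZ; fun_prop) abs_lkZ_le

/-! ### Regularity of the logarithmic potential -/

lemma conv_eq_integral (k η : ℝ² → ℝ) (X : ℝ²) : conv k η X = ∫ Y, k (X - Y) * η Y := by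
  rw [conv, ← integral_sub_left_eq_self _ _ X]
  simp

lemma BS0_eq (η : ℝ² → ℝ) : BS0 η = (1 / (2 * π)) • conv lk η := by
  ext X
  rw [Pi.smul_apply, conv_eq_integral]
  rfl

lemma rho_sq (V : ℝ²) : √(V.1 ^ 2 + V.2 ^ 2) ^ 2 = V.1 ^ 2 + V.2 ^ 2 := Real.sq_sqrt (by positivity)

lemma lk_eq_of_ne {V : ℝ²} (h : V.1 ≠ 0) : lk V = log 8 - 1 / 2 * log (V.1 ^ 2 + V.2 ^ 2) := by
  have hp : 0 < V.1 ^ 2 + V.2 ^ 2 := by positivity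
  rw [lk, Real.log_div (by norm_num) (Real.sqrt_pos.2 hp).ne', Real.log_sqrt hp.le]; ring

lemma conv_integrable' {m : ℕ} {M : ℝ} {k : ℝ² → ℝ} (hk : KI m k) (hc : Continuous η) (h : Dk m M η) (X : ℝ²) :
    Integrable fun Y => k (X - Y) * η Y := by simpa using (conv_integrable hk hc h X).comp_sub_left X

lemma conv_integrable_prod {m : ℕ} {M : ℝ} {k : ℝ² → ℝ} (hk : KI m k) (hm : Measurable k) (hc : Continuous η) (h : Dk m M η) {P : ℝ → ℝ²}
    (hP : Continuous P) {w : ℝ → ℝ} (hw : Continuous w) (a b : ℝ) :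
    Integrable (Function.uncurry fun s Y => k (P s - Y) * η Y * w s) ((volume.restrict (uIoc a b)).prod volume) := by
  refine (integrable_prod_iff ?_).2 ⟨.of_forall fun s => (conv_integrable' hk hc h (P s)).mul_const (w s), ?_⟩
  · exact (((hm.comp (by fun_prop)).mul (hc.measurable.comp measurable_snd)).mul (by fun_prop)).aestronglyMeasurable
  · have := ((conv_continuous (k := fun V => |k V|) hk.abs hc.abs (fun X => by simpa using h X)).comp hP).mul hw.abs
    refine (this.intervalIntegrable a b).def'.congr (.of_forall fun s => ?_)
    simp [conv_eq_integral, integral_mul_const]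

/-- A convolution is differentiated along a line by differentiating the kernel. -/
lemma conv_hasDerivAt_line {m m' : ℕ} {M M' : ℝ} {k k' : ℝ² → ℝ} (hk : KI m k) (hk' : KI m' k') (hm : Measurable k') (hc : Continuous η)
    (h : Dk m M η) (h' : Dk m' M' η) (e : ℝ²)
    (hd : ∀ᵐ V, Continuous (fun s : ℝ => k' (V + s • e)) ∧ ∀ s : ℝ, HasDerivAt (fun s => k (V + s • e)) (k' (V + s • e)) s)
    (X : ℝ²) : HasDerivAt (fun t : ℝ => conv k η (X + t • e)) (conv k' η X) 0 := by
  have line : Continuous fun s : ℝ => X + s • e := by fun_prop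
  have cc := (conv_continuous hk' hc h').comp line
  have key (t : ℝ) : conv k η (X + t • e) = conv k η X + ∫ s in 0..t, conv k' η (X + s • e) := by
    rw [← sub_eq_iff_eq_add', conv_eq_integral, conv_eq_integral, ← integral_sub (conv_integrable' hk hc h _) (conv_integrable' hk hc h _)]
    simp_rw [conv_eq_integral]
    rw [intervalIntegral_integral_swap]
    · refine integral_congr_ae ?_
      filter_upwards [(Measure.measurePreserving_sub_left volume X).quasiMeasurePreserving.ae hd] with Y hY
      rw [intervalIntegral.integral_mul_const, ← sub_mul]
      have := intervalIntegral.integral_eq_sub_of_hasDerivAt (a := 0) (b := t) (fun s _ => hY.2 s) (hY.1.intervalIntegrable _ _)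
      simp only [sub_add_eq_add_sub, zero_smul, add_zero] at this
      rw [this]
    · simpa using conv_integrable_prod hk' hm hc h' line continuous_one 0 t
  simp_rw [key]
  simpa using (intervalIntegral.integral_hasDerivAt_right (cc.intervalIntegrable 0 0) (cc.stronglyMeasurableAtFilter _ _) cc.continuousAt).const_add
    (conv k η X)

lemma hasFDerivAt_lk {V : ℝ²} (hV : 0 < V.1 ^ 2 + V.2 ^ 2) : HasFDerivAt lk (lin (lkR V) (lkZ V)) V := by
  have hs := Real.sqrt_pos.2 hV
  have h := ((hasDerivAt_const _ 8).div (Real.hasDerivAt_sqrt hV.ne') hs.ne').log (div_pos (by norm_num) hs).ne'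
  refine (h.comp_hasFDerivAt V (((hasFDerivAt_cR V).pow 2).add ((hasFDerivAt_cZ V).pow 2))).congr_fderiv ?_
  have := Real.sq_sqrt hV.le
  ext <;> simp [lkR, lkZ] <;> field_simp <;> simp [this]

/-- The logarithmic potential of a continuous decaying function is differentiable. -/
lemma conv_lk_hasFDerivAt {M M' : ℝ} (hc : Continuous η) (h : Dk 5 M η) (h' : Dk 4 M' η) (X₀ : ℝ²) :
    HasFDerivAt (conv lk η) (lin (conv lkR η X₀) (conv lkZ η X₀)) X₀ := by
  have line (V e : ℝ²) (hV : ∀ s : ℝ, 0 < (V + s • e).1 ^ 2 + (V + s • e).2 ^ 2) (s : ℝ) :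
      HasDerivAt (fun s : ℝ => lk (V + s • e)) (lkR (V + s • e) * e.1 + lkZ (V + s • e) * e.2) s := by
    simpa using! (hasFDerivAt_lk (hV s)).comp_hasDerivAt s (((hasDerivAt_id s).smul_const e).const_add V)
  have pR := conv_hasDerivAt_line ki_lk ki_lkR (by unfold lkR; fun_prop) hc h h' (1, 0) (by
    filter_upwards [ae_snd_ne_zero] with V hV
    have hp (s : ℝ) : 0 < (V + s • ((1:ℝ), (0:ℝ))).1 ^ 2 + (V + s • ((1:ℝ), (0:ℝ))).2 ^ 2 := by simp; positivity
    exact ⟨.div (by fun_prop) (by fun_prop) fun s => (hp s).ne', by simpa using line _ _ hp⟩)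
  have pZ := conv_hasDerivAt_line ki_lk ki_lkZ (by unfold lkZ; fun_prop) hc h h' (0, 1) (by
    filter_upwards [ae_fst_ne_zero] with V hV
    have hp (s : ℝ) : 0 < (V + s • ((0:ℝ), (1:ℝ))).1 ^ 2 + (V + s • ((0:ℝ), (1:ℝ))).2 ^ 2 := by simp; positivity
    exact ⟨.div (by fun_prop) (by fun_prop) fun s => (hp s).ne', by simpa using line _ _ hp⟩)
  have span {k : ℝ² → ℝ} (hk : KI 4 k) : Continuous ↿fun x y => ContinuousLinearMap.toSpanSingleton ℝ (conv k η (x, y)) :=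
    (ContinuousLinearMap.toSpanSingletonCLE (𝕜 := ℝ) (E := ℝ)).continuous.comp (conv_continuous hk hc h')
  refine (hasStrictFDerivAt_uncurry_coprod (u := X₀) (f := fun x y => conv lk η (x, y))
    (.of_forall fun X => ?_) (.of_forall fun X => ?_) (span ki_lkR).continuousAt (span ki_lkZ).continuousAt).hasFDerivAt.congr_fderiv ?_
  · have := HasDerivAt.comp_sub_const X.1 X.1 (by simpa using pR X)
    have e (x : ℝ) : X + (x - X.1, 0) = (x, X.2) := by ext <;> simp
    simpa [Function.HasUncurry.uncurry, e] using this.hasFDerivAt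
  · have := HasDerivAt.comp_sub_const X.2 X.2 (by simpa using pZ X)
    have e (x : ℝ) : X + (0, x - X.2) = (X.1, x) := by ext <;> simp
    simpa [Function.HasUncurry.uncurry, e] using this.hasFDerivAt
  · ext <;> simp [Function.HasUncurry.uncurry]

/-! ### Mapping properties of `BS0` -/

/-- Functions which decay faster than any power. -/
def Rapid (f : ℝ² → ℝ) : Prop := ∀ m, ∃ M, Dk m M f

lemma Rapid.gauss_mul (hg : PB g) : Rapid (gauss * g) := fun m => by
  obtain ⟨k, D, hD, hg⟩ := hg
  obtain ⟨C, hC, hb⟩ := gauss_le (k + m)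
  refine ⟨D * C, .of_mul_le fun X => ?_⟩
  rw [Pi.mul_apply, abs_mul, abs_of_pos (gauss_pos X)]
  calc gauss X * |g X| * ⟪X⟫ ^ m ≤ gauss X * (D * ⟪X⟫ ^ k) * ⟪X⟫ ^ m := by
        gcongr
        · exact (gauss_pos X).le
        · exact hg X
    _ = D * (gauss X * ⟪X⟫ ^ (k + m)) := by rw [pow_add]; ring
    _ ≤ D * C := by gcongr; exact hb X

lemma InZ.rapid (h : InZ η) : Rapid η := fun m => let ⟨M, _, hM⟩ := h.dk m; ⟨M, hM⟩

lemma PB.conv {m : ℕ} {k η : ℝ² → ℝ} {M : ℝ} (hk : KI m k) (h : Dk m M η) : PB (conv k η) := PB.of_le fun X => conv_abs_le hk h X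

lemma dR_BS0 (hd : Differentiable ℝ η) (hcR : Continuous (dR η))
    (hcZ : Continuous (dZ η)) (h : Rapid η) (hR : Rapid (dR η)) (hZ : Rapid (dZ η)) :
    Differentiable ℝ (BS0 η) ∧ dR (BS0 η) = BS0 (dR η) ∧ dZ (BS0 η) = BS0 (dZ η) := by
  obtain ⟨M1, h⟩ := h 5
  obtain ⟨M2, hR⟩ := hR 5
  obtain ⟨M3, hZ⟩ := hZ 5
  have mono {M f} (hf : Dk 5 M f) (hM : M ≤ |M1| + |M2| + |M3|) : Dk 5 (|M1| + |M2| + |M3|) f := fun X => (hf X).trans (by gcongr)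
  have key := conv_hasFDerivAt ki_lk hd hcR hcZ
    (mono h (by linarith [le_abs_self M1, abs_nonneg M2, abs_nonneg M3]))
    (mono hR (by linarith [le_abs_self M2, abs_nonneg M1, abs_nonneg M3]))
    (mono hZ (by linarith [le_abs_self M3, abs_nonneg M2, abs_nonneg M1]))
  have hdiff : Differentiable ℝ (conv lk η) := fun X => (key X).differentiableAt
  rw [BS0_eq, BS0_eq, BS0_eq]
  refine ⟨hdiff.const_smul _, ?_, ?_⟩
  · rw [dR_smul]; congr 1; ext X; rw [dR_of_hasFDerivAt (key X)]; simp
  · rw [dZ_smul]; congr 1; ext X; rw [dZ_of_hasFDerivAt (key X)]; simp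

lemma tmp_gauss_deriv {n : ℕ} (hg : Tmp (n + 1) g) :
    (∃ gR, Tmp n gR ∧ dR (gauss * g) = gauss * gR) ∧ (∃ gZ, Tmp n gZ ∧ dZ (gauss * g) = gauss * gZ) := by
  have tc : ∀ {f}, TG f → Tmp n f := fun h => .of_hasTemperateGrowth h
  refine ⟨⟨dR g + (-(1 / 2) : ℝ) • cR * g, hg.2.2.1.add ((tc (TG.cR.smul _)).mul hg.of_succ), ?_⟩,
    ⟨dZ g + (-(1 / 2) : ℝ) • cZ * g, hg.2.2.2.add ((tc (TG.cZ.smul _)).mul hg.of_succ), ?_⟩⟩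
  · rw [dR_mul differentiable_gauss hg.1, dR_gauss]; ext X; simp; ring
  · rw [dZ_mul differentiable_gauss hg.1, dZ_gauss]; ext X; simp; ring

/-- `BS0` gains one derivative. -/
lemma Tmp.BS0 : ∀ {n : ℕ} {g : ℝ² → ℝ}, Tmp n g → Tmp (n + 1) (BS0 (gauss * g))
  | 0, g, hg => by
    have hc : Continuous (gauss * g) := differentiable_gauss.continuous.mul hg.1
    obtain ⟨M, h5⟩ := Rapid.gauss_mul hg.2 5
    obtain ⟨M4, h4⟩ := Rapid.gauss_mul hg.2 4
    have key := conv_lk_hasFDerivAt hc h5 h4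
    have hdiff : Differentiable ℝ (conv lk (gauss * g)) := fun X => (key X).differentiableAt
    have sm {f : ℝ² → ℝ} (hf : Continuous f ∧ PB f) (c : ℝ) : Tmp 0 (c • f) := by
      refine ⟨hf.1.const_smul c, ?_⟩
      exact PB.mul (f := fun _ => c) (TG.const c).pb hf.2
    rw [BS0_eq]
    refine ⟨hdiff.const_smul _, (sm ⟨hdiff.continuous, PB.conv ki_lk h5⟩ _).2, ?_, ?_⟩
    · rw [dR_smul]
      have : dR (conv lk (gauss * g)) = conv lkR (gauss * g) := by ext X; rw [dR_of_hasFDerivAt (key X)]; simp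
      rw [this]
      exact sm ⟨conv_continuous ki_lkR hc h4, PB.conv ki_lkR h4⟩ _
    · rw [dZ_smul]
      have : dZ (conv lk (gauss * g)) = conv lkZ (gauss * g) := by ext X; rw [dZ_of_hasFDerivAt (key X)]; simp
      rw [this]
      exact sm ⟨conv_continuous ki_lkZ hc h4, PB.conv ki_lkZ h4⟩ _
  | n + 1, g, hg => by
    obtain ⟨⟨gR, hR, eR⟩, ⟨gZ, hZ, eZ⟩⟩ := tmp_gauss_deriv hg
    have hd : Differentiable ℝ (gauss * g) := differentiable_gauss.mul hg.1
    have hr := Rapid.gauss_mul hg.2.1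
    have hrR := Rapid.gauss_mul hR.pb
    have hrZ := Rapid.gauss_mul hZ.pb
    obtain ⟨d1, d2, d3⟩ := dR_BS0 hd (eR ▸ differentiable_gauss.continuous.mul hR.continuous)
      (eZ ▸ differentiable_gauss.continuous.mul hZ.continuous) hr (eR ▸ hrR) (eZ ▸ hrZ)
    refine ⟨d1, ?_, ?_, ?_⟩
    · obtain ⟨M, h5⟩ := hr 5
      rw [BS0_eq]
      exact PB.mul (f := fun _ => 1 / (2 * π)) (TG.const _).pb (PB.conv ki_lk h5)
    · rw [d2, eR]; exact hR.BS0
    · rw [d3, eZ]; exact hZ.BS0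

lemma TG.BS0 (h : InZ η) : TG (BS0 η) := by
  obtain ⟨g, hg, rfl⟩ := inZ_iff.1 h
  exact hasTemperateGrowth_iff_tmp.2 fun n => (Tmp.BS0 (Tmp.of_hasTemperateGrowth hg)).of_succ

lemma InZ.BS0_deriv (h : InZ η) :
    VortexRing.dR (BS0 η) = BS0 (VortexRing.dR η) ∧ VortexRing.dZ (BS0 η) = BS0 (VortexRing.dZ η) :=
  (dR_BS0 h.diff h.dR.cont h.dZ.cont h.rapid h.dR.rapid h.dZ.rapid).2

lemma BS0_integrable (hc : Continuous η) (h : Rapid η) (X : ℝ²) :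
    Integrable fun Y => log (8 / √(distSq X Y)) * η Y := by
  obtain ⟨M, h5⟩ := h 5
  have := (conv_integrable ki_lk hc h5 X).comp_sub_left X
  simpa [lk, distSq] using! this

lemma BS0_add {η ξ : ℝ² → ℝ} (h : InZ η) (h' : InZ ξ) : BS0 (η + ξ) = BS0 η + BS0 ξ := by
  ext X
  simp only [BS0, Pi.add_apply, mul_add]
  rw [integral_add (BS0_integrable h.cont h.rapid X) (BS0_integrable h'.cont h'.rapid X), mul_add]

lemma BS0_smul (c : ℝ) (η : ℝ² → ℝ) : BS0 (c • η) = c • BS0 η := by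
  ext X
  simp only [BS0, Pi.smul_apply, smul_eq_mul]
  simp_rw [mul_left_comm _ c]
  rw [integral_const_mul]; ring

lemma BS0_sub {η ξ : ℝ² → ℝ} (h : InZ η) (h' : InZ ξ) : BS0 (η - ξ) = BS0 η - BS0 ξ := by
  have : η - ξ = η + (-1 : ℝ) • ξ := by simp [sub_eq_add_neg]
  rw [this, BS0_add h (h'.smul _), BS0_smul]; simp [sub_eq_add_neg]

/-! ### Angular Fourier modes of the logarithmic potential -/

lemma integral_cos_int_mul_add (m : ℤ) (d : ℝ) : ∫ α in (-π)..π, cos (m * α + d) = if m = 0 then 2 * π * cos d else 0 := by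
  split_ifs with h
  · simp only [h, Int.cast_zero, zero_mul, zero_add, intervalIntegral.integral_const, smul_eq_mul]; ring
  · have h1 : (m : ℝ) ≠ 0 := by exact_mod_cast h
    rw [intervalIntegral.integral_comp_mul_add _ h1, integral_cos, sin_add, sin_add, mul_neg, sin_neg, cos_neg, sin_int_mul_pi]
    simp

lemma integral_cos_mul_cos (k n : ℕ) (hn : 1 ≤ n) (θ c : ℝ) :
    ∫ α in (-π)..π, cos (k * (α - θ)) * cos (n * α - c) = if k = n then π * cos (n * θ - c) else 0 := by
  have e (α : ℝ) : cos (k * (α - θ)) * cos (n * α - c)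
      = 1 / 2 * cos ((k - n : ℤ) * α + (c - k * θ)) + 1 / 2 * cos ((k + n : ℤ) * α + (-c - k * θ)) := by
    rw [show ((k - n : ℤ) : ℝ) * α + (c - k * θ) = k * (α - θ) - (n * α - c) by push_cast; ring,
      show ((k + n : ℤ) : ℝ) * α + (-c - k * θ) = k * (α - θ) + (n * α - c) by push_cast; ring, cos_sub _ (_ - c), cos_add _ (_ - c)]
    ring
  simp_rw [e]
  rw [intervalIntegral.integral_add (Continuous.intervalIntegrable (by fun_prop) _ _) (Continuous.intervalIntegrable (by fun_prop) _ _),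
    intervalIntegral.integral_const_mul, intervalIntegral.integral_const_mul, integral_cos_int_mul_add, integral_cos_int_mul_add,
    if_neg (show (k + n : ℤ) ≠ 0 by omega)]
  by_cases h : k = n
  · subst h; rw [sub_self, if_pos rfl, if_pos rfl, ← cos_neg]; ring_nf
  · rw [if_neg (by omega), if_neg h]; simp

lemma dist_sq_polar (r s θ α : ℝ) (hr : 0 < r) :
    (r * cos θ - s * cos α) ^ 2 + (r * sin θ - s * sin α) ^ 2
      = (max r s) ^ 2 * (1 + (min r s / max r s) ^ 2 - 2 * (min r s / max r s) * cos (α - θ)) := by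
  have hM : 0 < max r s := lt_max_of_lt_left hr
  have h1 : max r s * min r s = r * s := max_mul_min r s
  have h2 : max r s ^ 2 + min r s ^ 2 = r ^ 2 + s ^ 2 := by rcases le_total r s with h | h <;> simp [h]; ring
  have h3 : (max r s) ^ 2 * (1 + (min r s / max r s) ^ 2 - 2 * (min r s / max r s) * cos (α - θ))
      = max r s ^ 2 + min r s ^ 2 - 2 * (max r s * min r s) * cos (α - θ) := by
    field_simp
  rw [h3, h1, h2, cos_sub]
  nlinarith [sin_sq_add_cos_sq θ, sin_sq_add_cos_sq α]

lemma hasSum_log_one_sub {t : ℝ} (ht0 : 0 ≤ t) (ht : t < 1) (γ : ℝ) :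
    HasSum (fun k : ℕ => t ^ k / k * cos (k * γ)) (-(1 / 2) * log (1 + t ^ 2 - 2 * t * cos γ)) := by
  have hz : ‖(t : ℂ) * Complex.exp (γ * Complex.I)‖ < 1 := by
    rw [norm_mul, Complex.norm_exp_ofReal_mul_I, Complex.norm_real, Real.norm_of_nonneg ht0]; simpa
  have h := Complex.hasSum_re (Complex.hasSum_taylorSeries_neg_log hz)
  convert h using 1
  · ext k
    rw [mul_pow, ← Complex.exp_nat_mul]
    have : (k : ℂ) * (γ * Complex.I) = ((k * γ : ℝ) : ℂ) * Complex.I := by push_cast; ring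
    rw [this, ← Complex.ofReal_pow, ← Complex.ofReal_natCast, mul_div_right_comm, ← Complex.ofReal_div,
      Complex.re_ofReal_mul, Complex.exp_ofReal_mul_I_re]
  · rw [Complex.neg_re, Complex.log_re]
    have : ‖1 - (t : ℂ) * Complex.exp (γ * Complex.I)‖ = √(1 + t ^ 2 - 2 * t * cos γ) := by
      rw [Complex.norm_def, Complex.normSq_apply]
      congr 1
      simp [Complex.exp_ofReal_mul_I_re, Complex.exp_ofReal_mul_I_im]
      nlinarith [sin_sq_add_cos_sq γ]
    rw [this, Real.log_sqrt]; · ring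
    nlinarith [sin_sq_add_cos_sq γ, sq_nonneg (t - cos γ), sq_nonneg (sin γ)]

lemma one_add_sq_sub_pos {t : ℝ} (h0 : 0 ≤ t) (h1 : t < 1) (γ : ℝ) : 0 < 1 + t ^ 2 - 2 * t * cos γ := by
  nlinarith [mul_le_mul_of_nonneg_left (cos_le_one γ) h0, sq_pos_of_pos (sub_pos.2 h1)]

lemma min_div_max_lt_one {r s : ℝ} (hr : 0 < r) (hrs : r ≠ s) : min r s / max r s < 1 := by
  rw [div_lt_one (lt_max_of_lt_left hr)]
  rcases lt_or_gt_of_ne hrs with h | h <;> simp [h.le, h]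

lemma lk_polar {r s : ℝ} (hr : 0 < r) (hs : 0 < s) (hrs : r ≠ s) (θ α : ℝ) :
    HasSum (fun k : ℕ => (min r s / max r s) ^ k / k * cos (k * (α - θ)))
      (lk (r * cos θ - s * cos α, r * sin θ - s * sin α) - log (8 / max r s)) := by
  have hM : 0 < max r s := lt_max_of_lt_left hr
  have ht0 : 0 ≤ min r s / max r s := by positivity
  have ht := min_div_max_lt_one hr hrs
  convert hasSum_log_one_sub ht0 ht (α - θ) using 1
  have hp := one_add_sq_sub_pos ht0 ht (α - θ)
  rw [lk]
  simp only
  rw [dist_sq_polar r s θ α hr, Real.sqrt_mul (by positivity), Real.sqrt_sq hM.le,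
    Real.log_div (by norm_num) (by positivity), Real.log_div (by norm_num) hM.ne',
    Real.log_mul hM.ne' (Real.sqrt_pos.2 hp).ne', Real.log_sqrt hp.le]
  ring

lemma integral_lk_mul_cos {r s : ℝ} (hr : 0 < r) (hs : 0 < s) (hrs : r ≠ s) (θ c : ℝ) {n : ℕ} (hn : 1 ≤ n) :
    ∫ α in (-π)..π, lk (r * cos θ - s * cos α, r * sin θ - s * sin α) * cos (n * α - c) = π / n * (min r s / max r s) ^ n * cos (n * θ - c) := by
  have ht0 : 0 ≤ min r s / max r s := by positivity
  have ht := min_div_max_lt_one hr hrs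
  set t := min r s / max r s with htd
  have hsum : HasSum (fun k : ℕ => ∫ α in (-π)..π, t ^ k / k * (cos (k * (α - θ)) * cos (n * α - c)))
      (∫ α in (-π)..π, (lk (r * cos θ - s * cos α, r * sin θ - s * sin α) - log (8 / max r s)) * cos (n * α - c)) := by
    refine intervalIntegral.hasSum_integral_of_dominated_convergence (fun k _ => t ^ k)
      (fun k => Continuous.aestronglyMeasurable (by fun_prop))
      (fun k => .of_forall fun α _ => ?_) (.of_forall fun α _ => summable_geometric_of_lt_one ht0 ht)
      (continuous_const.intervalIntegrable _ _) (.of_forall fun α _ => ?_)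
    · rw [Real.norm_eq_abs, abs_mul, abs_mul, abs_of_nonneg (by positivity)]
      calc _ ≤ t ^ k / k * (1 * 1) := by gcongr <;> exact abs_cos_le_one _
        _ ≤ _ := by
          rcases Nat.eq_zero_or_pos k with rfl | hk
          · simp
          · simpa using div_le_self (pow_nonneg ht0 k) (by exact_mod_cast hk)
    · simpa only [mul_assoc] using (lk_polar hr hs hrs θ α).mul_right (cos (n * α - c))
  have hval (k : ℕ) : ∫ α in (-π)..π, t ^ k / k * (cos (k * (α - θ)) * cos (n * α - c))
      = if k = n then π / n * t ^ n * cos (n * θ - c) else 0 := by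
    rw [intervalIntegral.integral_const_mul, integral_cos_mul_cos k n hn]
    split_ifs with h
    · subst h; ring
    · simp
  simp_rw [hval] at hsum
  have hcont : Continuous fun α : ℝ => lk (r * cos θ - s * cos α, r * sin θ - s * sin α) := by
    refine continuous_iff_continuousAt.2 fun α => (hasFDerivAt_lk ?_).continuousAt.comp (f := fun α => (r * cos θ - s * cos α, r * sin θ - s * sin α)) (by fun_prop)
    rw [dist_sq_polar r s θ α hr]
    have := one_add_sq_sub_pos ht0 ht (α - θ)
    positivity
  rw [← hsum.unique (hasSum_ite_eq n _)]
  simp_rw [sub_mul]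
  have h0 := integral_cos_int_mul_add n (-c)
  rw [if_neg (by omega)] at h0
  rw [intervalIntegral.integral_sub (Continuous.intervalIntegrable (by fun_prop) _ _) (Continuous.intervalIntegrable (by fun_prop) _ _),
    intervalIntegral.integral_const_mul]
  simp only [Int.cast_natCast, ← sub_eq_add_neg] at h0
  rw [h0, mul_zero, sub_zero]

/-! ### Polar coordinates -/

lemma integrableOn_polar  (hf : Integrable f) :
    IntegrableOn (fun p : ℝ² => p.1 • f (p.1 * cos p.2, p.1 * sin p.2)) (Ioi 0 ×ˢ Ioo (-π) π) := by
  have h := (integrableOn_image_iff_integrableOn_abs_det_fderiv_smul volume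
    polarCoord.open_target.measurableSet
    (fun p _ => (hasFDerivAt_polarCoord_symm p).hasFDerivWithinAt) polarCoord.symm.injOn f).1 hf.integrableOn
  simp_rw [det_fderivPolarCoordSymm] at h
  refine h.congr_fun (fun p hp => ?_) polarCoord.open_target.measurableSet
  simp only
  rw [abs_of_pos hp.1]
  rfl

lemma integral_polar  (hf : Integrable f) :
    ∫ X, f X = ∫ s in Ioi (0 : ℝ), s • ∫ α in (-π)..π, f polar[s; α] := by
  rw [← integral_comp_polarCoord_symm f]
  change ∫ p in Ioi (0:ℝ) ×ˢ Ioo (-π) π, p.1 • f (p.1 * cos p.2, p.1 * sin p.2) = _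
  rw [Measure.volume_eq_prod, setIntegral_prod _ (integrableOn_polar hf)]
  refine setIntegral_congr_fun measurableSet_Ioi fun s _ => ?_
  simp only
  rw [integral_smul, intervalIntegral.integral_of_le (by linarith [pi_pos]), integral_Ioc_eq_integral_Ioo]

/-- The action of `BS0` on the `n`-th angular mode. -/
def modeT (n : ℕ) (a : ℝ → ℝ) (r : ℝ) : ℝ :=
  (1 / (2 * n) : ℝ) • ∫ s in Ioi (0 : ℝ), ((min r s / max r s) ^ n * s) • a s

lemma BS0_mode (hc : Continuous f) (hf : Rapid f) {n : ℕ} (hn : 1 ≤ n) {a : ℝ → ℝ}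
    {c : ℝ} (h : ∀ s, 0 < s → ∀ α, f polar[s; α] = a s * cos (n * α - c))
    {r : ℝ} (hr : 0 < r) (θ : ℝ) :
    BS0 f polar[r; θ] = modeT n a r * cos (n * θ - c) := by
  have hi := BS0_integrable hc hf polar[r; θ]
  rw [BS0, integral_polar hi, modeT, smul_eq_mul]
  have : ∀ᵐ s : ℝ, s ≠ r := by simp [ae_iff]
  have e : ∫ s in Ioi (0:ℝ), s • ∫ α in (-π)..π, log (8 / √(distSq polar[r; θ] polar[s; α])) * f polar[s; α]
      = ∫ s in Ioi (0:ℝ), (π / n * cos (n * θ - c)) * (((min r s / max r s) ^ n * s) • a s) := by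
    refine setIntegral_congr_ae measurableSet_Ioi ?_
    filter_upwards [this] with s hs hs0
    have h2 := integral_lk_mul_cos hr hs0 (Ne.symm hs) θ c hn
    have h1 : ∀ α, log (8 / √(distSq polar[r; θ] polar[s; α])) * f polar[s; α]
        = a s * (lk (r * cos θ - s * cos α, r * sin θ - s * sin α) * cos (n * α - c)) := fun α => by
      rw [h s hs0 α]
      simp only [lk, distSq]; ring
    simp_rw [h1]
    rw [intervalIntegral.integral_const_mul, h2]
    simp only [smul_eq_mul]; ring
  rw [e, integral_const_mul]
  have : (n : ℝ) ≠ 0 := by positivity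
  field_simp

lemma lk_neg (V : ℝ²) : lk (-V) = lk V := by simp [lk]

/-- Angular Fourier coefficients. -/
def fcoef (n : ℕ) (c : ℝ) (f : ℝ² → ℝ) (r : ℝ) : ℝ := ∫ α in (-π)..π, f polar[r; α] * cos (n * α - c)

/-- Angular Fourier coefficients of the logarithmic potential. -/
lemma BS0_fourier (hc : Continuous η) (hf : Rapid η) {n : ℕ} (hn : 1 ≤ n) (c : ℝ) {r : ℝ} (hr : 0 < r) :
    fcoef n c (BS0 η) r = modeT n (fcoef n c η) r := by
  obtain ⟨M, h5⟩ := hf 5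
  have hF := conv_integrable_prod ki_lk measurable_lk hc h5 (P := fun θ => polar[r; θ]) (by fun_prop) (w := fun θ => cos (n * θ - c)) (by fun_prop) (-π) π
  have e1 (θ : ℝ) : BS0 η polar[r; θ] * cos (n * θ - c) = 1 / (2 * π) * ∫ Y, lk (polar[r; θ] - Y) * η Y * cos (n * θ - c) := by
    rw [BS0_eq, Pi.smul_apply, conv_eq_integral, integral_mul_const, smul_eq_mul, mul_assoc]
  rw [fcoef]
  simp_rw [e1]
  have hh := hF.integral_prod_right
  rw [uIoc_of_le (by linarith [pi_pos])] at hh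
  rw [intervalIntegral.integral_const_mul, intervalIntegral_integral_swap hF, integral_polar (hh.congr (.of_forall fun Y => by
      rw [intervalIntegral.integral_of_le (by linarith [pi_pos])]; rfl)), modeT]
  have : ∀ᵐ s : ℝ, s ≠ r := by simp [ae_iff]
  have e : ∫ s in Ioi (0:ℝ), s • ∫ α in (-π)..π, ∫ θ in (-π)..π, lk (polar[r; θ] - polar[s; α]) * η polar[s; α] * cos (n * θ - c)
      = ∫ s in Ioi (0:ℝ), π / n * (((min r s / max r s) ^ n * s) • fcoef n c η s) := by
    refine setIntegral_congr_ae measurableSet_Ioi ?_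
    filter_upwards [this] with s hs hs0
    have h1 (α : ℝ) : ∫ θ in (-π)..π, lk (polar[r; θ] - polar[s; α]) * η polar[s; α] * cos (n * θ - c)
        = π / n * (min r s / max r s) ^ n * (η polar[s; α] * cos (n * α - c)) := by
      have h2 := integral_lk_mul_cos hs0 hr hs α c hn
      rw [min_comm, max_comm] at h2
      rw [mul_left_comm, ← h2, ← intervalIntegral.integral_const_mul]
      refine intervalIntegral.integral_congr fun θ _ => ?_
      have e := lk_neg (polar[r; θ] - polar[s; α])
      rw [neg_sub] at e
      simp only [Prod.mk_sub_mk] at e ⊢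
      rw [← e]; ring
    simp_rw [h1]
    rw [intervalIntegral.integral_const_mul, fcoef]
    simp only [smul_eq_mul]; ring
  rw [e, integral_const_mul]
  simp only [smul_eq_mul]
  have : (n : ℝ) ≠ 0 := by positivity
  field_simp

/-! ### The entire function `Ein` and its derivatives -/

/-- `∫₀¹ t^k e^{-xt} dt`; for `k = 0` this is `(1 - e^{-x}) / x`. -/
def EK (k : ℕ) (x : ℝ) : ℝ := ∫ t in (0 : ℝ)..1, t ^ k * exp (-(x * t))

lemma intervalIntegrable_EK (k : ℕ) (x : ℝ) : IntervalIntegrable (fun t => t ^ k * exp (-(x * t))) volume 0 1 :=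
  (by fun_prop : Continuous fun t : ℝ => t ^ k * exp (-(x * t))).intervalIntegrable _ _

lemma hasDerivAt_EK (k : ℕ) (x : ℝ) : HasDerivAt (EK k) (-EK (k + 1) x) x := by
  have key := intervalIntegral.hasDerivAt_integral_of_dominated_loc_of_deriv_le (𝕜 := ℝ) (μ := volume)
    (F := fun x t => t ^ k * exp (-(x * t))) (F' := fun x t => -(t ^ (k + 1) * exp (-(x * t))))
    (s := Metric.ball x 1) (x₀ := x) (a := 0) (b := 1) (bound := fun _ => exp (|x| + 1))
    (Metric.ball_mem_nhds x one_pos)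
    (.of_forall fun y => (by fun_prop : Continuous fun t : ℝ => t ^ k * exp (-(y * t))).aestronglyMeasurable)
    (intervalIntegrable_EK k x)
    (by fun_prop : Continuous fun t : ℝ => -(t ^ (k + 1) * exp (-(x * t)))).aestronglyMeasurable
    (.of_forall fun t ht y hy => ?_) (continuous_const.intervalIntegrable _ _)
    (.of_forall fun t ht y hy => ?_)
  · have := key.2
    rw [intervalIntegral.integral_neg] at this
    exact this
  · rw [uIoc_of_le zero_le_one] at ht
    rw [norm_neg, Real.norm_of_nonneg (by have := ht.1; positivity)]
    rw [Metric.mem_ball, Real.dist_eq] at hy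
    have h1 : t ^ (k + 1) ≤ 1 := pow_le_one₀ ht.1.le ht.2
    have h2 : -(y * t) ≤ |x| + 1 := by
      have hy1 : |y| ≤ |x| + 1 := by have := abs_sub_abs_le_abs_sub y x; linarith
      have : |y| * t ≤ |y| * 1 := by gcongr; exact ht.2
      have : -(y * t) ≤ |y| * t := by rw [← neg_mul]; exact mul_le_mul_of_nonneg_right (neg_le_abs y) ht.1.le
      linarith
    calc t ^ (k + 1) * exp (-(y * t)) ≤ 1 * exp (|x| + 1) := by gcongr
      _ = _ := one_mul _
  · have h1 : HasDerivAt (fun y : ℝ => -(y * t)) (-(1 * t)) y := ((hasDerivAt_id y).mul_const t).neg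
    have := (h1.exp).const_mul (t ^ k)
    convert! this using 1
    ring

lemma continuous_EK (k : ℕ) : Continuous (EK k) := continuous_iff_continuousAt.2 fun x => (hasDerivAt_EK k x).continuousAt

lemma EK_pos (k : ℕ) (x : ℝ) : 0 < EK k x := intervalIntegral.intervalIntegral_pos_of_pos_on
    (intervalIntegrable_EK k x) (fun t ht => by have := ht.1; positivity) one_pos

lemma EK_le_exp (k : ℕ) {x c : ℝ} (hc : 0 ≤ c) (hx : -c ≤ x) : EK k x ≤ exp c := by
  have : ∀ t ∈ Icc (0:ℝ) 1, t ^ k * exp (-(x * t)) ≤ exp c := fun t ht => by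
    have h1 : t ^ k ≤ 1 := pow_le_one₀ ht.1 ht.2
    have h2 : -(x * t) ≤ c := by nlinarith [ht.1, ht.2]
    calc t ^ k * exp (-(x * t)) ≤ 1 * exp c := by gcongr
      _ = _ := one_mul _
  calc EK k x ≤ ∫ t in (0:ℝ)..1, exp c := intervalIntegral.integral_mono_on zero_le_one
        (intervalIntegrable_EK k x) (continuous_const.intervalIntegrable _ _) this
    _ = _ := by simp

lemma EK_le_EK0 (k : ℕ) (x : ℝ) : EK k x ≤ EK 0 x := by
  refine intervalIntegral.integral_mono_on zero_le_one (intervalIntegrable_EK k x) (intervalIntegrable_EK 0 x) fun t ht => ?_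
  have h1 : t ^ k ≤ 1 := pow_le_one₀ ht.1 ht.2
  rw [pow_zero]
  gcongr

lemma mul_EK0 (x : ℝ) : x * EK 0 x = 1 - exp (-x) := by
  simpa [EK] using intervalIntegral.mul_integral_comp_mul_left (f := fun t => exp (-t)) (a := 0) (b := 1) x

lemma one_le_mul_EK0 {x : ℝ} (hx : 0 ≤ x) : 1 ≤ (1 + x) * EK 0 x := by
  have h1 := mul_EK0 x
  have h2 : exp (-x) ≤ EK 0 x := by
    have : ∫ t in (0:ℝ)..1, exp (-x) ≤ EK 0 x := intervalIntegral.integral_mono_on zero_le_one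
        (continuous_const.intervalIntegrable _ _) (intervalIntegrable_EK 0 x) fun t ht => by
          rw [pow_zero, one_mul]; apply exp_le_exp.2; nlinarith [ht.2]
    simpa using this
  nlinarith

lemma hasDerivAt_Ein (x : ℝ) : HasDerivAt Ein (EK 0 x) x := by
  have e : Ein = fun x => ∫ t in (0:ℝ)..x, EK 0 t := by
    ext x
    refine intervalIntegral.integral_congr_ae ?_
    have : ∀ᵐ s : ℝ, s ≠ 0 := by simp [ae_iff]
    filter_upwards [this] with t ht _
    have := mul_EK0 t
    field_simp; linarith
  rw [e]
  exact (continuous_EK 0).integral_hasStrictDerivAt 0 x |>.hasDerivAt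

lemma Ein_zero : Ein 0 = 0 := by simp [Ein]

/-- `|X|²/4`. -/
def quarter (X : ℝ²) : ℝ := (X.1 ^ 2 + X.2 ^ 2) / 4

lemma quarter_nonneg (X : ℝ²) : 0 ≤ quarter X := by unfold quarter; positivity

lemma gauss_eq (X : ℝ²) : gauss X = exp (-quarter X) := by unfold gauss quarter; congr 1; ring

lemma tg_quarter : TG quarter := by
  have : quarter = (1 / 4 : ℝ) • (cR ^ 2 + cZ ^ 2) := by ext X; simp [quarter, cR, cZ]; ring
  rw [this]; exact ((TG.cR.pow 2).add (TG.cZ.pow 2)).smul _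

lemma hasFDerivAt_quarter (X : ℝ²) : HasFDerivAt quarter (lin (X.1 / 2) (X.2 / 2)) X := by
  have := ((((hasFDerivAt_cR X).pow 2).add ((hasFDerivAt_cZ X).pow 2)).const_mul (1 / 4 : ℝ))
  have e : quarter = fun X : ℝ² => (1 / 4 * ((fun x : ℝ² => x.1 ^ 2) + fun x : ℝ² => x.2 ^ 2) X) := by ext X; simp only [quarter, Pi.add_apply]; ring
  rw [e]
  refine this.congr_fderiv ?_
  ext <;> simp <;> ring

lemma HasDerivAt.comp_quarter {f : ℝ → ℝ} {f' : ℝ} (h : HasDerivAt f f' (quarter X)) :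
    HasFDerivAt (fun X => f (quarter X)) (lin (f' * (X.1 / 2)) (f' * (X.2 / 2))) X := by
  refine (h.comp_hasFDerivAt X (hasFDerivAt_quarter X)).congr_fderiv ?_
  ext <;> simp

/-- `EK k (|X|²/4)`. -/
def EKf (k : ℕ) (X : ℝ²) : ℝ := EK k (quarter X)

lemma hasFDerivAt_EKf (k : ℕ) (X : ℝ²) :
    HasFDerivAt (EKf k) (lin (-EKf (k + 1) X * (X.1 / 2)) (-EKf (k + 1) X * (X.2 / 2))) X :=
  HasDerivAt.comp_quarter (hasDerivAt_EK k (quarter X))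

lemma EKf_pos (k : ℕ) (X : ℝ²) : 0 < EKf k X := EK_pos _ _

lemma dR_EKf (k : ℕ) : dR (EKf k) = ((-(1 / 2) : ℝ) • cR) * EKf (k + 1) := by ext X; rw [dR_of_hasFDerivAt (hasFDerivAt_EKf k X)]; simp [cR]; ring
lemma dZ_EKf (k : ℕ) : dZ (EKf k) = ((-(1 / 2) : ℝ) • cZ) * EKf (k + 1) := by ext X; rw [dZ_of_hasFDerivAt (hasFDerivAt_EKf k X)]; simp [cZ]; ring

lemma differentiable_EKf (k : ℕ) : Differentiable ℝ (EKf k) := fun X => (hasFDerivAt_EKf k X).differentiableAt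

lemma pb_EKf (k : ℕ) : PB (EKf k) := PB.of_le (k := 0) (C := 1) fun X => by
    rw [abs_of_pos (EKf_pos k X)]
    simpa [EKf] using EK_le_exp k (x := quarter X) (c := 0) le_rfl (by simpa using quarter_nonneg X)

lemma tmp_EKf : ∀ (n k : ℕ), Tmp n (EKf k)
  | 0, k => ⟨(differentiable_EKf k).continuous, pb_EKf k⟩
  | n + 1, k => by
    refine ⟨differentiable_EKf k, pb_EKf k, ?_, ?_⟩
    · rw [dR_EKf]; exact Tmp.mul (.of_hasTemperateGrowth (TG.cR.smul _)) (tmp_EKf n _)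
    · rw [dZ_EKf]; exact Tmp.mul (.of_hasTemperateGrowth (TG.cZ.smul _)) (tmp_EKf n _)

lemma tg_EKf (k : ℕ) : TG (EKf k) := hasTemperateGrowth_iff_tmp.2 fun n => tmp_EKf n k

/-- Ratios `EK k / EK 0`, bounded by one. -/
def Urat (k : ℕ) (X : ℝ²) : ℝ := EKf k X / EKf 0 X

/-- `1 / EK 0 (|X|²/4)`. -/
def Kf (X : ℝ²) : ℝ := (EKf 0 X)⁻¹

lemma Kf_pos (X : ℝ²) : 0 < Kf X := inv_pos.2 (EKf_pos 0 X)

lemma hasFDerivAt_Urat (k : ℕ) (X : ℝ²) : HasFDerivAt (Urat k)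
    (lin ((-Urat (k + 1) X + Urat k X * Urat 1 X) * (X.1 / 2))
      ((-Urat (k + 1) X + Urat k X * Urat 1 X) * (X.2 / 2))) X := by
  have h0 := (EKf_pos 0 X).ne'
  have := HasDerivAt.comp_quarter ((hasDerivAt_EK k (quarter X)).div (hasDerivAt_EK 0 (quarter X)) h0)
  refine HasFDerivAt.congr_fderiv this ?_
  have h0' : EK 0 (quarter X) ≠ 0 := h0
  have : (-EK (k + 1) (quarter X) * EK 0 (quarter X) - EK k (quarter X) * -EK (0 + 1) (quarter X)) /
      EK 0 (quarter X) ^ 2 = -Urat (k + 1) X + Urat k X * Urat 1 X := by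
    unfold Urat EKf; field_simp; ring
  rw [this]

lemma hasFDerivAt_Kf (X : ℝ²) : HasFDerivAt Kf
    (lin ((Urat 1 X * Kf X) * (X.1 / 2)) ((Urat 1 X * Kf X) * (X.2 / 2))) X := by
  have h0 := (EKf_pos 0 X).ne'
  have := HasDerivAt.comp_quarter ((hasDerivAt_EK 0 (quarter X)).inv h0)
  refine HasFDerivAt.congr_fderiv this ?_
  have h0' : EK 0 (quarter X) ≠ 0 := h0
  have : (- -EK (0 + 1) (quarter X)) / EK 0 (quarter X) ^ 2 = Urat 1 X * Kf X := by unfold Urat Kf EKf; field_simp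
  rw [this]

lemma dR_Urat (k : ℕ) : dR (Urat k) = ((1 / 2 : ℝ) • cR) * ((fun _ => -1) * Urat (k + 1) + Urat k * Urat 1) := by
  ext X; rw [dR_of_hasFDerivAt (hasFDerivAt_Urat k X)]; simp [cR]; ring
lemma dZ_Urat (k : ℕ) : dZ (Urat k) = ((1 / 2 : ℝ) • cZ) * ((fun _ => -1) * Urat (k + 1) + Urat k * Urat 1) := by
  ext X; rw [dZ_of_hasFDerivAt (hasFDerivAt_Urat k X)]; simp [cZ]; ring
lemma dR_Kf : dR Kf = ((1 / 2 : ℝ) • cR) * (Urat 1 * Kf) := by ext X; rw [dR_of_hasFDerivAt (hasFDerivAt_Kf X)]; simp [cR]; ring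
lemma dZ_Kf : dZ Kf = ((1 / 2 : ℝ) • cZ) * (Urat 1 * Kf) := by ext X; rw [dZ_of_hasFDerivAt (hasFDerivAt_Kf X)]; simp [cZ]; ring

lemma pb_Urat (k : ℕ) : PB (Urat k) := PB.of_le (k := 0) (C := 1) fun X => by
    rw [Urat, abs_of_pos (div_pos (EKf_pos k X) (EKf_pos 0 X)), div_le_iff₀ (EKf_pos 0 X)]
    rw [pow_zero, mul_one, one_mul]
    exact EK_le_EK0 k (quarter X)

lemma Kf_le (X : ℝ²) : Kf X ≤ 1 + quarter X := by
  rw [Kf, inv_le_iff_one_le_mul₀ (EKf_pos 0 X)]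
  exact one_le_mul_EK0 (quarter_nonneg X)

lemma pb_Kf : PB Kf := by
  obtain ⟨k, C, hC, h⟩ := (TG.one.add tg_quarter).pb
  exact ⟨k, C, hC, fun X => (abs_of_pos (Kf_pos X)).trans_le (((Kf_le X).trans (le_abs_self _)).trans (h X))⟩

lemma tmp_Urat : ∀ (n k : ℕ), Tmp n (Urat k)
  | 0, k => ⟨(show Differentiable ℝ (Urat k) from fun X => (hasFDerivAt_Urat k X).differentiableAt).continuous, pb_Urat k⟩
  | n + 1, k => by
    have : Tmp n ((fun _ => -1) * Urat (k + 1) + Urat k * Urat 1) :=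
      ((Tmp.of_hasTemperateGrowth (TG.const _)).mul (tmp_Urat n _)).add ((tmp_Urat n _).mul (tmp_Urat n _))
    refine ⟨fun X => (hasFDerivAt_Urat k X).differentiableAt, pb_Urat k, ?_, ?_⟩
    · rw [dR_Urat]; exact Tmp.mul (.of_hasTemperateGrowth (TG.cR.smul _)) this
    · rw [dZ_Urat]; exact Tmp.mul (.of_hasTemperateGrowth (TG.cZ.smul _)) this

lemma tmp_Kf : ∀ n : ℕ, Tmp n Kf
  | 0 => ⟨(show Differentiable ℝ Kf from fun X => (hasFDerivAt_Kf X).differentiableAt).continuous, pb_Kf⟩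
  | n + 1 => by
    refine ⟨fun X => (hasFDerivAt_Kf X).differentiableAt, pb_Kf, ?_, ?_⟩
    · rw [dR_Kf]; exact Tmp.mul (.of_hasTemperateGrowth (TG.cR.smul _)) ((tmp_Urat n _).mul (tmp_Kf n))
    · rw [dZ_Kf]; exact Tmp.mul (.of_hasTemperateGrowth (TG.cZ.smul _)) ((tmp_Urat n _).mul (tmp_Kf n))

lemma tg_Kf : TG Kf := hasTemperateGrowth_iff_tmp.2 tmp_Kf

/-! ### The first angular mode and the stream function `φ₀` -/

lemma modeT_one {a : ℝ → ℝ}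
    (h1 : IntegrableOn (fun s => s ^ 2 • a s) (Ioi 0)) (h0 : IntegrableOn a (Ioi 0)) {r : ℝ} (hr : 0 < r) :
    modeT 1 a r = (1 / 2 : ℝ) • ((1 / r) • (∫ s in Ioc 0 r, s ^ 2 • a s) + r • ∫ s in Ioi r, a s) := by
  have hI : Ioi (0:ℝ) = Ioc 0 r ∪ Ioi r := (Ioc_union_Ioi_eq_Ioi hr.le).symm
  have e1 : EqOn (fun s => ((min r s / max r s) ^ 1 * s) • a s) (fun s => (1 / r) • (s ^ 2 • a s)) (Ioc 0 r) := by
    intro s hs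
    simp only [min_eq_right hs.2, max_eq_left hs.2, smul_smul]
    congr 1; ring
  have e2 : EqOn (fun s => ((min r s / max r s) ^ 1 * s) • a s) (fun s => r • a s) (Ioi r) := by
    intro s hs
    have hs' : r < s := hs
    have : s ≠ 0 := by linarith
    simp only [min_eq_left hs'.le, max_eq_right hs'.le]
    congr 1; field_simp
  have i1 : IntegrableOn (fun s => ((min r s / max r s) ^ 1 * s) • a s) (Ioc 0 r) :=
    IntegrableOn.congr_fun ((h1.mono_set (Ioc_subset_Ioi_self)).smul (1 / r)) e1.symm measurableSet_Ioc
  have i2 : IntegrableOn (fun s => ((min r s / max r s) ^ 1 * s) • a s) (Ioi r) :=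
    IntegrableOn.congr_fun ((h0.mono_set (Ioi_subset_Ioi hr.le)).smul r) e2.symm measurableSet_Ioi
  rw [modeT, hI, setIntegral_union (by rw [Set.disjoint_left]; intro x hx hx'; exact absurd hx.2 (not_le.2 hx'))
    measurableSet_Ioi i1 i2, setIntegral_congr_fun measurableSet_Ioc e1,
    setIntegral_congr_fun measurableSet_Ioi e2, integral_smul, integral_smul]
  norm_num

/-- `(1 - e^{-r²/4}) / r`, proportional to the derivative of `φ₀`. -/
def qrad (r : ℝ) : ℝ := r / 4 * EK 0 (r ^ 2 / 4)

lemma qrad_eq {r : ℝ} (hr : 0 < r) : qrad r = (1 - exp (-(r ^ 2 / 4))) / r := by rw [← mul_EK0, qrad]; field_simp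

lemma qrad_pos {r : ℝ} (hr : 0 < r) : 0 < qrad r := by have := EK_pos 0 (r ^ 2 / 4); unfold qrad; positivity

/-- The weight times `qrad`. -/
def wq (s : ℝ) : ℝ := s / 4 * exp (-(s ^ 2 / 4))

lemma integrable_pow_mul_exp (k : ℕ) : Integrable fun s : ℝ => s ^ k * exp (-(s ^ 2 / 4)) := by
  have := integrable_rpow_mul_exp_neg_mul_sq (b := 1 / 4) (by norm_num) (s := k)
    (by have : (0:ℝ) ≤ k := Nat.cast_nonneg k
        linarith)
  refine this.congr (.of_forall fun s => ?_)
  simp only [rpow_natCast]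
  congr 2; ring

lemma integrable_wq : Integrable wq ∧ Integrable (fun s => s ^ 2 * wq s) := by
  constructor
  · refine ((integrable_pow_mul_exp 1).const_mul (1 / 4)).congr (.of_forall fun s => ?_)
    simp only [wq]; ring
  · refine ((integrable_pow_mul_exp 3).const_mul (1 / 4)).congr (.of_forall fun s => ?_)
    simp only [wq]; ring

lemma integral_wq_Ioi (r : ℝ) : ∫ s in Ioi r, wq s = 1 / 2 * exp (-(r ^ 2 / 4)) := by
  have hd : ∀ s ∈ Ici r, HasDerivAt (fun s : ℝ => -(1 / 2) * exp (-(s ^ 2 / 4))) (wq s) s := fun s _ => by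
    have := ((((hasDerivAt_id s).pow 2).div_const 4).neg.exp).const_mul (-(1 / 2))
    convert! this using 1
    simp [wq]; ring
  have ht : Filter.Tendsto (fun s : ℝ => -(1 / 2) * exp (-(s ^ 2 / 4))) Filter.atTop (nhds 0) := by
    have h1 : Filter.Tendsto (fun s : ℝ => s ^ 2 / 4) Filter.atTop Filter.atTop :=
      (Filter.tendsto_pow_atTop (by norm_num)).atTop_div_const (by norm_num)
    have := (tendsto_exp_neg_atTop_nhds_zero.comp h1).const_mul (-(1 / 2) : ℝ)
    simpa [Function.comp_def] using this
  rw [integral_Ioi_of_hasDerivAt_of_tendsto' hd integrable_wq.1.integrableOn ht]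
  ring

lemma modeT_wq {r : ℝ} (hr : 0 < r) : modeT 1 wq r = qrad r := by
  rw [modeT_one integrable_wq.2.integrableOn integrable_wq.1.integrableOn hr, integral_wq_Ioi, ← intervalIntegral.integral_of_le hr.le]
  have hd : ∀ s ∈ uIcc 0 r, HasDerivAt (fun s : ℝ => -(2 + s ^ 2 / 2) * exp (-(s ^ 2 / 4))) (s ^ 2 • wq s) s := fun s _ => by
    have h1 := (((hasDerivAt_id s).pow 2).div_const 4).neg.exp
    have h2 := ((((hasDerivAt_id s).pow 2).div_const 2).const_add 2).neg
    have := h2.mul h1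
    convert! this using 1
    simp [wq]; ring
  rw [intervalIntegral.integral_eq_sub_of_hasDerivAt hd
    ((by unfold wq; fun_prop : Continuous fun s : ℝ => s ^ 2 • wq s).intervalIntegrable _ _), qrad_eq hr]
  simp only [smul_eq_mul]
  norm_num
  field_simp
  ring

lemma exists_polar (X : ℝ²) (hX : X ≠ 0) : ∃ r θ, 0 < r ∧ X = polar[r; θ] := by
  set z : ℂ := ⟨X.1, X.2⟩ with hz
  have hz0 : z ≠ 0 := by
    intro h
    apply hX
    have h1 := congrArg Complex.re h
    have h2 := congrArg Complex.im h
    exact Prod.ext h1 h2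
  refine ⟨‖z‖, z.arg, norm_pos_iff.2 hz0, Prod.ext ?_ ?_⟩
  · exact (Complex.norm_mul_cos_arg z).symm
  · exact (Complex.norm_mul_sin_arg z).symm

lemma eq_of_polar (hf : Continuous f) (hg : Continuous g)
    (h : ∀ r θ, 0 < r → f polar[r; θ] = g polar[r; θ]) : f = g := by
  refine hf.ext_on (dense_compl_singleton (0 : ℝ²)) hg fun X hX => ?_
  obtain ⟨r, θ, hr, rfl⟩ := exists_polar X hX
  exact h r θ hr

lemma quarter_polar (r θ : ℝ) : quarter polar[r; θ] = r ^ 2 / 4 := by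
  simp only [quarter]
  nlinarith [sin_sq_add_cos_sq θ]

lemma eta0_apply (X : ℝ²) : eta0 X = 1 / (4 * π) * exp (-quarter X) := by rw [← gauss_eq]; rfl

lemma dR_eta0 : dR eta0 = (-(1 / 2) : ℝ) • (cR * eta0) := by rw [eta0_eq, dR_smul, dR_gauss]; ext X; simp; ring
lemma dZ_eta0 : dZ eta0 = (-(1 / 2) : ℝ) • (cZ * eta0) := by rw [eta0_eq, dZ_smul, dZ_gauss]; ext X; simp; ring

lemma tg_phi0 : TG phi0 := TG.BS0 inZ_eta0

lemma modeT_const_mul (n : ℕ) (c : ℝ) (a : ℝ → ℝ) (r : ℝ) : modeT n (fun s => c * a s) r = c * modeT n a r := by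
  simp only [modeT, smul_eq_mul, mul_left_comm _ c, integral_const_mul]

lemma dR_phi0 : dR phi0 = (-(1 / (8 * π))) • (cR * EKf 0) := by
  rw [phi0, inZ_eta0.BS0_deriv.1]
  refine eq_of_polar (TG.BS0 inZ_eta0.dR).cont ((TG.cR.mul (tg_EKf 0)).smul _).cont fun r θ hr => ?_
  rw [BS0_mode inZ_eta0.dR.cont inZ_eta0.dR.rapid le_rfl (a := fun s => (-(1 / (2 * π))) * wq s) (c := 0) ?_ hr]
  · rw [modeT_const_mul, modeT_wq hr]
    simp only [qrad, EKf, quarter_polar, cR, Pi.smul_apply, Pi.mul_apply, smul_eq_mul]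
    have := pi_ne_zero
    simp; field_simp; ring
  · intro s hs α
    rw [dR_eta0]
    simp only [Pi.smul_apply, Pi.mul_apply, smul_eq_mul, eta0_apply, quarter_polar, cR, wq]
    have := pi_ne_zero
    simp; field_simp

lemma dZ_phi0 : dZ phi0 = (-(1 / (8 * π))) • (cZ * EKf 0) := by
  rw [phi0, inZ_eta0.BS0_deriv.2]
  refine eq_of_polar (TG.BS0 inZ_eta0.dZ).cont ((TG.cZ.mul (tg_EKf 0)).smul _).cont fun r θ hr => ?_
  rw [BS0_mode inZ_eta0.dZ.cont inZ_eta0.dZ.rapid le_rfl (a := fun s => (-(1 / (2 * π))) * wq s) (c := π / 2) ?_ hr]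
  · rw [modeT_const_mul, modeT_wq hr]
    simp only [qrad, EKf, quarter_polar, cZ, Pi.smul_apply, Pi.mul_apply, smul_eq_mul]
    have := pi_ne_zero
    simp [cos_sub_pi_div_two]; field_simp; ring
  · intro s hs α
    rw [dZ_eta0]
    simp only [Pi.smul_apply, Pi.mul_apply, smul_eq_mul, eta0_apply, quarter_polar, cZ, wq]
    have := pi_ne_zero
    simp [cos_sub_pi_div_two]; field_simp

lemma phi0_eq (X : ℝ²) : phi0 X = phi0 0 - 1 / (4 * π) * Ein (quarter X) := by
  have hd : ∀ X, HasFDerivAt (fun X => phi0 X + 1 / (4 * π) * Ein (quarter X)) 0 X := fun X => by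
    have h1 := hasFDerivAt_lin (tg_phi0.diff X)
    have h2 := (HasDerivAt.comp_quarter (hasDerivAt_Ein (quarter X))).const_mul (1 / (4 * π))
    refine (h1.add h2).congr_fderiv ?_
    rw [dR_phi0, dZ_phi0]
    have := pi_ne_zero
    ext <;> simp [cR, cZ, EKf] <;> field_simp <;> ring
  have := is_const_of_fderiv_eq_zero (𝕜 := ℝ) (fun X => (hd X).differentiableAt) (fun X => (hd X).fderiv) X 0
  have q0 : quarter 0 = 0 := by simp [quarter]
  rw [q0, Ein_zero, mul_zero, add_zero] at this
  linarith

/-! ### The linear operator `Λ` -/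

/-- Multiplication by `Φ₀'(η₀)`. -/
def Aop (η : ℝ² → ℝ) : ℝ² → ℝ := fun X => EKf 0 X * (exp (quarter X) * η X)

lemma exp_quarter_mul_gauss (X : ℝ²) : exp (quarter X) * gauss X = 1 := exp_mul_gauss X

lemma Aop_gauss_mul (g : ℝ² → ℝ) : Aop (gauss * g) = EKf 0 * g := by
  ext X
  have := exp_quarter_mul_gauss X
  simp only [Aop, Pi.mul_apply]
  linear_combination (EKf 0 X * g X) * this

lemma TG.Aop (h : InZ η) : TG (Aop η) := by
  obtain ⟨g, hg, rfl⟩ := inZ_iff.1 h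
  rw [Aop_gauss_mul]; exact (tg_EKf 0).mul hg

/-- Bracket with `η₀`. -/
lemma pb_eta0 (f : ℝ² → ℝ) : pb f eta0 = (1 / 2 : ℝ) • (eta0 * (cR * dZ f - cZ * dR f)) := by rw [pb, dR_eta0, dZ_eta0]; ext X; simp; ring

lemma pb_phi0 (h : InZ η) : pb phi0 η = -pb (Aop η) eta0 := by
  obtain ⟨g, hg, rfl⟩ := inZ_iff.1 h
  rw [Aop_gauss_mul, pb_eta0, pb, dR_phi0, dZ_phi0, dR_mul differentiable_gauss hg.diff,
    dZ_mul differentiable_gauss hg.diff, dR_mul (differentiable_EKf 0) hg.diff,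
    dZ_mul (differentiable_EKf 0) hg.diff, dR_EKf, dZ_EKf, dR_gauss, dZ_gauss, eta0_eq]
  ext X
  have := pi_ne_zero
  simp
  field_simp; ring

lemma pb_sub_left {f g h : ℝ² → ℝ} (hf : Differentiable ℝ f) (hg : Differentiable ℝ g) :
    pb (f - g) h = pb f h - pb g h := by
  rw [pb, pb, pb, dR_sub hf hg, dZ_sub hf hg]; ring
lemma pb_add_left {f g h : ℝ² → ℝ} (hf : Differentiable ℝ f) (hg : Differentiable ℝ g) :
    pb (f + g) h = pb f h + pb g h := by
  rw [pb, pb, pb, dR_add hf hg, dZ_add hf hg]; ring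
lemma pb_neg_left {f h : ℝ² → ℝ} : pb (-f) h = -pb f h := by rw [pb, pb, dR_neg, dZ_neg]; ring
lemma pb_smul_left {f h : ℝ² → ℝ} (c : ℝ) : pb (c • f) h = c • pb f h := by rw [pb, pb, dR_smul, dZ_smul]; ext X; simp; ring

lemma Lam_eq (h : InZ η) : Lam η = pb (BS0 η - Aop η) eta0 := by rw [Lam, pb_phi0 h, pb_sub_left (TG.BS0 h).diff (TG.Aop h).diff]; ring

/-! ### Uniqueness for the linearized equation -/

/-- The radial factor of `Aop`. -/
def Arad (r : ℝ) : ℝ := EK 0 (r ^ 2 / 4) * exp (r ^ 2 / 4)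

lemma Arad_pos (r : ℝ) : 0 < Arad r := mul_pos (EK_pos _ _) (exp_pos _)

lemma continuous_Arad : Continuous Arad := ((continuous_EK 0).comp (by fun_prop)).mul (by fun_prop)

lemma continuous_qrad : Continuous qrad := by
  have := continuous_EK 0
  unfold qrad; fun_prop

lemma wq_mul_Arad (r : ℝ) : Arad r * wq r = qrad r := by
  unfold Arad wq qrad
  have : exp (r ^ 2 / 4) * exp (-(r ^ 2 / 4)) = 1 := by rw [← exp_add]; simp
  linear_combination (EK 0 (r ^ 2 / 4) * r / 4) * this

lemma wq_pos {r : ℝ} (hr : 0 < r) : 0 < wq r := by unfold wq; positivity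

lemma Aop_polar (η : ℝ² → ℝ) (r θ : ℝ) :
    Aop η polar[r; θ] = Arad r * η polar[r; θ] := by
  simp only [Aop, EKf, quarter_polar, Arad]; ring

lemma le_qrad {r : ℝ} (hr : 0 < r) : r / (4 + r ^ 2) ≤ qrad r := by
  have h := one_le_mul_EK0 (x := r ^ 2 / 4) (by positivity)
  rw [qrad, div_le_iff₀ (by positivity)]
  nlinarith

lemma min_div_max_mem {r s : ℝ} (hr : 0 < r) (hs : 0 < s) :
    0 ≤ min r s / max r s ∧ min r s / max r s ≤ 1 := by
  have : 0 < max r s := lt_max_of_lt_left hr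
  have h0 : 0 < min r s := lt_min hr hs
  exact ⟨by positivity, (div_le_one this).2 min_le_max⟩

lemma min_div_max_pow_mul_le {n : ℕ} (hn : 1 ≤ n) {r s : ℝ} (hr : 0 < r) (hs : 0 < s) :
    0 ≤ (min r s / max r s) ^ n * s ∧ (min r s / max r s) ^ n * s ≤ min r s / max r s * s := by
  obtain ⟨h0, h1⟩ := min_div_max_mem hr hs
  exact ⟨by positivity, mul_le_mul_of_nonneg_right (pow_le_of_le_one h0 h1 (by omega)) hs.le⟩

lemma min_div_max_mul_le_left {r s : ℝ} (hr : 0 < r) (hs : 0 < s) : min r s / max r s * s ≤ r := by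
  rcases le_total r s with h | h
  · rw [min_eq_left h, max_eq_right h, div_mul_cancel₀ _ hs.ne']
  · rw [min_eq_right h, max_eq_left h, div_mul_eq_mul_div, div_le_iff₀ hr]; nlinarith

lemma min_div_max_mul_le {r s : ℝ} (hr : 0 < r) (hs : 0 < s) :
    min r s / max r s * s ≤ 5 * (1 + s ^ 2) * qrad r := by
  have h := le_qrad hr
  have h2 : min r s / max r s * s ≤ s ^ 2 / r := by
    rcases le_total r s with h | h
    · rw [min_eq_left h, max_eq_right h, div_mul_cancel₀ _ hs.ne', le_div_iff₀ hr]; nlinarith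
    · rw [min_eq_right h, max_eq_left h, div_mul_eq_mul_div, sq]
  have h3 : r / (4 + r ^ 2) * (5 * (1 + s ^ 2)) ≤ 5 * (1 + s ^ 2) * qrad r := by rw [mul_comm]; gcongr
  refine le_trans ?_ h3
  rcases le_total r 1 with h4 | h4
  · refine (min_div_max_mul_le_left hr hs).trans ?_
    rw [div_mul_eq_mul_div, le_div_iff₀ (by positivity)]
    have : r ^ 2 ≤ 1 := by nlinarith
    nlinarith [mul_nonneg hr.le (sq_nonneg s)]
  · refine h2.trans ?_
    rw [div_mul_eq_mul_div, div_le_div_iff₀ hr (by positivity)]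
    nlinarith [mul_nonneg (sq_nonneg s) (by nlinarith : 0 ≤ r ^ 2 - 1)]

lemma integrableOn_wq_kernel {r : ℝ} (hr : 0 < r) :
    IntegrableOn (fun s => (min r s / max r s * s) * wq s) (Ioi 0) := by
  have h : IntegrableOn (fun s : ℝ => r * wq s) (Ioi 0) := (integrable_wq.1.const_mul r).integrableOn
  refine Integrable.mono' h ?_ ?_
  · exact Measurable.aestronglyMeasurable (by unfold wq; fun_prop)
  · refine (ae_restrict_mem measurableSet_Ioi).mono fun s hs => ?_
    have hs : 0 < s := hs
    have h0 := wq_pos hs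
    rw [Real.norm_of_nonneg (by positivity)]
    gcongr
    exact min_div_max_mul_le_left hr hs

/-- `modeT n` is a contraction, for `n ≥ 2`, in the norm weighted by `qrad`. -/
lemma norm_modeT_le_wq {n : ℕ} (hn : 1 ≤ n) {a : ℝ → ℝ} {M : ℝ} (hM : ∀ s, 0 < s → ‖a s‖ ≤ M * wq s)
    {r : ℝ} (hr : 0 < r) : ‖modeT n a r‖ ≤ M / n * qrad r := by
  have key : ‖∫ s in Ioi (0:ℝ), ((min r s / max r s) ^ n * s) • a s‖ ≤ ∫ s in Ioi (0:ℝ), M * ((min r s / max r s * s) * wq s) := by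
    refine norm_integral_le_of_norm_le ((integrableOn_wq_kernel hr).const_mul M) ?_
    refine (ae_restrict_mem measurableSet_Ioi).mono fun s hs => ?_
    obtain ⟨h0, h1⟩ := min_div_max_pow_mul_le hn hr hs
    rw [norm_smul, Real.norm_of_nonneg h0, mul_left_comm]
    exact mul_le_mul h1 (hM s hs) (norm_nonneg _) (h0.trans h1)
  have e : ∫ s in Ioi (0:ℝ), M * ((min r s / max r s * s) * wq s) = M * (2 * qrad r) := by
    rw [integral_const_mul, ← modeT_wq hr, modeT]
    simp
  rw [modeT, norm_smul, Real.norm_of_nonneg (by positivity)]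
  calc 1 / (2 * (n:ℝ)) * _ ≤ 1 / (2 * n) * (M * (2 * qrad r)) := by rw [← e]; gcongr
    _ = _ := by field_simp

lemma norm_kernel_smul_le {n : ℕ} (hn : 1 ≤ n) {r s x : ℝ} (hr : 0 < r) (hs : 0 < s) :
    ‖((min r s / max r s) ^ n * s) • x‖ ≤ 5 * qrad r * ((1 + s ^ 2) * ‖x‖) := by
  obtain ⟨h0, h1⟩ := min_div_max_pow_mul_le hn hr hs
  rw [norm_smul, Real.norm_of_nonneg h0, ← mul_assoc, mul_right_comm 5]
  exact mul_le_mul_of_nonneg_right (h1.trans (min_div_max_mul_le hr hs)) (norm_nonneg _)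

lemma norm_modeT_le {n : ℕ} (hn : 1 ≤ n) {a : ℝ → ℝ} (ha : IntegrableOn (fun s => (1 + s ^ 2) * ‖a s‖) (Ioi 0))
    {r : ℝ} (hr : 0 < r) :
    ‖modeT n a r‖ ≤ (5 * ∫ s in Ioi (0:ℝ), (1 + s ^ 2) * ‖a s‖) * qrad r := by
  have hn0 : (1:ℝ) ≤ n := by exact_mod_cast hn
  have key : ‖∫ s in Ioi (0:ℝ), ((min r s / max r s) ^ n * s) • a s‖ ≤ ∫ s in Ioi (0:ℝ), (5 * qrad r) * ((1 + s ^ 2) * ‖a s‖) := by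
    refine norm_integral_le_of_norm_le (ha.const_mul _) ?_
    refine (ae_restrict_mem measurableSet_Ioi).mono fun s hs => ?_
    exact norm_kernel_smul_le hn hr hs
  rw [integral_const_mul] at key
  rw [modeT, norm_smul, Real.norm_of_nonneg (by positivity)]
  have h3 : 1 / (2 * (n:ℝ)) ≤ 1 := by rw [div_le_one (by positivity)]; linarith
  calc _ ≤ 1 * ‖∫ s in Ioi (0:ℝ), ((min r s / max r s) ^ n * s) • a s‖ := by gcongr
    _ ≤ _ := by rw [one_mul]; refine key.trans (le_of_eq ?_); ring

/-- Angular modes with index at least two are not in the kernel of the linearized operator. -/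
lemma mode_eq_zero {n : ℕ} (hn : 2 ≤ n) {a : ℝ → ℝ}
    (ha : IntegrableOn (fun s => (1 + s ^ 2) * ‖a s‖) (Ioi 0))
    (h : ∀ r, 0 < r → Arad r • a r = modeT n a r) {r : ℝ} (hr : 0 < r) : a r = 0 := by
  obtain ⟨C, hC⟩ : ∃ C, ∀ r, 0 < r → ‖modeT n a r‖ ≤ C * qrad r := ⟨_, fun r hr => norm_modeT_le (by omega) ha hr⟩
  have iter : ∀ (k : ℕ) (r : ℝ), 0 < r → ‖a r‖ ≤ C / n ^ k * wq r := by
    have step : ∀ (C : ℝ), (∀ r, 0 < r → ‖modeT n a r‖ ≤ C * qrad r) → ∀ r, 0 < r → ‖a r‖ ≤ C * wq r := by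
      intro C hC r hr
      have h1 := hC r hr
      rw [← h r hr, norm_smul, Real.norm_of_nonneg (Arad_pos r).le, ← wq_mul_Arad] at h1
      have h2 := Arad_pos r
      by_contra h3
      push Not at h3
      nlinarith [mul_lt_mul_of_pos_left h3 h2]
    intro k
    induction k with
    | zero => simpa using step C hC
    | succ k ih =>
      refine step _ fun r hr => (norm_modeT_le_wq (by omega) ih hr).trans (le_of_eq ?_)
      rw [pow_succ]; field_simp
  have hlim : Filter.Tendsto (fun k : ℕ => C / (n:ℝ) ^ k * wq r) Filter.atTop (nhds (0 * wq r)) := by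
    refine Filter.Tendsto.mul_const _ (tendsto_const_nhds.div_atTop (tendsto_pow_atTop_atTop_of_one_lt ?_))
    exact_mod_cast hn
  rw [zero_mul] at hlim
  exact norm_le_zero_iff.1 (ge_of_tendsto' hlim fun k => iter k r hr)

lemma hasDerivAt_integral_Ioc {b : ℝ → ℝ} (hb : ContinuousOn b (Ioi 0)) (hi : IntegrableOn b (Ioi 0)) {r : ℝ}
    (hr : 0 < r) : HasDerivAt (fun r => ∫ s in Ioc 0 r, b s) (b r) r := by
  have h1 : HasDerivAt (fun r => ∫ s in (0:ℝ)..r, b s) (b r) r := by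
    refine intervalIntegral.integral_hasDerivAt_right ?_ ?_ (hb.continuousAt (Ioi_mem_nhds hr))
    · rw [intervalIntegrable_iff_integrableOn_Ioc_of_le hr.le]
      exact hi.mono_set Ioc_subset_Ioi_self
    · exact hb.stronglyMeasurableAtFilter isOpen_Ioi _ hr
  refine h1.congr_of_eventuallyEq ?_
  filter_upwards [Ioi_mem_nhds hr] with x hx
  rw [intervalIntegral.integral_of_le (le_of_lt hx)]

lemma integral_Ioi_eq_sub {b : ℝ → ℝ} (hi : IntegrableOn b (Ioi 0)) {r : ℝ} (hr : 0 ≤ r) :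
    ∫ s in Ioi r, b s = (∫ s in Ioi 0, b s) - ∫ s in Ioc 0 r, b s := by
  rw [eq_sub_iff_add_eq, add_comm, ← setIntegral_union]
  · rw [Ioc_union_Ioi_eq_Ioi hr]
  · exact Set.disjoint_left.2 fun x hx hx' => not_lt.2 hx.2 hx'
  · exact measurableSet_Ioi
  · exact hi.mono_set Ioc_subset_Ioi_self
  · exact hi.mono_set (Ioi_subset_Ioi hr)

lemma hasDerivAt_integral_Ioi {b : ℝ → ℝ} (hb : ContinuousOn b (Ioi 0)) (hi : IntegrableOn b (Ioi 0)) {r : ℝ}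
    (hr : 0 < r) : HasDerivAt (fun r => ∫ s in Ioi r, b s) (-b r) r := by
  have h1 := (hasDerivAt_integral_Ioc hb hi hr).const_sub (∫ s in Ioi 0, b s)
  refine h1.congr_of_eventuallyEq ?_
  filter_upwards [Ioi_mem_nhds hr] with x hx
  exact integral_Ioi_eq_sub hi (le_of_lt hx)

open Filter Topology in
lemma tendsto_integral_Ioc_zero {b : ℝ → ℝ} (hi : IntegrableOn b (Ioi 0)) :
    Tendsto (fun r => ∫ s in Ioc 0 r, b s) (𝓝[>] 0) (𝓝 0) := by
  have hi' : IntegrableOn b (Icc 0 1) := by rw [integrableOn_Icc_iff_integrableOn_Ioc]; exact hi.mono_set Ioc_subset_Ioi_self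
  have h := (intervalIntegral.continuousOn_primitive (a := 0) (b := 1) hi').continuousWithinAt
    (x := 0) (by simp)
  have h2 := h.tendsto
  simp only [Ioc_self, Measure.restrict_empty, integral_zero_measure] at h2
  refine h2.mono_left ?_
  rw [← nhdsWithin_Ioc_eq_nhdsGT (zero_lt_one' ℝ)]
  exact nhdsWithin_mono _ Ioc_subset_Icc_self

lemma integrableOn_of_one_add_sq {b : ℝ → ℝ} (hb : ContinuousOn b (Ioi 0))
    (ha : IntegrableOn (fun s => (1 + s ^ 2) * |b s|) (Ioi 0)) :
    IntegrableOn b (Ioi 0) ∧ IntegrableOn (fun s => s ^ 2 * b s) (Ioi 0) := by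
  have hm := hb.aestronglyMeasurable (μ := volume) measurableSet_Ioi
  constructor
  · refine Integrable.mono' ha hm (.of_forall fun s => ?_)
    rw [Real.norm_eq_abs]
    nlinarith [abs_nonneg (b s), mul_nonneg (sq_nonneg s) (abs_nonneg (b s))]
  · refine Integrable.mono' ha ((by fun_prop : Continuous fun s : ℝ => s ^ 2).aestronglyMeasurable.mul hm)
      (.of_forall fun s => ?_)
    rw [Real.norm_eq_abs, abs_mul, abs_of_nonneg (sq_nonneg s)]
    nlinarith [abs_nonneg (b s)]

lemma continuous_wq : Continuous wq := by unfold wq; fun_prop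

lemma const_of_hasDerivAt_zero {f : ℝ → ℝ} (hf : ∀ r, 0 < r → HasDerivAt f 0 r) {r r' : ℝ} (hr : 0 < r)
    (hr' : 0 < r') : f r = f r' := by
  refine (convex_Ioi (0:ℝ)).is_const_of_fderivWithin_eq_zero (𝕜 := ℝ) (f := f)
    (fun x hx => (hf x hx).differentiableAt.differentiableWithinAt) (fun x hx => ?_) hr hr'
  rw [fderivWithin_of_isOpen isOpen_Ioi hx, (hf x hx).hasFDerivAt.fderiv]; ext; simp

open Filter Topology in
lemma eq_of_tendsto_of_hasDerivAt_zero {f : ℝ → ℝ} {l : Filter ℝ} [l.NeBot] {c r : ℝ} (hf : ∀ r, 0 < r → HasDerivAt f 0 r)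
    (hl : Ioi 0 ∈ l) (h : Tendsto f l (𝓝 c)) (hr : 0 < r) : f r = c :=
  tendsto_nhds_unique (tendsto_const_nhds.congr' (Filter.mem_of_superset hl fun _ hx => const_of_hasDerivAt_zero hf hr hx)) h

open Filter Topology in
/-- In the first angular mode the kernel of the linearized operator is spanned by `wq`. -/
lemma mode_one_eq_const_mul {b : ℝ → ℝ} (hb : ContinuousOn b (Ioi 0))
    (ha : IntegrableOn (fun s => (1 + s ^ 2) * |b s|) (Ioi 0))
    (h : ∀ r, 0 < r → Arad r * b r = modeT 1 b r) : ∃ c, ∀ r, 0 < r → b r = c * wq r := by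
  obtain ⟨hi0, hi2⟩ := integrableOn_of_one_add_sq hb ha
  have hq0 := integrable_wq.1.integrableOn (s := Ioi 0)
  have hq2 := integrable_wq.2.integrableOn (s := Ioi 0)
  set E : ℝ → ℝ := fun r => ∫ s in Ioc 0 r, s ^ 2 * b s with hE
  set B : ℝ → ℝ := fun r => ∫ s in Ioi r, b s with hB
  set Eq : ℝ → ℝ := fun r => ∫ s in Ioc 0 r, s ^ 2 * wq s with hEq
  set Bq : ℝ → ℝ := fun r => ∫ s in Ioi r, wq s with hBq
  have hb2 : ContinuousOn (fun s => s ^ 2 * b s) (Ioi 0) := (by fun_prop : Continuous fun s : ℝ => s ^ 2).continuousOn.mul hb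
  have hw2 : ContinuousOn (fun s => s ^ 2 * wq s) (Ioi 0) := ((by fun_prop : Continuous fun s : ℝ => s ^ 2).mul continuous_wq).continuousOn
  have v1 : ∀ r, 0 < r → 2 * r * (Arad r * b r) = E r + r ^ 2 * B r := fun r hr => by
    rw [h r hr, modeT_one (by simpa using hi2) hi0 hr]
    simp only [smul_eq_mul, hE, hB]; field_simp
  have v2 : ∀ r, 0 < r → 2 * r * (Arad r * wq r) = Eq r + r ^ 2 * Bq r := fun r hr => by
    rw [wq_mul_Arad, ← modeT_wq hr, modeT_one (by simpa using hq2) hq0 hr]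
    simp only [smul_eq_mul, hEq, hBq]; field_simp
  have dE : ∀ r, 0 < r → HasDerivAt E (r ^ 2 * b r) r := fun r hr => hasDerivAt_integral_Ioc hb2 hi2 hr
  have dEq : ∀ r, 0 < r → HasDerivAt Eq (r ^ 2 * wq r) r := fun r hr => hasDerivAt_integral_Ioc hw2 hq2 hr
  have dB : ∀ r, 0 < r → HasDerivAt B (-b r) r := fun r hr => hasDerivAt_integral_Ioi hb hi0 hr
  have dBq : ∀ r, 0 < r → HasDerivAt Bq (-wq r) r := fun r hr => hasDerivAt_integral_Ioi continuous_wq.continuousOn hq0 hr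
  have hW : ∀ r, 0 < r → B r * Eq r - E r * Bq r = 0 := by
    have hlim : Tendsto (fun r => B r * Eq r - E r * Bq r) (𝓝[>] 0) (𝓝 ((∫ s in Ioi 0, b s) * 0 - 0 * ∫ s in Ioi 0, wq s)) := by
      have hB0 : ∀ {c : ℝ → ℝ}, IntegrableOn c (Ioi 0) → Tendsto (fun r => ∫ s in Ioi r, c s) (𝓝[>] 0) (𝓝 (∫ s in Ioi 0, c s)) := by
        intro c hc
        have := (tendsto_integral_Ioc_zero hc).const_sub (∫ s in Ioi 0, c s)
        rw [sub_zero] at this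
        refine this.congr' ?_
        filter_upwards [self_mem_nhdsWithin] with r hr
        exact (integral_Ioi_eq_sub hc (le_of_lt hr)).symm
      exact ((hB0 hi0).mul (tendsto_integral_Ioc_zero hq2)).sub ((tendsto_integral_Ioc_zero hi2).mul (hB0 hq0))
    rw [mul_zero, zero_mul, sub_zero] at hlim
    refine fun r hr => eq_of_tendsto_of_hasDerivAt_zero (f := fun r => B r * Eq r - E r * Bq r) (fun r hr => ?_) self_mem_nhdsWithin hlim hr
    refine (((dB r hr).mul (dEq r hr)).sub ((dE r hr).mul (dBq r hr))).congr_deriv ?_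
    linear_combination b r * v2 r hr - wq r * v1 r hr
  have hEq0 : ∀ r, 0 < r → 0 < Eq r := fun r hr => by
    rw [hEq]
    simp only
    rw [← intervalIntegral.integral_of_le hr.le]
    refine intervalIntegral.intervalIntegral_pos_of_pos_on ?_ (fun s hs => ?_) hr
    · exact (Continuous.mul (by fun_prop) continuous_wq).intervalIntegrable _ _
    · have := wq_pos hs.1
      have := hs.1
      positivity
  have hb' : ∀ r, 0 < r → b r * Eq r = E r * wq r := fun r hr => by
    have h1 := v1 r hr
    have h2 := v2 r hr
    have h3 := hW r hr
    have h4 : 2 * r * Arad r ≠ 0 := by have := Arad_pos r; positivity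
    refine mul_left_cancel₀ h4 ?_
    linear_combination Eq r * h1 - E r * h2 + r ^ 2 * h3
  have hc := @const_of_hasDerivAt_zero (fun r => E r / Eq r) fun r hr => by
    refine ((dE r hr).div (dEq r hr) (hEq0 r hr).ne').congr_deriv ?_
    rw [div_eq_zero_iff]; left
    linear_combination r ^ 2 * hb' r hr
  refine ⟨E 1 / Eq 1, fun r hr => ?_⟩
  have h0 := (hEq0 r hr).ne'
  rw [← hc hr one_pos, div_mul_eq_mul_div, eq_div_iff h0, hb' r hr]

lemma eq_zero_of_fourier {f : ℝ → ℝ} (hc : Continuous f) (hp : Function.Periodic f (2 * π))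
    (h : ∀ (n : ℕ) (c : ℝ), ∫ θ in (-π)..π, f θ * cos (n * θ - c) = 0) (x : ℝ) : f x = 0 := by
  have hpi := pi_pos
  have : Fact (0 < 2 * π) := ⟨by positivity⟩
  have hp' : Function.Periodic (fun t => (f t : ℂ)) (2 * π) := fun t => by simp [hp t]
  let F : C(AddCircle (2 * π), ℂ) := ⟨hp'.lift, continuous_coinduced_dom.2 (Complex.continuous_ofReal.comp hc)⟩
  have hF : ∀ t : ℝ, F t = f t := fun t => hp'.lift_coe t
  have hz (n : ℤ) (c : ℝ) : ∫ θ in (-π)..π, ((f θ * cos (n * θ - c) : ℝ) : ℂ) = 0 := by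
    rw [intervalIntegral.integral_ofReal]
    obtain ⟨m, rfl | rfl⟩ := Int.eq_nat_or_neg n
    · exact_mod_cast h m c
    · have e (θ : ℝ) : cos ((-(m : ℤ) : ℤ) * θ - c) = cos (m * θ - -c) := by rw [← cos_neg]; congr 1; push_cast; ring
      simp_rw [e, h m (-c)]; rfl
  have hcoef : ∀ n : ℤ, fourierCoeff F n = 0 := by
    intro n
    rw [fourierCoeff_eq_intervalIntegral _ _ (-π), show -π + 2 * π = π by ring]
    have e (t : ℝ) : (fourier (-n) (t : AddCircle (2 * π)) : ℂ) • F t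
        = ((f t * cos ((-n : ℤ) * t - 0) : ℝ) : ℂ) + ((f t * cos ((-n : ℤ) * t - π / 2) : ℝ) : ℂ) * Complex.I := by
      have : (2 * π * Complex.I * (-n : ℤ) * t / (2 * π : ℝ) : ℂ) = (((-n : ℤ) * t : ℝ) : ℂ) * Complex.I := by
        have : (π : ℂ) ≠ 0 := by exact_mod_cast hpi.ne'
        push_cast; field_simp
      rw [hF, fourier_coe_apply, this, Complex.exp_mul_I, cos_sub_pi_div_two]
      push_cast
      simp; ring
    have ci (c : ℝ) : Continuous fun t : ℝ => ((f t * cos ((-n : ℤ) * t - c) : ℝ) : ℂ) := by fun_prop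
    simp_rw [e]
    rw [intervalIntegral.integral_add ((ci _).intervalIntegrable _ _) (((ci _).mul_const _).intervalIntegrable _ _),
      intervalIntegral.integral_mul_const, hz, hz]
    simp
  have hs : Summable (fourierCoeff F) := by rw [show fourierCoeff F = 0 from funext hcoef]; exact summable_zero
  have h1 := has_pointwise_sum_fourier_series_of_summable hs (x : AddCircle (2 * π))
  simp only [hcoef, zero_smul] at h1
  have h2 := h1.unique hasSum_zero
  rw [hF] at h2
  exact_mod_cast h2

lemma hasDerivAt_polar (hf : Differentiable ℝ f) (r θ : ℝ) :
    HasDerivAt (fun θ => f polar[r; θ])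
      (cR polar[r; θ] * dZ f polar[r; θ] - cZ polar[r; θ] * dR f polar[r; θ]) θ := by
  have h1 := hasFDerivAt_lin (hf polar[r; θ])
  have h2 : HasDerivAt (fun θ => polar[r; θ]) (r * -sin θ, r * cos θ) θ := ((hasDerivAt_cos θ).const_mul r).prodMk ((hasDerivAt_sin θ).const_mul r)
  refine (h1.comp_hasDerivAt θ h2).congr_deriv ?_
  simp only [lin_apply, cR, cZ]; ring

/-- Functions whose bracket with `η₀` vanishes are radial. -/
lemma radial_of_pb_eta0 (hf : Differentiable ℝ f) (h : pb f eta0 = 0) (r θ θ' : ℝ) :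
    f polar[r; θ] = f (r * cos θ', r * sin θ') := by
  refine is_const_of_deriv_eq_zero (f := fun θ => f polar[r; θ])
    (fun θ => (hasDerivAt_polar hf r θ).differentiableAt) (fun θ => ?_) θ θ'
  rw [(hasDerivAt_polar hf r θ).deriv]
  have := congrFun h polar[r; θ]
  rw [pb_eta0] at this
  simp only [Pi.smul_apply, Pi.mul_apply, Pi.sub_apply, smul_eq_mul, Pi.zero_apply, eta0_apply] at this
  have h4 : 1 / 2 * (1 / (4 * π) * exp (-quarter polar[r; θ])) ≠ 0 := by positivity
  refine mul_left_cancel₀ h4 ?_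
  rw [mul_zero, ← this]; ring

lemma periodic_polar (f : ℝ² → ℝ) (r : ℝ) : Function.Periodic (fun θ => f polar[r; θ]) (2 * π) := fun θ => by simp

lemma angMean_polar (f : ℝ² → ℝ) (r θ : ℝ) :
    angMean f polar[r; θ] = 1 / (2 * π) * ∫ α in (-π)..π, f polar[r; α] := by
  have e : ∀ α, f ((r * cos θ) * cos α - (r * sin θ) * sin α, (r * cos θ) * sin α + (r * sin θ) * cos α) = f polar[r; (α + θ)] := fun α => by
    rw [cos_add, sin_add]; congr 2 <;> ring
  rw [angMean]
  simp only [e]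
  rw [intervalIntegral.integral_comp_add_right (fun α => f polar[r; α])]
  have := (periodic_polar f r).intervalIntegral_add_eq (0 + θ) (-π)
  rw [show 0 + θ + 2 * π = 2 * π + θ by ring, show -π + 2 * π = π by ring] at this
  rw [this]

lemma continuous_angMean (hf : Continuous f) : Continuous (angMean f) := by
  unfold angMean
  refine continuous_const.mul ?_
  exact intervalIntegral.continuous_parametric_intervalIntegral_of_continuous' (by fun_prop) _ _

lemma angMean_eq_zero_of_mode (hf : Continuous f) {n : ℕ} (hn : 1 ≤ n) {a : ℝ → ℝ}
    (h : ∀ r, 0 < r → ∀ θ, f polar[r; θ] = a r * cos (n * θ)) : angMean f = 0 := by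
  refine eq_of_polar (continuous_angMean hf) continuous_const fun r θ hr => ?_
  rw [angMean_polar]
  simp_rw [h r hr]
  have hn0 : (n:ℝ) ≠ 0 := by positivity
  rw [intervalIntegral.integral_const_mul, intervalIntegral.integral_comp_mul_left _ hn0]
  simp [sin_nat_mul_pi]

lemma one_add_sq_sq_le (r α : ℝ) (hr : 0 ≤ r) :
    (1 + r ^ 2) ^ 2 ≤ 16 * ⟪(polar[r; α] : ℝ²)⟫ ^ 4 := by
  have h := norm_sq_le polar[r; α]
  have e : (r * cos α) ^ 2 + (r * sin α) ^ 2 = r ^ 2 := by nlinarith [sin_sq_add_cos_sq α]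
  simp only at h
  rw [e, Real.sqrt_sq hr] at h
  set N := ‖(polar[r; α] : ℝ²)‖
  have h0 : 0 ≤ N := norm_nonneg _
  have h1 : 1 + r ^ 2 ≤ (2 * (1 + N)) ^ 2 := by nlinarith
  calc (1 + r ^ 2) ^ 2 ≤ ((2 * (1 + N)) ^ 2) ^ 2 := by gcongr
    _ = _ := by ring

lemma Dk.polar_le {M : ℝ} (h : Dk 8 M f) {r : ℝ} (hr : 0 ≤ r) (α : ℝ) :
    |f polar[r; α]| ≤ 256 * M * ((1 + r ^ 2) ^ 4)⁻¹ := by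
  have hM := h.nonneg
  refine (h _).trans ?_
  have h1 := one_add_sq_sq_le r α hr
  set N := ‖(polar[r; α] : ℝ²)‖
  have h0 : 0 ≤ N := norm_nonneg _
  have h2 : (1 + r ^ 2) ^ 4 ≤ 256 * (1 + N) ^ 8 := by
    calc (1 + r ^ 2) ^ 4 = ((1 + r ^ 2) ^ 2) ^ 2 := by ring
      _ ≤ (16 * (1 + N) ^ 4) ^ 2 := by gcongr
      _ = _ := by ring
  rw [← div_eq_mul_inv, ← div_eq_mul_inv, div_le_div_iff₀ (by positivity) (by positivity)]
  nlinarith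

lemma continuous_fcoef (hf : Continuous f) (n : ℕ) (c : ℝ) : Continuous (fcoef n c f) := by
  unfold fcoef
  exact intervalIntegral.continuous_parametric_intervalIntegral_of_continuous' (by fun_prop) _ _

lemma integrable_one_add_sq_of_le {a : ℝ → ℝ}
    (hm : ContinuousOn a (Ioi 0)) {C : ℝ} (h : ∀ s, 0 < s → ‖a s‖ ≤ C * ((1 + s ^ 2) ^ 2)⁻¹) :
    IntegrableOn (fun s => (1 + s ^ 2) * ‖a s‖) (Ioi 0) := by
  refine Integrable.mono' (integrable_inv_one_add_sq.const_mul C).integrableOn ?_ ?_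
  · exact ((by fun_prop : Continuous fun s : ℝ => 1 + s ^ 2).continuousOn.mul hm.norm).aestronglyMeasurable measurableSet_Ioi
  · refine (ae_restrict_mem measurableSet_Ioi).mono fun s hs => ?_
    have := h s hs
    rw [Real.norm_of_nonneg (by positivity)]
    calc (1 + s ^ 2) * ‖a s‖ ≤ (1 + s ^ 2) * (C * ((1 + s ^ 2) ^ 2)⁻¹) := by gcongr
      _ = _ := by
        have : 1 + s ^ 2 ≠ 0 := by positivity
        field_simp

lemma integrable_fcoef (hf : Continuous f) (h : Rapid f) (n : ℕ) (c : ℝ) : IntegrableOn (fun s => (1 + s ^ 2) * |fcoef n c f s|) (Ioi 0) := by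
  obtain ⟨M, hM⟩ := h 8
  have h0 := hM.nonneg
  have := pi_pos
  refine integrable_one_add_sq_of_le (C := 256 * M * (2 * π)) (continuous_fcoef hf n c).continuousOn fun s hs => ?_
  have := intervalIntegral.norm_integral_le_of_norm_le_const (a := -π) (b := π) (C := 256 * M * ((1 + s ^ 2) ^ 4)⁻¹)
    (f := fun α => f polar[s; α] * cos (n * α - c)) fun α _ => by
      rw [norm_mul]
      exact (mul_le_of_le_one_right (norm_nonneg _) (abs_cos_le_one _)).trans (hM.polar_le hs.le α)
  refine this.trans ?_
  rw [show π - -π = 2 * π by ring, abs_of_pos (by positivity), mul_right_comm]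
  gcongr
  · nlinarith [sq_nonneg s]
  · norm_num

lemma integrableOn_modeT {n : ℕ} (hn : 1 ≤ n) {a : ℝ → ℝ}
    (hm : ContinuousOn a (Ioi 0)) (ha : IntegrableOn (fun s => (1 + s ^ 2) * ‖a s‖) (Ioi 0)) {r : ℝ} (hr : 0 < r) :
    IntegrableOn (fun s => ((min r s / max r s) ^ n * s) • a s) (Ioi 0) := by
  refine Integrable.mono' (ha.const_mul (5 * qrad r)) ?_ ?_
  · exact (Measurable.aestronglyMeasurable (f := fun s => (min r s / max r s) ^ n * s) (by fun_prop)).smul (hm.aestronglyMeasurable measurableSet_Ioi)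
  · exact (ae_restrict_mem measurableSet_Ioi).mono fun s hs => norm_kernel_smul_le hn hr hs

lemma integral_sq_wq_pos : 0 < ∫ s in Ioi (0:ℝ), s ^ 2 * wq s := by
  rw [setIntegral_pos_iff_support_of_nonneg_ae]
  · have : Function.support (fun s => s ^ 2 * wq s) ∩ Ioi 0 = Ioi 0 := by
      refine inter_eq_right.2 fun s hs => ?_
      have := wq_pos hs
      have hs : 0 < s := hs
      exact (mul_pos (pow_pos hs 2) this).ne'
    rw [this]; simp
  · refine (ae_restrict_mem measurableSet_Ioi).mono fun s hs => ?_
    have := wq_pos hs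
    simp only [Pi.zero_apply]; positivity
  · exact integrable_wq.2.integrableOn

lemma InZ.integrable_mul (h : InZ η) (hg : TG g) : Integrable fun X => g X * η X := by
  have h1 := h.mul_left hg
  obtain ⟨M, hM⟩ := h1.rapid 4
  refine Integrable.mono' (ki_one.abs.const_mul M) h1.cont.aestronglyMeasurable (.of_forall fun X => ?_)
  simpa using hM X

lemma InZ.integrable (h : InZ η) : Integrable η := by simpa using h.integrable_mul TG.one

lemma lam_kernel {ξ : ℝ² → ℝ} (h : InZ ξ) (hm : angMean ξ = 0) (hR : (∫ X, cR X * ξ X) = 0)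
    (hZ : (∫ X, cZ X * ξ X) = 0) (hL : Lam ξ = 0) : ξ = 0 := by
  have hpi := pi_pos
  rw [Lam_eq h] at hL
  set f := BS0 ξ - Aop ξ with hf
  have hd : Differentiable ℝ f := (TG.BS0 h).diff.sub (TG.Aop h).diff
  have hrad := radial_of_pb_eta0 hd hL
  have hcont := h.cont
  have key (n : ℕ) (hn : 1 ≤ n) (c r : ℝ) (hr : 0 < r) : Arad r * fcoef n c ξ r = modeT n (fcoef n c ξ) r := by
    rw [← BS0_fourier hcont h.rapid hn c hr]
    have h4 (α : ℝ) : BS0 ξ polar[r; α] = Arad r * ξ polar[r; α] + f polar[r; 0] := by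
      rw [← hrad r α 0, hf, Pi.sub_apply, Aop_polar]; ring
    have h5 := integral_cos_int_mul_add n (-c)
    rw [if_neg (by omega)] at h5
    simp only [Int.cast_natCast, ← sub_eq_add_neg] at h5
    simp_rw [fcoef, h4, add_mul, mul_assoc]
    rw [intervalIntegral.integral_add (Continuous.intervalIntegrable (by fun_prop) _ _) (Continuous.intervalIntegrable (by fun_prop) _ _),
      intervalIntegral.integral_const_mul, intervalIntegral.integral_const_mul, h5, mul_zero, add_zero]
  have hzero (n : ℕ) (c r : ℝ) (hr : 0 < r) : fcoef n c ξ r = 0 := by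
    have hif := integrable_fcoef hcont h.rapid n c
    rcases Nat.lt_or_ge n 2 with hn | hn
    · interval_cases n
      · have h1 := congrFun hm polar[r; 0]
        rw [angMean_polar] at h1
        have h2 : ∫ α in (-π)..π, ξ polar[r; α] = 0 := by simpa [hpi.ne'] using h1
        simp [fcoef, h2]
      · obtain ⟨b, hb⟩ := mode_one_eq_const_mul (continuous_fcoef hcont 1 c).continuousOn hif (key 1 le_rfl c)
        have iR := h.integrable_mul TG.cR
        have iZ := h.integrable_mul TG.cZ
        have h0 := integral_add (iR.const_mul (cos c)) (iZ.const_mul (sin c))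
        rw [integral_const_mul, integral_const_mul, hR, hZ, integral_polar (f := fun X => cos c * (cR X * ξ X) + sin c * (cZ X * ξ X))
          ((iR.const_mul _).add (iZ.const_mul _))] at h0
        simp only [mul_zero, add_zero] at h0
        have h1 : ∫ s in Ioi (0:ℝ), b * (s ^ 2 * wq s) = 0 := by
          refine Eq.trans (setIntegral_congr_fun measurableSet_Ioi fun s hs => ?_) h0
          simp only [smul_eq_mul]
          rw [mul_left_comm, ← hb s hs, fcoef, sq, mul_assoc, ← intervalIntegral.integral_const_mul s]
          congr 2; ext α
          simp only [cR, cZ, Nat.cast_one, one_mul, cos_sub]; ring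
        rw [integral_const_mul] at h1
        have h2 : b = 0 := by simpa [integral_sq_wq_pos.ne'] using h1
        simpa [h2] using hb r hr
    · exact mode_eq_zero hn hif (key n (by omega) c) hr
  refine eq_of_polar hcont continuous_const fun r θ hr => ?_
  exact eq_zero_of_fourier (f := fun θ => ξ polar[r; θ]) (hcont.comp (by fun_prop)) (periodic_polar ξ r)
    (fun n c => hzero n c r hr) θ

lemma isLamSol_unique {f η ξ : ℝ² → ℝ} (h : IsLamSol f η) (h' : IsLamSol f ξ) : η = ξ := by
  obtain ⟨h1, h2, h3, h4, h5⟩ := h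
  obtain ⟨g1, g2, g3, g4, g5⟩ := h'
  rw [← sub_eq_zero]
  have hd := h1.sub g1
  refine lam_kernel hd ?_ ?_ ?_ ?_
  · ext X
    have e1 := congrFun h2 X
    have e2 := congrFun g2 X
    simp only [angMean, Pi.zero_apply, Pi.sub_apply] at e1 e2 ⊢
    rw [intervalIntegral.integral_sub, mul_sub, e1, e2, sub_zero]
    · exact (h1.cont.comp (by fun_prop)).intervalIntegrable _ _
    · exact (g1.cont.comp (by fun_prop)).intervalIntegrable _ _
  · simp only [Pi.sub_apply, mul_sub]
    rw [integral_sub (h1.integrable_mul TG.cR) (g1.integrable_mul TG.cR), h3, g3, sub_zero]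
  · simp only [Pi.sub_apply, mul_sub]
    rw [integral_sub (h1.integrable_mul TG.cZ) (g1.integrable_mul TG.cZ), h4, g4, sub_zero]
  · have e1 := Lam_eq h1
    have e2 := Lam_eq g1
    rw [Lam_eq hd, BS0_sub h1 g1]
    have e3 : BS0 η - BS0 ξ - Aop (η - ξ) = (BS0 η - Aop η) - (BS0 ξ - Aop ξ) := by ext X; simp [Aop]; ring
    rw [e3, pb_sub_left ((TG.BS0 h1).diff.sub (TG.Aop h1).diff) ((TG.BS0 g1).diff.sub (TG.Aop g1).diff), ← e1, ← e2, h5, g5, sub_self]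

lemma lamInv_eq {f η : ℝ² → ℝ} (h : IsLamSol f η) : lamInv f = η := by
  have hex : ∃ η, IsLamSol f η := ⟨η, h⟩
  rw [lamInv, dif_pos hex]
  exact isLamSol_unique hex.choose_spec h

lemma inZ_lamInv (f : ℝ² → ℝ) : InZ (lamInv f) := by
  unfold lamInv
  split_ifs with h
  · exact h.choose_spec.1
  · exact InZ.zero

lemma inZ_fpInv (κ : ℝ) (f : ℝ² → ℝ) : InZ (fpInv κ f) := by
  unfold fpInv
  split_ifs with h
  · exact h.choose_spec.1
  · exact InZ.zero

/-! ### Existence for the linearized equation in one angular mode -/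

/-- The function equal to `cos (n θ)` at the point with polar coordinates `(r, θ)`. -/
def angCos (n : ℕ) (X : ℝ²) : ℝ := (((X.1 : ℂ) + X.2 * Complex.I) ^ n).re / rho X ^ n

lemma rho_polar {r : ℝ} (hr : 0 ≤ r) (θ : ℝ) : rho polar[r; θ] = r := by
  have : (r * cos θ) ^ 2 + (r * sin θ) ^ 2 = r ^ 2 := by nlinarith [sin_sq_add_cos_sq θ]
  simp only [rho]; rw [this, Real.sqrt_sq hr]

lemma continuous_rho : Continuous rho := by unfold rho; fun_prop

lemma rho_nonneg (X : ℝ²) : 0 ≤ rho X := Real.sqrt_nonneg _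

lemma rho_pos (hX : X ≠ 0) : 0 < rho X := by
  obtain ⟨r, θ, hr, rfl⟩ := exists_polar X hX
  rwa [rho_polar hr.le]

lemma angCos_polar (n : ℕ) {r : ℝ} (hr : 0 < r) (θ : ℝ) : angCos n polar[r; θ] = cos (n * θ) := by
  have e : (((r * cos θ : ℝ) : ℂ) + ((r * sin θ : ℝ) : ℂ) * Complex.I) = r * Complex.exp (θ * Complex.I) := by rw [Complex.exp_mul_I]; push_cast; ring
  simp only [angCos]
  rw [e, rho_polar hr.le, mul_pow, ← Complex.exp_nat_mul, ← Complex.ofReal_pow, Complex.re_ofReal_mul,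
    show (n : ℂ) * (θ * Complex.I) = ((n * θ : ℝ) : ℂ) * Complex.I by push_cast; ring, Complex.exp_ofReal_mul_I_re]
  field_simp

lemma qrad_le {r : ℝ} (hr : 0 ≤ r) : qrad r ≤ r / 4 := by
  have := EK_le_exp 0 (x := r ^ 2 / 4) (c := 0) le_rfl (by simpa using (by positivity : 0 ≤ r ^ 2 / 4))
  rw [exp_zero] at this
  unfold qrad
  nlinarith

/-- Smooth solutions of the linearized equation from bounded radial profiles. -/
lemma exists_of_profile (hf : TG f) {n : ℕ} (hn : 1 ≤ n) {g u : ℝ → ℝ}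
    (hg : ∀ r, 0 < r → ∀ θ, f polar[r; θ] = g r * cos (n * θ))
    (hu : ContinuousOn u (Ioi 0)) {M : ℝ} (hM : ∀ r, 0 < r → |u r| ≤ M)
    (he : ∀ r, 0 < r → qrad r * u r = modeT n (fun s => (qrad s * u s - g s) / Arad s) r) :
    ∃ (η : ℝ² → ℝ) (a : ℝ → ℝ), InZ η ∧ BS0 η - Aop η = f ∧ ∀ r, 0 < r → ∀ θ, η polar[r; θ] = a r * cos (n * θ) := by
  have hM0 : 0 ≤ M := (abs_nonneg _).trans (hM 1 one_pos)
  set Ψ : ℝ² → ℝ := fun X => qrad (rho X) * u (rho X) * angCos n X with hΨ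
  have hpol : ∀ r, 0 < r → ∀ θ, Ψ polar[r; θ] = qrad r * u r * cos (n * θ) := fun r hr θ => by simp only [hΨ, rho_polar hr.le, angCos_polar n hr]
  have hΨ0 : Ψ 0 = 0 := by simp [hΨ, rho, qrad]
  have hΨb : ∀ X, |Ψ X| ≤ M / 4 * rho X := fun X => by
    rcases eq_or_ne X 0 with rfl | hX
    · rw [hΨ0]; simp [rho]
    · obtain ⟨r, θ, hr, rfl⟩ := exists_polar X hX
      rw [hpol r hr, rho_polar hr.le, abs_mul, abs_mul, abs_of_pos (qrad_pos hr)]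
      have h1 := qrad_le hr.le
      calc qrad r * |u r| * |cos (n * θ)| ≤ r / 4 * M * 1 := by
            gcongr
            · exact hM r hr
            · exact abs_cos_le_one _
        _ = _ := by ring
  have hΨc : Continuous Ψ := by
    rw [continuous_iff_continuousAt]
    intro X
    rcases eq_or_ne X 0 with rfl | hX
    · rw [ContinuousAt, hΨ0]
      refine squeeze_zero_norm hΨb ?_
      have := (continuous_rho.const_mul (M / 4)).tendsto 0
      simpa [rho] using this
    · have h1 := rho_pos hX
      have h2 : ContinuousAt u (rho X) := hu.continuousAt (Ioi_mem_nhds h1)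
      refine ((continuous_qrad.comp continuous_rho).continuousAt.mul (h2.comp continuous_rho.continuousAt)).mul ?_
      unfold angCos
      refine ContinuousAt.div ?_ (continuous_rho.continuousAt.pow n) (by positivity)
      fun_prop
  have hΨp : PB Ψ := PB.of_le (k := 1) (C := M) fun X => by
    refine (hΨb X).trans ?_
    have := norm_sq_le X
    have h2 : rho X ≤ 2 * ‖X‖ := this
    nlinarith [norm_nonneg X]
  set η := gauss * (Kf * (Ψ - f)) with hη
  have hsubt : ∀ k, Tmp k Ψ → Tmp k (Kf * (Ψ - f)) := fun k h => by
    refine (tmp_Kf k).mul ?_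
    rw [sub_eq_add_neg]
    exact h.add (Tmp.of_hasTemperateGrowth hf.neg)
  have hηpol : ∀ r, 0 < r → ∀ θ, η polar[r; θ] = (qrad r * u r - g r) / Arad r * cos (n * θ) := fun r hr θ => by
    simp only [hη, Pi.mul_apply, Pi.sub_apply, hpol r hr, hg r hr, gauss_eq, Kf, EKf, quarter_polar, Arad]
    rw [exp_neg]
    have := (EK_pos 0 (r ^ 2 / 4)).ne'
    field_simp
  have hBS : BS0 η = Ψ := by
    have h0 := hsubt 0 ⟨hΨc, hΨp⟩
    refine eq_of_polar (Tmp.BS0 h0).continuous hΨc fun r θ hr => ?_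
    rw [BS0_mode (c := 0) (differentiable_gauss.continuous.mul h0.1) (Rapid.gauss_mul h0.2) hn
      (fun s hs α => by rw [sub_zero]; exact hηpol s hs α) hr, hpol r hr, he r hr, sub_zero]
  have hT : ∀ k, Tmp k Ψ := by
    intro k
    induction k with
    | zero => exact ⟨hΨc, hΨp⟩
    | succ k ih => rw [← hBS]; exact Tmp.BS0 (hsubt k ih)
  have hTG : TG Ψ := hasTemperateGrowth_iff_tmp.2 hT
  refine ⟨η, _, InZ.gauss_mul (tg_Kf.mul (hTG.sub hf)), ?_, hηpol⟩
  rw [hBS, hη, Aop_gauss_mul]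
  ext X
  have := (EKf_pos 0 X).ne'
  simp only [Pi.sub_apply, Pi.mul_apply, Kf]
  field_simp; ring

lemma continuousOn_modeT {n : ℕ} (hn : 1 ≤ n) {a : ℝ → ℝ}
    (hm : ContinuousOn a (Ioi 0)) (ha : IntegrableOn (fun s => (1 + s ^ 2) * |a s|) (Ioi 0)) :
    ContinuousOn (modeT n a) (Ioi 0) := by
  suffices h : ContinuousOn (fun r => ∫ s in Ioi (0:ℝ), ((min r s / max r s) ^ n * s) • a s) (Ioi 0) from
    h.const_smul (1 / (2 * n) : ℝ)
  refine continuousOn_of_dominated (bound := fun s => (1 + s ^ 2) * |a s|) (fun r hr => ?_) (fun r hr => ?_) ha ?_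
  · exact (integrableOn_modeT hn hm ha hr).1
  · refine (ae_restrict_mem measurableSet_Ioi).mono fun s hs => ?_
    have hs : 0 < s := hs
    obtain ⟨h0, h1⟩ := min_div_max_mem hr hs
    have h2 : (min r s / max r s) ^ n ≤ 1 := pow_le_one₀ h0 h1
    rw [norm_smul, Real.norm_of_nonneg (by positivity), Real.norm_eq_abs]
    gcongr
    nlinarith
  · refine (ae_restrict_mem measurableSet_Ioi).mono fun s hs => ?_
    have hs : 0 < s := hs
    have h1 : ContinuousOn (fun r : ℝ => min r s / max r s) (Ioi 0) := (by fun_prop : Continuous fun r : ℝ => min r s).continuousOn.div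
        (by fun_prop : Continuous fun r : ℝ => max r s).continuousOn fun r _ => (lt_max_of_lt_right hs).ne'
    exact ((h1.pow n).mul continuousOn_const).mul continuousOn_const

section profile
variable {n : ℕ} {g : ℝ → ℝ}

lemma profile_eq (hg : ∀ r, 0 < r → ∀ θ, f polar[r; θ] = g r * cos (n * θ)) {r : ℝ} (hr : 0 < r) :
    g r = f (r, 0) := by simpa using (hg r hr 0).symm

lemma continuousOn_profile (hf : TG f) (hg : ∀ r, 0 < r → ∀ θ, f polar[r; θ] = g r * cos (n * θ)) :
    ContinuousOn g (Ioi 0) :=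
  ((hf.cont.comp (by fun_prop : Continuous fun r : ℝ => (r, (0:ℝ)))).continuousOn).congr fun _ hr => profile_eq hg hr

lemma profile_bound (hf : TG f) (hg : ∀ r, 0 < r → ∀ θ, f polar[r; θ] = g r * cos (n * θ)) :
    ∃ C, 0 ≤ C ∧ ∀ r, 0 < r → |g r / Arad r| ≤ C * ((1 + r ^ 2) ^ 4)⁻¹ ∧ |exp (-(r ^ 2 / 4)) * g r| ≤ C * ((1 + r ^ 2) ^ 4)⁻¹ := by
  obtain ⟨M, hM⟩ := (InZ.gauss_mul (tg_Kf.mul hf)).rapid 8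
  obtain ⟨M', hM'⟩ := (InZ.gauss_mul hf).rapid 8
  have h0 := hM.nonneg
  have h0' := hM'.nonneg
  refine ⟨256 * M + 256 * M', by positivity, fun r hr => ⟨?_, ?_⟩⟩
  · have := hM.polar_le hr.le 0
    have e : (gauss * (Kf * f)) polar[r; 0] = g r / Arad r := by
      simp only [Pi.mul_apply, hg r hr, gauss_eq, Kf, EKf, quarter_polar, Arad]
      rw [exp_neg]
      have := (EK_pos 0 (r ^ 2 / 4)).ne'
      simp; field_simp
    rw [e] at this
    refine this.trans ?_
    gcongr; linarith
  · have := hM'.polar_le hr.le 0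
    have e : (gauss * f) polar[r; 0] = exp (-(r ^ 2 / 4)) * g r := by
      simp only [Pi.mul_apply, hg r hr, gauss_eq, quarter_polar]
      simp
    rw [e] at this
    refine this.trans ?_
    gcongr; linarith

lemma integrable_one_add_sq_wq (M : ℝ) : IntegrableOn (fun s => (1 + s ^ 2) * |M * wq s|) (Ioi 0) := by
  have h1 := (integrable_wq.1.abs.add integrable_wq.2.abs).integrableOn (s := Ioi 0)
  refine IntegrableOn.congr_fun (h1.const_mul |M|) (fun s _ => ?_) measurableSet_Ioi
  simp only [Pi.add_apply, abs_mul, abs_pow, sq_abs]; ring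

lemma integrable_profile (hf : TG f) (hg : ∀ r, 0 < r → ∀ θ, f polar[r; θ] = g r * cos (n * θ))
    {u : ℝ → ℝ} (hu : ContinuousOn u (Ioi 0)) {M : ℝ} (hM : ∀ r, 0 < r → |u r| ≤ M) :
    ContinuousOn (fun s => (qrad s * u s - g s) / Arad s) (Ioi 0) ∧
    IntegrableOn (fun s => (1 + s ^ 2) * |(qrad s * u s - g s) / Arad s|) (Ioi 0) := by
  have hgc := continuousOn_profile hf hg
  have hc : ContinuousOn (fun s => (qrad s * u s - g s) / Arad s) (Ioi 0) :=
    ((continuous_qrad.continuousOn.mul hu).sub hgc).div continuous_Arad.continuousOn fun s _ => (Arad_pos s).ne'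
  refine ⟨hc, ?_⟩
  obtain ⟨C, hC, hCg⟩ := profile_bound hf hg
  have i1 : IntegrableOn (fun s => (1 + s ^ 2) * |g s / Arad s|) (Ioi 0) := by
    refine integrable_one_add_sq_of_le (C := C) (hgc.div continuous_Arad.continuousOn fun s _ => (Arad_pos s).ne') fun s hs => ?_
    refine (hCg s hs).1.trans ?_
    gcongr
    · nlinarith [sq_nonneg s]
    · norm_num
  refine Integrable.mono' ((integrable_one_add_sq_wq M).add i1) ?_ ?_
  · exact ((by fun_prop : Continuous fun s : ℝ => 1 + s ^ 2).continuousOn.mul hc.abs).aestronglyMeasurable measurableSet_Ioi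
  · refine (ae_restrict_mem measurableSet_Ioi).mono fun s hs => ?_
    have hs : 0 < s := hs
    have hA := Arad_pos s
    have h1 : |(qrad s * u s - g s) / Arad s| ≤ |M * wq s| + |g s / Arad s| := by
      have e : (qrad s * u s - g s) / Arad s = u s * wq s - g s / Arad s := by rw [← wq_mul_Arad]; field_simp
      rw [e]
      refine (abs_sub _ _).trans ?_
      have := wq_pos hs
      rw [abs_mul, abs_mul]
      exact add_le_add_left (mul_le_mul_of_nonneg_right ((hM s hs).trans (le_abs_self _)) (abs_nonneg _)) _
    rw [Real.norm_of_nonneg (by positivity), Pi.add_apply, ← mul_add]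
    gcongr

open BoundedContinuousFunction in
lemma exists_lam_of_two_le (hf : TG f) (hn : 2 ≤ n) (hg : ∀ r, 0 < r → ∀ θ, f polar[r; θ] = g r * cos (n * θ)) :
    ∃ (η : ℝ² → ℝ) (a : ℝ → ℝ), InZ η ∧ BS0 η - Aop η = f ∧ ∀ r, 0 < r → ∀ θ, η polar[r; θ] = a r * cos (n * θ) := by
  have hn1 : 1 ≤ n := by omega
  let ext (u : Ioi (0:ℝ) →ᵇ ℝ) : ℝ → ℝ := fun s => if h : 0 < s then u ⟨s, h⟩ else 0
  have ext_eq : ∀ (u : Ioi (0:ℝ) →ᵇ ℝ) (r : ℝ) (hr : 0 < r), ext u r = u ⟨r, hr⟩ := fun u r hr => by simp [ext, hr]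
  have hext : ∀ u : Ioi (0:ℝ) →ᵇ ℝ, ContinuousOn (ext u) (Ioi 0) := fun u => by
    rw [continuousOn_iff_continuous_domRestrict]
    have : (Ioi (0:ℝ)).domRestrict (ext u) = u := by funext r; exact ext_eq u r r.2
    rw [this]; exact u.continuous
  have hb : ∀ (u : Ioi (0:ℝ) →ᵇ ℝ) (r : ℝ), 0 < r → |ext u r| ≤ ‖u‖ := fun u r hr => by rw [ext_eq u r hr]; exact u.norm_coe_le_norm _
  let a (u : Ioi (0:ℝ) →ᵇ ℝ) : ℝ → ℝ := fun s => (qrad s * ext u s - g s) / Arad s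
  have ha : ∀ u, ContinuousOn (a u) (Ioi 0) ∧ IntegrableOn (fun s => (1 + s ^ 2) * |a u s|) (Ioi 0) :=
    fun u => integrable_profile hf hg (hext u) (hb u)
  have hTc : ∀ u, Continuous fun r : Ioi (0:ℝ) => modeT n (a u) r / qrad r := fun u => by
    have h1 := (continuousOn_modeT hn1 (ha u).1 (ha u).2).div continuous_qrad.continuousOn fun r hr => (qrad_pos hr).ne'
    exact continuousOn_iff_continuous_domRestrict.1 h1
  have hTb : ∀ u, ∃ C, ∀ r : Ioi (0:ℝ), ‖modeT n (a u) r / qrad r‖ ≤ C := fun u =>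
    ⟨_, fun r => by
      rw [norm_div, Real.norm_of_nonneg (qrad_pos r.2).le, div_le_iff₀ (qrad_pos r.2)]
      exact norm_modeT_le hn1 (ha u).2 r.2⟩
  choose C hC using hTb
  let T (u : Ioi (0:ℝ) →ᵇ ℝ) : Ioi (0:ℝ) →ᵇ ℝ := BoundedContinuousFunction.ofNormedAddCommGroup _ (hTc u) (C u) (hC u)
  have hT : ContractingWith (1 / 2 : NNReal) T := by
    refine ⟨by rw [← NNReal.coe_lt_coe]; norm_num, LipschitzWith.of_dist_le_mul fun u v => ?_⟩
    rw [BoundedContinuousFunction.dist_le (by positivity)]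
    intro r
    have hq := qrad_pos r.2
    have e : T u r - T v r = modeT n (fun s => a u s - a v s) r / qrad r := by
      change modeT n (a u) r / qrad r - modeT n (a v) r / qrad r = _
      rw [← sub_div]
      congr 1
      simp only [modeT]
      rw [← smul_sub, ← integral_sub (integrableOn_modeT hn1 (ha u).1 (ha u).2 r.2) (integrableOn_modeT hn1 (ha v).1 (ha v).2 r.2)]
      congr 2; ext s; rw [smul_sub]
    rw [Real.dist_eq, e, abs_div, abs_of_pos hq, div_le_iff₀ hq]
    have h1 : ∀ s, 0 < s → ‖a u s - a v s‖ ≤ dist u v * wq s := fun s hs => by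
      have e : a u s - a v s = (u ⟨s, hs⟩ - v ⟨s, hs⟩) * wq s := by
        simp only [a, ext_eq u s hs, ext_eq v s hs, ← wq_mul_Arad]
        have := (Arad_pos s).ne'
        field_simp; ring
      rw [e, norm_mul, Real.norm_of_nonneg (wq_pos hs).le]
      have := wq_pos hs
      refine mul_le_mul_of_nonneg_right ?_ this.le
      exact BoundedContinuousFunction.dist_coe_le_dist (f := u) (g := v) ⟨s, hs⟩
    refine (norm_modeT_le_wq hn1 h1 r.2).trans ?_
    gcongr
    rw [NNReal.coe_div, NNReal.coe_one, NNReal.coe_ofNat, div_mul_eq_mul_div, one_mul]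
    gcongr
    exact_mod_cast hn
  have hfix : T (hT.fixedPoint T) = hT.fixedPoint T := hT.fixedPoint_isFixedPt
  set u := hT.fixedPoint T
  refine exists_of_profile hf hn1 hg (hext u) (hb u) fun r hr => ?_
  have h1 := DFunLike.congr_fun hfix ⟨r, hr⟩
  change modeT n (a u) r / qrad r = u ⟨r, hr⟩ at h1
  rw [ext_eq u r hr, ← h1, mul_div_cancel₀ _ (qrad_pos hr).ne']

end profile

/-- The two primitives that enter `modeT 1 wq`. -/
lemma qrad_split : ∃ Eq Bq : ℝ → ℝ, (∀ r, 0 < r → qrad r = (Eq r / r + r * Bq r) / 2) ∧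
    (∀ r, 0 < r → HasDerivAt Eq (r ^ 2 * wq r) r) ∧ (∀ r, 0 < r → HasDerivAt Bq (-wq r) r) ∧
    (∀ r, Bq r = 1 / 2 * exp (-(r ^ 2 / 4))) ∧ Filter.Tendsto Eq (nhdsWithin 0 (Ioi 0)) (nhds 0) := by
  have hq0 := integrable_wq.1.integrableOn (s := Ioi 0)
  have hq2 := integrable_wq.2.integrableOn (s := Ioi 0)
  have hw2 : ContinuousOn (fun s => s ^ 2 * wq s) (Ioi 0) := ((by fun_prop : Continuous fun s : ℝ => s ^ 2).mul continuous_wq).continuousOn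
  refine ⟨fun r => ∫ s in Ioc 0 r, s ^ 2 * wq s, fun r => ∫ s in Ioi r, wq s, fun r hr => ?_,
    fun r hr => hasDerivAt_integral_Ioc hw2 hq2 hr, fun r hr => hasDerivAt_integral_Ioi continuous_wq.continuousOn hq0 hr,
    fun r => integral_wq_Ioi r, tendsto_integral_Ioc_zero hq2⟩
  rw [← modeT_wq hr, modeT_one (by simpa using hq2) hq0 hr]
  simp only [smul_eq_mul]; ring

open Filter Topology in
lemma tendsto_integral_Ioi_zero {a : ℝ → ℝ} (h : IntegrableOn a (Ioi 0)) : Tendsto (fun r => ∫ s in Ioi r, a s) atTop (𝓝 0) := by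
  have h1 := (intervalIntegral_tendsto_integral_Ioi 0 h tendsto_id).const_sub (∫ s in Ioi 0, a s)
  rw [sub_self] at h1
  refine h1.congr' ?_
  filter_upwards [eventually_ge_atTop 0] with r hr
  rw [integral_Ioi_eq_sub h hr, id, intervalIntegral.integral_of_le hr]

section profile
variable {g : ℝ → ℝ}

open Filter Topology in
/-- The first angular mode, under the solvability condition. -/
lemma exists_lam_one (hf : TG f) (hg : ∀ r, 0 < r → ∀ θ, f polar[r; θ] = g r * cos ((1:ℕ) * θ))
    (hsolv : (∫ s in Ioi (0:ℝ), s * wq s * g s) = 0) :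
    ∃ (η : ℝ² → ℝ) (a : ℝ → ℝ), InZ η ∧ BS0 η - Aop η = f ∧ ∀ r, 0 < r → ∀ θ, η polar[r; θ] = a r * cos ((1:ℕ) * θ) := by
  obtain ⟨C, hC, hCg⟩ := profile_bound hf hg
  have hgc := continuousOn_profile hf hg
  set p : ℝ → ℝ := fun s => s * wq s * g s with hp
  have hpc : ContinuousOn p (Ioi 0) := ((continuous_id.mul continuous_wq).continuousOn).mul hgc
  have hpb : ∀ s, 0 < s → |p s| ≤ C * s ^ 2 * ((1 + s ^ 2) ^ 4)⁻¹ := fun s hs => by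
    have h1 := (hCg s hs).2
    have e : p s = s ^ 2 / 4 * (exp (-(s ^ 2 / 4)) * g s) := by simp only [hp, wq]; ring
    rw [e, abs_mul, abs_of_nonneg (by positivity : 0 ≤ s ^ 2 / 4)]
    calc s ^ 2 / 4 * _ ≤ s ^ 2 / 4 * (C * ((1 + s ^ 2) ^ 4)⁻¹) := by gcongr
      _ ≤ s ^ 2 * (C * ((1 + s ^ 2) ^ 4)⁻¹) := by gcongr; linarith [sq_nonneg s]
      _ = _ := by ring
  have hpi : IntegrableOn p (Ioi 0) := by
    refine Integrable.mono' (integrable_inv_one_add_sq.const_mul C).integrableOn (hpc.aestronglyMeasurable measurableSet_Ioi) ?_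
    refine (ae_restrict_mem measurableSet_Ioi).mono fun s hs => (hpb s hs).trans ?_
    rw [mul_assoc]
    gcongr
    rw [← div_eq_mul_inv, div_le_iff₀ (by positivity)]
    have : (1 + s ^ 2)⁻¹ * (1 + s ^ 2) ^ 4 = (1 + s ^ 2) ^ 3 := by
      have : 1 + s ^ 2 ≠ 0 := by positivity
      field_simp
    rw [this]
    nlinarith [sq_nonneg s, pow_nonneg (sq_nonneg s) 2, pow_nonneg (sq_nonneg s) 3]
  set G : ℝ → ℝ := fun r => ∫ s in Ioc 0 r, p s with hG
  have dG : ∀ r, 0 < r → HasDerivAt G (p r) r := fun r hr => hasDerivAt_integral_Ioc hpc hpi hr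
  have hG' : ∀ r, 0 < r → G r = -∫ s in Ioi r, p s := fun r hr => by rw [integral_Ioi_eq_sub hpi hr.le, hsolv]; simp [hG]
  have G3 : ∀ r, 0 < r → |G r| ≤ C * r ^ 3 := fun r hr => by
    have h1 : ‖∫ s in Ioc 0 r, p s‖ ≤ (C * r ^ 2) * volume.real (Ioc 0 r) := by
      refine norm_setIntegral_le_of_norm_le_const (by simp) fun s hs => (hpb s hs.1).trans ?_
      have h2 : ((1 + s ^ 2) ^ 4)⁻¹ ≤ 1 := inv_le_one_of_one_le₀ (one_le_pow₀ (by nlinarith [sq_nonneg s]))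
      have h3 : s ^ 2 ≤ r ^ 2 := by nlinarith [hs.1, hs.2]
      calc C * s ^ 2 * ((1 + s ^ 2) ^ 4)⁻¹ ≤ C * r ^ 2 * 1 := by gcongr
        _ = _ := mul_one _
    rw [Real.volume_real_Ioc_of_le hr.le, sub_zero] at h1
    refine h1.trans (le_of_eq ?_); ring
  have G5 : ∀ r, 0 < r → |G r| ≤ C * r ^ (-5 : ℝ) := fun r hr => by
    rw [hG' r hr, abs_neg]
    have h1 : ‖∫ s in Ioi r, p s‖ ≤ ∫ s in Ioi r, C * s ^ (-6 : ℝ) := by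
      refine norm_integral_le_of_norm_le ((integrableOn_Ioi_rpow_of_lt (by norm_num) hr).const_mul C) ?_
      refine (ae_restrict_mem measurableSet_Ioi).mono fun s hs => ?_
      have hs0 : 0 < s := hr.trans hs
      refine (hpb s hs0).trans ?_
      rw [mul_assoc]
      gcongr
      rw [rpow_neg hs0.le, show (6:ℝ) = ((6:ℕ):ℝ) by norm_num, rpow_natCast, ← div_eq_mul_inv,
        div_le_iff₀ (by positivity), inv_mul_eq_div, le_div_iff₀ (by positivity)]
      calc s ^ 2 * s ^ 6 = (s ^ 2) ^ 4 := by ring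
        _ ≤ (1 + s ^ 2) ^ 4 := by gcongr; linarith
    rw [integral_const_mul, integral_Ioi_rpow_of_lt (by norm_num) hr] at h1
    refine h1.trans ?_
    gcongr
    rw [show (-6:ℝ) + 1 = -5 by norm_num]
    have : 0 < r ^ (-5:ℝ) := by positivity
    linarith
  set b : ℝ → ℝ := fun s => G s / (s * qrad s ^ 2) with hb
  have hbc : ContinuousOn b (Ioi 0) := by
    refine ContinuousOn.div (fun r hr => (dG r hr).continuousAt.continuousWithinAt) ?_ fun s hs => ?_
    · exact (continuous_id.mul (continuous_qrad.pow 2)).continuousOn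
    · have := qrad_pos hs
      have hs : 0 < s := hs
      exact (by positivity : 0 < s * qrad s ^ 2).ne'
  have hbb : ∀ s, 0 < s → |b s| ≤ 50 * C * (1 + s ^ 2)⁻¹ := fun s hs => by
    have h1 := le_qrad hs
    have h2 := qrad_pos hs
    have h3 : |b s| ≤ |G s| * ((4 + s ^ 2) ^ 2 / s ^ 3) := by
      rw [hb]; simp only
      rw [abs_div, abs_of_pos (by positivity : 0 < s * qrad s ^ 2), div_eq_mul_inv]
      gcongr
      rw [inv_le_comm₀ (by positivity) (by positivity), inv_div]
      calc s ^ 3 / (4 + s ^ 2) ^ 2 = s * (s / (4 + s ^ 2)) ^ 2 := by field_simp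
        _ ≤ s * qrad s ^ 2 := by gcongr
    refine h3.trans ?_
    rw [← div_eq_mul_inv, le_div_iff₀ (by positivity)]
    rcases le_total s 1 with h | h
    · have h4 : s ^ 2 ≤ 1 := by nlinarith
      calc |G s| * ((4 + s ^ 2) ^ 2 / s ^ 3) * (1 + s ^ 2) ≤ (C * s ^ 3) * ((4 + 1) ^ 2 / s ^ 3) * (1 + 1) := by
            gcongr
            exact G3 s hs
        _ = _ := by field_simp; ring
    · have h4 : 1 ≤ s ^ 2 := by nlinarith
      have h5 : s ^ (-5:ℝ) = 1 / s ^ 5 := by rw [rpow_neg hs.le, show (5:ℝ) = ((5:ℕ):ℝ) by norm_num, rpow_natCast, one_div]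
      calc |G s| * ((4 + s ^ 2) ^ 2 / s ^ 3) * (1 + s ^ 2) ≤ (C * (1 / s ^ 5)) * ((5 * s ^ 2) ^ 2 / s ^ 3) * (2 * s ^ 2) := by
            gcongr
            · rw [← h5]; exact G5 s hs
            · linarith
            · linarith
        _ = 50 * C * (1 / s ^ 2) := by field_simp; ring
        _ ≤ 50 * C * 1 := by
            gcongr
            rw [div_le_one (by positivity)]; exact h4
        _ = _ := mul_one _
  have hbi : IntegrableOn b (Ioi 0) := by
    refine Integrable.mono' (integrable_inv_one_add_sq.const_mul (50 * C)).integrableOn (hbc.aestronglyMeasurable measurableSet_Ioi) ?_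
    exact (ae_restrict_mem measurableSet_Ioi).mono fun s hs => hbb s hs
  set h : ℝ → ℝ := fun r => ∫ s in Ioc 0 r, b s
  have dh : ∀ r, 0 < r → HasDerivAt h (b r) r := fun r hr => hasDerivAt_integral_Ioc hbc hbi hr
  have hhb : ∀ r, 0 < r → |h r| ≤ ∫ s in Ioi (0:ℝ), |b s| := fun r hr => by
    refine (norm_integral_le_integral_norm (μ := volume.restrict (Ioc 0 r)) b).trans ?_
    exact setIntegral_mono_set hbi.norm (.of_forall fun s => abs_nonneg _) Ioc_subset_Ioi_self.eventuallyLE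
  have hhc : ContinuousOn h (Ioi 0) := fun r hr => (dh r hr).continuousAt.continuousWithinAt
  refine exists_of_profile hf le_rfl hg hhc hhb fun r₀ hr₀ => ?_
  obtain ⟨hac, hai⟩ := integrable_profile hf hg hhc hhb
  set a : ℝ → ℝ := fun s => (qrad s * h s - g s) / Arad s with ha
  obtain ⟨hi0, hi2⟩ := integrableOn_of_one_add_sq hac hai
  have hac2 : ContinuousOn (fun s => s ^ 2 * a s) (Ioi 0) := (by fun_prop : Continuous fun s : ℝ => s ^ 2).continuousOn.mul hac
  obtain ⟨Eq, Bq, hq, dEq, dBq, hBq, limEq⟩ := qrad_split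
  have dq : ∀ r, 0 < r → HasDerivAt qrad ((Bq r - Eq r / r ^ 2) / 2) r := fun r hr => by
    have h1 : HasDerivAt (fun r => (Eq r / r + r * Bq r) / 2) ((Bq r - Eq r / r ^ 2) / 2) r := by
      refine ((((dEq r hr).div (hasDerivAt_id r) hr.ne').add ((hasDerivAt_id r).mul (dBq r hr))).div_const 2).congr_deriv ?_
      simp only [id]
      field_simp; ring
    refine h1.congr_of_eventuallyEq ?_
    filter_upwards [Ioi_mem_nhds hr] with x hx using hq x hx
  have haq : ∀ r, 0 < r → a r = wq r * (qrad r * h r - g r) / qrad r := fun r hr => by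
    have := (Arad_pos r).ne'
    have := (wq_pos hr).ne'
    simp only [ha]
    rw [← wq_mul_Arad r]; field_simp
  have hE : ∀ r, 0 < r → Eq r = 2 * r * qrad r - r ^ 2 * Bq r := fun r hr => by rw [hq r hr]; field_simp; ring
  -- the two primitives of the equation
  have dE : ∀ r, 0 < r → HasDerivAt (fun r => Eq r * h r - r * G r / qrad r) (r ^ 2 * a r) r := fun r hr => by
    have q0 := (qrad_pos hr).ne'
    refine (((dEq r hr).mul (dh r hr)).sub (((hasDerivAt_id r).mul (dG r hr)).div (dq r hr) q0)).congr_deriv ?_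
    simp only [Pi.mul_apply, id, hb, hp]
    rw [haq r hr, hE r hr]
    field_simp
    ring
  have dB : ∀ r, 0 < r → HasDerivAt (fun r => Bq r * h r + G r / (r * qrad r)) (-a r) r := fun r hr => by
    have q0 := (qrad_pos hr).ne'
    refine (((dBq r hr).mul (dh r hr)).add ((dG r hr).div ((hasDerivAt_id r).mul (dq r hr)) (mul_ne_zero hr.ne' q0))).congr_deriv ?_
    simp only [Pi.mul_apply, id, hb, hp]
    rw [haq r hr, hE r hr]
    field_simp
    ring
  have ratio : ∀ r, 0 < r → r / qrad r ≤ 4 + r ^ 2 := fun r hr => by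
    rw [div_le_iff₀ (qrad_pos hr)]
    have := le_qrad hr
    rw [div_le_iff₀ (by positivity)] at this
    linarith
  have limE : Tendsto (fun r => Eq r * h r - r * G r / qrad r) (𝓝[>] 0) (𝓝 (0 * 0 - 0)) := by
    have l2 : Tendsto (fun r => r * G r / qrad r) (𝓝[>] 0) (𝓝 0) := by
      have l3 : Tendsto (fun r => (4 + r ^ 2) * |G r|) (𝓝[>] 0) (𝓝 0) := by
        have l4 : Tendsto (fun r : ℝ => 4 + r ^ 2) (𝓝[>] 0) (𝓝 (4 + 0 ^ 2)) :=
          ((by fun_prop : Continuous fun r : ℝ => 4 + r ^ 2).tendsto 0).mono_left nhdsWithin_le_nhds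
        simpa using l4.mul (tendsto_integral_Ioc_zero hpi).abs
      refine squeeze_zero_norm' ?_ l3
      filter_upwards [self_mem_nhdsWithin] with r hr
      have hr : 0 < r := hr
      have h1 := qrad_pos hr
      rw [Real.norm_eq_abs, abs_div, abs_mul, abs_of_pos hr, abs_of_pos h1, mul_comm r, mul_div_assoc, mul_comm]
      exact mul_le_mul_of_nonneg_right (ratio r hr) (abs_nonneg _)
    exact (limEq.mul (tendsto_integral_Ioc_zero hbi)).sub l2
  have limB : Tendsto (fun r => Bq r * h r + G r / (r * qrad r)) atTop (𝓝 0) := by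
    have l0 := (tendsto_integral_Ioi_zero hpi).abs
    have l1 : Tendsto (fun r => Bq r * h r) atTop (𝓝 0) := by
      have lB : Tendsto Bq atTop (𝓝 0) := by
        have h1 : Tendsto (fun s : ℝ => s ^ 2 / 4) atTop atTop := (tendsto_pow_atTop (by norm_num)).atTop_div_const (by norm_num)
        have := (tendsto_exp_neg_atTop_nhds_zero.comp h1).const_mul (1 / 2 : ℝ)
        rw [mul_zero] at this
        exact this.congr fun r => (hBq r).symm
      have lb := lB.abs.mul_const (∫ s in Ioi (0:ℝ), |b s|)
      rw [abs_zero, zero_mul] at lb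
      refine squeeze_zero_norm' ?_ lb
      filter_upwards [eventually_gt_atTop 0] with r hr
      rw [norm_mul, Real.norm_eq_abs, Real.norm_eq_abs]
      exact mul_le_mul_of_nonneg_left (hhb r hr) (abs_nonneg _)
    have l2 : Tendsto (fun r => G r / (r * qrad r)) atTop (𝓝 0) := by
      have l3 := l0.const_mul 5
      rw [abs_zero, mul_zero] at l3
      refine squeeze_zero_norm' ?_ l3
      filter_upwards [eventually_ge_atTop 1] with r hr
      have hr0 : 0 < r := by linarith
      have h1 := qrad_pos hr0
      have h2 := le_qrad hr0
      rw [div_le_iff₀ (by positivity)] at h2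
      rw [← abs_neg, ← hG' r hr0, Real.norm_eq_abs, abs_div, abs_of_pos (by positivity : 0 < r * qrad r), div_le_iff₀ (by positivity)]
      have h3 : 1 ≤ 5 * (r * qrad r) := by
        have h4 : r ^ 2 ≥ 1 := by nlinarith
        have h6 : qrad r * (4 + r ^ 2) ≤ qrad r * (5 * r ^ 2) := by gcongr; linarith
        exact (le_mul_iff_one_le_right hr0).1 (by linarith : r ≤ r * (5 * (r * qrad r)))
      nlinarith [abs_nonneg (G r)]
    simpa using l1.add l2
  have e1 := eq_of_tendsto_of_hasDerivAt_zero (f := fun r => (Eq r * h r - r * G r / qrad r) - ∫ s in Ioc 0 r, s ^ 2 * a s)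
    (fun r hr => ((dE r hr).sub (hasDerivAt_integral_Ioc hac2 hi2 hr)).congr_deriv (sub_self _)) self_mem_nhdsWithin
    (limE.sub (tendsto_integral_Ioc_zero hi2)) hr₀
  have e2 := eq_of_tendsto_of_hasDerivAt_zero (f := fun r => (Bq r * h r + G r / (r * qrad r)) - ∫ s in Ioi r, a s)
    (fun r hr => ((dB r hr).sub (hasDerivAt_integral_Ioi hac hi0 hr)).congr_deriv (sub_self _)) (Ioi_mem_atTop 0)
    (limB.sub (tendsto_integral_Ioi_zero hi0)) hr₀
  simp only [mul_zero, sub_zero, sub_eq_zero] at e1 e2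
  rw [modeT_one (by simpa using hi2) hi0 hr₀]
  simp only [smul_eq_mul]
  rw [← e1, ← e2]
  have q0 := (qrad_pos hr₀).ne'
  rw [hE r₀ hr₀]
  field_simp
  ring

end profile

/-! ### Rotations and reflections -/

def rot (α : ℝ) (X : ℝ²) : ℝ² := (X.1 * cos α - X.2 * sin α, X.1 * sin α + X.2 * cos α)

def reflZ (X : ℝ²) : ℝ² := (X.1, -X.2)

/-- A linear isometry of `ℂ`, viewed as a measurable equivalence of the plane. -/
def planeEquiv (L : ℂ ≃ₗᵢ[ℝ] ℂ) : ℝ² ≃ᵐ ℝ² := (Complex.measurableEquivRealProd.symm.trans L.toMeasurableEquiv).trans Complex.measurableEquivRealProd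

lemma measurePreserving_planeEquiv (L : ℂ ≃ₗᵢ[ℝ] ℂ) : MeasurePreserving (planeEquiv L) :=
  (Complex.volume_preserving_equiv_real_prod.symm.trans L.measurePreserving).trans
    Complex.volume_preserving_equiv_real_prod

lemma planeEquiv_rot (α : ℝ) : ⇑(planeEquiv (rotation (Circle.exp α))) = rot α := by
  ext X
  · simp [planeEquiv, rot, Complex.measurableEquivRealProd, Circle.coe_exp, Complex.exp_ofReal_mul_I_re, Complex.exp_ofReal_mul_I_im]
    ring
  · simp [planeEquiv, rot, Complex.measurableEquivRealProd, Circle.coe_exp, Complex.exp_ofReal_mul_I_re, Complex.exp_ofReal_mul_I_im]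
    ring

lemma planeEquiv_reflZ : ⇑(planeEquiv Complex.conjLIE) = reflZ := by ext X <;> simp [planeEquiv, reflZ, Complex.measurableEquivRealProd]

lemma integral_rot (f : ℝ² → ℝ) (α : ℝ) : ∫ X, f (rot α X) = ∫ X, f X := by
  rw [← planeEquiv_rot]
  exact (measurePreserving_planeEquiv _).integral_comp' f

lemma integral_reflZ (f : ℝ² → ℝ) : ∫ X, f (reflZ X) = ∫ X, f X := by
  rw [← planeEquiv_reflZ]
  exact (measurePreserving_planeEquiv _).integral_comp' f

lemma distSq_rot (α : ℝ) (X Y : ℝ²) : distSq (rot α X) (rot α Y) = distSq X Y := by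
  simp only [distSq, rot]
  linear_combination ((X.1 - Y.1) ^ 2 + (X.2 - Y.2) ^ 2) * sin_sq_add_cos_sq α

lemma BS0_rot (f : ℝ² → ℝ) (α : ℝ) (X : ℝ²) : BS0 f (rot α X) = BS0 (fun Y => f (rot α Y)) X := by
  simp only [BS0]
  rw [← integral_rot _ α]
  simp_rw [distSq_rot]

/-- Invariance under rotations. -/
def Radial (f : ℝ² → ℝ) : Prop := ∀ α X, f (rot α X) = f X

lemma rot_polar (r α θ : ℝ) : rot α polar[r; θ] = polar[r; (θ + α)] := by
  simp only [rot, cos_add, sin_add]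
  ext <;> ring

lemma radial_of_polar (h : ∀ r θ θ', 0 < r → f polar[r; θ] = f (r * cos θ', r * sin θ')) :
    Radial f := fun α X => by
  rcases eq_or_ne X 0 with rfl | hX
  · simp [rot, ← Prod.zero_eq_mk]
  · obtain ⟨r, θ, hr, rfl⟩ := exists_polar X hX
    rw [rot_polar]; exact h r _ _ hr

lemma Radial.polar (h : Radial f) (r θ θ' : ℝ) :
    f polar[r; θ] = f (r * cos θ', r * sin θ') := by
  rw [← h (θ' - θ), rot_polar, add_sub_cancel]

lemma Radial.eq_rho (h : Radial f) (X : ℝ²) : f X = f (rho X, 0) := by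
  rcases eq_or_ne X 0 with rfl | hX
  · simp [rho, ← Prod.zero_eq_mk]
  · obtain ⟨r, θ, hr, rfl⟩ := exists_polar X hX
    rw [rho_polar hr.le, h.polar r θ 0]; simp

lemma Radial.angMean (h : Radial f) : angMean f = f := by
  ext X
  have : ∀ α, f (X.1 * cos α - X.2 * sin α, X.1 * sin α + X.2 * cos α) = f X := fun α => h α X
  have hpi := pi_ne_zero
  simp only [VortexRing.angMean, this]
  simp; field_simp

lemma radial_angMean (f : ℝ² → ℝ) : Radial (angMean f) := radial_of_polar fun r θ θ' _ => by rw [angMean_polar, angMean_polar]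

lemma Radial.BS0 (h : Radial f) : Radial (BS0 f) := fun α X => by
  rw [BS0_rot]
  congr 1
  funext Y; exact h α Y

section
lemma Radial.add (hf : Radial f) (hg : Radial g) : Radial (f + g) := fun α X => by simp [hf α X, hg α X]
lemma Radial.sub (hf : Radial f) (hg : Radial g) : Radial (f - g) := fun α X => by simp [hf α X, hg α X]
lemma Radial.mul (hf : Radial f) (hg : Radial g) : Radial (f * g) := fun α X => by simp [hf α X, hg α X]
lemma Radial.smul (hf : Radial f) (c : ℝ) : Radial (c • f) := fun α X => by simp [hf α X]
lemma Radial.const (c : ℝ) : Radial fun _ => c := fun _ _ => rfl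
lemma radial_quarter : Radial quarter := fun α X => by
  simp only [quarter, rot]
  linear_combination (X.1 ^ 2 + X.2 ^ 2) / 4 * sin_sq_add_cos_sq α
lemma Radial.of_quarter (h : ℝ → ℝ) : Radial fun X => h (quarter X) := fun α X => congrArg h (radial_quarter α X)
lemma radial_eta0 : Radial eta0 := by
  rw [show eta0 = fun X => 1 / (4 * π) * exp (-quarter X) from funext eta0_apply]
  exact .of_quarter fun x => 1 / (4 * π) * exp (-x)
lemma radial_phi0 : Radial phi0 := radial_eta0.BS0
lemma radial_EKf (k : ℕ) : Radial (EKf k) := .of_quarter (EK k)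
lemma Radial.Aop (hf : Radial f) : Radial (Aop f) := (radial_EKf 0).mul ((Radial.of_quarter exp).mul hf)
end

/-- `f` is multiplied by `s` under the reflection `Z ↦ -Z`. -/
def ParZ (s : ℝ) (f : ℝ² → ℝ) : Prop := ∀ X, f (reflZ X) = s * f X

section
variable {s t : ℝ}
lemma ParZ.add (hf : ParZ s f) (hg : ParZ s g) : ParZ s (f + g) := fun X => by simp [hf X, hg X]; ring
lemma ParZ.sub (hf : ParZ s f) (hg : ParZ s g) : ParZ s (f - g) := fun X => by simp [hf X, hg X]; ring
lemma ParZ.mul (hf : ParZ s f) (hg : ParZ t g) : ParZ (s * t) (f * g) := fun X => by simp [hf X, hg X]; ring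
lemma ParZ.smul (hf : ParZ s f) (c : ℝ) : ParZ s (c • f) := fun X => by simp [hf X]; ring
lemma ParZ.of_eq (hf : ParZ s f) (h : s = t) : ParZ t f := h ▸ hf
lemma ParZ.dR (hf : ParZ s f) : ParZ s (dR f) := fun X => by
  have : (fun r => f (r, -X.2)) = fun r => s * f (r, X.2) := by ext r; exact hf (r, X.2)
  simp [VortexRing.dR, reflZ, this]
lemma ParZ.dZ (hf : ParZ s f) : ParZ (-s) (dZ f) := fun X => by
  have : (fun z => f (X.1, -z)) = fun z => s * f (X.1, z) := by ext z; exact hf (X.1, z)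
  have h := congrArg (fun g => deriv g X.2) this
  simp only [deriv_const_mul_field, deriv_comp_neg (fun z => f (X.1, z))] at h
  simp only [VortexRing.dZ, reflZ]
  linarith
lemma ParZ.pb (hf : ParZ s f) (hg : ParZ t g) : ParZ (-(s * t)) (pb f g) :=
  ((hf.dR.mul hg.dZ).of_eq (by ring)).sub ((hf.dZ.mul hg.dR).of_eq (by ring))
lemma parZ_cR : ParZ 1 cR := fun X => by simp [cR, reflZ]
lemma parZ_cZ : ParZ (-1) cZ := fun X => by simp [cZ, reflZ]
lemma parZ_quarter (h : ℝ → ℝ) : ParZ 1 fun X => h (quarter X) := fun X => by simp [quarter, reflZ]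
lemma parZ_eta0 : ParZ 1 eta0 := by
  rw [show eta0 = fun X => 1 / (4 * π) * exp (-quarter X) from funext eta0_apply]
  exact parZ_quarter fun x => 1 / (4 * π) * exp (-x)
lemma ParZ.pow (hf : ParZ 1 f) (n : ℕ) : ParZ 1 (f ^ n) := fun X => by simp [hf X]
lemma distSq_reflZ (X Y : ℝ²) : distSq (reflZ X) (reflZ Y) = distSq X Y := by simp only [distSq, reflZ]; ring
lemma ParZ.BS0 (hf : ParZ s f) : ParZ s (BS0 f) := fun X => by
  simp only [VortexRing.BS0]
  rw [mul_left_comm, ← integral_const_mul s, ← integral_reflZ]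
  congr 1
  refine integral_congr_ae (.of_forall fun Y => ?_)
  simp only
  rw [distSq_reflZ, hf Y]; ring
lemma polP_reflZ (m : ℕ) (X Y : ℝ²) : polP m (reflZ X) (reflZ Y) = polP m X Y := by
  obtain ⟨R, Z⟩ := X
  obtain ⟨R', Z'⟩ := Y
  rcases m with _ | _ | _ | _ | _ | m <;> simp only [polP, reflZ] <;> ring
lemma polQ_reflZ (m : ℕ) (X Y : ℝ²) : polQ m (reflZ X) (reflZ Y) = polQ m X Y := by
  obtain ⟨R, Z⟩ := X
  obtain ⟨R', Z'⟩ := Y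
  rcases m with _ | _ | _ | _ | _ | m <;> simp only [polQ, reflZ] <;> ring
lemma ParZ.BS (β : ℝ) (m : ℕ) (hf : ParZ s f) : ParZ s (BS β m f) := fun X => by
  simp only [VortexRing.BS]
  rw [mul_left_comm, ← integral_const_mul s, ← integral_reflZ]
  congr 1
  refine integral_congr_ae (.of_forall fun Y => ?_)
  simp only
  rw [distSq_reflZ, polP_reflZ, polQ_reflZ, hf Y]; ring
lemma Radial.parZ (hf : Radial f) : ParZ 1 f := fun X => by rw [hf.eq_rho, hf.eq_rho X]; simp [rho, reflZ]
lemma ParZ.integral_eq_zero (hf : ParZ (-1) f) : ∫ X, f X = 0 := by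
  have h := integral_reflZ f
  simp_rw [hf _] at h
  rw [integral_const_mul] at h
  linarith
end

/-! ### Angular modes -/

/-- Functions of the form `a(r) cos (n θ)`. -/
def Mode (n : ℕ) (f : ℝ² → ℝ) : Prop := ∃ a : ℝ → ℝ, ∀ r, 0 < r → ∀ θ, f polar[r; θ] = a r * cos (n * θ)

lemma Mode.parZ {n : ℕ} (h : Mode n f) : ParZ 1 f := fun X => by
  obtain ⟨a, ha⟩ := h
  rcases eq_or_ne X 0 with rfl | hX
  · simp [reflZ, ← Prod.zero_eq_mk]
  · obtain ⟨r, θ, hr, rfl⟩ := exists_polar X hX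
    have : reflZ polar[r; θ] = polar[r; (-θ)] := by simp [reflZ]
    rw [this, ha r hr, ha r hr]; simp

lemma Mode.two_even (h : Mode 2 f) (X : ℝ²) : f (rot π X) = f X := by
  obtain ⟨a, ha⟩ := h
  rcases eq_or_ne X 0 with rfl | hX
  · simp [rot, ← Prod.zero_eq_mk]
  · obtain ⟨r, θ, hr, rfl⟩ := exists_polar X hX
    rw [rot_polar, ha r hr, ha r hr, show ((2:ℕ):ℝ) * (θ + π) = (2:ℕ) * θ + 2 * π by push_cast; ring, cos_add_two_pi]

lemma Mode.angMean_eq_zero {n : ℕ} (h : Mode n f) (hn : 1 ≤ n) (hc : Continuous f) : angMean f = 0 := by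
  obtain ⟨a, ha⟩ := h
  exact angMean_eq_zero_of_mode hc hn ha

/-- Nonresonant right-hand sides in the second mode. -/
lemma exists_isLamSol_two (hf : TG f) (hm : Mode 2 f) :
    ∃ η, IsLamSol (pb f eta0) η ∧ BS0 η - Aop η = f ∧ Mode 2 η := by
  obtain ⟨g, hg⟩ := hm
  obtain ⟨η, a, h1, h2, h3⟩ := exists_lam_of_two_le hf le_rfl hg
  have hmη : Mode 2 η := ⟨a, h3⟩
  have odd : ∀ c : ℝ² → ℝ, (∀ X, c (rot π X) = -c X) → ∫ X, c X * η X = 0 := fun c hc => by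
    have h := integral_rot (fun X => c X * η X) π
    simp only [hc, hmη.two_even, neg_mul] at h
    rw [integral_neg] at h
    linarith
  refine ⟨η, ⟨h1, hmη.angMean_eq_zero (by norm_num) h1.cont, odd _ fun X => by simp [cR, rot], odd _ fun X => by simp [cZ, rot], ?_⟩, h2, hmη⟩
  rw [Lam_eq h1, h2]

lemma integral_eta0 : ∫ X, eta0 X = 1 := by
  have h : ∀ X : ℝ², eta0 X = (1 / (4 * π)) * (exp (-(1 / 4) * X.1 ^ 2) * exp (-(1 / 4) * X.2 ^ 2)) := fun X => by rw [← exp_add, eta0]; congr 2; ring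
  simp_rw [h]
  rw [integral_const_mul, Measure.volume_eq_prod, integral_prod_mul (fun x : ℝ => exp (-(1 / 4) * x ^ 2)) (fun x : ℝ => exp (-(1 / 4) * x ^ 2)),
    integral_gaussian, Real.mul_self_sqrt (by positivity)]
  have := pi_ne_zero
  field_simp

/-- Integration by parts against functions in `𝒵`. -/
lemma integral_dR (h : InZ η) : ∫ X, dR η X = 0 := by
  have hi := h.dR.integrable
  rw [Measure.volume_eq_prod, integral_prod_symm _ hi]
  refine (integral_congr_ae (.of_forall fun z => ?_)).trans (integral_zero _ _)
  obtain ⟨M, hM⟩ := h.rapid 2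
  obtain ⟨M', hM'⟩ := h.dR.rapid 2
  have hb : ∀ {f : ℝ² → ℝ} {M : ℝ}, Dk 2 M f → ∀ r : ℝ, |f (r, z)| ≤ M * (1 + r ^ 2)⁻¹ := fun {f M} hf r => by
    have h0 := hf.nonneg
    refine (hf (r, z)).trans ?_
    gcongr
    have : |r| ≤ ‖(r, z)‖ := norm_fst_le (r, z)
    have h1 := norm_nonneg (r, z)
    nlinarith [sq_abs r, abs_nonneg r]
  have hint : Integrable fun r => dR η (r, z) :=
    Integrable.mono' (integrable_inv_one_add_sq.const_mul M') ((h.dR.cont.comp (by fun_prop)).aestronglyMeasurable)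
      (.of_forall (hb hM'))
  have hint2 : Integrable fun r => η (r, z) :=
    Integrable.mono' (integrable_inv_one_add_sq.const_mul M) ((h.cont.comp (by fun_prop)).aestronglyMeasurable)
      (.of_forall (hb hM))
  refine integral_eq_zero_of_hasDerivAt_of_integrable (f := fun r => η (r, z)) (fun r => ?_) hint hint2
  have := hasDerivAt_slice_fst (hasFDerivAt_lin (h.diff (r, z)))
  simpa [lin_apply] using this

lemma integral_cR_dR_eta0 : ∫ X, cR X * dR eta0 X = -1 := by
  have h := integral_dR (inZ_eta0.mul_left TG.cR)
  rw [dR_mul TG.cR.diff inZ_eta0.diff, dR_cR] at h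
  have e : ∫ X, ((1 : ℝ² → ℝ) * eta0 + cR * dR eta0) X = (∫ X, eta0 X) + ∫ X, cR X * dR eta0 X := by
    rw [← integral_add inZ_eta0.integrable (inZ_eta0.dR.integrable_mul TG.cR)]
    congr 1; ext X; simp
  rw [e, integral_eta0] at h
  linarith

lemma Aop_dR_eta0 : Aop (dR eta0) = dR phi0 := by
  rw [dR_eta0, dR_phi0]
  ext X
  simp only [Aop, Pi.smul_apply, Pi.mul_apply, smul_eq_mul, eta0_apply]
  have : exp (quarter X) * exp (-quarter X) = 1 := by rw [← exp_add]; simp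
  linear_combination (-(1 / (8 * π)) * EKf 0 X * cR X) * this

lemma mode_one_dR_eta0 : Mode 1 (dR eta0) := ⟨fun r => -(1 / 2) * (r * (1 / (4 * π) * exp (-(r ^ 2 / 4)))), fun r _ θ => by
    rw [dR_eta0]
    simp only [Pi.smul_apply, Pi.mul_apply, smul_eq_mul, eta0_apply, quarter_polar, cR]
    simp; ring⟩

/-- Right-hand sides in the first mode, under the solvability condition. -/
lemma exists_isLamSol_one (hf : TG f) {g : ℝ → ℝ}
    (hg : ∀ r, 0 < r → ∀ θ, f polar[r; θ] = g r * cos ((1:ℕ) * θ))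
    (hs : (∫ s in Ioi (0:ℝ), s * wq s * g s) = 0) :
    ∃ η, IsLamSol (pb f eta0) η ∧ BS0 η - Aop η = f ∧ Mode 1 η := by
  obtain ⟨η, a, h1, h2, h3⟩ := exists_lam_one hf hg hs
  set c := ∫ X, cR X * η X with hc
  have hz : InZ (η + c • dR eta0) := h1.add (inZ_eta0.dR.smul c)
  have hm : Mode 1 (η + c • dR eta0) := by
    obtain ⟨b, hb⟩ := mode_one_dR_eta0
    refine ⟨fun r => a r + c * b r, fun r hr θ => ?_⟩
    simp only [Pi.add_apply, Pi.smul_apply, smul_eq_mul, h3 r hr, hb r hr]; ring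
  have he : BS0 (η + c • dR eta0) - Aop (η + c • dR eta0) = f := by
    rw [BS0_add h1 (inZ_eta0.dR.smul c), BS0_smul, ← inZ_eta0.BS0_deriv.1, ← h2]
    have := Aop_dR_eta0
    ext X
    have h4 := congrFun this X
    simp only [Aop, phi0, Pi.add_apply, Pi.sub_apply, Pi.smul_apply, smul_eq_mul] at h4 ⊢
    linear_combination -c * h4
  refine ⟨_, ⟨hz, hm.angMean_eq_zero le_rfl hz.cont, ?_, ?_, ?_⟩, he, hm⟩
  · have e : ∫ X, cR X * (η + c • dR eta0) X = (∫ X, cR X * η X) + c * ∫ X, cR X * dR eta0 X := by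
      rw [← integral_const_mul, ← integral_add (h1.integrable_mul TG.cR) ((inZ_eta0.dR.integrable_mul TG.cR).const_mul c)]
      congr 1; ext X; simp; ring
    rw [e, integral_cR_dR_eta0]; ring
  · exact ((parZ_cZ.mul hm.parZ).of_eq (by ring)).integral_eq_zero
  · rw [Lam_eq hz, he]

/-! ### The constant `v` and the first order profile -/

lemma integral_subst_sq (H : ℝ → ℝ) : ∫ s in Ioi (0:ℝ), s / 2 * H (s ^ 2 / 4) = ∫ x in Ioi (0:ℝ), H x := by
  have h1 := integral_comp_rpow_Ioi (fun y => 1 / 4 * H (1 / 4 * y)) (p := 2) (by norm_num)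
  rw [integral_const_mul, integral_comp_mul_left_Ioi H 0 (by norm_num : (0:ℝ) < 1 / 4), mul_zero] at h1
  have h2 : ∫ x in Ioi (0:ℝ), H x = 1 / 4 * ((1 / 4 : ℝ)⁻¹ • ∫ x in Ioi (0:ℝ), H x) := by rw [smul_eq_mul]; ring
  rw [h2, ← h1]
  refine setIntegral_congr_fun measurableSet_Ioi fun s hs => ?_
  simp only [smul_eq_mul]
  norm_num
  rw [show s ^ 2 / 4 = 1 / 4 * s ^ 2 by ring]; ring

lemma integral_log_mul_exp : IntegrableOn (fun x => log x * exp (-x)) (Ioi 0) ∧ ∫ x in Ioi (0:ℝ), log x * exp (-x) = -eulerMascheroniConstant := by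
  have h1 := Complex.hasDerivAt_GammaIntegral (s := 1) (by simp)
  have e : ∫ t in Ioi (0:ℝ), (t : ℂ) ^ ((1:ℂ) - 1) * (log t * exp (-t)) = ((∫ t in Ioi (0:ℝ), log t * exp (-t) : ℝ) : ℂ) := by
    rw [← integral_complex_ofReal]
    refine setIntegral_congr_fun measurableSet_Ioi fun s hs => ?_
    simp
  rw [e] at h1
  have h2 : HasDerivAt Complex.Gamma ((∫ t in Ioi (0:ℝ), log t * exp (-t) : ℝ) : ℂ) 1 := by
    refine h1.congr_of_eventuallyEq ?_
    have : {z : ℂ | 0 < z.re} ∈ nhds (1:ℂ) := (isOpen_lt continuous_const Complex.continuous_re).mem_nhds (by simp)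
    filter_upwards [this] with z hz
    exact Complex.Gamma_eq_integral hz
  have h3 := HasDerivAt.real_of_complex (z := 1) (e := Complex.Gamma) (by simpa using h2)
  have h4 : HasDerivAt Real.Gamma (∫ t in Ioi (0:ℝ), log t * exp (-t)) 1 := by
    have e3 : Real.Gamma = fun x : ℝ => (Complex.Gamma x).re := rfl
    rw [e3]; simpa using h3
  have h5 := h4.unique Real.hasDerivAt_Gamma_one
  refine ⟨?_, h5⟩
  by_contra hn
  rw [integral_undef hn] at h5
  have := Real.one_half_lt_eulerMascheroniConstant
  linarith

lemma integrableOn_pow_exp (n : ℕ) : IntegrableOn (fun x : ℝ => x ^ n * exp (-x)) (Ioi 0) := by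
  have := Real.GammaIntegral_convergent (s := n + 1) (by positivity)
  refine this.congr_fun (fun x hx => ?_) measurableSet_Ioi
  simp only [add_sub_cancel_right, rpow_natCast]; ring

lemma integral_pow_exp (n : ℕ) : ∫ x in Ioi (0:ℝ), x ^ n * exp (-x) = n.factorial := by
  rw [← Real.Gamma_nat_eq_factorial, Real.Gamma_eq_integral (by positivity)]
  refine setIntegral_congr_fun measurableSet_Ioi fun x hx => ?_
  simp only [add_sub_cancel_right, rpow_natCast]; ring

lemma EK0_nonneg_le_one {x : ℝ} (hx : 0 ≤ x) : 0 ≤ EK 0 x ∧ EK 0 x ≤ 1 :=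
  ⟨(EK_pos 0 x).le, by simpa using EK_le_exp 0 (c := 0) le_rfl (by simpa using hx)⟩

lemma Ein_bounds {x : ℝ} (hx : 0 ≤ x) : 0 ≤ Ein x ∧ Ein x ≤ x := by
  have e : Ein x = ∫ t in (0:ℝ)..x, EK 0 t := by
    have := intervalIntegral.integral_eq_sub_of_hasDerivAt (a := 0) (b := x) (fun t _ => hasDerivAt_Ein t)
      ((continuous_EK 0).intervalIntegrable _ _)
    rw [this, Ein_zero, sub_zero]
  rw [e]
  constructor
  · exact intervalIntegral.integral_nonneg hx fun t ht => (EK_pos 0 t).le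
  · have : ∫ t in (0:ℝ)..x, EK 0 t ≤ ∫ t in (0:ℝ)..x, (1:ℝ) :=
      intervalIntegral.integral_mono_on hx ((continuous_EK 0).intervalIntegrable _ _) (by simp)
        fun t ht => (EK0_nonneg_le_one ht.1).2
    simpa using this

lemma continuous_Ein : Continuous Ein := continuous_iff_continuousAt.2 fun x => (hasDerivAt_Ein x).continuousAt

lemma integrableOn_exp_mul {h : ℝ → ℝ} (hc : Continuous h) (n : ℕ) (hb : ∀ x, 0 ≤ x → |h x| ≤ x ^ n) :
    IntegrableOn (fun x => exp (-x) * h x) (Ioi 0) := by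
  refine Integrable.mono' (integrableOn_pow_exp n) (by fun_prop : Continuous fun x => exp (-x) * h x).aestronglyMeasurable ?_
  refine (ae_restrict_mem measurableSet_Ioi).mono fun x hx => ?_
  rw [norm_mul, Real.norm_of_nonneg (exp_pos _).le, mul_comm]
  exact mul_le_mul_of_nonneg_right (hb x (le_of_lt hx)) (exp_pos _).le

lemma integral_exp_EK0 : ∫ x in Ioi (0:ℝ), exp (-x) * EK 0 x = log 2 := by
  have h1 : ∀ x ∈ Ioi (0:ℝ), exp (-x) * EK 0 x = x⁻¹ • (exp (-(1 * x)) - exp (-(2 * x))) := fun x hx => by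
    have hx : 0 < x := hx
    have h2 := mul_EK0 x
    have h3 : exp (-(2 * x)) = exp (-x) * exp (-x) := by rw [← exp_add]; congr 1; ring
    rw [smul_eq_mul, h3, one_mul]
    field_simp
    linear_combination h2
  rw [setIntegral_congr_fun measurableSet_Ioi h1]
  have hc : Continuous fun x : ℝ => exp (-x) := by fun_prop
  have hL : Filter.Tendsto (fun x : ℝ => exp (-x)) (nhdsWithin 0 (Ioi 0)) (nhds 1) := by
    have := (hc.tendsto 0).mono_left (nhdsWithin_le_nhds (s := Ioi 0))
    simpa using this
  have h := Frullani.integral_Ioi_eq (a := 1) (b := 2) (hc.locallyIntegrable.locallyIntegrableOn _) one_pos two_pos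
    hL tendsto_exp_neg_atTop_nhds_zero (IntegrableOn.congr_fun
      (integrableOn_exp_mul (continuous_EK 0) 0 fun x hx => by
        obtain ⟨h0, h1⟩ := EK0_nonneg_le_one hx
        rw [abs_of_nonneg h0]; simpa using h1) h1 measurableSet_Ioi)
  refine h.trans ?_
  simp

lemma integral_exp_one_sub : ∫ x in Ioi (0:ℝ), exp (-x) * (1 - exp (-x)) = 1 / 2 := by
  have h1 : IntegrableOn (fun x : ℝ => exp (-x)) (Ioi 0) := by simpa using integrableOn_pow_exp 0
  have h2 : ∫ x in Ioi (0:ℝ), exp (-x) = 1 := by simpa using integral_pow_exp 0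
  have h3 : IntegrableOn (fun x : ℝ => exp (-(2 * x))) (Ioi 0) := by simpa using integrableOn_exp_mul_Ioi (a := -2) (by norm_num) 0
  have h4 : ∫ x in Ioi (0:ℝ), exp (-(2 * x)) = 1 / 2 := by
    have := integral_exp_mul_Ioi (a := -2) (by norm_num) 0
    simpa using this
  have : ∀ x : ℝ, exp (-x) * (1 - exp (-x)) = exp (-x) - exp (-(2 * x)) := fun x => by
    rw [mul_sub, ← exp_add]; congr 1
    · ring
    · congr 1; ring
  simp_rw [this]
  rw [integral_sub h1 h3, h2, h4]; norm_num

open Filter Topology in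
lemma integral_mul_exp_Ein : ∫ x in Ioi (0:ℝ), x * exp (-x) * Ein x = log 2 + 1 / 2 := by
  have hEK := continuous_EK 0
  have hEin := continuous_Ein
  have i1 : IntegrableOn (fun x => exp (-x) * (x * Ein x)) (Ioi 0) := integrableOn_exp_mul (by fun_prop) 2 fun x hx => by
      obtain ⟨h0, h1⟩ := Ein_bounds hx
      rw [abs_of_nonneg (by positivity)]; nlinarith
  have i2 : IntegrableOn (fun x => exp (-x) * EK 0 x) (Ioi 0) := integrableOn_exp_mul hEK 0 fun x hx => by
      obtain ⟨h0, h1⟩ := EK0_nonneg_le_one hx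
      rw [abs_of_nonneg h0]; simpa using h1
  have i3 : IntegrableOn (fun x => exp (-x) * (1 - exp (-x))) (Ioi 0) := integrableOn_exp_mul (by fun_prop) 0 fun x hx => by
      have := exp_le_one_iff.2 (neg_nonpos.2 hx)
      have := exp_pos (-x)
      rw [abs_of_nonneg (by linarith)]; simp; linarith
  have hd : ∀ x ∈ Ici (0:ℝ), HasDerivAt (fun x => -((1 + x) * exp (-x)) * Ein x)
      (exp (-x) * (x * Ein x) - (exp (-x) * EK 0 x + exp (-x) * (1 - exp (-x)))) x := fun x _ => by
    have h1 : HasDerivAt (fun x : ℝ => -((1 + x) * exp (-x))) (x * exp (-x)) x := by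
      have := (((hasDerivAt_id x).const_add 1).mul (hasDerivAt_id x).neg.exp).neg
      refine this.congr_deriv ?_
      simp only [Pi.neg_apply, id]; ring
    refine (h1.mul (hasDerivAt_Ein x)).congr_deriv ?_
    rw [← mul_EK0]; ring
  have ht : Tendsto (fun x => -((1 + x) * exp (-x)) * Ein x) atTop (𝓝 0) := by
    have h2 : Tendsto (fun x : ℝ => x * exp (-x) + x ^ 2 * exp (-x)) atTop (𝓝 (0 + 0)) := by
      refine Tendsto.add ?_ ?_
      · simpa using tendsto_pow_mul_exp_neg_atTop_nhds_zero 1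
      · exact tendsto_pow_mul_exp_neg_atTop_nhds_zero 2
    rw [add_zero] at h2
    refine squeeze_zero_norm' ?_ h2
    filter_upwards [eventually_ge_atTop 0] with x hx
    obtain ⟨h0, h1⟩ := Ein_bounds hx
    have := exp_pos (-x)
    rw [norm_mul, norm_neg, Real.norm_of_nonneg (by positivity), Real.norm_of_nonneg h0]
    calc (1 + x) * exp (-x) * Ein x ≤ (1 + x) * exp (-x) * x := by gcongr
      _ = _ := by ring
  have h := integral_Ioi_of_hasDerivAt_of_tendsto' hd (i1.sub (i2.add i3)) ht
  have h6 := integral_sub i1 (i2.add i3)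
  simp only [Pi.add_apply] at h6
  rw [h6, integral_add i2 i3, integral_exp_EK0, integral_exp_one_sub, Ein_zero] at h
  have e : ∫ x in Ioi (0:ℝ), x * exp (-x) * Ein x = ∫ x in Ioi (0:ℝ), exp (-x) * (x * Ein x) := by congr 1; ext x; ring
  rw [e]; linarith

lemma phi0_zero : phi0 0 = 1 / (2 * π) * (2 * log 2 + eulerMascheroniConstant / 2) := by
  have hi := BS0_integrable inZ_eta0.cont inZ_eta0.rapid 0
  have hpi := pi_ne_zero
  rw [phi0, BS0, integral_polar hi]
  congr 1
  have e : ∀ s ∈ Ioi (0:ℝ), s • (∫ α in (-π)..π, log (8 / √(distSq 0 polar[s; α])) * eta0 polar[s; α])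
      = s / 2 * ((fun x => (log 4 - log x / 2) * exp (-x)) (s ^ 2 / 4)) := fun s hs => by
    have hs : 0 < s := hs
    have h1 : ∀ α, log (8 / √(distSq 0 polar[s; α])) * eta0 polar[s; α] = log (8 / s) * (1 / (4 * π) * exp (-(s ^ 2 / 4))) := fun α => by
      have : distSq 0 polar[s; α] = s ^ 2 := by simp only [distSq, Prod.fst_zero, Prod.snd_zero]; nlinarith [sin_sq_add_cos_sq α]
      rw [this, Real.sqrt_sq hs.le, eta0_apply, quarter_polar]
    simp only [h1]
    rw [intervalIntegral.integral_const, smul_eq_mul, smul_eq_mul]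
    have h2 : log (8 / s) = log 4 - log (s ^ 2 / 4) / 2 := by
      rw [log_div (by norm_num) hs.ne', log_div (by positivity) (by norm_num), log_pow,
        show (8:ℝ) = 2 ^ 3 by norm_num, show (4:ℝ) = 2 ^ 2 by norm_num, log_pow, log_pow]
      push_cast; ring
    rw [h2]; field_simp; ring
  refine (setIntegral_congr_fun measurableSet_Ioi e).trans ((integral_subst_sq fun x => (log 4 - log x / 2) * exp (-x)).trans ?_)
  obtain ⟨i1, h1⟩ := integral_log_mul_exp
  have i2 : IntegrableOn (fun x : ℝ => exp (-x)) (Ioi 0) := by simpa using integrableOn_pow_exp 0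
  have h2 : ∫ x in Ioi (0:ℝ), exp (-x) = 1 := by simpa using integral_pow_exp 0
  have e2 : ∀ x : ℝ, (log 4 - log x / 2) * exp (-x) = log 4 * exp (-x) - 1 / 2 * (log x * exp (-x)) := fun x => by ring
  simp_rw [e2]
  rw [integral_sub (i2.const_mul _) (i1.const_mul _), integral_const_mul, integral_const_mul, h1, h2, show (4:ℝ) = 2 ^ 2 by norm_num, log_pow]
  push_cast; ring

/-- The right-hand side of the equation for `η₁₀`. -/
def firstRhs : ℝ² → ℝ := (cv / (2 * π)) • cR - (1 / 2 : ℝ) • (cR * phi0) + (3 : ℝ) • dR phi0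

lemma tg_firstRhs : TG firstRhs := ((TG.cR.smul _).sub ((TG.cR.mul tg_phi0).smul _)).add (tg_phi0.dR.smul _)

lemma firstRhs_polar (r : ℝ) (_ : 0 < r) (θ : ℝ) : firstRhs polar[r; θ]
    = (r * (cv / (2 * π) - 1 / 2 * (phi0 0 - 1 / (4 * π) * Ein (r ^ 2 / 4)) - 3 / (8 * π) * EK 0 (r ^ 2 / 4))) * cos ((1:ℕ) * θ) := by
  rw [firstRhs, dR_phi0]
  simp only [Pi.add_apply, Pi.sub_apply, Pi.smul_apply, Pi.mul_apply, smul_eq_mul, cR, EKf]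
  rw [phi0_eq]
  simp only [quarter_polar]
  push_cast; rw [one_mul]; ring

lemma firstRhs_solvable : ∫ s in Ioi (0:ℝ), s * wq s *
    (s * (cv / (2 * π) - 1 / 2 * (phi0 0 - 1 / (4 * π) * Ein (s ^ 2 / 4)) - 3 / (8 * π) * EK 0 (s ^ 2 / 4))) = 0 := by
  have hpi := pi_ne_zero
  have e : ∀ s ∈ Ioi (0:ℝ), s * wq s * (s * (cv / (2 * π) - 1 / 2 * (phi0 0 - 1 / (4 * π) * Ein (s ^ 2 / 4)) - 3 / (8 * π) * EK 0 (s ^ 2 / 4)))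
      = s / 2 * ((fun x => (2 * (cv / (2 * π) - 1 / 2 * phi0 0)) * (x ^ 1 * exp (-x)) + 1 / (4 * π) * (x * exp (-x) * Ein x)
        - 3 / (4 * π) * (exp (-x) * (1 - exp (-x)))) (s ^ 2 / 4)) := fun s _ => by
    simp only [wq]
    rw [← mul_EK0]; ring
  refine (setIntegral_congr_fun measurableSet_Ioi e).trans ((integral_subst_sq fun x =>
    (2 * (cv / (2 * π) - 1 / 2 * phi0 0)) * (x ^ 1 * exp (-x)) + 1 / (4 * π) * (x * exp (-x) * Ein x)
        - 3 / (4 * π) * (exp (-x) * (1 - exp (-x)))).trans ?_)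
  have i1 := integrableOn_pow_exp 1
  have hEin := continuous_Ein
  have i2 : IntegrableOn (fun x => x * exp (-x) * Ein x) (Ioi 0) := by
    refine IntegrableOn.congr_fun (integrableOn_exp_mul (h := fun x => x * Ein x) (by fun_prop) 2 fun x hx => ?_) (fun x _ => ?_) measurableSet_Ioi
    · obtain ⟨h0, h1⟩ := Ein_bounds hx
      rw [abs_of_nonneg (by positivity)]; nlinarith
    · ring
  have i3 : IntegrableOn (fun x => exp (-x) * (1 - exp (-x))) (Ioi 0) := integrableOn_exp_mul (by fun_prop) 0 fun x hx => by
      have := exp_le_one_iff.2 (neg_nonpos.2 hx)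
      have := exp_pos (-x)
      rw [abs_of_nonneg (by linarith)]; simp; linarith
  have j12 := (i1.const_mul (2 * (cv / (2 * π) - 1 / 2 * phi0 0))).add (i2.const_mul (1 / (4 * π)))
  have h12 := integral_sub j12 (i3.const_mul (3 / (4 * π)))
  simp only [Pi.add_apply] at h12
  rw [h12, integral_add (i1.const_mul _) (i2.const_mul _), integral_const_mul,
    integral_const_mul, integral_const_mul, integral_pow_exp, integral_mul_exp_Ein, integral_exp_one_sub, phi0_zero, cv]
  simp only [Nat.factorial_one, Nat.cast_one]
  field_simp
  ring

lemma pb_firstRhs : pb firstRhs eta0 = (cv / (2 * π)) • dZ eta0 - (3 / 2 : ℝ) • (dZ phi0 * eta0) - (1 / 2 : ℝ) • (phi0 * dZ eta0) := by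
  have hpi := pi_ne_zero
  have hd : Differentiable ℝ phi0 := tg_phi0.diff
  have hE := differentiable_EKf 0
  rw [firstRhs, pb_eta0, dR_phi0, dZ_eta0]
  rw [dR_add (((TG.cR.smul _).sub ((TG.cR.mul tg_phi0).smul _)).diff) (((TG.cR.mul (tg_EKf 0)).smul _).smul _).diff,
    dZ_add (((TG.cR.smul _).sub ((TG.cR.mul tg_phi0).smul _)).diff) (((TG.cR.mul (tg_EKf 0)).smul _).smul _).diff,
    dR_sub (TG.cR.smul _).diff ((TG.cR.mul tg_phi0).smul _).diff, dZ_sub (TG.cR.smul _).diff ((TG.cR.mul tg_phi0).smul _).diff]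
  simp only [dR_smul, dZ_smul, dR_mul TG.cR.diff hd, dZ_mul TG.cR.diff hd, dR_mul TG.cR.diff hE, dZ_mul TG.cR.diff hE,
    dR_cR, dZ_cR, dR_phi0, dZ_phi0, dR_EKf, dZ_EKf]
  ext X
  simp only [Pi.add_apply, Pi.sub_apply, Pi.smul_apply, Pi.mul_apply, smul_eq_mul, Pi.one_apply, Pi.zero_apply, cR, cZ]
  field_simp
  ring

lemma eta10_spec : IsLamSol (pb firstRhs eta0) eta10 ∧ BS0 eta10 - Aop eta10 = firstRhs ∧ Mode 1 eta10 := by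
  obtain ⟨η, h1, h2, h3⟩ := exists_isLamSol_one tg_firstRhs firstRhs_polar firstRhs_solvable
  have : eta10 = η := by rw [eta10, ← pb_firstRhs]; exact lamInv_eq h1
  rw [this]; exact ⟨h1, h2, h3⟩

lemma eta200_spec : IsLamSol (-((3 / (16 * π)) • (cR * cZ * eta0))) eta200 ∧
    BS0 eta200 - Aop eta200 = (3 / (32 * π)) • (cR ^ 2 - cZ ^ 2) ∧ Mode 2 eta200 := by
  have htg : TG ((3 / (32 * π)) • (cR ^ 2 - cZ ^ 2)) := ((TG.cR.pow 2).sub (TG.cZ.pow 2)).smul _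
  have hm : Mode 2 ((3 / (32 * π)) • (cR ^ 2 - cZ ^ 2)) := ⟨fun r => 3 / (32 * π) * r ^ 2, fun r _ θ => by
    simp only [Pi.smul_apply, Pi.sub_apply, Pi.pow_apply, cR, cZ, smul_eq_mul]
    push_cast
    rw [cos_two_mul]
    have := sin_sq_add_cos_sq θ
    linear_combination (-(3 / (32 * π) * r ^ 2)) * this⟩
  obtain ⟨η, h1, h2, h3⟩ := exists_isLamSol_two htg hm
  have e : pb ((3 / (32 * π)) • (cR ^ 2 - cZ ^ 2)) eta0 = -((3 / (16 * π)) • (cR * cZ * eta0)) := by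
    have hpi := pi_ne_zero
    rw [pb_eta0, dR_smul, dZ_smul, pow_two, pow_two, dR_sub (TG.cR.mul TG.cR).diff (TG.cZ.mul TG.cZ).diff,
      dZ_sub (TG.cR.mul TG.cR).diff (TG.cZ.mul TG.cZ).diff, dR_mul TG.cR.diff TG.cR.diff, dZ_mul TG.cR.diff TG.cR.diff,
      dR_mul TG.cZ.diff TG.cZ.diff, dZ_mul TG.cZ.diff TG.cZ.diff, dR_cR, dR_cZ, dZ_cR, dZ_cZ]
    ext X
    simp only [Pi.add_apply, Pi.sub_apply, Pi.neg_apply, Pi.smul_apply, Pi.mul_apply, smul_eq_mul, Pi.one_apply, Pi.zero_apply]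
    field_simp
    ring
  rw [e] at h1
  have : eta200 = η := lamInv_eq h1
  rw [this]; exact ⟨h1, h2, h3⟩

/-! ### The operators `BS β m` -/

/-- Separated kernels. -/
def Sep (k : ℝ² → ℝ² → ℝ) : Prop := ∃ (n : ℕ) (p q : Fin n → ℝ² → ℝ), (∀ i, TG (p i)) ∧ (∀ i, TG (q i)) ∧ ∀ X Y, k X Y = ∑ i, p i X * q i Y

lemma Sep.mk_mul {p q : ℝ² → ℝ} (hp : TG p) (hq : TG q) : Sep fun X Y => p X * q Y :=
  ⟨1, fun _ => p, fun _ => q, fun _ => hp, fun _ => hq, fun X Y => by simp⟩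

lemma Sep.left {p : ℝ² → ℝ} (hp : TG p) : Sep fun X _ => p X := by simpa using Sep.mk_mul hp TG.one
lemma Sep.right {q : ℝ² → ℝ} (hq : TG q) : Sep fun _ Y => q Y := by simpa using Sep.mk_mul TG.one hq
lemma Sep.const (c : ℝ) : Sep fun _ _ => c := Sep.left (TG.const c)

lemma Sep.add {k l : ℝ² → ℝ² → ℝ} (hk : Sep k) (hl : Sep l) : Sep fun X Y => k X Y + l X Y := by
  obtain ⟨n, p, q, hp, hq, h⟩ := hk
  obtain ⟨n', p', q', hp', hq', h'⟩ := hl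
  refine ⟨n + n', Fin.append p p', Fin.append q q', ?_, ?_, fun X Y => ?_⟩
  · exact fun i => Fin.addCases (fun i => by simpa using hp i) (fun i => by simpa using hp' i) i
  · exact fun i => Fin.addCases (fun i => by simpa using hq i) (fun i => by simpa using hq' i) i
  · show k X Y + l X Y = _
    rw [Fin.sum_univ_add, h, h']; simp

lemma Sep.mul {k l : ℝ² → ℝ² → ℝ} (hk : Sep k) (hl : Sep l) : Sep fun X Y => k X Y * l X Y := by
  obtain ⟨n, p, q, hp, hq, h⟩ := hk
  obtain ⟨n', p', q', hp', hq', h'⟩ := hl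
  let e := (finProdFinEquiv : Fin n × Fin n' ≃ Fin (n * n'))
  refine ⟨n * n', fun i => p (e.symm i).1 * p' (e.symm i).2, fun i => q (e.symm i).1 * q' (e.symm i).2,
    fun i => (hp _).mul (hp' _), fun i => (hq _).mul (hq' _), fun X Y => ?_⟩
  show k X Y * l X Y = _
  rw [h, h', Finset.sum_mul_sum, ← Finset.sum_product', Finset.univ_product_univ, ← e.sum_comp]
  refine Finset.sum_congr rfl fun i _ => ?_
  simp only [Equiv.symm_apply_apply, Pi.mul_apply]; ring

lemma Sep.pow {k : ℝ² → ℝ² → ℝ} (hk : Sep k) : ∀ n : ℕ, Sep fun X Y => k X Y ^ n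
  | 0 => by simpa using Sep.const 1
  | n + 1 => by simpa only [pow_succ] using (hk.pow n).mul hk

lemma Sep.neg {k : ℝ² → ℝ² → ℝ} (hk : Sep k) : Sep fun X Y => -k X Y := by simpa using (Sep.const (-1)).mul hk
lemma Sep.sub {k l : ℝ² → ℝ² → ℝ} (hk : Sep k) (hl : Sep l) : Sep fun X Y => k X Y - l X Y := by simpa only [sub_eq_add_neg] using hk.add hl.neg
lemma Sep.smul {k : ℝ² → ℝ² → ℝ} (c : ℝ) (hk : Sep k) : Sep fun X Y => c * k X Y := (Sep.const c).mul hk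

lemma sep_polP (m : ℕ) : Sep (polP m) := by
  have R : Sep fun X _ => X.1 := Sep.left TG.cR
  have Z : Sep fun X _ => X.2 := Sep.left TG.cZ
  have R' : Sep fun _ Y => Y.1 := Sep.right TG.cR
  have Z' : Sep fun _ Y => Y.2 := Sep.right TG.cZ
  rcases m with _ | _ | _ | _ | _ | m
  · exact Sep.const 1
  · have := (R.add R').smul (1 / 2)
    convert this using 3; simp only [polP]; ring
  · have := (((R.sub R').pow 2).smul (1 / 16)).add (((Z.sub Z').pow 2).smul (3 / 16))
    convert this using 3; simp only [polP]; ring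
  · have := ((R.add R').smul (-(1 / 32))).mul (((R.sub R').pow 2).add (((Z.sub Z').pow 2).smul 3))
    convert this using 3; simp only [polP]
  · have := ((((((Z.sub Z').pow 4).smul (-(15 / 1024))).add ((((R.sub R').pow 2).smul (21 / 512)).mul ((Z.sub Z').pow 2))).add
      (((R.mul R').smul (3 / 16)).mul ((Z.sub Z').pow 2))).add ((((R.pow 2).sub (R'.pow 2)).pow 2).smul (17 / 1024))).sub
      (((R.mul R').smul (1 / 256)).mul ((R.sub R').pow 2))
    convert this using 3; simp only [polP]
  · exact Sep.const 0

lemma sep_polQ (m : ℕ) : Sep (polQ m) := by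
  have R : Sep fun X _ => X.1 := Sep.left TG.cR
  have Z : Sep fun X _ => X.2 := Sep.left TG.cZ
  have R' : Sep fun _ Y => Y.1 := Sep.right TG.cR
  have Z' : Sep fun _ Y => Y.2 := Sep.right TG.cZ
  rcases m with _ | _ | _ | _ | _ | m
  · exact Sep.const (-2)
  · have := (R.add R').smul (-(1 / 2))
    convert this using 3; simp only [polQ]; ring
  · have := (((R.pow 2).add (R'.pow 2)).smul (1 / 4)).sub ((((R.sub R').pow 2).add ((Z.sub Z').pow 2)).smul (1 / 16))
    convert this using 3; simp only [polQ]; ring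
  · have := ((R.add R').smul (-(1 / 48))).mul (((R.add R').pow 2).sub (((Z.sub Z').pow 2).smul 6))
    convert this using 3; simp only [polQ]
  · have := (((((((Z.sub Z').pow 4).smul (31 / 2048)).sub ((((R.add R').pow 2).smul (89 / 1024)).mul ((Z.sub Z').pow 2))).add
      (((R.mul R').smul (1 / 256)).mul ((Z.sub Z').pow 2))).sub ((((R.pow 2).sub (R'.pow 2)).pow 2).smul (19 / 6144))).add
      (((R.mul R').smul (35 / 1536)).mul ((R.add R').pow 2))).sub (((R.pow 2).smul (1 / 128)).mul (R'.pow 2))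
    convert this using 3; simp only [polQ]
  · exact Sep.const 0

/-- The operator with kernel `k X Y / (2π)`. -/
def kerOp (k : ℝ² → ℝ² → ℝ) (f : ℝ² → ℝ) : ℝ² → ℝ := fun X => (1 / (2 * π)) * ∫ Y, k X Y * f Y

/-- The operator with kernel `log (8/D) k X Y / (2π)`. -/
def logOp (k : ℝ² → ℝ² → ℝ) (f : ℝ² → ℝ) : ℝ² → ℝ := fun X => (1 / (2 * π)) * ∫ Y, log (8 / √(distSq X Y)) * k X Y * f Y

section
variable {k l : ℝ² → ℝ² → ℝ}

lemma Sep.kerOp_integrable (hk : Sep k) (hf : InZ f) (X : ℝ²) : Integrable fun Y => k X Y * f Y := by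
  obtain ⟨n, p, q, hp, hq, h⟩ := hk
  simp_rw [h, Finset.sum_mul]
  refine integrable_finsetSum _ fun i _ => ?_
  simp_rw [mul_assoc]
  exact (hf.integrable_mul (hq i)).const_mul _

lemma Sep.logOp_integrable (hk : Sep k) (hf : InZ f) (X : ℝ²) :
    Integrable fun Y => log (8 / √(distSq X Y)) * k X Y * f Y := by
  obtain ⟨n, p, q, hp, hq, h⟩ := hk
  simp_rw [h, Finset.mul_sum, Finset.sum_mul]
  refine integrable_finsetSum _ fun i _ => ?_
  have h1 := hf.mul_left (hq i)
  refine ((BS0_integrable h1.cont h1.rapid X).const_mul (p i X)).congr (.of_forall fun Y => ?_)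
  simp only [Pi.mul_apply]; ring

lemma kerOp_sum {n : ℕ} (p q : Fin n → ℝ² → ℝ) (hq : ∀ i, TG (q i)) (hf : InZ f)
    (h : ∀ X Y, k X Y = ∑ i, p i X * q i Y) :
    kerOp k f = ∑ i, p i * fun _ => (1 / (2 * π)) * ∫ Y, q i Y * f Y := by
  ext X
  simp only [kerOp, h, Finset.sum_mul, Finset.sum_apply, Pi.mul_apply]
  rw [integral_finsetSum]
  · rw [Finset.mul_sum]
    refine Finset.sum_congr rfl fun i _ => ?_
    simp_rw [mul_assoc]; rw [integral_const_mul]; ring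
  · intro i _
    simp_rw [mul_assoc]
    exact (hf.integrable_mul (hq i)).const_mul _

lemma logOp_sum {n : ℕ} (p q : Fin n → ℝ² → ℝ) (hq : ∀ i, TG (q i)) (hf : InZ f)
    (h : ∀ X Y, k X Y = ∑ i, p i X * q i Y) :
    logOp k f = ∑ i, p i * BS0 (q i * f) := by
  ext X
  have e : ∀ (i : Fin n) (Y : ℝ²), log (8 / √(distSq X Y)) * (p i X * q i Y) * f Y
      = p i X * (log (8 / √(distSq X Y)) * (q i * f) Y) := fun i Y => by simp only [Pi.mul_apply]; ring
  simp only [logOp, h, Finset.mul_sum, Finset.sum_mul, Finset.sum_apply, Pi.mul_apply, e]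
  rw [integral_finsetSum]
  · rw [Finset.mul_sum]
    refine Finset.sum_congr rfl fun i _ => ?_
    rw [integral_const_mul, BS0, mul_left_comm]; rfl
  · intro i _
    have h1 := hf.mul_left (hq i)
    exact (BS0_integrable h1.cont h1.rapid X).const_mul _

lemma TG.sum {n : ℕ} {p : Fin n → ℝ² → ℝ} (h : ∀ i, TG (p i)) : TG (∑ i, p i) := by
  induction n with
  | zero => simpa using TG.zero
  | succ n ih => rw [Fin.sum_univ_succ]; exact (h 0).add (ih fun i => h _)

lemma Sep.tg_kerOp (hk : Sep k) (hf : InZ f) : TG (kerOp k f) := by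
  obtain ⟨n, p, q, hp, hq, h⟩ := hk
  rw [kerOp_sum p q hq hf h]
  exact TG.sum fun i => (hp i).mul (TG.const _)

lemma Sep.tg_logOp (hk : Sep k) (hf : InZ f) : TG (logOp k f) := by
  obtain ⟨n, p, q, hp, hq, h⟩ := hk
  rw [logOp_sum p q hq hf h]
  exact TG.sum fun i => (hp i).mul (TG.BS0 (hf.mul_left (hq i)))

lemma kerOp_add (hk : Sep k) (hf : InZ f) (hg : InZ g) : kerOp k (f + g) = kerOp k f + kerOp k g := by
  ext X
  simp only [kerOp, Pi.add_apply, mul_add]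
  rw [integral_add (hk.kerOp_integrable hf X) (hk.kerOp_integrable hg X), mul_add]

lemma logOp_add (hk : Sep k) (hf : InZ f) (hg : InZ g) : logOp k (f + g) = logOp k f + logOp k g := by
  ext X
  simp only [logOp, Pi.add_apply, mul_add]
  rw [integral_add (hk.logOp_integrable hf X) (hk.logOp_integrable hg X), mul_add]

lemma kerOp_smul (c : ℝ) : kerOp k (c • f) = c • kerOp k f := by
  ext X
  simp only [kerOp, Pi.smul_apply, smul_eq_mul, mul_left_comm _ c]; rw [integral_const_mul, mul_left_comm]

lemma logOp_smul (c : ℝ) : logOp k (c • f) = c • logOp k f := by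
  ext X
  simp only [logOp, Pi.smul_apply, smul_eq_mul, mul_left_comm _ c]; rw [integral_const_mul, mul_left_comm]

/-- The part of `BS β m` that does not depend on `β`. -/
def BSL (m : ℕ) (f : ℝ² → ℝ) : ℝ² → ℝ := logOp (polP m) f + kerOp (polQ m) f

/-- The coefficient of `β` in `BS β m`. -/
def BSP (m : ℕ) (f : ℝ² → ℝ) : ℝ² → ℝ := kerOp (polP m) f

lemma BS_eq (β : ℝ) (m : ℕ) (hf : InZ f) : BS β m f = β • BSP m f + BSL m f := by
  ext X
  have h1 := (sep_polP m).kerOp_integrable hf X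
  have h2 := (sep_polP m).logOp_integrable hf X
  have h3 := (sep_polQ m).kerOp_integrable hf X
  have e : ∀ Y, ((β + log (8 / √(distSq X Y))) * polP m X Y + polQ m X Y) * f Y
      = (β * (polP m X Y * f Y) + log (8 / √(distSq X Y)) * polP m X Y * f Y) + polQ m X Y * f Y := fun Y => by ring
  simp only [BS, e, BSP, BSL, logOp, kerOp, Pi.add_apply, Pi.smul_apply, smul_eq_mul]
  have h12 := integral_add ((h1.const_mul β).add h2) h3
  simp only [Pi.add_apply] at h12
  rw [h12, integral_add (h1.const_mul β) h2, integral_const_mul]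
  ring

lemma tg_BSL (m : ℕ) (hf : InZ f) : TG (BSL m f) := ((sep_polP m).tg_logOp hf).add ((sep_polQ m).tg_kerOp hf)
lemma tg_BSP (m : ℕ) (hf : InZ f) : TG (BSP m f) := (sep_polP m).tg_kerOp hf
lemma tg_BS (β : ℝ) (m : ℕ) (hf : InZ f) : TG (BS β m f) := by rw [BS_eq β m hf]; exact ((tg_BSP m hf).smul β).add (tg_BSL m hf)

lemma BS_add (β : ℝ) (m : ℕ) (hf : InZ f) (hg : InZ g) : BS β m (f + g) = BS β m f + BS β m g := by
  rw [BS_eq β m hf, BS_eq β m hg, BS_eq β m (hf.add hg), BSP, BSL, kerOp_add (sep_polP m) hf hg,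
    logOp_add (sep_polP m) hf hg, kerOp_add (sep_polQ m) hf hg]
  simp only [BSP, BSL, smul_add]; abel

lemma BS_smul (β : ℝ) (m : ℕ) (c : ℝ) : BS β m (c • f) = c • BS β m f := by
  ext X
  simp only [BS, Pi.smul_apply, smul_eq_mul, mul_left_comm _ c]; rw [integral_const_mul, mul_left_comm]

end

lemma BSL_one (hf : InZ f) :
    BSL 1 f = (1 / 2 : ℝ) • (cR * BS0 f + BS0 (cR * f)) - (1 / (4 * π)) • ((∫ X, f X) • cR + fun _ => ∫ X, cR X * f X) := by
  have e1 : logOp (polP 1) f = ∑ i : Fin 2, (![(1 / 2 : ℝ) • cR, (fun _ => 1 / 2)] i) * BS0 ((![1, cR] : Fin 2 → ℝ² → ℝ) i * f) := by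
    refine logOp_sum _ _ (fun i => ?_) hf fun X Y => ?_
    · fin_cases i; exacts [TG.one, TG.cR]
    · simp [polP, Fin.sum_univ_two, cR]; ring
  have e2 : kerOp (polQ 1) f = ∑ i : Fin 2, (![(-(1 / 2) : ℝ) • cR, (fun _ => -(1 / 2))] i) * fun _ => (1 / (2 * π)) * ∫ Y, (![1, cR] : Fin 2 → ℝ² → ℝ) i Y * f Y := by
    refine kerOp_sum _ _ (fun i => ?_) hf fun X Y => ?_
    · fin_cases i; exacts [TG.one, TG.cR]
    · simp [polQ, Fin.sum_univ_two, cR]; ring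
  rw [BSL, e1, e2]
  ext X
  simp [Fin.sum_univ_two]; ring

lemma BSP_one (hf : InZ f) :
    BSP 1 f = (1 / (4 * π)) • ((∫ X, f X) • cR + fun _ => ∫ X, cR X * f X) := by
  have e2 : kerOp (polP 1) f = ∑ i : Fin 2, (![(1 / 2 : ℝ) • cR, (fun _ => 1 / 2)] i) * fun _ => (1 / (2 * π)) * ∫ Y, (![1, cR] : Fin 2 → ℝ² → ℝ) i Y * f Y := by
    refine kerOp_sum _ _ (fun i => ?_) hf fun X Y => ?_
    · fin_cases i; exacts [TG.one, TG.cR]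
    · simp [polP, Fin.sum_univ_two, cR]; ring
  rw [BSP, e2]
  ext X
  simp [Fin.sum_univ_two]; ring

/-! ### Rotations and the Fokker-Planck operator -/

lemma hasFDerivAt_comp_rot (hf : Differentiable ℝ f) (α : ℝ) (X : ℝ²) :
    HasFDerivAt (fun X => f (rot α X)) (lin (cos α * dR f (rot α X) + sin α * dZ f (rot α X))
      (-sin α * dR f (rot α X) + cos α * dZ f (rot α X))) X := by
  have h1 : HasFDerivAt (rot α) ((lin (cos α) (-sin α)).prod (lin (sin α) (cos α))) X := by
    refine HasFDerivAt.prodMk ?_ ?_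
    · refine (((hasFDerivAt_cR X).mul_const (cos α)).sub ((hasFDerivAt_cZ X).mul_const (sin α))).congr_fderiv ?_
      ext <;> simp [lin_apply]
    · refine (((hasFDerivAt_cR X).mul_const (sin α)).add ((hasFDerivAt_cZ X).mul_const (cos α))).congr_fderiv ?_
      ext <;> simp [lin_apply]
  refine ((hasFDerivAt_lin (hf (rot α X))).comp X h1).congr_fderiv ?_
  ext <;> simp [lin_apply] <;> ring

lemma dR_comp_rot (hf : Differentiable ℝ f) (α : ℝ) :
    dR (fun X => f (rot α X)) = cos α • (fun X => dR f (rot α X)) + sin α • (fun X => dZ f (rot α X)) := by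
  ext X; rw [dR_of_hasFDerivAt (hasFDerivAt_comp_rot hf α X)]; simp [lin_apply]
lemma dZ_comp_rot (hf : Differentiable ℝ f) (α : ℝ) :
    dZ (fun X => f (rot α X)) = (-sin α) • (fun X => dR f (rot α X)) + cos α • (fun X => dZ f (rot α X)) := by
  ext X; rw [dZ_of_hasFDerivAt (hasFDerivAt_comp_rot hf α X)]; simp [lin_apply]

lemma norm_rot_le (α : ℝ) (X : ℝ²) : ‖rot α X‖ ≤ 2 * ‖X‖ := by
  have h1 : rho (rot α X) = rho X := by
    have := radial_quarter α X
    simp only [quarter] at this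
    simp only [rho]; congr 1; linarith
  have h2 := norm_le_rho (rot α X)
  have h3 := norm_sq_le X
  simp only [rho] at h1
  linarith

lemma Tmp.comp_rot (α : ℝ) : ∀ {n : ℕ} {f : ℝ² → ℝ}, Tmp n f → Tmp n fun X => f (rot α X) := by
  have hpb : ∀ {f : ℝ² → ℝ}, PB f → PB fun X => f (rot α X) := by
    rintro f ⟨k, C, hC, h⟩
    refine PB.of_le (k := k) (C := C * 2 ^ k) fun X => (h _).trans ?_
    have := norm_rot_le α X
    rw [mul_assoc, ← mul_pow]
    gcongr
    linarith
  have hc : Continuous (rot α) := by unfold rot; fun_prop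
  intro n
  induction n with
  | zero => exact fun {f} h => ⟨h.1.comp hc, hpb h.2⟩
  | succ n ih =>
    intro f h
    refine ⟨fun X => (hasFDerivAt_comp_rot h.1 α X).differentiableAt, hpb h.2.1, ?_, ?_⟩
    · rw [dR_comp_rot h.1]
      exact (Tmp.mul (.of_hasTemperateGrowth (TG.const _)) (ih h.2.2.1)).add (Tmp.mul (.of_hasTemperateGrowth (TG.const _)) (ih h.2.2.2))
    · rw [dZ_comp_rot h.1]
      exact (Tmp.mul (.of_hasTemperateGrowth (TG.const _)) (ih h.2.2.1)).add (Tmp.mul (.of_hasTemperateGrowth (TG.const _)) (ih h.2.2.2))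

lemma TG.comp_rot (h : TG f) (α : ℝ) : TG fun X => f (rot α X) := hasTemperateGrowth_iff_tmp.2 fun _ => (Tmp.of_hasTemperateGrowth h).comp_rot α

lemma InZ.comp_rot (h : InZ f) (α : ℝ) : InZ fun X => f (rot α X) := by
  obtain ⟨g, hg, rfl⟩ := inZ_iff.1 h
  refine inZ_iff.2 ⟨_, hg.comp_rot α, ?_⟩
  ext X
  simp only [Pi.mul_apply, gauss_eq, radial_quarter α X]

lemma fokkerPlanck_comp_rot (h : InZ f) (α : ℝ) :
    fokkerPlanck (fun X => f (rot α X)) = fun X => fokkerPlanck f (rot α X) := by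
  have hs := sin_sq_add_cos_sq α
  have c1 := (h.dR.comp_rot α).diff
  have c2 := (h.dZ.comp_rot α).diff
  rw [fokkerPlanck, dR_comp_rot h.diff, dZ_comp_rot h.diff, dR_add (c1.const_smul _) (c2.const_smul _),
    dZ_add (c1.const_smul _) (c2.const_smul _), dR_smul, dR_smul, dZ_smul, dZ_smul, dR_comp_rot h.dR.diff, dR_comp_rot h.dZ.diff,
    dZ_comp_rot h.dR.diff, dZ_comp_rot h.dZ.diff]
  ext X
  simp only [fokkerPlanck, Pi.add_apply, Pi.smul_apply, Pi.mul_apply, smul_eq_mul, cR, cZ]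
  have e1 : (rot α X).1 = X.1 * cos α - X.2 * sin α := rfl
  have e2 : (rot α X).2 = X.1 * sin α + X.2 * cos α := rfl
  rw [e1, e2]
  linear_combination (dR (dR f) (rot α X) + dZ (dZ f) (rot α X)) * hs

lemma integral_dZ (h : InZ η) : ∫ X, dZ η X = 0 := by
  have h1 := integral_dR (h.comp_rot (π / 2))
  rw [dR_comp_rot h.diff] at h1
  simp only [cos_pi_div_two, sin_pi_div_two, zero_smul, one_smul, zero_add] at h1
  rwa [integral_rot (dZ η)] at h1

lemma fokkerPlanck_gauss_mul (hg : TG g) :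
    fokkerPlanck (gauss * g) = dR (gauss * dR g) + dZ (gauss * dZ g) := by
  have hG := differentiable_gauss
  rw [fokkerPlanck, dR_mul hG hg.diff, dZ_mul hG hg.diff, dR_mul hG hg.dR.diff, dZ_mul hG hg.dZ.diff, dR_gauss, dZ_gauss]
  have e1 : Differentiable ℝ ((-(1 / 2) : ℝ) • (cR * gauss) * g) := (((TG.cR.diff.mul hG).const_smul _).mul hg.diff)
  have e2 : Differentiable ℝ ((-(1 / 2) : ℝ) • (cZ * gauss) * g) := (((TG.cZ.diff.mul hG).const_smul _).mul hg.diff)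
  rw [dR_add e1 (hG.mul hg.dR.diff), dZ_add e2 (hG.mul hg.dZ.diff), dR_mul ((TG.cR.diff.mul hG).const_smul _) hg.diff,
    dZ_mul ((TG.cZ.diff.mul hG).const_smul _) hg.diff, dR_smul, dZ_smul, dR_mul TG.cR.diff hG, dZ_mul TG.cZ.diff hG,
    dR_mul hG hg.dR.diff, dZ_mul hG hg.dZ.diff, dR_gauss, dZ_gauss, dR_cR, dZ_cZ]
  ext X
  simp only [Pi.add_apply, Pi.smul_apply, Pi.mul_apply, Pi.one_apply, smul_eq_mul]
  ring

/-- Uniqueness for the resolvent of the Fokker-Planck operator. -/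
lemma fokkerPlanck_unique (h : InZ η) {κ : ℝ} (hκ : 0 < κ) (he : κ • η - fokkerPlanck η = 0) : η = 0 := by
  obtain ⟨g, hg, rfl⟩ := inZ_iff.1 h
  have z1 : InZ (gauss * (g * dR g)) := InZ.gauss_mul (hg.mul hg.dR)
  have z2 : InZ (gauss * (g * dZ g)) := InZ.gauss_mul (hg.mul hg.dZ)
  have i1 := integral_dR z1
  have i2 := integral_dZ z2
  have hG := differentiable_gauss
  have key : ∀ X, gauss X * (κ * (g X * g X) + (dR g X) ^ 2 + (dZ g X) ^ 2) = dR (gauss * (g * dR g)) X + dZ (gauss * (g * dZ g)) X := fun X => by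
    have h1 := congrFun he X
    rw [fokkerPlanck_gauss_mul hg, dR_mul hG hg.dR.diff, dZ_mul hG hg.dZ.diff] at h1
    rw [dR_mul hG (hg.mul hg.dR).diff, dZ_mul hG (hg.mul hg.dZ).diff, dR_mul hg.diff hg.dR.diff, dZ_mul hg.diff hg.dZ.diff]
    simp only [Pi.add_apply, Pi.sub_apply, Pi.smul_apply, Pi.mul_apply, Pi.zero_apply, smul_eq_mul] at h1 ⊢
    linear_combination g X * h1
  have hint : ∫ X, gauss X * (κ * (g X * g X) + (dR g X) ^ 2 + (dZ g X) ^ 2) = 0 := by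
    simp_rw [key]
    rw [integral_add z1.dR.integrable z2.dZ.integrable, i1, i2, add_zero]
  have hc : Continuous fun X => gauss X * (κ * (g X * g X) + (dR g X) ^ 2 + (dZ g X) ^ 2) := by
    have := hG.continuous
    have := hg.cont
    have := hg.dR.cont
    have := hg.dZ.cont
    fun_prop
  have h0 : (fun X => gauss X * (κ * (g X * g X) + (dR g X) ^ 2 + (dZ g X) ^ 2)) = 0 := by
    have hi : Integrable fun X => gauss X * (κ * (g X * g X) + (dR g X) ^ 2 + (dZ g X) ^ 2) := by
      simp_rw [key]; exact z1.dR.integrable.add z2.dZ.integrable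
    have := (integral_eq_zero_iff_of_nonneg (fun X => by
      have := (gauss_pos X).le
      have := mul_self_nonneg (g X)
      simp only [Pi.zero_apply]; positivity) hi).1 hint
    exact (Continuous.ae_eq_iff_eq volume hc continuous_const).1 this
  ext X
  have h1 := congrFun h0 X
  simp only [Pi.zero_apply, mul_eq_zero, (gauss_pos X).ne', false_or] at h1
  have h2 : g X * g X = 0 := by
    have := mul_self_nonneg (g X)
    nlinarith [sq_nonneg (dR g X), sq_nonneg (dZ g X)]
  have h3 : g X = 0 := by simpa using h2
  simp [h3]

lemma radial_fpInv {κ : ℝ} (hκ : 0 < κ) (hg : Radial g) : Radial (fpInv κ g) := by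
  unfold fpInv
  split_ifs with h
  · obtain ⟨h1, h2⟩ := h.choose_spec
    set η := h.choose
    intro α X
    have hz := (h1.comp_rot α).sub h1
    have : κ • ((fun X => η (rot α X)) - η) - fokkerPlanck ((fun X => η (rot α X)) - η) = 0 := by
      have e : fokkerPlanck ((fun X => η (rot α X)) - η) = fokkerPlanck (fun X => η (rot α X)) - fokkerPlanck η := by
        have a1 := h1.comp_rot α
        simp only [fokkerPlanck]
        rw [dR_sub a1.diff h1.diff, dZ_sub a1.diff h1.diff, dR_sub a1.dR.diff h1.dR.diff, dZ_sub a1.dZ.diff h1.dZ.diff]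
        ext X; simp only [Pi.add_apply, Pi.sub_apply, Pi.smul_apply, Pi.mul_apply, smul_eq_mul]; ring
      rw [e, fokkerPlanck_comp_rot h1]
      ext X
      have e1 := congrFun h2 X
      have e2 := congrFun h2 (rot α X)
      rw [hg α X] at e2
      simp only [Pi.sub_apply, Pi.smul_apply, smul_eq_mul, Pi.zero_apply] at e1 e2 ⊢
      linarith
    have h0 := congrFun (fokkerPlanck_unique hz hκ this) X
    simpa [sub_eq_zero] using h0
  · exact fun _ _ => rfl

/-! ### Functions with angular modes `0` and `2` -/

/-- Only the angular modes `1` and `cos (2θ)` are present. -/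
def M02 (f : ℝ² → ℝ) : Prop := ∃ a b : ℝ → ℝ, ∀ r, 0 < r → ∀ θ, f polar[r; θ] = a r + b r * cos ((2 : ℕ) * θ)

section

lemma M02.add (hf : M02 f) (hg : M02 g) : M02 (f + g) := by
  obtain ⟨a, b, h⟩ := hf
  obtain ⟨a', b', h'⟩ := hg
  exact ⟨a + a', b + b', fun r hr θ => by simp only [Pi.add_apply, h r hr, h' r hr]; ring⟩

lemma M02.mul_radial (hf : M02 f) (hg : Radial g) : M02 (g * f) := by
  obtain ⟨a, b, h⟩ := hf
  refine ⟨fun r => g polar[r; 0] * a r, fun r => g polar[r; 0] * b r, fun r hr θ => ?_⟩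
  simp only [Pi.mul_apply, h r hr, hg.polar r θ 0]; ring

lemma M02.smul (hf : M02 f) (c : ℝ) : M02 (c • f) := hf.mul_radial (Radial.const c)
lemma M02.neg (hf : M02 f) : M02 (-f) := by simpa using hf.smul (-1)
lemma M02.sub (hf : M02 f) (hg : M02 g) : M02 (f - g) := by simpa only [sub_eq_add_neg] using hf.add hg.neg

lemma Radial.m02 (hf : Radial f) : M02 f := ⟨fun r => f polar[r; 0], 0, fun r _ θ => by simp [hf.polar r θ 0]⟩

lemma Mode.m02 (hf : Mode 2 f) : M02 f := by
  obtain ⟨a, h⟩ := hf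
  exact ⟨0, a, fun r hr θ => by simp [h r hr]⟩

lemma Mode.mul_m02 (hf : Mode 1 f) (hg : Mode 1 g) : M02 (f * g) := by
  obtain ⟨a, h⟩ := hf
  obtain ⟨b, h'⟩ := hg
  refine ⟨fun r => a r * b r / 2, fun r => a r * b r / 2, fun r hr θ => ?_⟩
  simp only [Pi.mul_apply, h r hr, h' r hr]
  push_cast
  rw [cos_two_mul, one_mul]; ring

lemma mode_one_cR : Mode 1 cR := ⟨fun r => r, fun r _ θ => by simp [cR]⟩

lemma m02_cZ_sq : M02 (cZ * cZ) := by
  refine ⟨fun r => r ^ 2 / 2, fun r => -(r ^ 2 / 2), fun r _ θ => ?_⟩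
  simp only [Pi.mul_apply, cZ]
  push_cast
  rw [cos_two_mul]
  linear_combination r ^ 2 * sin_sq_add_cos_sq θ

lemma Mode.mul_radial {n : ℕ} (hf : Mode n f) (hg : Radial g) : Mode n (g * f) := by
  obtain ⟨a, h⟩ := hf
  exact ⟨fun r => g polar[r; 0] * a r, fun r hr θ => by simp only [Pi.mul_apply, h r hr, hg.polar r θ 0]; ring⟩
lemma Mode.add {n : ℕ} (hf : Mode n f) (hg : Mode n g) : Mode n (f + g) := by
  obtain ⟨a, h⟩ := hf
  obtain ⟨b, h'⟩ := hg
  exact ⟨a + b, fun r hr θ => by simp only [Pi.add_apply, h r hr, h' r hr]; ring⟩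
lemma Mode.smul {n : ℕ} (hf : Mode n f) (c : ℝ) : Mode n (c • f) := hf.mul_radial (Radial.const c)
lemma Mode.sub {n : ℕ} (hf : Mode n f) (hg : Mode n g) : Mode n (f - g) := by have := hf.add (hg.smul (-1)); simpa [sub_eq_add_neg] using this

/-- The part of angular mode `2`. -/
def mode2 (f : ℝ² → ℝ) : ℝ² → ℝ := (1 / 2 : ℝ) • (f - fun X => f (rot (π / 2) X))

lemma M02.mode_mode2 (hf : M02 f) : Mode 2 (mode2 f) := by
  obtain ⟨a, b, h⟩ := hf
  refine ⟨b, fun r hr θ => ?_⟩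
  simp only [mode2, Pi.smul_apply, Pi.sub_apply, rot_polar, h r hr, smul_eq_mul]
  push_cast
  rw [show 2 * (θ + π / 2) = 2 * θ + π by ring, cos_add_pi]; ring

lemma M02.radial_sub_mode2 (hf : M02 f) : Radial (f - mode2 f) := by
  obtain ⟨b, hb⟩ := hf.mode_mode2
  obtain ⟨a, b', h⟩ := hf
  refine radial_of_polar fun r θ θ' hr => ?_
  have key : ∀ θ, (f - mode2 f) polar[r; θ] = a r := fun θ => by
    simp only [mode2, Pi.smul_apply, Pi.sub_apply, rot_polar, h r hr, smul_eq_mul]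
    push_cast
    rw [show 2 * (θ + π / 2) = 2 * θ + π by ring, cos_add_pi]; ring
  rw [key, key]

lemma InZ.mode2 (hf : InZ f) : InZ (mode2 f) := (hf.sub (hf.comp_rot _)).smul _
lemma TG.mode2 (hf : TG f) : TG (mode2 f) := (hf.sub (hf.comp_rot _)).smul _

lemma M02.BS0 (hm : M02 f) (hf : InZ f) : M02 (BS0 f) := by
  have e : VortexRing.BS0 f = VortexRing.BS0 (f - VortexRing.mode2 f) + VortexRing.BS0 (VortexRing.mode2 f) := by
    rw [← BS0_add (hf.sub hf.mode2) hf.mode2, sub_add_cancel]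
  rw [e]
  refine (hm.radial_sub_mode2.BS0.m02).add ?_
  obtain ⟨b, hb⟩ := hm.mode_mode2
  refine Mode.m02 ⟨modeT 2 b, fun r hr θ => ?_⟩
  have := BS0_mode hf.mode2.cont hf.mode2.rapid one_le_two (a := b) (c := 0) (fun s hs α => by rw [hb s hs, sub_zero]) hr θ
  rw [this, sub_zero]

lemma Radial.curl (h : Radial f) (hd : Differentiable ℝ f) (X : ℝ²) : X.1 * dZ f X - X.2 * dR f X = 0 := by
  rcases eq_or_ne X 0 with rfl | hX
  · simp
  · obtain ⟨r, θ, hr, rfl⟩ := exists_polar X hX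
    have h1 := hasDerivAt_polar hd r θ
    have h2 : (fun θ => f polar[r; θ]) = fun _ => f polar[r; 0] := funext fun θ => h.polar r θ 0
    rw [h2] at h1
    exact h1.unique (hasDerivAt_const θ _)

lemma Radial.pb_eta0 (h : Radial f) (hd : Differentiable ℝ f) : pb f eta0 = 0 := by
  rw [VortexRing.pb_eta0]
  ext X
  have := h.curl hd X
  simp [cR, cZ, this]

end

/-! ### Identities for the first and second order profiles -/

lemma inZ_eta10 : InZ eta10 := inZ_lamInv _
lemma inZ_eta200 : InZ eta200 := inZ_lamInv _
lemma inZ_eta210 : InZ eta210 := inZ_lamInv _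
lemma inZ_eta22 : InZ eta22 := inZ_fpInv _ _

lemma eta1_zero : eta1 0 = eta10 := by simp [eta1]
lemma eta2_zero (β : ℝ) : eta2 β 0 = β • eta200 + eta210 + eta22 := by simp [eta2]

/-- The first order part of the potential vorticity. -/
def zeta1 : ℝ² → ℝ := eta10 - cR * eta0

lemma inZ_zeta1 : InZ zeta1 := inZ_eta10.sub (inZ_eta0.mul_left TG.cR)

lemma mode_zeta1 : Mode 1 zeta1 := by
  rw [zeta1, mul_comm]
  exact eta10_spec.2.2.sub (mode_one_cR.mul_radial radial_eta0)

lemma integral_cR_eta0 : ∫ X, cR X * eta0 X = 0 := by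
  have h := integral_dR inZ_eta0
  rw [dR_eta0] at h
  simp only [Pi.smul_apply, Pi.mul_apply, smul_eq_mul] at h
  rw [integral_const_mul] at h
  linarith

lemma integral_cR_sq_eta0 : ∫ X, cR X * (cR X * eta0 X) = 2 := by
  have h := integral_cR_dR_eta0
  rw [dR_eta0] at h
  simp only [Pi.smul_apply, Pi.mul_apply, smul_eq_mul, mul_left_comm (cR _) (-(1/2))] at h
  rw [integral_const_mul] at h
  linarith

lemma cR_eta0 : cR * eta0 = (-2 : ℝ) • dR eta0 := by rw [dR_eta0, smul_smul]; norm_num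
lemma cZ_eta0 : cZ * eta0 = (-2 : ℝ) • dZ eta0 := by rw [dZ_eta0, smul_smul]; norm_num

lemma BS0_cR_eta0 : BS0 (cR * eta0) = (-2 : ℝ) • dR phi0 := by rw [cR_eta0, BS0_smul, phi0, inZ_eta0.BS0_deriv.1]
lemma BS0_cZ_eta0 : BS0 (cZ * eta0) = (-2 : ℝ) • dZ phi0 := by rw [cZ_eta0, BS0_smul, phi0, inZ_eta0.BS0_deriv.2]

lemma Aop_add (f g : ℝ² → ℝ) : Aop (f + g) = Aop f + Aop g := by ext X; simp [Aop]; ring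
lemma Aop_sub (f g : ℝ² → ℝ) : Aop (f - g) = Aop f - Aop g := by ext X; simp [Aop]; ring
lemma Aop_smul (c : ℝ) (f : ℝ² → ℝ) : Aop (c • f) = c • Aop f := by ext X; simp [Aop]; ring

lemma phi1_zero (β : ℝ) : phi1 β 0 = Aop zeta1 + b0 β • cR := by
  have h2 := eta10_spec.2.1
  rw [sub_eq_iff_eq_add] at h2
  have e : Aop (cR * eta0) = (-2 : ℝ) • dR phi0 := by rw [cR_eta0, Aop_smul, Aop_dR_eta0]
  rw [phi1, eta1_zero, h2, zeta1, Aop_sub, e, BS_eq β 1 inZ_eta0, BSL_one inZ_eta0, BSP_one inZ_eta0, BS0_cR_eta0,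
    integral_eta0, integral_cR_eta0, firstRhs]
  change _ + (_ + ((1 / 2 : ℝ) • (cR * phi0 + _) - _)) = _
  ext X
  have hpi := pi_ne_zero
  simp only [Pi.add_apply, Pi.sub_apply, Pi.smul_apply, Pi.mul_apply, smul_eq_mul, b0]
  field_simp
  ring

/-- The sum of the terms of order `ε²` that do not involve `η₂`, at `β = δ = 0`. -/
def secondS : ℝ² → ℝ := BS 0 1 eta10 + BS 0 2 eta0 - (b0 0 / 2) • cR ^ 2 + Aop (cR * eta10 - cR ^ 2 * eta0)
    + (2 * π) • ((EKf 0 - EKf 1) * fun X => (exp (quarter X) * zeta1 X) ^ 2)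

lemma tg_exp_zeta1 : TG fun X => exp (quarter X) * zeta1 X := inZ_zeta1

lemma zeta1_eq : zeta1 = gauss * fun X => exp (quarter X) * zeta1 X := by
  ext X
  have := exp_quarter_mul_gauss X
  simp only [Pi.mul_apply]
  linear_combination (-zeta1 X) * this

lemma tg_secondS : TG secondS := ((((tg_BS 0 1 inZ_eta10).add (tg_BS 0 2 inZ_eta0)).sub ((TG.cR.pow 2).smul _)).add
    (TG.Aop ((inZ_eta10.mul_left TG.cR).sub (inZ_eta0.mul_left (TG.cR.pow 2))))).add
    ((((tg_EKf 0).sub (tg_EKf 1)).mul (tg_exp_zeta1.pow 2)).smul _)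

lemma pb_Aop_zeta1 : pb (Aop zeta1) zeta1 = pb ((2 * π) • ((EKf 0 - EKf 1) * fun X => (exp (quarter X) * zeta1 X) ^ 2)) eta0 := by
  set g : ℝ² → ℝ := fun X => exp (quarter X) * zeta1 X with hg
  have tg : TG g := inZ_zeta1
  have e1 : zeta1 = gauss * g := zeta1_eq
  have e2 : (fun X => (exp (quarter X) * zeta1 X) ^ 2) = g * g := by ext X; simp [hg]; ring
  have hE := tg_EKf 0
  have hE1 := tg_EKf 1
  have hD := hE.sub hE1
  rw [e2, VortexRing.pb_eta0, dR_smul, dZ_smul, dR_mul hD.diff (tg.mul tg).diff, dZ_mul hD.diff (tg.mul tg).diff,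
    dR_mul tg.diff tg.diff, dZ_mul tg.diff tg.diff, e1, Aop_gauss_mul, pb, dR_mul hE.diff tg.diff, dZ_mul hE.diff tg.diff,
    dR_mul differentiable_gauss tg.diff, dZ_mul differentiable_gauss tg.diff, dR_gauss, dZ_gauss, dR_EKf, dZ_EKf]
  ext X
  have hc := ((radial_EKf 0).sub (radial_EKf 1)).curl hD.diff X
  have hpi := pi_ne_zero
  simp only [Pi.add_apply, Pi.sub_apply, Pi.smul_apply, Pi.mul_apply, smul_eq_mul, eta0_eq, cR, cZ] at hc ⊢
  have hp : 2 * π * (1 / (4 * π)) = 1 / 2 := by field_simp; norm_num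
  linear_combination (-(1 / 2) * (2 * π * (1 / (4 * π))) * gauss X * g X ^ 2) * hc
    - (gauss X * g X * (EKf 0 X - EKf 1 X) * (X.1 * dZ g X - X.2 * dR g X)) * hp

lemma source2_zero : source2 0 0 = pb secondS eta0 := by
  have z10 := inZ_eta10
  have z0 := inZ_eta0
  have hR := TG.cR
  have tA : TG (Aop zeta1) := TG.Aop inZ_zeta1
  have t1 := tg_BS 0 1 inZ_eta10
  have t2 := tg_BS 0 2 inZ_eta0
  have q1 := (t1.add t2)
  have q2 := ((hR.pow 2).smul (b0 0 / 2))
  have zz : InZ (cR * eta10 - cR ^ 2 * eta0) := (z10.mul_left hR).sub (z0.mul_left (hR.pow 2))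
  have q3 := TG.Aop zz
  have q4 : TG ((2 * π) • ((EKf 0 - EKf 1) * fun X => (exp (quarter X) * zeta1 X) ^ 2)) :=
    (((tg_EKf 0).sub (tg_EKf 1)).mul (tg_exp_zeta1.pow 2)).smul _
  rw [secondS, pb_add_left ((q1.sub q2).add q3).diff q4.diff, pb_add_left (q1.sub q2).diff q3.diff, pb_sub_left q1.diff q2.diff,
    ← pb_Aop_zeta1, ← neg_neg (pb (Aop (cR * eta10 - cR ^ 2 * eta0)) eta0), ← pb_phi0 zz, source2, phi1_zero, eta1_zero]
  have hrad := congrFun ((radial_phi0).pb_eta0 tg_phi0.diff)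
  have e1 : dR (Aop zeta1 + b0 0 • cR) = dR (Aop zeta1) + b0 0 • (1 : ℝ² → ℝ) := by rw [dR_add tA.diff (hR.smul _).diff, dR_smul, dR_cR]
  have e2 : dZ (Aop zeta1 + b0 0 • cR) = dZ (Aop zeta1) := by rw [dZ_add tA.diff (hR.smul _).diff, dZ_smul, dZ_cR, smul_zero, add_zero]
  have d1 : dR (cR * eta0) = eta0 + cR * dR eta0 := by rw [dR_mul hR.diff z0.diff, dR_cR, one_mul]
  have d2 : dZ (cR * eta0) = cR * dZ eta0 := by rw [dZ_mul hR.diff z0.diff, dZ_cR, zero_mul, zero_add]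
  have d3 : dR zeta1 = dR eta10 - (eta0 + cR * dR eta0) := by rw [zeta1, dR_sub z10.diff (z0.mul_left hR).diff, d1]
  have d4 : dZ zeta1 = dZ eta10 - cR * dZ eta0 := by rw [zeta1, dZ_sub z10.diff (z0.mul_left hR).diff, d2]
  have d5 : dR (cR * eta10 - cR ^ 2 * eta0) = eta10 + cR * dR eta10 - ((cR + cR) * eta0 + cR * cR * dR eta0) := by
    rw [dR_sub (z10.mul_left hR).diff (z0.mul_left (hR.pow 2)).diff, dR_mul hR.diff z10.diff, dR_mul (hR.pow 2).diff z0.diff,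
      pow_two, dR_mul hR.diff hR.diff, dR_cR, one_mul, one_mul, mul_one]
  have d6 : dZ (cR * eta10 - cR ^ 2 * eta0) = cR * dZ eta10 - cR * cR * dZ eta0 := by
    rw [dZ_sub (z10.mul_left hR).diff (z0.mul_left (hR.pow 2)).diff, dZ_mul hR.diff z10.diff, dZ_mul (hR.pow 2).diff z0.diff,
      pow_two, dZ_mul hR.diff hR.diff, dZ_cR]
    simp
  have d7 : dR ((b0 0 / 2) • cR ^ 2) = (b0 0 / 2) • (cR + cR) := by rw [dR_smul, pow_two, dR_mul hR.diff hR.diff, dR_cR, one_mul, mul_one]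
  have d8 : dZ ((b0 0 / 2) • cR ^ 2) = 0 := by rw [dZ_smul, pow_two, dZ_mul hR.diff hR.diff, dZ_cR]; simp
  ext X
  have h0 := hrad X
  simp only [pb, e1, e2, d1, d3, d4, d5, d6, d7, d8, Pi.add_apply, Pi.sub_apply, Pi.neg_apply, Pi.smul_apply,
    Pi.mul_apply, smul_eq_mul, Pi.one_apply, Pi.zero_apply, zero_mul] at h0 ⊢
  linear_combination (-(cR X * cR X)) * h0

/-! ### The terms of second order are radially symmetric -/

lemma Mode.one_odd (h : Mode 1 f) (X : ℝ²) (hX : X ≠ 0) : f (rot π X) = -f X := by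
  obtain ⟨a, ha⟩ := h
  obtain ⟨r, θ, hr, rfl⟩ := exists_polar X hX
  rw [rot_polar, ha r hr, ha r hr]; push_cast
  rw [one_mul, one_mul, cos_add_pi]; ring

lemma integral_eta10 : ∫ X, eta10 X = 0 := by
  have h := integral_rot eta10 π
  have e : (fun X => eta10 (rot π X)) =ᵐ[volume] fun X => -eta10 X := by
    filter_upwards [ae_fst_ne_zero] with X hX
    exact eta10_spec.2.2.one_odd X fun h0 => hX (by rw [h0]; rfl)
  rw [integral_congr_ae e, integral_neg] at h
  linarith

lemma integral_cZ_sq_eta0 : ∫ X, cZ X * (cZ X * eta0 X) = 2 := by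
  have h := integral_rot (fun X => cR X * (cR X * eta0 X)) (π / 2)
  rw [integral_cR_sq_eta0] at h
  rw [← h]
  refine integral_congr_ae (.of_forall fun X => ?_)
  simp only [radial_eta0 (π / 2) X]
  simp [rot, cR, cZ]

lemma integral_cZ_eta0 : ∫ X, cZ X * eta0 X = 0 := ((parZ_cZ.mul parZ_eta0).of_eq (by norm_num)).integral_eq_zero

/-- Monomials in the second variable that occur in `polP 2` and `polQ 2`. -/
def quadMon : Fin 5 → ℝ² → ℝ := ![1, cR, cR * cR, cZ, cZ * cZ]

lemma tg_quadMon (i : Fin 5) : TG (quadMon i) := by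
  fin_cases i
  exacts [TG.one, TG.cR, TG.cR.mul TG.cR, TG.cZ, TG.cZ.mul TG.cZ]

lemma integral_quadMon_eta0 (i : Fin 5) : ∫ X, quadMon i X * eta0 X = (![1, 0, 2, 0, 2] : Fin 5 → ℝ) i := by
  fin_cases i
  · simpa [quadMon] using integral_eta0
  · simpa [quadMon] using integral_cR_eta0
  · simpa [quadMon, mul_assoc] using integral_cR_sq_eta0
  · simpa [quadMon] using integral_cZ_eta0
  · simpa [quadMon, mul_assoc] using integral_cZ_sq_eta0

def quadP : Fin 5 → ℝ² → ℝ :=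
  ![(1 / 16 : ℝ) • (cR * cR) + (3 / 16 : ℝ) • (cZ * cZ), (-(1 / 8) : ℝ) • cR, fun _ => 1 / 16, (-(3 / 8) : ℝ) • cZ, fun _ => 3 / 16]
def quadQ : Fin 5 → ℝ² → ℝ :=
  ![(3 / 16 : ℝ) • (cR * cR) + (-(1 / 16) : ℝ) • (cZ * cZ), (1 / 8 : ℝ) • cR, fun _ => 3 / 16, (1 / 8 : ℝ) • cZ, fun _ => -(1 / 16)]

lemma polP_two (X Y : ℝ²) : polP 2 X Y = ∑ i, quadP i X * quadMon i Y := by simp [quadP, quadMon, Fin.sum_univ_five, polP, cR, cZ]; ring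
lemma polQ_two (X Y : ℝ²) : polQ 2 X Y = ∑ i, quadQ i X * quadMon i Y := by simp [quadQ, quadMon, Fin.sum_univ_five, polQ, cR, cZ]; ring

lemma BSP_two_eta0 : BSP 2 eta0 = (1 / (32 * π)) • (cR ^ 2 + (3 : ℝ) • cZ ^ 2) + fun _ => 1 / (4 * π) := by
  rw [BSP, kerOp_sum _ _ tg_quadMon inZ_eta0 polP_two]
  ext X
  have hpi := pi_ne_zero
  simp [integral_quadMon_eta0, quadP, Fin.sum_univ_five]
  field_simp
  ring

lemma m02_cR_sq : M02 (cR * cR) := mode_one_cR.mul_m02 mode_one_cR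

lemma m02_BSL_two_eta0 : M02 (BSL 2 eta0) := by
  have c (a : ℝ) : M02 fun _ => a := (Radial.const a).m02
  have dR0 : cR * dR phi0 = (-(1 / (8 * π))) • (EKf 0 * (cR * cR)) := by rw [dR_phi0]; ext X; simp; ring
  have dZ0 : cZ * dZ phi0 = (-(1 / (8 * π))) • (EKf 0 * (cZ * cZ)) := by rw [dZ_phi0]; ext X; simp; ring
  have mR : M02 (cR * dR phi0) := dR0 ▸ (m02_cR_sq.mul_radial (radial_EKf 0)).smul _
  have mZ : M02 (cZ * dZ phi0) := dZ0 ▸ (m02_cZ_sq.mul_radial (radial_EKf 0)).smul _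
  have bR : M02 (BS0 (cR * cR * eta0)) := ((mul_comm eta0 (cR * cR)) ▸ m02_cR_sq.mul_radial radial_eta0).BS0 (inZ_eta0.mul_left (TG.cR.mul TG.cR))
  have bZ : M02 (BS0 (cZ * cZ * eta0)) := ((mul_comm eta0 (cZ * cZ)) ▸ m02_cZ_sq.mul_radial radial_eta0).BS0 (inZ_eta0.mul_left (TG.cZ.mul TG.cZ))
  have e : BSL 2 eta0 = phi0 * ((1 / 16 : ℝ) • (cR * cR) + (3 / 16 : ℝ) • (cZ * cZ)) + (1 / 4 : ℝ) • (cR * dR phi0)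
      + (1 / 16 : ℝ) • BS0 (cR * cR * eta0) + (3 / 4 : ℝ) • (cZ * dZ phi0) + (3 / 16 : ℝ) • BS0 (cZ * cZ * eta0)
      + (1 / (2 * π)) • ((3 / 16 : ℝ) • (cR * cR) + (-(1 / 16) : ℝ) • (cZ * cZ) + fun _ => 1 / 4) := by
    rw [BSL, logOp_sum _ _ tg_quadMon inZ_eta0 polP_two, kerOp_sum _ _ tg_quadMon inZ_eta0 polQ_two]
    ext X
    have h1 := congrFun BS0_cR_eta0 X
    have h2 := congrFun BS0_cZ_eta0 X
    simp only [Pi.smul_apply, smul_eq_mul] at h1 h2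
    simp only [Pi.add_apply, Finset.sum_apply, Pi.mul_apply, integral_quadMon_eta0]
    simp [quadP, quadQ, quadMon, Fin.sum_univ_five, h1, h2, phi0]
    ring
  rw [e]
  exact (((((((m02_cR_sq.smul _).add (m02_cZ_sq.smul _)).mul_radial radial_phi0).add (mR.smul _)).add (bR.smul _)).add
    (mZ.smul _)).add (bZ.smul _)).add ((((m02_cR_sq.smul _).add (m02_cZ_sq.smul _)).add (c _)).smul _)

lemma BS_zero (m : ℕ) (hf : InZ f) : BS 0 m f = BSL m f := by rw [BS_eq 0 m hf, zero_smul, zero_add]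

lemma BSL_one_eta10 : BSL 1 eta10 = (1 / 2 : ℝ) • (cR * BS0 eta10 + BS0 (cR * eta10)) := by
  rw [BSL_one inZ_eta10, integral_eta10, eta10_spec.1.2.2.1]
  ext X; simp; ring

lemma BSP_one_eta10 : BSP 1 eta10 = 0 := by
  rw [BSP_one inZ_eta10, integral_eta10, eta10_spec.1.2.2.1]
  ext X; simp

lemma mode_BS0_eta10 : Mode 1 (BS0 eta10) := by
  obtain ⟨a, ha⟩ := eta10_spec.2.2
  refine ⟨modeT 1 a, fun r hr θ => ?_⟩
  have := BS0_mode inZ_eta10.cont inZ_eta10.rapid le_rfl (a := a) (c := 0) (fun s hs α => by rw [ha s hs, sub_zero]) hr θ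
  rw [this, sub_zero]

lemma m02_secondS : M02 secondS := by
  have h1 : M02 (cR * eta10) := mode_one_cR.mul_m02 eta10_spec.2.2
  have h2 : M02 (cR ^ 2 * eta0) := by rw [pow_two, mul_comm]; exact m02_cR_sq.mul_radial radial_eta0
  have hA : M02 (Aop (cR * eta10 - cR ^ 2 * eta0)) := by
    have := (h1.sub h2).mul_radial (g := fun X => EK 0 (quarter X) * exp (quarter X)) (Radial.of_quarter fun x => EK 0 x * exp x)
    convert this using 1
    ext X; simp [VortexRing.Aop, EKf, mul_assoc]
  have hz : M02 fun X => (exp (quarter X) * zeta1 X) ^ 2 := by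
    have := mode_zeta1.mul_radial (Radial.of_quarter exp)
    convert this.mul_m02 this using 1
    ext X; simp; ring
  rw [secondS, BS_zero 1 inZ_eta10, BS_zero 2 inZ_eta0, BSL_one_eta10]
  refine (((((mode_one_cR.mul_m02 mode_BS0_eta10).add (h1.BS0 (inZ_eta10.mul_left TG.cR))).smul _).add m02_BSL_two_eta0).sub ?_).add
    hA |>.add ((hz.mul_radial ((radial_EKf 0).sub (radial_EKf 1))).smul _)
  rw [pow_two]; exact m02_cR_sq.smul _

lemma eta210_spec : BS0 eta210 - Aop eta210 = -mode2 secondS ∧ Mode 2 eta210 := by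
  have hm : Mode 2 (-mode2 secondS) := by simpa using m02_secondS.mode_mode2.smul (-1)
  have ht : TG (-mode2 secondS) := tg_secondS.mode2.neg
  obtain ⟨η, h1, h2, h3⟩ := exists_isLamSol_two ht hm
  have e : pb (-mode2 secondS) eta0 = -source2 0 0 := by
    have hr := m02_secondS.radial_sub_mode2.pb_eta0 (tg_secondS.sub tg_secondS.mode2).diff
    rw [pb_sub_left tg_secondS.diff tg_secondS.mode2.diff, sub_eq_zero] at hr
    rw [pb_neg_left, ← hr, source2_zero]
  rw [e] at h1
  have : eta210 = η := lamInv_eq h1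
  rw [this]; exact ⟨h2, h3⟩

lemma radial_eta22 : Radial eta22 := radial_fpInv one_pos (by simpa using (radial_angMean source2δ).smul (-1))

lemma hasDerivAt_Phi0 (β : ℝ) {s : ℝ} (hs : 0 < s) :
    HasDerivAt (Phi0 β) (EK 0 (log (1 / (4 * π * s))) / (4 * π * s)) s ∧
    HasDerivAt (fun s => EK 0 (log (1 / (4 * π * s))) / (4 * π * s))
      ((EK 1 (log (1 / (4 * π * s))) - EK 0 (log (1 / (4 * π * s)))) / (4 * π * s ^ 2)) s := by
  have hlin : HasDerivAt (fun s => 4 * π * s) (4 * π) s := by simpa using (hasDerivAt_id s).const_mul (4 * π)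
  have hL : HasDerivAt (fun s => log (1 / (4 * π * s))) (-(1 / s)) s := by
    have h := (hlin.log (by positivity)).neg
    refine (h.congr_deriv ?_).congr_of_eventuallyEq (.of_forall fun u => ?_)
    · field_simp
    · simp only [one_div, log_inv]; rfl
  constructor
  · have h := (((hasDerivAt_Ein _).comp s hL).const_mul (1 / (4 * π))).const_sub (phi0 0 - b0 β / 2)
    refine h.congr_deriv ?_
    field_simp
  · have h := ((hasDerivAt_EK 0 _).comp s hL).div hlin (by positivity)
    refine h.congr_deriv ?_
    field_simp
    simp only [Function.comp_apply]

lemma log_eta0 (X : ℝ²) : log (1 / (4 * π * eta0 X)) = quarter X := by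
  have hpi := pi_ne_zero
  rw [eta0_apply, show 4 * π * (1 / (4 * π) * exp (-quarter X)) = exp (-quarter X) by field_simp, one_div, ← exp_neg, log_exp, neg_neg]

lemma eta0_pos (X : ℝ²) : 0 < eta0 X := by rw [eta0_apply]; positivity

lemma deriv_Phi0_eta0 (β : ℝ) (X : ℝ²) : deriv (Phi0 β) (eta0 X) = EKf 0 X * exp (quarter X) ∧
    deriv (deriv (Phi0 β)) (eta0 X) = -(4 * π * ((EKf 0 X - EKf 1 X) * exp (quarter X) ^ 2)) := by
  obtain ⟨h1, h2⟩ := hasDerivAt_Phi0 β (eta0_pos X)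
  have e0 : eta0 X = (4 * π * exp (quarter X))⁻¹ := by rw [eta0_apply, exp_neg]; field_simp
  constructor
  · rw [h1.deriv, log_eta0, e0, EKf]; field_simp
  · have : deriv (Phi0 β) =ᶠ[nhds (eta0 X)] fun s => EK 0 (log (1 / (4 * π * s))) / (4 * π * s) := by
      filter_upwards [eventually_gt_nhds (eta0_pos X)] with s hs using (hasDerivAt_Phi0 β hs).1.deriv
    rw [this.deriv_eq, h2.deriv, log_eta0, e0, EKf, EKf]
    field_simp
    ring

/-- The part of the second order terms that does not depend on `β`. -/
def secondK : ℝ² → ℝ := secondS - mode2 secondS + (BS0 eta22 - Aop eta22)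

lemma tg_secondK : TG secondK := (tg_secondS.sub tg_secondS.mode2).add ((TG.BS0 inZ_eta22).sub (TG.Aop inZ_eta22))

lemma radial_secondK : Radial secondK := m02_secondS.radial_sub_mode2.add (radial_eta22.BS0.sub radial_eta22.Aop)

lemma secondOrder_eq (β : ℝ) (X : ℝ²) : secondOrder β X = β / (4 * π) + secondK X := by
  have hpi := pi_ne_zero
  have h1 := congrFun eta200_spec.2.1 X
  have h2 := congrFun eta210_spec.1 X
  have z1 := inZ_eta200.smul β
  have z2 := inZ_eta210
  have z3 := inZ_eta22
  have hP := congrFun BSP_two_eta0 X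
  simp only [Pi.add_apply, Pi.sub_apply, Pi.neg_apply, Pi.smul_apply, smul_eq_mul, Pi.pow_apply, Aop, cR, cZ] at h1 h2 hP
  rw [secondOrder, (deriv_Phi0_eta0 β X).1, (deriv_Phi0_eta0 β X).2, phi2, eta2_zero, eta1_zero, BS0_add (z1.add z2) z3,
    BS0_add z1 z2, BS0_smul, BS_eq β 1 inZ_eta10, BS_eq β 2 inZ_eta0, BSP_one_eta10, secondK]
  simp only [Pi.add_apply, Pi.sub_apply, Pi.smul_apply, smul_eq_mul, Pi.zero_apply]
  rw [hP]
  simp only [Aop, secondS, zeta1, BS_zero 1 inZ_eta10, BS_zero 2 inZ_eta0, Pi.add_apply, Pi.sub_apply, Pi.smul_apply, Pi.mul_apply, smul_eq_mul,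
    Pi.pow_apply, cR, b0] at h2 ⊢
  have e4 : (β - 1 + 2 * cv) / (4 * π) = (0 - 1 + 2 * cv) / (4 * π) + β / (4 * π) := by ring
  rw [e4]
  have hf : 3 / (32 * π) = 3 * (1 / (32 * π)) := by ring
  have hh : 1 / (4 * π) = 8 * (1 / (32 * π)) := by field_simp; ring
  have hi : β / (4 * π) = 8 * β * (1 / (32 * π)) := by field_simp; ring
  rw [hf] at h1
  rw [hi, hh] 
  linear_combination β * h1 + h2

/-! ### Radial functions as functions of `ρ² / 4` -/

lemma TG.dR_dZ_comm (h : TG f) : VortexRing.dR (VortexRing.dZ f) = VortexRing.dZ (VortexRing.dR f) := by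
  have h2 : ContDiff ℝ 1 (fderiv ℝ f) := h.1.fderiv_right (by norm_cast)
  have hd : Differentiable ℝ (fderiv ℝ f) := h2.differentiable (by simp)
  have key : ∀ v X, HasFDerivAt (fun X => fderiv ℝ f X v) ((fderiv ℝ (fderiv ℝ f) X).flip v) X := fun v X =>
    ((ContinuousLinearMap.apply ℝ ℝ v).hasFDerivAt.comp X (hd X).hasFDerivAt).congr_fderiv (by ext <;> simp)
  have eR : VortexRing.dR f = fun X => fderiv ℝ f X (1, 0) := funext fun X => dR_of_hasFDerivAt (h.diff X).hasFDerivAt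
  have eZ : VortexRing.dZ f = fun X => fderiv ℝ f X (0, 1) := funext fun X => dZ_of_hasFDerivAt (h.diff X).hasFDerivAt
  ext X
  rw [eR, eZ, dR_of_hasFDerivAt (key _ X), dZ_of_hasFDerivAt (key _ X)]
  exact (h.1.contDiffAt (x := X)).isSymmSndFDerivAt (by simp; norm_cast) _ _

lemma TG.axis_bound (h : TG f) (c : ℝ) :
    ∃ (C : ℝ) (N : ℕ), 0 ≤ C ∧ ∀ x, 0 ≤ x → |c * f (2 * √x, 0)| ≤ C * (1 + x) ^ N := by
  obtain ⟨N, C, hC, hb⟩ := h.pb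
  refine ⟨|c| * C * 2 ^ N, N, by positivity, fun x hx => ?_⟩
  have h1 := hb (2 * √x, 0)
  have h2 : ‖((2 * √x, 0) : ℝ²)‖ = 2 * √x := by rw [Prod.norm_def]; simp [abs_of_nonneg (sqrt_nonneg x)]
  have h3 : 1 + 2 * √x ≤ 2 * (1 + x) := by nlinarith [sq_sqrt hx, sq_nonneg (√x - 1)]
  rw [h2] at h1
  rw [abs_mul]
  calc |c| * |f (2 * √x, 0)| ≤ |c| * (C * (2 * (1 + x)) ^ N) := by
        refine mul_le_mul_of_nonneg_left (h1.trans ?_) (abs_nonneg c)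
        gcongr
    _ = _ := by rw [mul_pow]; ring

lemma Radial.exists_profile {k : ℝ² → ℝ} (hr : Radial k) (hk : TG k) : ∃ κ κ₁ κ₂ : ℝ → ℝ, Continuous κ₂ ∧
    (∀ x, HasDerivAt κ (κ₁ x) x) ∧ (∀ x, HasDerivAt κ₁ (κ₂ x) x) ∧
    (∃ (C : ℝ) (N : ℕ), 0 ≤ C ∧ ∀ x, 0 ≤ x → |κ₁ x| ≤ C * (1 + x) ^ N) ∧
    (∃ (C : ℝ) (N : ℕ), 0 ≤ C ∧ ∀ x, 0 ≤ x → |κ₂ x| ≤ C * (1 + x) ^ N) ∧ ∀ X, κ (quarter X) = k X := by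
  have hc : cR * dZ k = cZ * dR k := by
    ext X
    have := hr.curl hk.diff X
    simp only [Pi.mul_apply, cR, cZ]; linarith
  have tR := TG.cR
  have tZ := TG.cZ
  have step : ∀ {f g : ℝ² → ℝ}, TG f → TG g → cR * f = cZ * g → cR * dZ f = g + cZ * dZ g := fun {f g} hf hg h => by
    have := congrArg dZ h
    rw [dZ_mul tR.diff hf.diff, dZ_mul tZ.diff hg.diff, dZ_cR, dZ_cZ] at this
    simpa using this
  have tA2 := hk.dZ.dZ
  have tA4 := tA2.dZ.dZ
  have c1 := step hk.dZ hk.dR hc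
  have c2 : cR * dZ (dZ (dZ k)) = dZ (dR k) + (dZ (dR k) + cZ * dZ (dZ (dR k))) := by
    have := congrArg dZ c1
    rw [dZ_mul tR.diff tA2.diff, dZ_add hk.dR.diff (tZ.mul hk.dR.dZ).diff, dZ_mul tZ.diff hk.dR.dZ.diff, dZ_cR, dZ_cZ] at this
    simpa using this
  have c3 : cR * dZ (dZ (dZ (dZ k))) = dZ (dZ (dR k)) + (dZ (dZ (dR k)) + (dZ (dZ (dR k)) + cZ * dZ (dZ (dZ (dR k))))) := by
    have := congrArg dZ c2
    have t := hk.dR.dZ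
    rw [dZ_mul tR.diff tA2.dZ.diff, dZ_add t.diff (t.add (tZ.mul t.dZ)).diff, dZ_add t.diff (tZ.mul t.dZ).diff,
      dZ_mul tZ.diff t.dZ.diff, dZ_cR, dZ_cZ] at this
    simpa using this
  have comm : dZ (dZ (dR k)) = dR (dZ (dZ k)) := by rw [hk.dZ.dR_dZ_comm, hk.dR_dZ_comm]
  have e1 : ∀ r, r * dZ (dZ k) (r, 0) = dR k (r, 0) := fun r => by have := congrFun c1 (r, 0); simpa [cR, cZ] using this
  have e2 : ∀ r, r * dZ (dZ (dZ (dZ k))) (r, 0) = 3 * dR (dZ (dZ k)) (r, 0) := fun r => by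
    have := congrFun c3 (r, 0)
    rw [comm] at this
    simp [cR, cZ] at this; linarith
  have axis : ∀ {f : ℝ² → ℝ}, Continuous f → Continuous fun x => f (2 * √x, 0) := fun hf => by fun_prop
  have der : ∀ {f : ℝ² → ℝ}, TG f → ∀ x, 0 < x → HasDerivAt (fun x => f (2 * √x, 0)) (dR f (2 * √x, 0) / √x) x := fun {f} hf x hx => by
    have h1 : HasDerivAt (fun r => f (r, 0)) (dR f (2 * √x, 0)) (2 * √x) := by
      have := hasDerivAt_slice_fst (hasFDerivAt_lin (hf.diff (2 * √x, 0)))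
      simpa [lin_apply] using this
    have h2 := ((hasDerivAt_sqrt hx.ne').const_mul 2)
    refine (h1.comp x h2).congr_deriv ?_
    have := (sqrt_pos.2 hx).ne'
    field_simp
  let κ₂ : ℝ → ℝ := fun x => 4 / 3 * dZ (dZ (dZ (dZ k))) (2 * √x, 0)
  have hκ₂ : Continuous κ₂ := (axis tA4.cont).const_mul _
  let κ₁ : ℝ → ℝ := fun x => 2 * dZ (dZ k) (0, 0) + ∫ t in (0:ℝ)..x, κ₂ t
  have hκ₁' : ∀ x, HasDerivAt κ₁ (κ₂ x) x := fun x => (hκ₂.integral_hasStrictDerivAt 0 x).hasDerivAt.const_add _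
  have hκ₁ : Continuous κ₁ := continuous_iff_continuousAt.2 fun x => (hκ₁' x).continuousAt
  let κ : ℝ → ℝ := fun x => k (0, 0) + ∫ t in (0:ℝ)..x, κ₁ t
  have hκ' : ∀ x, HasDerivAt κ (κ₁ x) x := fun x => (hκ₁.integral_hasStrictDerivAt 0 x).hasDerivAt.const_add _
  have q1 : ∀ x, 0 ≤ x → κ₁ x = 2 * dZ (dZ k) (2 * √x, 0) := fun x hx => by
    have := intervalIntegral.integral_eq_sub_of_hasDerivAt_of_le hx (f := fun x => 2 * dZ (dZ k) (2 * √x, 0)) (f' := κ₂)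
      ((axis tA2.cont).const_mul 2).continuousOn (fun y hy => by
        refine ((der tA2 y hy.1).const_mul 2).congr_deriv ?_
        have h1 := e2 (2 * √y)
        have := (sqrt_pos.2 hy.1).ne'
        simp only [κ₂]
        field_simp
        linarith) (hκ₂.intervalIntegrable _ _)
    simp only [κ₁, this, sqrt_zero, mul_zero]; ring
  have q0 : ∀ x, 0 ≤ x → κ x = k (2 * √x, 0) := fun x hx => by
    have := intervalIntegral.integral_eq_sub_of_hasDerivAt_of_le hx (f := fun x => k (2 * √x, 0)) (f' := κ₁)
      (axis hk.cont).continuousOn (fun y hy => by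
        refine (der hk y hy.1).congr_deriv ?_
        have h1 := e1 (2 * √y)
        have := (sqrt_pos.2 hy.1).ne'
        rw [q1 y hy.1.le, ← h1]
        field_simp) (hκ₁.intervalIntegrable _ _)
    simp only [κ, this, sqrt_zero, mul_zero]; ring
  refine ⟨κ, κ₁, κ₂, hκ₂, hκ', hκ₁', ?_, ?_, fun X => ?_⟩
  · obtain ⟨C, N, hC, hb⟩ := tA2.axis_bound 2
    exact ⟨C, N, hC, fun x hx => by rw [q1 x hx]; exact hb x hx⟩
  · exact tA4.axis_bound _
  · rw [q0 _ (quarter_nonneg X), hr.eq_rho X]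
    congr 2
    rw [rho, quarter, sqrt_div' _ (by norm_num), show √(4:ℝ) = 2 by rw [show (4:ℝ) = 2 ^ 2 by norm_num]; simp]
    ring

/-- The second order correction, as a function of `ρ² / 4`. -/
lemma exists_secondOrder_profile : ∃ κ κ₁ κ₂ : ℝ → ℝ, Continuous κ₂ ∧ (∀ x, HasDerivAt κ (κ₁ x) x) ∧ (∀ x, HasDerivAt κ₁ (κ₂ x) x) ∧
    (∃ (C : ℝ) (N : ℕ), 0 ≤ C ∧ ∀ x, 0 ≤ x → |κ₁ x| ≤ C * (1 + x) ^ N) ∧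
    (∃ (C : ℝ) (N : ℕ), 0 ≤ C ∧ ∀ x, 0 ≤ x → |κ₂ x| ≤ C * (1 + x) ^ N) ∧
    ∀ β X, secondOrder β X = β * (1 / (4 * π)) + κ (quarter X) := by
  obtain ⟨κ, κ₁, κ₂, h0, h1, h2, h3, h4, h5⟩ := radial_secondK.exists_profile tg_secondK
  exact ⟨κ, κ₁, κ₂, h0, h1, h2, h3, h4, fun β X => by rw [secondOrder_eq, h5]; ring⟩

lemma angMean_secondOrder (β : ℝ) : angMean (secondOrder β) = secondOrder β := by
  have : Radial (secondOrder β) := fun α X => by simp only [secondOrder_eq, radial_secondK α X]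
  exact this.angMean

lemma contDiff_two_of_hasDerivAt {κ κ₁ κ₂ : ℝ → ℝ} (h0 : Continuous κ₂) (h1 : ∀ x, HasDerivAt κ (κ₁ x) x)
    (h2 : ∀ x, HasDerivAt κ₁ (κ₂ x) x) : ContDiff ℝ 2 κ := by
  have e1 : deriv κ = κ₁ := funext fun x => (h1 x).deriv
  have e2 : deriv κ₁ = κ₂ := funext fun x => (h2 x).deriv
  rw [show (2 : WithTop ℕ∞) = 1 + 1 by norm_num, contDiff_succ_iff_deriv]
  refine ⟨fun x => (h1 x).differentiableAt, by simp, ?_⟩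
  rw [e1, contDiff_one_iff_deriv, e2]
  exact ⟨fun x => (h2 x).differentiableAt, h0⟩

lemma exists_isPhi2 : ∃ Φa Φb : ℝ → ℝ, IsPhi2 Φa Φb := by
  obtain ⟨κ, κ₁, κ₂, h0, h1, h2, -, -, h5⟩ := exists_secondOrder_profile
  refine ⟨fun _ => 1 / (4 * π), fun s => κ (log (1 / (4 * π * s))), contDiffOn_const, ?_, fun β X => ?_⟩
  · refine (contDiff_two_of_hasDerivAt h0 h1 h2).comp_contDiffOn ?_
    have hp : ∀ x ∈ Ioi (0:ℝ), 4 * π * x ≠ 0 := fun x hx => by have := (mem_Ioi.1 hx).ne'; positivity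
    exact ContDiffOn.log (contDiffOn_const.div (contDiffOn_const.mul contDiffOn_id) hp) fun x hx => one_div_ne_zero (hp x hx)
  · rw [angMean_secondOrder, h5, log_eta0]

/-! ### Orders of magnitude -/

/-- On `S`, `f = O(e ^ k)` up to powers of `J`. -/
def Bd {ι : Type*} (S : Set ι) (e J : ι → ℝ) (k : ℕ) (f : ι → ℝ) : Prop := ∃ (C : ℝ) (N : ℕ), 0 ≤ C ∧ ∀ i ∈ S, |f i| ≤ C * e i ^ k * J i ^ N

/-- The small parameter `e` lies in `[0,1]`, and the weight `J` is at least `1`. -/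
structure IsScale {ι : Type*} (S : Set ι) (e J : ι → ℝ) : Prop where
  nonneg : ∀ i ∈ S, 0 ≤ e i
  le_one : ∀ i ∈ S, e i ≤ 1
  one_le : ∀ i ∈ S, 1 ≤ J i

section
variable {ι : Type*} {S : Set ι} {e J : ι → ℝ} {k l : ℕ} {f g : ι → ℝ}

lemma Bd.of_abs_le (hf : Bd S e J k f) (h : ∀ i ∈ S, |g i| ≤ |f i|) : Bd S e J k g := by
  obtain ⟨C, N, hC, hb⟩ := hf
  exact ⟨C, N, hC, fun i hi => (h i hi).trans (hb i hi)⟩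

lemma Bd.congr (hf : Bd S e J k f) (h : ∀ i ∈ S, g i = f i) : Bd S e J k g := hf.of_abs_le fun i hi => by rw [h i hi]

lemma Bd.mul (hs : IsScale S e J) (hf : Bd S e J k f) (hg : Bd S e J l g) : Bd S e J (k + l) fun i => f i * g i := by
  obtain ⟨C, N, hC, hb⟩ := hf
  obtain ⟨C', N', hC', hb'⟩ := hg
  refine ⟨C * C', N + N', mul_nonneg hC hC', fun i hi => ?_⟩
  have h0 := hs.nonneg i hi
  have hJ : 0 ≤ J i := zero_le_one.trans (hs.one_le i hi)
  rw [abs_mul, pow_add, pow_add]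
  calc |f i| * |g i| ≤ (C * e i ^ k * J i ^ N) * (C' * e i ^ l * J i ^ N') := mul_le_mul (hb i hi) (hb' i hi) (abs_nonneg _) (by positivity)
    _ = _ := by ring

lemma Bd.add (hs : IsScale S e J) (hf : Bd S e J k f) (hg : Bd S e J k g) : Bd S e J k fun i => f i + g i := by
  obtain ⟨C, N, hC, hb⟩ := hf
  obtain ⟨C', N', hC', hb'⟩ := hg
  refine ⟨C + C', N + N', add_nonneg hC hC', fun i hi => ?_⟩
  have h0 := pow_nonneg (hs.nonneg i hi) k
  have hJ := hs.one_le i hi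
  have h1 : J i ^ N ≤ J i ^ (N + N') := pow_le_pow_right₀ hJ (by omega)
  have h2 : J i ^ N' ≤ J i ^ (N + N') := pow_le_pow_right₀ hJ (by omega)
  calc |f i + g i| ≤ |f i| + |g i| := abs_add_le _ _
    _ ≤ C * e i ^ k * J i ^ N + C' * e i ^ k * J i ^ N' := add_le_add (hb i hi) (hb' i hi)
    _ ≤ C * e i ^ k * J i ^ (N + N') + C' * e i ^ k * J i ^ (N + N') := by gcongr
    _ = _ := by ring

lemma Bd.mono (hs : IsScale S e J) (hf : Bd S e J k f) (h : l ≤ k) : Bd S e J l f := by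
  obtain ⟨C, N, hC, hb⟩ := hf
  refine ⟨C, N, hC, fun i hi => (hb i hi).trans ?_⟩
  have hJ := (zero_le_one.trans (hs.one_le i hi))
  have := pow_le_pow_of_le_one (hs.nonneg i hi) (hs.le_one i hi) h
  gcongr

lemma Bd.const (c : ℝ) : Bd S e J 0 fun _ => c := ⟨|c|, 0, abs_nonneg c, fun i _ => by simp⟩
lemma Bd.neg (hf : Bd S e J k f) : Bd S e J k fun i => -f i := hf.of_abs_le fun i _ => by simp
lemma Bd.sub (hs : IsScale S e J) (hf : Bd S e J k f) (hg : Bd S e J k g) : Bd S e J k fun i => f i - g i := by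
  simpa only [sub_eq_add_neg] using hf.add hs hg.neg
lemma Bd.smul (hs : IsScale S e J) (c : ℝ) (hf : Bd S e J k f) : Bd S e J k fun i => c * f i := by simpa using (Bd.const c).mul hs hf
lemma Bd.zero (k : ℕ) : Bd S e J k fun _ => 0 := ⟨0, 0, le_rfl, fun i _ => by simp⟩
lemma Bd.small (hs : IsScale S e J) : Bd S e J 1 e := ⟨1, 0, zero_le_one, fun i hi => by simp [abs_of_nonneg (hs.nonneg i hi)]⟩
lemma Bd.weight (hs : IsScale S e J) : Bd S e J 0 J := ⟨1, 1, zero_le_one, fun i hi => by simp [abs_of_nonneg (zero_le_one.trans (hs.one_le i hi))]⟩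
lemma Bd.pow (hs : IsScale S e J) (hf : Bd S e J k f) : ∀ n : ℕ, Bd S e J (n * k) fun i => f i ^ n
  | 0 => by simpa using Bd.const 1
  | n + 1 => by simpa only [pow_succ, Nat.succ_mul] using (hf.pow hs n).mul hs hf

/-- Functions of `X`, indexed by `ι`, which are `O(e ^ k)` at the point `x` together with their gradient. -/
def DBd (S : Set ι) (e J : ι → ℝ) (x : ι → ℝ²) (k : ℕ) (f : ι → ℝ² → ℝ) : Prop :=
  (∀ i ∈ S, DifferentiableAt ℝ (f i) (x i)) ∧ Bd S e J k (fun i => f i (x i)) ∧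
    Bd S e J k (fun i => dR (f i) (x i)) ∧ Bd S e J k fun i => dZ (f i) (x i)

variable {x : ι → ℝ²} {F G : ι → ℝ² → ℝ}

lemma hasFDerivAt_add_lin {f g : ℝ² → ℝ} {X : ℝ²} (hf : DifferentiableAt ℝ f X) (hg : DifferentiableAt ℝ g X) :
    HasFDerivAt (fun X => f X + g X) (lin (dR f X + dR g X) (dZ f X + dZ g X)) X :=
  ((hasFDerivAt_lin hf).add (hasFDerivAt_lin hg)).congr_fderiv (by ext <;> simp [lin_apply])

lemma hasFDerivAt_mul_lin {f g : ℝ² → ℝ} {X : ℝ²} (hf : DifferentiableAt ℝ f X) (hg : DifferentiableAt ℝ g X) :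
    HasFDerivAt (fun X => f X * g X) (lin (f X * dR g X + g X * dR f X) (f X * dZ g X + g X * dZ f X)) X :=
  ((hasFDerivAt_lin hf).mul (hasFDerivAt_lin hg)).congr_fderiv (by ext <;> simp [lin_apply])

lemma hasFDerivAt_comp_lin {f : ℝ² → ℝ} {X : ℝ²} (hf : DifferentiableAt ℝ f X) {g : ℝ → ℝ} {g' : ℝ}
    (hg : HasDerivAt g g' (f X)) : HasFDerivAt (fun X => g (f X)) (lin (g' * dR f X) (g' * dZ f X)) X :=
  (hg.comp_hasFDerivAt X (hasFDerivAt_lin hf)).congr_fderiv (by ext <;> simp [lin_apply])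

lemma dR_lin {f : ℝ² → ℝ} {X : ℝ²} {a b : ℝ} (h : HasFDerivAt f (lin a b) X) : dR f X = a := by rw [dR_of_hasFDerivAt h]; simp [lin_apply]
lemma dZ_lin {f : ℝ² → ℝ} {X : ℝ²} {a b : ℝ} (h : HasFDerivAt f (lin a b) X) : dZ f X = b := by rw [dZ_of_hasFDerivAt h]; simp [lin_apply]

lemma DBd.of_hasFDerivAt {a b : ι → ℝ} (h : ∀ i ∈ S, HasFDerivAt (F i) (lin (a i) (b i)) (x i))
    (h0 : Bd S e J k fun i => F i (x i)) (ha : Bd S e J k a) (hb : Bd S e J k b) : DBd S e J x k F :=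
  ⟨fun i hi => (h i hi).differentiableAt, h0, ha.congr fun i hi => dR_lin (h i hi), hb.congr fun i hi => dZ_lin (h i hi)⟩

lemma DBd.add (hs : IsScale S e J) (hF : DBd S e J x k F) (hG : DBd S e J x k G) :
    DBd S e J x k fun i X => F i X + G i X :=
  .of_hasFDerivAt (fun i hi => hasFDerivAt_add_lin (hF.1 i hi) (hG.1 i hi)) (hF.2.1.add hs hG.2.1)
    (hF.2.2.1.add hs hG.2.2.1) (hF.2.2.2.add hs hG.2.2.2)

lemma DBd.mul (hs : IsScale S e J) (hF : DBd S e J x k F) (hG : DBd S e J x l G) :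
    DBd S e J x (k + l) fun i X => F i X * G i X :=
  .of_hasFDerivAt (fun i hi => hasFDerivAt_mul_lin (hF.1 i hi) (hG.1 i hi)) (hF.2.1.mul hs hG.2.1)
    ((hF.2.1.mul hs hG.2.2.1).add hs (add_comm k l ▸ hG.2.1.mul hs hF.2.2.1))
    ((hF.2.1.mul hs hG.2.2.2).add hs (add_comm k l ▸ hG.2.1.mul hs hF.2.2.2))

lemma DBd.mono (hs : IsScale S e J) (hF : DBd S e J x k F) (h : l ≤ k) : DBd S e J x l F :=
  ⟨hF.1, hF.2.1.mono hs h, hF.2.2.1.mono hs h, hF.2.2.2.mono hs h⟩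

lemma DBd.param (hf : Bd S e J k f) : DBd S e J x k fun i _ => f i := .of_hasFDerivAt (a := fun _ => 0) (b := fun _ => 0)
    (fun i _ => (hasFDerivAt_const (f i) (x i)).congr_fderiv (by ext <;> simp [lin_apply])) hf (Bd.zero k) (Bd.zero k)

lemma DBd.const (c : ℝ) : DBd S e J x 0 fun _ _ => c := .param (Bd.const c)
lemma DBd.smul (hs : IsScale S e J) (c : ℝ) (hF : DBd S e J x k F) : DBd S e J x k fun i X => c * F i X := by simpa using (DBd.const c).mul hs hF
lemma DBd.neg (hs : IsScale S e J) (hF : DBd S e J x k F) : DBd S e J x k fun i X => -F i X := by simpa using hF.smul hs (-1)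
lemma DBd.sub (hs : IsScale S e J) (hF : DBd S e J x k F) (hG : DBd S e J x k G) :
    DBd S e J x k fun i X => F i X - G i X := by simpa only [sub_eq_add_neg] using hF.add hs (hG.neg hs)
lemma DBd.pow (hs : IsScale S e J) (hF : DBd S e J x k F) : ∀ n : ℕ, DBd S e J x (n * k) fun i X => F i X ^ n
  | 0 => by simpa using DBd.const 1
  | n + 1 => by simpa only [pow_succ, Nat.succ_mul] using (hF.pow hs n).mul hs hF

lemma DBd.congr (hF : DBd S e J x k F) (h : ∀ i ∈ S, G i =ᶠ[nhds (x i)] F i) : DBd S e J x k G :=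
  .of_hasFDerivAt (fun i hi => (hasFDerivAt_lin (hF.1 i hi)).congr_of_eventuallyEq (h i hi))
    (hF.2.1.congr fun i hi => (h i hi).eq_of_nhds) hF.2.2.1 hF.2.2.2

/-- Composition with a function that is `O(y ^ k)` together with `y` times its derivative. -/
lemma DBd.comp (hs : IsScale S e J) (hF : DBd S e J x 1 F) {g g' : ℝ → ℝ} {r C : ℝ} (hC : 0 ≤ C) {k : ℕ}
    (hr : ∀ i ∈ S, |F i (x i)| ≤ r) (hg : ∀ y, |y| ≤ r → HasDerivAt g (g' y) y)
    (h0 : ∀ y, |y| ≤ r → |g y| ≤ C * |y| ^ (k + 1)) (h1 : ∀ y, |y| ≤ r → |g' y| ≤ C * |y| ^ k) :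
    DBd S e J x (k + 1) fun i X => g (F i X) := by
  have hp : ∀ n, Bd S e J n fun i => C * F i (x i) ^ n := fun n => by simpa using (hF.2.1.pow hs n).smul hs C
  have hv : Bd S e J (k + 1) fun i => g (F i (x i)) := (hp (k + 1)).of_abs_le fun i hi => by
    rw [abs_mul, abs_of_nonneg hC, abs_pow]; exact h0 _ (hr i hi)
  have hd : Bd S e J k fun i => g' (F i (x i)) := (hp k).of_abs_le fun i hi => by rw [abs_mul, abs_of_nonneg hC, abs_pow]; exact h1 _ (hr i hi)
  exact .of_hasFDerivAt (fun i hi => hasFDerivAt_comp_lin (hF.1 i hi) (hg _ (hr i hi))) hv (hd.mul hs hF.2.2.1) (hd.mul hs hF.2.2.2)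

lemma Bd.of_pb {f : ℝ² → ℝ} (h : PB f) (hJ : ∀ i ∈ S, 1 + ‖x i‖ ≤ J i) : Bd S e J 0 fun i => f (x i) := by
  obtain ⟨N, C, hC, hb⟩ := h
  refine ⟨C, N, hC, fun i hi => (hb _).trans ?_⟩
  have := hJ i hi
  rw [pow_zero, mul_one]
  gcongr

lemma DBd.of_tg {f : ℝ² → ℝ} (h : TG f) (hJ : ∀ i ∈ S, 1 + ‖x i‖ ≤ J i) : DBd S e J x 0 fun _ => f :=
  ⟨fun i _ => h.diff (x i), .of_pb h.pb hJ, .of_pb h.dR.pb hJ, .of_pb h.dZ.pb hJ⟩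

end

/-! ### Polynomial families -/

/-- Polynomials in `β` and `δ` with coefficients in `P`. -/
inductive PF (P : (ℝ² → ℝ) → Prop) : (ℝ → ℝ → ℝ² → ℝ) → Prop
  | base {f : ℝ² → ℝ} : P f → PF P fun _ _ => f
  | add {G H} : PF P G → PF P H → PF P fun β δ => G β δ + H β δ
  | beta {G} : PF P G → PF P fun β δ => β • G β δ
  | delta {G} : PF P G → PF P fun β δ => δ • G β δ

section
variable {P Q T : (ℝ² → ℝ) → Prop} {G H : ℝ → ℝ → ℝ² → ℝ}

/-- Linear subspaces. -/
structure IsLin (P : (ℝ² → ℝ) → Prop) : Prop where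
  add : ∀ {f g}, P f → P g → P (f + g)
  smul : ∀ {f} (c : ℝ), P f → P (c • f)

lemma isLin_tg : IsLin TG := ⟨TG.add, fun c h => h.smul c⟩
lemma isLin_inZ : IsLin InZ := ⟨InZ.add, fun c h => h.smul c⟩

lemma PF.mem (hP : IsLin P) (hG : PF P G) (β δ : ℝ) : P (G β δ) := by
  induction hG with
  | base h => exact h
  | add _ _ h h' => exact hP.add h h'
  | beta _ h => exact hP.smul _ h
  | delta _ h => exact hP.smul _ h

lemma PF.map (hP : IsLin P) (L : (ℝ² → ℝ) → ℝ² → ℝ) (hL : ∀ {f}, P f → Q (L f))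
    (ha : ∀ {f g}, P f → P g → L (f + g) = L f + L g) (hm : ∀ {f} (c : ℝ), P f → L (c • f) = c • L f)
    (hG : PF P G) : PF Q fun β δ => L (G β δ) := by
  induction hG with
  | base h => exact .base (hL h)
  | add h h' i i' => simp only [fun β δ => ha (h.mem hP β δ) (h'.mem hP β δ)]; exact i.add i'
  | beta h i => simp only [fun β δ => hm β (h.mem hP β δ)]; exact i.beta
  | delta h i => simp only [fun β δ => hm δ (h.mem hP β δ)]; exact i.delta

lemma PF.smul (hP : IsLin P) (c : ℝ) (hG : PF P G) : PF P fun β δ => c • G β δ :=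
  hG.map hP (fun f => c • f) (hP.smul c) (fun _ _ => smul_add _ _ _) fun _ _ => smul_comm _ _ _

lemma PF.sub (hP : IsLin P) (hG : PF P G) (hH : PF P H) : PF P fun β δ => G β δ - H β δ := by
  have := hG.add (hH.smul hP (-1))
  simpa [sub_eq_add_neg] using this

lemma PF.mulc (hP : IsLin P) {p : ℝ² → ℝ} (hp : ∀ {f}, P f → Q (p * f)) (hG : PF P G) : PF Q fun β δ => p * G β δ :=
  hG.map hP (fun f => p * f) hp (fun _ _ => mul_add _ _ _) fun _ _ => mul_smul_comm _ _ _

lemma PF.bilin (hP : IsLin P) (hQ : IsLin Q) (B : (ℝ² → ℝ) → (ℝ² → ℝ) → ℝ² → ℝ)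
    (hB : ∀ {f g}, P f → Q g → T (B f g))
    (ha : ∀ {f f' g}, P f → P f' → Q g → B (f + f') g = B f g + B f' g)
    (hm : ∀ {f g} (c : ℝ), P f → Q g → B (c • f) g = c • B f g)
    (ha' : ∀ {f g g'}, P f → Q g → Q g' → B f (g + g') = B f g + B f g')
    (hm' : ∀ {f g} (c : ℝ), P f → Q g → B f (c • g) = c • B f g)
    (hG : PF P G) (hH : PF Q H) : PF T fun β δ => B (G β δ) (H β δ) := by
  induction hG with
  | base h => exact hH.map hQ (B _) (hB h) (ha' h) fun c => hm' c h
  | add h h' i i' => simp only [fun β δ => ha (h.mem hP β δ) (h'.mem hP β δ) (hH.mem hQ β δ)]; exact i.add i'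
  | beta h i => simp only [fun β δ => hm β (h.mem hP β δ) (hH.mem hQ β δ)]; exact i.beta
  | delta h i => simp only [fun β δ => hm δ (h.mem hP β δ) (hH.mem hQ β δ)]; exact i.delta

lemma PF.mul (hG : PF TG G) (hH : PF TG H) : PF TG fun β δ => G β δ * H β δ :=
  hG.bilin isLin_tg isLin_tg (fun f g => f * g) TG.mul (fun _ _ _ => add_mul _ _ _) (fun _ _ _ => smul_mul_assoc _ _ _)
    (fun _ _ _ => mul_add _ _ _) (fun _ _ _ => mul_smul_comm _ _ _) hH

lemma PF.pb (hG : PF TG G) (hH : PF InZ H) : PF InZ fun β δ => pb (G β δ) (H β δ) := by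
  refine hG.bilin isLin_tg isLin_inZ VortexRing.pb (fun h h' => InZ.pbr_right h h')
    (fun h h' _ => pb_add_left h.diff h'.diff) (fun c _ _ => pb_smul_left c) (fun {f g g'} _ h h' => ?_) (fun {f g} c _ _ => ?_) hH
  · simp only [VortexRing.pb, dR_add h.diff h'.diff, dZ_add h.diff h'.diff]; ring
  · simp only [VortexRing.pb, dR_smul, dZ_smul]; ext X; simp; ring

lemma PF.dR (hG : PF InZ G) : PF InZ fun β δ => dR (G β δ) :=
  hG.map isLin_inZ VortexRing.dR InZ.dR (fun h h' => dR_add h.diff h'.diff) fun c _ => dR_smul c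
lemma PF.dZ (hG : PF InZ G) : PF InZ fun β δ => dZ (G β δ) :=
  hG.map isLin_inZ VortexRing.dZ InZ.dZ (fun h h' => dZ_add h.diff h'.diff) fun c _ => dZ_smul c
lemma PF.BS0 (hG : PF InZ G) : PF TG fun β δ => BS0 (G β δ) :=
  hG.map isLin_inZ VortexRing.BS0 TG.BS0 (fun h h' => BS0_add h h') fun c _ => BS0_smul c _
lemma PF.Aop (hG : PF InZ G) : PF TG fun β δ => Aop (G β δ) := hG.map isLin_inZ VortexRing.Aop TG.Aop (fun _ _ => Aop_add _ _) fun c _ => Aop_smul c _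

lemma PF.BS (m : ℕ) (hG : PF InZ G) : PF TG fun β δ => BS β m (G β δ) := by
  have h1 : PF TG fun β δ => BSP m (G β δ) := hG.map isLin_inZ (BSP m) (tg_BSP m) (fun h h' => kerOp_add (sep_polP m) h h') fun c _ => kerOp_smul c
  have h2 : PF TG fun β δ => BSL m (G β δ) := hG.map isLin_inZ (BSL m) (tg_BSL m) (fun h h' => by
      simp only [BSL, logOp_add (sep_polP m) h h', kerOp_add (sep_polQ m) h h']; abel) fun c _ => by
      simp only [BSL, kerOp_smul, logOp_smul, smul_add]
  simp only [fun β δ => BS_eq β m (hG.mem isLin_inZ β δ)]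
  exact h1.beta.add h2

/-- The value at `δ = 0` and the rest. -/
lemma PF.sub_zero (hP : IsLin P) (hG : PF P G) : ∃ H, PF P H ∧ ∀ β δ, G β δ = G β 0 + δ • H β δ := by
  induction hG with
  | base h => exact ⟨fun _ _ => (0 : ℝ) • _, .base (hP.smul 0 h), fun β δ => by simp⟩
  | add _ _ i i' =>
    obtain ⟨H, h, e⟩ := i
    obtain ⟨H', h', e'⟩ := i'
    exact ⟨_, h.add h', fun β δ => by beta_reduce; rw [e β δ, e' β δ, smul_add]; abel⟩
  | beta _ i =>
    obtain ⟨H, h, e⟩ := i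
    exact ⟨_, h.beta, fun β δ => by beta_reduce; rw [e β δ, smul_add, smul_comm]⟩
  | delta h _ => exact ⟨_, h, fun β δ => by simp⟩

lemma PF.dk (hG : PF InZ G) (m : ℕ) : ∃ (C : ℝ) (N : ℕ), 0 ≤ C ∧ ∀ β δ, |δ| ≤ 1 → Dk m (C * (1 + |β|) ^ N) (G β δ) := by
  induction hG with
  | base h =>
    obtain ⟨M, hM, hd⟩ := h.dk m
    exact ⟨M, 0, hM, fun β δ _ => by simpa using hd⟩
  | add _ _ i i' =>
    obtain ⟨C, N, hC, h⟩ := i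
    obtain ⟨C', N', hC', h'⟩ := i'
    refine ⟨C + C', N + N', add_nonneg hC hC', fun β δ hδ X => (abs_add_le _ _).trans ?_⟩
    have h1 := (h β δ hδ X)
    have h2 := (h' β δ hδ X)
    have hb : 1 ≤ 1 + |β| := by linarith [abs_nonneg β]
    have e1 : (1 + |β|) ^ N ≤ (1 + |β|) ^ (N + N') := pow_le_pow_right₀ hb (by omega)
    have e2 : (1 + |β|) ^ N' ≤ (1 + |β|) ^ (N + N') := pow_le_pow_right₀ hb (by omega)
    rw [add_mul, add_mul]
    refine add_le_add (h1.trans ?_) (h2.trans ?_) <;> gcongr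
  | beta _ i =>
    obtain ⟨C, N, hC, h⟩ := i
    refine ⟨C, N + 1, hC, fun β δ hδ X => ?_⟩
    have h1 := h β δ hδ X
    beta_reduce
    rw [Pi.smul_apply, smul_eq_mul, abs_mul]
    calc |β| * |_| ≤ (1 + |β|) * (C * (1 + |β|) ^ N * (⟪X⟫ ^ m)⁻¹) := mul_le_mul (by linarith) h1 (abs_nonneg _) (by positivity)
      _ = _ := by ring
  | delta _ i =>
    obtain ⟨C, N, hC, h⟩ := i
    refine ⟨C, N, hC, fun β δ hδ X => ?_⟩
    beta_reduce
    rw [Pi.smul_apply, smul_eq_mul, abs_mul]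
    exact (mul_le_of_le_one_left (abs_nonneg _) hδ).trans (h β δ hδ X)

lemma PF.dbd {ι : Type*} {S : Set ι} {e J β δ : ι → ℝ} {x : ι → ℝ²} (hs : IsScale S e J) (hβ : Bd S e J 0 β)
    (hδ : Bd S e J 0 δ) (hJ : ∀ i ∈ S, 1 + ‖x i‖ ≤ J i) (hG : PF TG G) : DBd S e J x 0 fun i => G (β i) (δ i) := by
  induction hG with
  | base h => exact .of_tg h hJ
  | add _ _ i i' => exact i.add hs i'
  | beta _ i => exact (DBd.param hβ).mul hs i
  | delta _ i => exact (DBd.param hδ).mul hs i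

end

/-! ### The profiles are polynomial families -/

lemma pf_eta0 : PF InZ fun _ _ => eta0 := .base inZ_eta0
lemma pf_eta1 : PF InZ fun _ δ => eta1 δ := (PF.base inZ_eta10).add (PF.base (inZ_lamInv _)).delta
lemma pf_eta2 : PF InZ eta2 := (((PF.base inZ_eta200).add (PF.base (inZ_lamInv _)).delta).beta.add
    ((PF.base inZ_eta210).add (PF.base (inZ_lamInv _)).delta)).add (PF.base inZ_eta22)
lemma pf_eta3 : PF InZ fun β _ => eta3 β := (PF.base (inZ_lamInv _)).beta.add (PF.base (inZ_lamInv _))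
lemma pf_eta4 : PF InZ fun β _ => eta4 β := by
  have h : PF InZ fun β _ => (lamInv (-coeffβ 0 fun β' => source4 β' 0) + (β • lamInv (-coeffβ 1 fun β' => source4 β' 0)
      + β • β • lamInv (-coeffβ 2 fun β' => source4 β' 0))) + (eta60 + β • (eta61 + β • eta62)) :=
    ((PF.base (inZ_lamInv _)).add ((PF.base (inZ_lamInv _)).beta.add (PF.base (inZ_lamInv _)).beta.beta)).add
      ((PF.base (inZ_fpInv _ _)).add ((PF.base (inZ_fpInv _ _)).add (PF.base (inZ_fpInv _ _)).beta).beta)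
  convert h using 3 with β δ
  rw [eta4, Finset.sum_range_succ, Finset.sum_range_succ, Finset.sum_range_one]
  simp only [pow_zero, pow_one, one_smul, pow_two, smul_smul, smul_add, add_assoc]

lemma pf_phi1 : PF TG phi1 := pf_eta1.BS0.add (pf_eta0.BS 1)
lemma pf_phi2 : PF TG phi2 := (pf_eta2.BS0.add (pf_eta1.BS 1)).add (pf_eta0.BS 2)

lemma PF.b0_smul {P : (ℝ² → ℝ) → Prop} (hP : IsLin P) {G : ℝ → ℝ → ℝ² → ℝ} (hG : PF P G) :
    PF P fun β δ => b0 β • G β δ := by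
  have := (hG.smul hP (1 / (4 * π))).beta.add (hG.smul hP ((-1 + 2 * cv) / (4 * π)))
  convert this using 4
  rw [smul_smul, ← add_smul, b0]; congr 1; ring

lemma pf_source3pre : PF InZ source3pre := by
  have hZ := isLin_inZ
  have m : ∀ {G : ℝ → ℝ → ℝ² → ℝ} (n : ℕ), PF InZ G → PF InZ fun β δ => cR ^ n * G β δ := fun n h => h.mulc hZ fun hf => hf.mul_left (TG.cR.pow n)
  have m1 : ∀ {G : ℝ → ℝ → ℝ² → ℝ}, PF InZ G → PF InZ fun β δ => cR * G β δ := fun h => h.mulc hZ fun hf => hf.mul_left TG.cR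
  refine ((((((?_ : PF InZ _).add ?_).add ?_).sub hZ ?_).sub hZ ?_).add ?_).add ?_
  · exact PF.pb (((pf_eta2.BS 1).add (pf_eta1.BS 2)).add (pf_eta0.BS 3)) pf_eta0
  · exact pf_phi2.pb (pf_eta1.sub hZ (m1 pf_eta0))
  · exact pf_phi1.pb ((pf_eta2.sub hZ (m1 pf_eta1)).add (m 2 pf_eta0))
  · exact PF.pb (.base tg_phi0) (((m1 pf_eta2).sub hZ (m 2 pf_eta1)).add (m 3 pf_eta0))
  · exact pf_eta2.dZ.b0_smul hZ
  · exact ((m1 pf_eta1).sub hZ (m 2 pf_eta0)).dR.delta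
  · exact pf_eta1.delta

lemma parZ_source3pre (β : ℝ) : ParZ (-1) (source3pre β 0) := by
  have p1 : ParZ 1 eta10 := eta10_spec.2.2.parZ
  have p2 : ParZ 1 (eta2 β 0) := by
    rw [eta2_zero]
    exact ((eta200_spec.2.2.parZ.smul β).add eta210_spec.2.parZ).add radial_eta22.parZ
  have p0 := parZ_eta0
  have f1 : ParZ 1 (phi1 β 0) := by rw [phi1, eta1_zero]; exact p1.BS0.add (p0.BS β 1)
  have f2 : ParZ 1 (phi2 β 0) := by rw [phi2, eta1_zero]; exact (p2.BS0.add (p1.BS β 1)).add (p0.BS β 2)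
  have m : ∀ {f : ℝ² → ℝ} (n : ℕ), ParZ 1 f → ParZ 1 (cR ^ n * f) := fun n h => ((parZ_cR.pow n).mul h).of_eq (by norm_num)
  have m1 : ∀ {f : ℝ² → ℝ}, ParZ 1 f → ParZ 1 (cR * f) := fun h => (parZ_cR.mul h).of_eq (by norm_num)
  have e : ∀ {f g : ℝ² → ℝ}, ParZ 1 f → ParZ 1 g → ParZ (-1) (pb f g) := fun h h' => (h.pb h').of_eq (by norm_num)
  rw [source3pre, eta1_zero, zero_smul, zero_smul, add_zero, add_zero]
  exact (((((e (((p2.BS β 1).add (p1.BS β 2)).add (p0.BS β 3)) p0).add (e f2 (p1.sub (m1 p0)))).add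
    (e f1 ((p2.sub (m1 p1)).add (m 2 p0)))).sub (e radial_phi0.parZ (((m1 p2).sub (m 2 p1)).add (m 3 p0)))).sub
    (p2.dZ.smul (b0 β)))

lemma PF.integral_bound {G : ℝ → ℝ → ℝ² → ℝ} (hG : PF InZ G) : ∃ (C : ℝ) (N : ℕ), 0 ≤ C ∧ ∀ β δ, |δ| ≤ 1 → |∫ X, G β δ X| ≤ C * (1 + |β|) ^ N := by
  obtain ⟨C, N, hC, h⟩ := hG.dk 4
  have hi : Integrable fun X : ℝ² => (⟪X⟫ ^ 4)⁻¹ := by simpa [KI] using ki_one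
  have h0 : 0 ≤ ∫ X : ℝ², (⟪X⟫ ^ 4)⁻¹ := integral_nonneg fun X => by positivity
  refine ⟨C * ∫ X : ℝ², (⟪X⟫ ^ 4)⁻¹, N, mul_nonneg hC h0, fun β δ hδ => ?_⟩
  have := norm_integral_le_of_norm_le (hi.const_mul (C * (1 + |β|) ^ N)) (.of_forall fun X => by rw [norm_eq_abs]; exact h β δ hδ X)
  rw [integral_const_mul, norm_eq_abs] at this
  linarith

lemma velocity_bounds : ∃ (C : ℝ) (N : ℕ), 0 ≤ C ∧ ∀ β δ, 0 ≤ δ → δ ≤ 1 →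
    |a2 β δ| ≤ C * δ * (1 + |β|) ^ N ∧ |b2 β δ| ≤ C * (1 + |β|) ^ N := by
  have hZ := isLin_inZ
  obtain ⟨H, hH, e⟩ := pf_source3pre.sub_zero hZ
  obtain ⟨C, N, hC, h⟩ := (hH.mulc hZ fun hf => hf.mul_left TG.cR).integral_bound
  obtain ⟨C', N', hC', h'⟩ := (pf_source3pre.mulc hZ fun hf => hf.mul_left TG.cZ).integral_bound
  have hb0 : ∀ β, |b0 β| ≤ (1 + |2 * cv|) * (1 + |β|) := fun β => by
    have hpi : 1 ≤ 4 * π := by linarith [pi_gt_three]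
    rw [b0, abs_div, abs_of_pos (zero_lt_one.trans_le hpi)]
    refine (div_le_self (abs_nonneg _) hpi).trans ?_
    have h1 := abs_add_le (β - 1) (2 * cv)
    have h2 := abs_sub β 1
    have := abs_nonneg β
    have := abs_nonneg (2 * cv)
    rw [abs_one] at h2
    nlinarith [mul_nonneg (abs_nonneg (2 * cv)) (abs_nonneg β)]
  refine ⟨1 + C + (1 + |2 * cv|) + C', 1 + N + N', by positivity, fun β δ h0 h1 => ?_⟩
  have hβ : 1 ≤ 1 + |β| := by linarith [abs_nonneg β]
  have hδ : |δ| ≤ 1 := by rwa [abs_of_nonneg h0]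
  have p1 : (1 + |β|) ^ N ≤ (1 + |β|) ^ (1 + N + N') := pow_le_pow_right₀ hβ (by omega)
  have p2 : (1 + |β|) ^ N' ≤ (1 + |β|) ^ (1 + N + N') := pow_le_pow_right₀ hβ (by omega)
  have p3 : 1 + |β| ≤ (1 + |β|) ^ (1 + N + N') := by simpa using pow_le_pow_right₀ hβ (show 1 ≤ 1 + N + N' by omega)
  have q1 : ∫ X, cR X * source3pre β δ X = δ * ∫ X, cR X * H β δ X := by
    have z0 := pf_source3pre.mem hZ β 0
    have z1 := hH.mem hZ β δ
    have hs : ∀ X, cR X * source3pre β δ X = cR X * source3pre β 0 X + δ * (cR X * H β δ X) := fun X => by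
      rw [e β δ]; simp only [Pi.add_apply, Pi.smul_apply, smul_eq_mul]; ring
    have hz : ∫ X, cR X * source3pre β 0 X = 0 :=
      (((parZ_cR.mul (parZ_source3pre β)).of_eq (by norm_num)) : ParZ (-1) (cR * source3pre β 0)).integral_eq_zero
    simp_rw [hs]
    rw [integral_add (z0.integrable_mul TG.cR) ((z1.integrable_mul TG.cR).const_mul δ), hz, integral_const_mul, zero_add]
  constructor
  · rw [a2, q1, show -δ - δ * ∫ X, cR X * H β δ X = -(δ * (1 + ∫ X, cR X * H β δ X)) by ring, abs_neg, abs_mul, abs_of_nonneg h0]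
    have h2 := h β δ hδ
    have h3 := abs_add_le 1 (∫ X, cR X * H β δ X)
    rw [abs_one] at h3
    have h4 : |1 + ∫ X, cR X * H β δ X| ≤ (1 + C + (1 + |2 * cv|) + C') * (1 + |β|) ^ (1 + N + N') := by
      have : C * (1 + |β|) ^ N ≤ C * (1 + |β|) ^ (1 + N + N') := by gcongr
      change |∫ X, cR X * H β δ X| ≤ _ at h2
      have h5 : 0 ≤ ((1 + |2 * cv|) + C') * (1 + |β|) ^ (1 + N + N') := by positivity
      linarith
    calc δ * _ ≤ δ * _ := mul_le_mul_of_nonneg_left h4 h0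
      _ = _ := by ring
  · have h2 := h' β δ hδ
    change |∫ X, cZ X * source3pre β δ X| ≤ _ at h2
    have h3 := abs_sub (b0 β) (∫ X, cZ X * source3pre β δ X)
    have h4 : C' * (1 + |β|) ^ N' ≤ C' * (1 + |β|) ^ (1 + N + N') := by gcongr
    have h5 : (1 + |2 * cv|) * (1 + |β|) ≤ (1 + |2 * cv|) * (1 + |β|) ^ (1 + N + N') := by gcongr
    have h6 : 0 ≤ (1 + C) * (1 + |β|) ^ (1 + N + N') := by positivity
    rw [b2]
    linarith [hb0 β]

/-! ### Logarithms are harmless -/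

lemma exists_log_bound (n : ℕ) {a : ℝ} (ha : 0 < a) : ∃ C, 0 ≤ C ∧ ∀ ε, 0 < ε → ε ≤ 1 → ε ^ a * (1 + |log (1 / ε)|) ^ n ≤ C := by
  obtain ⟨b, hb, hbn⟩ : ∃ b : ℝ, 0 < b ∧ b * n ≤ a := by
    refine ⟨a / (n + 1), by positivity, ?_⟩
    rw [div_mul_eq_mul_div, div_le_iff₀ (by positivity)]; nlinarith
  refine ⟨(1 + 1 / b) ^ n, by positivity, fun ε h0 h1 => ?_⟩
  have hl : |log (1 / ε)| ≤ ε ^ (-b) / b := by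
    have h2 : 0 ≤ log (1 / ε) := log_nonneg (by rw [le_div_iff₀ h0]; linarith)
    rw [abs_of_nonneg h2]
    have := log_le_rpow_div (by positivity : 0 ≤ 1 / ε) hb
    rw [one_div, inv_rpow h0.le, ← rpow_neg h0.le] at this
    rwa [one_div]
  have h3 : 1 ≤ ε ^ (-b) := one_le_rpow_of_pos_of_le_one_of_nonpos h0 h1 (by linarith)
  have h4 : 1 + |log (1 / ε)| ≤ (1 + 1 / b) * ε ^ (-b) := by
    have : (1 + 1 / b) * ε ^ (-b) = ε ^ (-b) + ε ^ (-b) / b := by ring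
    linarith
  calc ε ^ a * (1 + |log (1 / ε)|) ^ n ≤ ε ^ a * ((1 + 1 / b) * ε ^ (-b)) ^ n := by gcongr
    _ = (1 + 1 / b) ^ n * (ε ^ a * ε ^ (-b * n)) := by rw [mul_pow, ← rpow_mul_natCast h0.le]; ring
    _ = (1 + 1 / b) ^ n * ε ^ (a - b * n) := by rw [← rpow_add h0]; ring_nf
    _ ≤ (1 + 1 / b) ^ n * 1 := by refine mul_le_mul_of_nonneg_left (rpow_le_one h0.le h1 (by linarith)) (by positivity)
    _ = _ := mul_one _

/-! ### The radius of the ring -/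

lemma radius_bound : ∃ ε₀ : ℝ, 0 < ε₀ ∧ ε₀ ≤ 1 ∧ ∀ Γ r₀ ν T : ℝ, 0 < Γ → 0 < r₀ → 0 < ν → ∀ rbar : ℝ → ℝ,
    IsRadius Γ r₀ ν T rbar → ∀ t ∈ Ioo 0 T, ν / Γ ≤ 1 → √(ν * t) / rbar t < ε₀ →
      |rbar t / r₀ - 1| ≤ 2 * (√(ν * t) / rbar t) ^ 2 := by
  obtain ⟨C, N, hC, hv⟩ := velocity_bounds
  obtain ⟨L, hL, hlog⟩ := exists_log_bound N one_pos
  refine ⟨1 / (1 + C * L), by positivity, by rw [div_le_one (by positivity)]; nlinarith [mul_nonneg hC hL], ?_⟩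
  intro Γ r₀ ν T hΓ hr₀ hν r hr t ht hδ1 ht0
  set ε₀ := 1 / (1 + C * L) with hε₀
  have hε₀1 : ε₀ ≤ 1 := by rw [hε₀, div_le_one (by positivity)]; nlinarith [mul_nonneg hC hL]
  set δ := ν / Γ with hδ
  have hδ0 : 0 < δ := by positivity
  let E : ℝ → ℝ := fun s => √(ν * s) / r s
  have hE0 : ∀ s ∈ Ioo 0 T, 0 < E s := fun s hs => div_pos (sqrt_pos.2 (mul_pos hν hs.1)) (hr.pos s hs)
  have hrd : ∀ s ∈ Ioo 0 T, E s ≤ ε₀ → -(2 * ν / r₀) ≤ rDot Γ r₀ δ (E s) ∧ rDot Γ r₀ δ (E s) ≤ 0 := by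
    intro s hs hle
    have h0 := hE0 s hs
    have h1 : |E s ^ 2 * a2 (log (1 / E s)) δ| ≤ δ := by
      have ha := (hv (log (1 / E s)) δ hδ0.le hδ1).1
      have hl := hlog (E s) h0 (hle.trans hε₀1)
      rw [rpow_one] at hl
      rw [abs_mul, abs_of_nonneg (sq_nonneg _)]
      calc E s ^ 2 * |a2 (log (1 / E s)) δ| ≤ E s ^ 2 * (C * δ * (1 + |log (1 / E s)|) ^ N) := by gcongr
        _ = E s * C * δ * (E s * (1 + |log (1 / E s)|) ^ N) := by ring
        _ ≤ ε₀ * C * δ * L := by gcongr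
        _ = δ * (ε₀ * (C * L)) := by ring
        _ ≤ δ * 1 := by
            refine mul_le_mul_of_nonneg_left ?_ hδ0.le
            rw [hε₀, div_mul_eq_mul_div, one_mul, div_le_one (by positivity)]; linarith
        _ = δ := mul_one _
    obtain ⟨h2, h3⟩ := abs_le.1 h1
    have hg : 0 < Γ / r₀ := by positivity
    have e : Γ / r₀ * δ = ν / r₀ := by rw [hδ]; field_simp
    constructor
    · have : -(2 * ν / r₀) = Γ / r₀ * (-δ + -δ) := by rw [mul_add, mul_neg, e]; ring
      rw [this, rDot]
      exact mul_le_mul_of_nonneg_left (by linarith) hg.le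
    · rw [rDot]; exact mul_nonpos_of_nonneg_of_nonpos hg.le (by linarith)
  have hEc : ContinuousOn E (Ioo 0 T) := fun s hs => by
    refine ContinuousAt.continuousWithinAt (ContinuousAt.div ?_ (hr.ode s hs).continuousAt (hr.pos s hs).ne')
    exact (continuous_const.mul continuous_id).sqrt.continuousAt
  have hsmall : ∀ s ∈ Ioc 0 t, E s ≤ ε₀ := by
    by_contra! hcon
    obtain ⟨s₁, hs₁, hbad⟩ := hcon
    have hsub : Icc s₁ t ⊆ Ioo 0 T := fun u hu => ⟨hs₁.1.trans_le hu.1, hu.2.trans_lt ht.2⟩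
    have hcs := hEc.mono hsub
    let A : Set ℝ := {s ∈ Icc s₁ t | ε₀ ≤ E s}
    have hA : IsCompact A := by
      have : A = Icc s₁ t ∩ E ⁻¹' (Ici ε₀) := by ext; simp [A]
      rw [this]
      exact isCompact_Icc.of_isClosed_subset (hcs.preimage_isClosed_of_isClosed isClosed_Icc isClosed_Ici) inter_subset_left
    obtain ⟨s₂, hs₂, hmax⟩ := hA.exists_isGreatest ⟨s₁, ⟨le_rfl, hs₁.2⟩, hbad.le⟩
    have hlt : ∀ s ∈ Ioc s₂ t, E s < ε₀ := fun s hs => by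
      by_contra! h
      exact absurd (hmax ⟨⟨hs₂.1.1.trans hs.1.le, hs.2⟩, h⟩) (not_le.2 hs.1)
    have hsub2 : Icc s₂ t ⊆ Ioo 0 T := fun u hu => hsub ⟨hs₂.1.1.trans hu.1, hu.2⟩
    have hanti : AntitoneOn r (Icc s₂ t) := by
      refine antitoneOn_of_deriv_nonpos (convex_Icc _ _) (fun s hs => (hr.ode s (hsub2 hs)).continuousAt.continuousWithinAt)
        (fun s hs => ?_) fun s hs => ?_
      · rw [interior_Icc] at hs
        exact (hr.ode s (hsub2 (Ioo_subset_Icc_self hs))).differentiableAt.differentiableWithinAt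
      · rw [interior_Icc] at hs
        rw [(hr.ode s (hsub2 (Ioo_subset_Icc_self hs))).deriv]
        exact (hrd s (hsub2 (Ioo_subset_Icc_self hs)) (hlt s ⟨hs.1, hs.2.le⟩).le).2
    have h2t : s₂ ≤ t := hs₂.1.2
    have h1 : r t ≤ r s₂ := hanti ⟨le_rfl, h2t⟩ ⟨h2t, le_rfl⟩ h2t
    have h2 : E s₂ ≤ E t := div_le_div₀ (sqrt_nonneg _) (sqrt_le_sqrt (mul_le_mul_of_nonneg_left h2t hν.le)) (hr.pos t ht) h1
    have h3 : E t < ε₀ := ht0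
    linarith [hs₂.2]
  have hsub : Icc 0 t ⊆ Ico 0 T := fun u hu => ⟨hu.1, hu.2.trans_lt ht.2⟩
  have hcont : ContinuousOn r (Icc 0 t) := hr.cont.mono hsub
  obtain ⟨c, hc, hmv⟩ := exists_hasDerivAt_eq_slope r (fun s => rDot Γ r₀ δ (E s)) ht.1 hcont fun s hs => hr.ode s ⟨hs.1, hs.2.trans ht.2⟩
  rw [hr.init, sub_zero] at hmv
  obtain ⟨h1, h2⟩ := hrd c ⟨hc.1, hc.2.trans ht.2⟩ (hsmall c ⟨hc.1, hc.2.le⟩)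
  have ht1 := ht.1
  have e1 : r t - r₀ = rDot Γ r₀ δ (E c) * t := by rw [hmv]; field_simp
  have hrt := hr.pos t ht
  have h3 : r t - r₀ ≤ 0 := by rw [e1]; exact mul_nonpos_of_nonpos_of_nonneg h2 ht1.le
  have h4 : -(2 * ν / r₀) * t ≤ r t - r₀ := by rw [e1]; exact mul_le_mul_of_nonneg_right h1 ht1.le
  have h5 : (√(ν * t) / r t) ^ 2 = ν * t / r t ^ 2 := by rw [div_pow, sq_sqrt (by positivity)]
  rw [h5, show r t / r₀ - 1 = -((r₀ - r t) / r₀) by field_simp; ring, abs_neg, abs_of_nonneg (div_nonneg (by linarith) hr₀.le), div_le_iff₀ hr₀]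
  have h6 : 2 * ν / r₀ * t ≤ 2 * (ν * t / r t ^ 2) * r₀ := by
    rw [show 2 * (ν * t / r t ^ 2) * r₀ = (2 * ν * t) * (r₀ / r t ^ 2) by ring, show 2 * ν / r₀ * t = (2 * ν * t) * (1 / r₀) by ring]
    refine mul_le_mul_of_nonneg_left ?_ (by positivity)
    rw [div_le_div_iff₀ hr₀ (by positivity)]
    nlinarith
  linarith

/-! ### Expansion of the function `F` -/

/-- The weight in `1 - 2 sin² = cos (1 - 3/2 sin²) - sin⁴ g`. -/
def kerG (ψ : ℝ) : ℝ := (1 + 3 / 2 * cos ψ) / (1 + cos ψ) ^ 2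

lemma trig_mem {ψ : ℝ} (h : ψ ∈ Icc 0 (π / 2)) : 0 ≤ cos ψ ∧ cos ψ ≤ 1 ∧ 0 ≤ sin ψ ∧ sin ψ ≤ 1 :=
  ⟨cos_nonneg_of_mem_Icc ⟨by linarith [h.1, pi_pos], h.2⟩, cos_le_one ψ, sin_nonneg_of_mem_Icc ⟨h.1, by linarith [h.2, pi_pos]⟩, sin_le_one ψ⟩

lemma kerG_mem {ψ : ℝ} (h : ψ ∈ Icc 0 (π / 2)) : 0 ≤ kerG ψ ∧ kerG ψ ≤ 3 := by
  obtain ⟨h0, h1, -, -⟩ := trig_mem h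
  refine ⟨by unfold kerG; positivity, ?_⟩
  rw [kerG, div_le_iff₀ (by positivity)]; nlinarith

lemma one_sub_two_sin_sq {ψ : ℝ} (h : ψ ∈ Icc 0 (π / 2)) :
    1 - 2 * sin ψ ^ 2 = cos ψ * (1 - 3 / 2 * sin ψ ^ 2) - sin ψ ^ 4 * kerG ψ := by
  obtain ⟨h0, -, -, -⟩ := trig_mem h
  have h1 : 1 + cos ψ ≠ 0 := by positivity
  have e : sin ψ ^ 4 * kerG ψ = (1 - cos ψ) ^ 2 * (1 + 3 / 2 * cos ψ) := by
    rw [kerG, show sin ψ ^ 4 = (sin ψ ^ 2) ^ 2 by ring, sin_sq, show 1 - cos ψ ^ 2 = (1 - cos ψ) * (1 + cos ψ) by ring]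
    field_simp
  rw [e, sin_sq]; ring

lemma continuousOn_kerG : ContinuousOn kerG (uIcc 0 (π / 2)) := by
  rw [uIcc_of_le (by positivity)]
  refine ContinuousOn.div (by fun_prop) (by fun_prop) fun ψ h => ?_
  have := (trig_mem h).1; positivity

lemma integrable_kerG {f : ℝ → ℝ} (hf : Continuous f) : IntervalIntegrable (fun ψ => f ψ * kerG ψ) volume 0 (π / 2) :=
  ContinuousOn.intervalIntegrable (hf.continuousOn.mul continuousOn_kerG)

lemma measurable_kerG : Measurable kerG := by unfold kerG; fun_prop

lemma abs_integral_kerG_le {f : ℝ → ℝ} {C : ℝ} (h : ∀ ψ ∈ Icc 0 (π / 2), |f ψ| ≤ C) :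
    |∫ ψ in (0:ℝ)..(π / 2), f ψ * kerG ψ| ≤ 6 * C := by
  have hC : 0 ≤ C := (abs_nonneg _).trans (h 0 ⟨le_rfl, by positivity⟩)
  have := intervalIntegral.norm_integral_le_of_norm_le_const (a := 0) (b := π / 2) (f := fun ψ => f ψ * kerG ψ) (C := 3 * C) fun ψ hψ => by
    rw [uIoc_of_le (by positivity)] at hψ
    have hm : ψ ∈ Icc 0 (π / 2) := ⟨hψ.1.le, hψ.2⟩
    rw [norm_eq_abs, abs_mul, abs_of_nonneg (kerG_mem hm).1]
    nlinarith [h ψ hm, kerG_mem hm, abs_nonneg (f ψ)]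
  rw [norm_eq_abs, sub_zero, abs_of_pos (show 0 < π / 2 by positivity)] at this
  nlinarith [pi_lt_four]

/-- The integral of the regular part. -/
def kerJ (σ : ℝ) : ℝ := ∫ ψ in (0:ℝ)..(π / 2), sin ψ ^ 4 / √(sin ψ ^ 2 + σ) * kerG ψ

/-- Minus the derivative of `kerJ`. -/
def kerJ' (σ : ℝ) : ℝ := ∫ ψ in (0:ℝ)..(π / 2), sin ψ ^ 4 / (2 * √(sin ψ ^ 2 + σ) ^ 3) * kerG ψ

lemma le_sqrt_add {x σ : ℝ} (hx : 0 ≤ x) (hσ : 0 ≤ σ) : x ≤ √(x ^ 2 + σ) ∧ √(x ^ 2 + σ) ≤ x + √σ := by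
  constructor
  · exact le_sqrt_of_sq_le (by linarith)
  · rw [sqrt_le_left (by positivity)]
    nlinarith [sq_sqrt hσ, mul_nonneg hx (sqrt_nonneg σ)]

lemma integral_sin_cube_kerG : ∫ ψ in (0:ℝ)..(π / 2), sin ψ ^ 3 * kerG ψ = 5 / 4 - log 2 := by
  have hd : ∀ ψ ∈ uIcc 0 (π / 2), HasDerivAt (fun ψ => 3 / 4 * cos ψ ^ 2 - 2 * cos ψ + log (1 + cos ψ)) (sin ψ ^ 3 * kerG ψ) ψ := fun ψ h => by
    rw [uIcc_of_le (by positivity)] at h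
    have h1 : 1 + cos ψ ≠ 0 := by have := (trig_mem h).1; positivity
    have hc := hasDerivAt_cos ψ
    refine ((((hc.pow 2).const_mul (3 / 4)).sub (hc.const_mul 2)).add ((hc.const_add 1).log h1)).congr_deriv ?_
    rw [kerG, show sin ψ ^ 3 = sin ψ * sin ψ ^ 2 by ring, sin_sq]
    field_simp
    ring
  rw [intervalIntegral.integral_eq_sub_of_hasDerivAt hd (integrable_kerG (by fun_prop))]
  simp; ring_nf

lemma integral_sin_kerG : ∫ ψ in (0:ℝ)..(π / 2), sin ψ * kerG ψ = 3 / 2 * log 2 - 1 / 4 := by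
  have hd : ∀ ψ ∈ uIcc 0 (π / 2), HasDerivAt (fun ψ => -(3 / 2 * log (1 + cos ψ) + 1 / 2 * (1 + cos ψ)⁻¹)) (sin ψ * kerG ψ) ψ := fun ψ h => by
    rw [uIcc_of_le (by positivity)] at h
    have h1 : 1 + cos ψ ≠ 0 := by have := (trig_mem h).1; positivity
    have hc := (hasDerivAt_cos ψ).const_add 1
    refine (((hc.log h1).const_mul (3 / 2)).add ((hc.inv h1).const_mul (1 / 2))).neg.congr_deriv ?_
    rw [kerG]
    field_simp
    ring
  rw [intervalIntegral.integral_eq_sub_of_hasDerivAt hd (integrable_kerG (by fun_prop))]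
  simp; ring_nf

lemma continuous_inv_sqrt {σ : ℝ} (hσ : 0 < σ) : Continuous fun ψ => (√(sin ψ ^ 2 + σ))⁻¹ :=
  Continuous.inv₀ (by fun_prop) fun ψ => (sqrt_pos.2 (by positivity)).ne'

lemma abs_kerJ_sub_le {σ : ℝ} (hσ : 0 < σ) : |kerJ σ - (5 / 4 - log 2)| ≤ 6 * √σ := by
  have hc := continuous_inv_sqrt hσ
  have hi := intervalIntegral.integral_sub (integrable_kerG (f := fun ψ => sin ψ ^ 4 / √(sin ψ ^ 2 + σ)) (by simp only [div_eq_mul_inv]; fun_prop))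
    (integrable_kerG (f := fun ψ => sin ψ ^ 3) (by fun_prop))
  simp only [← sub_mul] at hi
  rw [kerJ, ← integral_sin_cube_kerG, ← hi]
  refine abs_integral_kerG_le fun ψ h => ?_
  obtain ⟨-, -, h0, h1⟩ := trig_mem h
  obtain ⟨w1, w2⟩ := le_sqrt_add h0 hσ.le
  have hw : 0 < √(sin ψ ^ 2 + σ) := sqrt_pos.2 (by positivity)
  set x := sin ψ
  set w := √(x ^ 2 + σ)
  have e : x ^ 4 / w - x ^ 3 = -(x ^ 3 / w * (w - x)) := by field_simp; ring
  have h2 : x ^ 3 / w ≤ 1 := by rw [div_le_one hw]; nlinarith [pow_le_one₀ h0 h1 (n := 2), sq_nonneg x]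
  rw [e, abs_neg, abs_of_nonneg (mul_nonneg (by positivity) (by linarith))]
  calc x ^ 3 / w * (w - x) ≤ 1 * (w - x) := mul_le_mul_of_nonneg_right h2 (by linarith)
    _ ≤ √σ := by linarith

lemma abs_kerJ'_sub_le {σ : ℝ} (hσ : 0 < σ) : |kerJ' σ - (3 / 4 * log 2 - 1 / 8)| ≤ 12 * √σ := by
  have hc := continuous_inv_sqrt hσ
  have hi := integral_sin_kerG
  have e0 : 3 / 4 * log 2 - 1 / 8 = ∫ ψ in (0:ℝ)..(π / 2), sin ψ / 2 * kerG ψ := by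
    have : ∀ ψ, sin ψ / 2 * kerG ψ = 1 / 2 * (sin ψ * kerG ψ) := fun ψ => by ring
    simp_rw [this]
    rw [intervalIntegral.integral_const_mul, hi]; ring
  have e1 : ∀ ψ, sin ψ ^ 4 / (2 * √(sin ψ ^ 2 + σ) ^ 3) = sin ψ ^ 4 * (1 / 2 * (√(sin ψ ^ 2 + σ))⁻¹ ^ 3) := fun ψ => by rw [inv_pow]; field_simp
  have hs := intervalIntegral.integral_sub (integrable_kerG (f := fun ψ => sin ψ ^ 4 / (2 * √(sin ψ ^ 2 + σ) ^ 3)) (by simp only [e1]; fun_prop))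
    (integrable_kerG (f := fun ψ => sin ψ / 2) (by fun_prop))
  simp only [← sub_mul] at hs
  rw [kerJ', e0, ← hs]
  refine (abs_integral_kerG_le (C := 2 * √σ) fun ψ h => ?_).trans (by linarith [sqrt_nonneg σ])
  obtain ⟨-, -, h0, h1⟩ := trig_mem h
  obtain ⟨w1, w2⟩ := le_sqrt_add h0 hσ.le
  have hw : 0 < √(sin ψ ^ 2 + σ) := sqrt_pos.2 (by positivity)
  set x := sin ψ
  set w := √(x ^ 2 + σ)
  have e : x ^ 4 / (2 * w ^ 3) - x / 2 = -(x * (w ^ 2 + w * x + x ^ 2) / (2 * w ^ 3) * (w - x)) := by field_simp; ring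
  have h2 : x * (w ^ 2 + w * x + x ^ 2) / (2 * w ^ 3) ≤ 2 := by
    rw [div_le_iff₀ (by positivity)]
    have a1 : x * w ^ 2 ≤ w * w ^ 2 := mul_le_mul_of_nonneg_right w1 (by positivity)
    have a2 : x * (w * x) ≤ w * (w * w) := by gcongr
    have a3 : x * x ^ 2 ≤ w * w ^ 2 := by gcongr
    have := pow_pos hw 3
    nlinarith
  rw [e, abs_neg, abs_of_nonneg (mul_nonneg (by positivity) (by linarith))]
  calc _ ≤ 2 * (w - x) := mul_le_mul_of_nonneg_right h2 (by linarith)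
    _ ≤ 2 * √σ := by linarith

lemma hasDerivAt_kerJ {σ : ℝ} (hσ : 0 < σ) : HasDerivAt kerJ (-kerJ' σ) σ := by
  have key : ∀ (ψ τ : ℝ), 0 < τ → HasDerivAt (fun τ => sin ψ ^ 4 / √(sin ψ ^ 2 + τ) * kerG ψ)
      (-(sin ψ ^ 4 / (2 * √(sin ψ ^ 2 + τ) ^ 3) * kerG ψ)) τ := fun ψ τ hτ => by
    have hp : 0 < sin ψ ^ 2 + τ := by positivity
    have hw := (sqrt_pos.2 hp).ne'
    have h1 := ((hasDerivAt_id τ).const_add (sin ψ ^ 2)).sqrt hp.ne'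
    refine (((hasDerivAt_const τ (sin ψ ^ 4)).div h1 hw).mul_const (kerG ψ)).congr_deriv ?_
    simp only [id]
    field_simp
    ring
  have hm : ∀ τ, Measurable fun ψ => sin ψ ^ 4 / √(sin ψ ^ 2 + τ) * kerG ψ := fun τ => Measurable.mul (by fun_prop) measurable_kerG
  have hm' : Measurable fun ψ => -(sin ψ ^ 4 / (2 * √(sin ψ ^ 2 + σ) ^ 3) * kerG ψ) := (Measurable.mul (by fun_prop) measurable_kerG).neg
  have hc := continuous_inv_sqrt hσ
  have h := (intervalIntegral.hasDerivAt_integral_of_dominated_loc_of_deriv_le (μ := volume) (a := 0) (b := π / 2)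
    (F := fun τ ψ => sin ψ ^ 4 / √(sin ψ ^ 2 + τ) * kerG ψ) (F' := fun τ ψ => -(sin ψ ^ 4 / (2 * √(sin ψ ^ 2 + τ) ^ 3) * kerG ψ))
    (x₀ := σ) (s := Ioi 0) (bound := fun _ => 3) (Ioi_mem_nhds hσ) (.of_forall fun τ => (hm τ).aestronglyMeasurable)
    (integrable_kerG (f := fun ψ => sin ψ ^ 4 / √(sin ψ ^ 2 + σ)) (by simp only [div_eq_mul_inv]; fun_prop))
    hm'.aestronglyMeasurable (.of_forall fun ψ hψ τ hτ => ?_) (by simp) (.of_forall fun ψ _ τ hτ => key ψ τ hτ)).2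
  · refine h.congr_deriv ?_
    rw [intervalIntegral.integral_neg, kerJ']
  · rw [uIoc_of_le (by positivity)] at hψ
    have hm : ψ ∈ Icc 0 (π / 2) := ⟨hψ.1.le, hψ.2⟩
    have hτ' : 0 < τ := hτ
    obtain ⟨-, -, h0, h1⟩ := trig_mem hm
    obtain ⟨w1, w2⟩ := le_sqrt_add h0 hτ'.le
    obtain ⟨g0, g1⟩ := kerG_mem hm
    have hw : 0 < √(sin ψ ^ 2 + τ) := sqrt_pos.2 (by positivity)
    rw [norm_neg, norm_eq_abs, abs_of_nonneg (by positivity)]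
    have h2 : sin ψ ^ 4 / (2 * √(sin ψ ^ 2 + τ) ^ 3) ≤ 1 := by
      rw [div_le_one (by positivity)]
      have a3 : sin ψ ^ 3 ≤ √(sin ψ ^ 2 + τ) ^ 3 := by gcongr
      nlinarith [pow_nonneg h0 3]
    calc _ ≤ 1 * 3 := mul_le_mul h2 g1 g0 zero_le_one
      _ = 3 := one_mul 3

/-- The elementary part of the remainder in the expansion of `F`. -/
def kerM (σ : ℝ) : ℝ := (log (1 + √(1 + σ)) - 2 * log 2) * (1 + 3 / 4 * σ) - 3 / 4 * √(1 + σ) + 2 + σ / 4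

def kerM' (σ : ℝ) : ℝ := 3 / 4 * (log (1 + √(1 + σ)) - 2 * log 2) + (1 + 3 / 4 * σ) / (2 * √(1 + σ) * (1 + √(1 + σ))) - 3 / 8 / √(1 + σ) + 1 / 4

lemma hasDerivAt_kerM {σ : ℝ} (hσ : -1 < σ) : HasDerivAt kerM (kerM' σ) σ := by
  have hp : 0 < 1 + σ := by linarith
  have h1 := ((hasDerivAt_id σ).const_add 1).sqrt hp.ne'
  have h2 := ((h1.const_add 1).log (by positivity)).sub_const (2 * log 2)
  have h3 := ((hasDerivAt_id σ).const_mul (3 / 4)).const_add 1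
  refine ((((h2.mul h3).sub (h1.const_mul (3 / 4))).add_const 2).add ((hasDerivAt_id σ).div_const 4)).congr_deriv ?_
  simp only [id, kerM']
  field_simp
  ring

lemma abs_kerM'_sub_le {σ : ℝ} (hσ : 0 < σ) : |kerM' σ - (-(3 / 4 * log 2) + 1 / 8)| ≤ 2 * σ := by
  have hq := sq_sqrt (show 0 ≤ 1 + σ by linarith)
  have hw1 : 1 ≤ √(1 + σ) := one_le_sqrt.2 (by linarith)
  rw [kerM']
  set w := √(1 + σ)
  have hs : σ = w ^ 2 - 1 := by linarith
  have hw0 : 0 < w := by linarith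
  have e1 : (1 + 3 / 4 * σ) / (2 * w * (1 + w)) - 1 / 4 = (w - 1) * ((w - 1) / (8 * w * (1 + w))) := by rw [hs]; field_simp; ring
  have e2 : -(3 / 8 / w) + 3 / 8 = (w - 1) * (3 / (8 * w)) := by field_simp; ring
  have b1 : 0 ≤ (w - 1) / (8 * w * (1 + w)) ∧ (w - 1) / (8 * w * (1 + w)) ≤ 1 := by
    refine ⟨div_nonneg (by linarith) (by positivity), ?_⟩
    rw [div_le_one (by positivity)]; nlinarith
  have b2 : 0 ≤ 3 / (8 * w) ∧ 3 / (8 * w) ≤ 1 := by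
    refine ⟨by positivity, ?_⟩
    rw [div_le_one (by positivity)]; linarith
  have hl0 : log 2 ≤ log (1 + w) := log_le_log two_pos (by linarith)
  have hl : log (1 + w) - log 2 ≤ w - 1 := by
    rw [← log_div (by positivity) two_ne_zero]
    exact (log_le_sub_one_of_pos (by positivity)).trans (by linarith)
  have hws : w - 1 ≤ σ / 2 := by rw [hs]; nlinarith
  have e : 3 / 4 * (log (1 + w) - 2 * log 2) + (1 + 3 / 4 * σ) / (2 * w * (1 + w)) - 3 / 8 / w + 1 / 4 - (-(3 / 4 * log 2) + 1 / 8)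
      = 3 / 4 * (log (1 + w) - log 2) + (w - 1) * ((w - 1) / (8 * w * (1 + w))) + (w - 1) * (3 / (8 * w)) := by
    rw [← e1, ← e2]; ring
  have hw2 : 0 ≤ w - 1 := by linarith
  rw [e, abs_of_nonneg (by have := mul_nonneg hw2 b1.1; have := mul_nonneg hw2 b2.1; linarith)]
  have := mul_le_mul_of_nonneg_left b1.2 hw2
  have := mul_le_mul_of_nonneg_left b2.2 hw2
  linarith

lemma kerF_eq {s : ℝ} (hs : 0 < s) :
    kerF s = (log 8 - 1 / 2 * log s) * (1 + 3 / 16 * s) - 2 - s / 16 + (kerM (s / 4) - kerJ (s / 4)) := by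
  set σ := s / 4 with hσ'
  have hσ : 0 < σ := by positivity
  have hc := continuous_inv_sqrt hσ
  have h1 : kerF s = (∫ ψ in (0:ℝ)..(π / 2), cos ψ * (1 - 3 / 2 * sin ψ ^ 2) / √(sin ψ ^ 2 + σ)) - kerJ σ := by
    have hc1 : Continuous fun ψ => cos ψ * (1 - 3 / 2 * sin ψ ^ 2) / √(sin ψ ^ 2 + σ) := by simp only [div_eq_mul_inv]; fun_prop
    have hi := intervalIntegral.integral_sub (hc1.intervalIntegrable 0 (π / 2))
      (integrable_kerG (f := fun ψ => sin ψ ^ 4 / √(sin ψ ^ 2 + σ)) (by simp only [div_eq_mul_inv]; fun_prop))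
    rw [kerF, kerJ, ← hi]
    refine intervalIntegral.integral_congr fun ψ h => ?_
    rw [uIcc_of_le (by positivity)] at h
    rw [one_sub_two_sin_sq h]; ring
  have hd : ∀ ψ ∈ uIcc 0 (π / 2), HasDerivAt (fun ψ => log (sin ψ + √(sin ψ ^ 2 + σ)) * (1 + 3 / 4 * σ)
      - 3 / 4 * (sin ψ * √(sin ψ ^ 2 + σ))) (cos ψ * (1 - 3 / 2 * sin ψ ^ 2) / √(sin ψ ^ 2 + σ)) ψ := fun ψ h => by
    rw [uIcc_of_le (by positivity)] at h
    have h0 := (trig_mem h).2.2.1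
    have hp : 0 < sin ψ ^ 2 + σ := by positivity
    have hw := sqrt_pos.2 hp
    have hq := sq_sqrt hp.le
    have d0 := hasDerivAt_sin ψ
    have d1 : HasDerivAt (fun ψ => √(sin ψ ^ 2 + σ)) (sin ψ * cos ψ / √(sin ψ ^ 2 + σ)) ψ :=
      (((d0.pow 2).add_const σ).sqrt hp.ne').congr_deriv (by simp; field_simp)
    have d2 : HasDerivAt (fun ψ => sin ψ + √(sin ψ ^ 2 + σ)) (cos ψ + sin ψ * cos ψ / √(sin ψ ^ 2 + σ)) ψ := d0.add d1
    have d3 : HasDerivAt (fun ψ => sin ψ * √(sin ψ ^ 2 + σ)) _ ψ := d0.mul d1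
    refine (((d2.log (by positivity)).mul_const (1 + 3 / 4 * σ)).sub (d3.const_mul (3 / 4))).congr_deriv ?_
    set w := √(sin ψ ^ 2 + σ)
    have hσw : σ = w ^ 2 - sin ψ ^ 2 := by linarith
    have hsw : sin ψ + w ≠ 0 := by positivity
    field_simp
    rw [hσw]
    ring
  rw [h1, intervalIntegral.integral_eq_sub_of_hasDerivAt hd (Continuous.intervalIntegrable (by simp only [div_eq_mul_inv]; fun_prop) _ _)]
  have hl : log (√σ) = 1 / 2 * log s - log 2 := by
    rw [log_sqrt hσ.le, hσ', log_div hs.ne' (by norm_num), show (4:ℝ) = 2 ^ 2 by norm_num, log_pow]; push_cast; ring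
  have h8 : log 8 = 3 * log 2 := by rw [show (8:ℝ) = 2 ^ 3 by norm_num, log_pow]; push_cast; ring
  simp only [sin_pi_div_two, sin_zero, one_pow, ne_eq, OfNat.ofNat_ne_zero, not_false_eq_true, zero_pow, zero_add, zero_mul, mul_zero, hl, h8, kerM, one_mul]
  rw [show s = 4 * σ by rw [hσ']; ring] at *
  ring

/-- The remainder in the expansion of `F`. -/
def kerE (s : ℝ) : ℝ := kerM (s / 4) - kerJ (s / 4)
def kerE' (s : ℝ) : ℝ := 1 / 4 * (kerM' (s / 4) + kerJ' (s / 4))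

lemma hasDerivAt_kerE {s : ℝ} (hs : 0 < s) : HasDerivAt kerE (kerE' s) s := by
  have h4 : HasDerivAt (fun s : ℝ => s / 4) (1 / 4) s := (hasDerivAt_id s).div_const 4
  refine (((hasDerivAt_kerM (σ := s / 4) (by linarith)).comp s h4).sub ((hasDerivAt_kerJ (σ := s / 4) (by positivity)).comp s h4)).congr_deriv ?_
  rw [kerE']; ring

lemma abs_kerE'_le {s : ℝ} (hs : 0 < s) (h1 : s ≤ 1) : |kerE' s| ≤ 4 * √s := by
  have hσ : 0 < s / 4 := by positivity
  have a1 := abs_kerM'_sub_le hσ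
  have a2 := abs_kerJ'_sub_le hσ
  have e : kerE' s = 1 / 4 * ((kerM' (s / 4) - (-(3 / 4 * log 2) + 1 / 8)) + (kerJ' (s / 4) - (3 / 4 * log 2 - 1 / 8))) := by rw [kerE']; ring
  have hq : √(s / 4) ≤ √s := sqrt_le_sqrt (by linarith)
  have hq2 : s ≤ √s := by
    have := sqrt_le_one.2 h1
    nlinarith [sq_sqrt hs.le, sqrt_nonneg s]
  rw [e, abs_mul, abs_of_pos (by norm_num : (0:ℝ) < 1 / 4)]
  have := abs_add_le (kerM' (s / 4) - (-(3 / 4 * log 2) + 1 / 8)) (kerJ' (s / 4) - (3 / 4 * log 2 - 1 / 8))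
  linarith

lemma abs_kerE_le {s : ℝ} (hs : 0 < s) (h1 : s ≤ 1) : |kerE s| ≤ 4 * √s * s := by
  let f : ℝ → ℝ := fun t => if t ≤ 0 then 0 else kerE t
  have hf : ∀ t, 0 < t → f t = kerE t := fun t ht => if_neg (not_le.2 ht)
  have h0 : ∀ t, 0 < t → t ≤ 1 → |kerE t| ≤ 12 * √t := fun t ht ht1 => by
    have hσ : 0 < t / 4 := by positivity
    have a1 := abs_kerJ_sub_le hσ
    have hq : √(t / 4) ≤ √t := sqrt_le_sqrt (by linarith)
    have hq2 : t ≤ √t := by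
      have := sqrt_le_one.2 ht1
      nlinarith [sq_sqrt ht.le, sqrt_nonneg t]
    have a2 : |kerM (t / 4) - (5 / 4 - log 2)| ≤ 4 * t := by
      obtain ⟨c, hc, hm⟩ := exists_hasDerivAt_eq_slope kerM kerM' hσ
        (fun u hu => (hasDerivAt_kerM (by linarith [hu.1])).continuousAt.continuousWithinAt) fun u hu => hasDerivAt_kerM (by linarith [hu.1])
      have b := abs_kerM'_sub_le hc.1
      have hk : kerM 0 = 5 / 4 - log 2 := by rw [kerM, add_zero, sqrt_one]; norm_num; ring
      have hb : |kerM' c| ≤ 4 := by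
        have := abs_add_le (kerM' c - (-(3 / 4 * log 2) + 1 / 8)) (-(3 / 4 * log 2) + 1 / 8)
        rw [sub_add_cancel] at this
        have hl : |-(3 / 4 * log 2) + 1 / 8| ≤ 1 := by rw [abs_le]; constructor <;> linarith [log_two_lt_d9, log_two_gt_d9]
        linarith [hc.2]
      rw [← hk, show kerM (t / 4) - kerM 0 = kerM' c * (t / 4) by rw [hm, sub_zero, div_mul_cancel₀ _ hσ.ne'], abs_mul, abs_of_pos hσ]
      nlinarith
    have := abs_sub (kerM (t / 4) - (5 / 4 - log 2)) (kerJ (t / 4) - (5 / 4 - log 2))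
    rw [sub_sub_sub_cancel_right] at this
    rw [kerE]; linarith
  have hc : ContinuousOn f (Icc 0 s) := by
    intro t ht
    rcases ht.1.eq_or_lt with rfl | hpos
    · have hl : Filter.Tendsto (fun t => 12 * √t) (nhdsWithin 0 (Icc 0 s)) (nhds 0) := by
        have : Continuous fun t => 12 * √t := by fun_prop
        simpa using (this.tendsto 0).mono_left nhdsWithin_le_nhds
      have : f 0 = 0 := if_pos le_rfl
      rw [ContinuousWithinAt, this]
      refine squeeze_zero_norm' ?_ hl
      filter_upwards [self_mem_nhdsWithin] with u hu
      rcases hu.1.eq_or_lt with rfl | hu0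
      · simp [this]
      · rw [hf u hu0]; exact h0 u hu0 (hu.2.trans h1)
    · refine ContinuousAt.continuousWithinAt ((hasDerivAt_kerE hpos).continuousAt.congr ?_)
      filter_upwards [eventually_gt_nhds hpos] with u hu using (hf u hu).symm
  obtain ⟨c, hcm, hm⟩ := exists_hasDerivAt_eq_slope f kerE' hs hc fun u hu => by
    refine (hasDerivAt_kerE hu.1).congr_of_eventuallyEq ?_
    filter_upwards [eventually_gt_nhds hu.1] with v hv using hf v hv
  rw [hf s hs, show f 0 = 0 from if_pos le_rfl, sub_zero, sub_zero] at hm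
  have h2 := abs_kerE'_le hcm.1 (hcm.2.le.trans h1)
  have h3 : √c ≤ √s := sqrt_le_sqrt hcm.2.le
  rw [show kerE s = kerE' c * s by rw [hm]; field_simp, abs_mul, abs_of_pos hs]
  exact mul_le_mul_of_nonneg_right (by linarith) hs.le

/-! ### Expansion of the Biot-Savart kernel -/

section
variable {ι : Type*} {S : Set ι} {e J : ι → ℝ} {x : ι → ℝ²} {F : ι → ℝ² → ℝ}

lemma DBd.comp_of_deriv (hs : IsScale S e J) (hF : DBd S e J x 1 F) {g g' : ℝ → ℝ} {r C : ℝ} (hC : 0 ≤ C) (k : ℕ)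
    (hr : ∀ i ∈ S, |F i (x i)| ≤ r) (h0 : g 0 = 0) (hg : ∀ y, |y| ≤ r → HasDerivAt g (g' y) y)
    (h1 : ∀ y, |y| ≤ r → |g' y| ≤ C * |y| ^ k) : DBd S e J x (k + 1) fun i X => g (F i X) := by
  refine hF.comp hs hC hr hg (fun y hy => ?_) h1
  have h := (convex_Icc (-|y|) |y|).norm_image_sub_le_of_norm_hasDerivWithin_le (f := g) (f' := g') (C := C * |y| ^ k)
    (fun z hz => (hg z ((abs_le.2 hz).trans hy)).hasDerivWithinAt) (fun z hz => by
      have hz' := abs_le.2 hz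
      exact (h1 z (hz'.trans hy)).trans (by gcongr)) (x := 0) (y := y)
    ⟨by simp, by simp⟩ ⟨neg_abs_le y, le_abs_self y⟩
  rw [h0, sub_zero, sub_zero, norm_eq_abs, norm_eq_abs] at h
  rwa [pow_succ, ← mul_assoc]

/-- The third order remainder of `√(1 + y)`. -/
def sqrtRem (y : ℝ) : ℝ := √(1 + y) - (1 + y / 2 - y ^ 2 / 8)
/-- The third order remainder of `log (1 + y)`. -/
def logRem (y : ℝ) : ℝ := log (1 + y) - (y - y ^ 2 / 2)
/-- The first order remainder of `1 / √(1 + y)`. -/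
def invSqrtRem (y : ℝ) : ℝ := (√(1 + y))⁻¹ - 1

lemma DBd.sqrtRem (hs : IsScale S e J) (hF : DBd S e J x 1 F) (hr : ∀ i ∈ S, |F i (x i)| ≤ 1 / 4) :
    DBd S e J x 3 fun i X => sqrtRem (F i X) := by
  refine hF.comp_of_deriv hs (g' := fun y => 1 / (2 * √(1 + y)) - (1 / 2 - y / 4)) zero_le_one 2 hr (by simp [VortexRing.sqrtRem])
    (fun y hy => ?_) fun y hy => ?_ <;> obtain ⟨h1, h2⟩ := abs_le.1 hy
  · have := (((hasDerivAt_id y).const_add 1).sqrt (by simp only [id]; linarith)).sub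
      ((((hasDerivAt_id y).div_const 2).const_add 1).sub (((hasDerivAt_id y).pow 2).div_const 8))
    refine this.congr_deriv ?_
    simp; ring
  · have hw := sq_sqrt (show 0 ≤ 1 + y by linarith)
    have hw0 : 4 / 5 ≤ √(1 + y) := le_sqrt_of_sq_le (by norm_num; linarith)
    set w := √(1 + y)
    have e : 1 / (2 * w) - (1 / 2 - y / 4) = (w - 1) ^ 2 * ((w + 2) / (4 * w)) := by rw [show y = w ^ 2 - 1 by linarith]; field_simp; ring
    have b : (w + 2) / (4 * w) ≤ 1 := by rw [div_le_one (by linarith)]; linarith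
    have c : (w - 1) ^ 2 ≤ |y| ^ 2 := by
      rw [sq_abs, show y = (w - 1) * (w + 1) by linarith, mul_pow]
      nlinarith [sq_nonneg (w - 1)]
    rw [e, abs_of_nonneg (by positivity), one_mul]
    exact (mul_le_of_le_one_right (sq_nonneg _) b).trans c

lemma DBd.logRem (hs : IsScale S e J) (hF : DBd S e J x 1 F) (hr : ∀ i ∈ S, |F i (x i)| ≤ 1 / 4) :
    DBd S e J x 3 fun i X => logRem (F i X) := by
  refine hF.comp_of_deriv hs (g' := fun y => 1 / (1 + y) - (1 - y)) two_pos.le 2 hr (by simp [VortexRing.logRem])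
    (fun y hy => ?_) fun y hy => ?_ <;> obtain ⟨h1, h2⟩ := abs_le.1 hy
  · have := (((hasDerivAt_id y).const_add 1).log (by simp only [id]; linarith)).sub
      ((hasDerivAt_id y).sub (((hasDerivAt_id y).pow 2).div_const 2))
    refine this.congr_deriv ?_
    simp
  · have h3 : 0 < 1 + y := by linarith
    rw [show 1 / (1 + y) - (1 - y) = y ^ 2 / (1 + y) by field_simp; ring, sq_abs, abs_of_nonneg (by positivity), div_le_iff₀ h3]
    nlinarith [sq_nonneg y]

lemma DBd.invSqrtRem (hs : IsScale S e J) (hF : DBd S e J x 1 F) (hr : ∀ i ∈ S, |F i (x i)| ≤ 1 / 4) :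
    DBd S e J x 1 fun i X => invSqrtRem (F i X) := by
  refine hF.comp_of_deriv hs (g' := fun y => -(1 / (2 * √(1 + y))) / √(1 + y) ^ 2) zero_le_one 0 hr (by simp [VortexRing.invSqrtRem])
    (fun y hy => ?_) fun y hy => ?_ <;> obtain ⟨h1, h2⟩ := abs_le.1 hy
  · have hp : 0 < 1 + y := by linarith
    have := ((((hasDerivAt_id y).const_add 1).sqrt hp.ne').inv (sqrt_pos.2 hp).ne').sub_const 1
    exact this
  · have hw0 : 4 / 5 ≤ √(1 + y) := le_sqrt_of_sq_le (by norm_num; linarith)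
    set w := √(1 + y)
    rw [show -(1 / (2 * w)) / w ^ 2 = -(1 / (2 * w ^ 3)) by field_simp, abs_neg, abs_of_pos (by positivity), pow_zero, mul_one,
      div_le_one (by positivity)]
    have : (4 / 5 : ℝ) ^ 3 ≤ w ^ 3 := by gcongr
    norm_num at this; linarith

lemma Bd.sqrt (hs : IsScale S e J) {f : ι → ℝ} (hf : Bd S e J 2 f) : Bd S e J 1 fun i => √(f i) := by
  obtain ⟨C, N, hC, h⟩ := hf
  refine ⟨√C, N, sqrt_nonneg C, fun i hi => ?_⟩
  have h0 := hs.nonneg i hi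
  have hJ := hs.one_le i hi
  rw [abs_of_nonneg (sqrt_nonneg _), sqrt_le_left (by positivity), mul_pow, mul_pow, sq_sqrt hC, pow_one]
  refine ((le_abs_self _).trans (h i hi)).trans (mul_le_mul_of_nonneg_left ?_ (by positivity))
  exact le_self_pow₀ (one_le_pow₀ hJ) two_ne_zero

end

/-- The kernel of `BS^ε` as a function of `X` and `V = X - Y`. -/
def kerFull (ε : ℝ) (V X : ℝ²) : ℝ := √((1 + ε * X.1) * (1 + ε * (X.1 - V.1)))
  * kerF (ε ^ 2 * (V.1 ^ 2 + V.2 ^ 2) / ((1 + ε * X.1) * (1 + ε * (X.1 - V.1))))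

/-- The first three terms of its expansion. -/
def kerTwo (ε : ℝ) (V X : ℝ²) : ℝ :=
  (log (1 / ε) + lk V) * (1 + ε * polP 1 X (X - V) + ε ^ 2 * polP 2 X (X - V)) + (-2 + ε * polQ 1 X (X - V) + ε ^ 2 * polQ 2 X (X - V))

/-- Points `(ε, X, V)` such that `X` and `X - V` are well inside the half-plane. -/
def kerDom : Set (ℝ × ℝ² × ℝ²) :=
  {i | 0 < i.1 ∧ i.1 ≤ 1 ∧ i.1 * rho i.2.1 ≤ 1 / 4 ∧ i.1 * rho (i.2.1 - i.2.2) ≤ 1 / 4 ∧ i.2.2.1 ≠ 0}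

lemma isScale_kerDom : IsScale kerDom (fun i => i.1) fun i => ⟪i.2.1⟫ * ⟪i.2.2⟫ :=
  ⟨fun _ h => h.1.le, fun _ h => h.2.1, fun _ _ => one_le_mul_of_one_le_of_one_le (one_le_jb _) (one_le_jb _)⟩

lemma abs_fst_le_rho (X : ℝ²) : |X.1| ≤ rho X := abs_le_sqrt (by nlinarith [sq_nonneg X.2])

lemma rho_sub_le (X Y : ℝ²) : rho (X - Y) ^ 2 ≤ 2 * (rho X ^ 2 + rho Y ^ 2) := by
  rw [rho, rho, rho, rho_sq, rho_sq, rho_sq, Prod.fst_sub, Prod.snd_sub]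
  nlinarith [sq_nonneg (X.1 + Y.1), sq_nonneg (X.2 + Y.2)]

/-- The argument of `kerF` in `kerFull`, as a polynomial in bounded quantities. -/
def kerArg (i : ℝ × ℝ² × ℝ²) (X : ℝ²) : ℝ := i.1 ^ 2 * (i.2.2.1 ^ 2 + i.2.2.2 ^ 2) * (1 + invSqrtRem (i.1 * X.1)) ^ (2:ℕ)
  * (1 + invSqrtRem (i.1 * (X.1 - i.2.2.1))) ^ (2:ℕ)

/-- `DBd` on `kerDom`. -/
abbrev KDBd (k : ℕ) (F : ℝ × ℝ² × ℝ² → ℝ² → ℝ) : Prop := DBd kerDom (fun i => i.1) (fun i => ⟪i.2.1⟫ * ⟪i.2.2⟫) (fun i => i.2.1) k F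

lemma kernel_expansion : ∃ A B : ℝ × ℝ² × ℝ² → ℝ² → ℝ, KDBd 3 A ∧ KDBd 3 B ∧
    ∀ i ∈ kerDom, (fun X => kerFull i.1 i.2.2 X - kerTwo i.1 i.2.2 X) =ᶠ[nhds i.2.1]
      fun X => (log (1 / i.1) + lk i.2.2) * A i X + B i X := by
  have hs := isScale_kerDom
  have hV : ∀ {f : ℝ² → ℝ}, PB f → Bd kerDom (fun i => i.1) (fun i => ⟪i.2.1⟫ * ⟪i.2.2⟫) 0 fun i => f i.2.2 := fun hf =>
    Bd.of_pb hf fun i _ => by nlinarith [norm_nonneg i.2.1, norm_nonneg i.2.2]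
  have hR : KDBd 0 fun _ X => X.1 :=
    .of_tg TG.cR fun i _ => by nlinarith [norm_nonneg i.2.1, norm_nonneg i.2.2]
  have hε := DBd.param (x := fun i : ℝ × ℝ² × ℝ² => i.2.1) (Bd.small hs)
  have ha : DBd kerDom _ _ _ 1 fun i X => i.1 * X.1 := hε.mul hs hR
  have hb : DBd kerDom _ _ _ 1 fun i X => i.1 * (X.1 - i.2.2.1) := hε.mul hs (hR.sub hs (.param (hV TG.cR.pb)))
  have hd : DBd kerDom _ _ (fun i => i.2.1) 2 fun i _ => i.1 ^ 2 * (i.2.2.1 ^ 2 + i.2.2.2 ^ 2) :=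
    .param (((Bd.small hs).pow hs 2).mul hs (hV ((TG.cR.pow 2).add (TG.cZ.pow 2)).pb))
  have ra : ∀ i ∈ kerDom, |i.1 * i.2.1.1| ≤ 1 / 4 := fun i hi => by
    rw [abs_mul, abs_of_pos hi.1]
    exact (mul_le_mul_of_nonneg_left (abs_fst_le_rho _) hi.1.le).trans hi.2.2.1
  have rb : ∀ i ∈ kerDom, |i.1 * (i.2.1.1 - i.2.2.1)| ≤ 1 / 4 := fun i hi => by
    rw [abs_mul, abs_of_pos hi.1]
    exact (mul_le_mul_of_nonneg_left (abs_fst_le_rho (i.2.1 - i.2.2)) hi.1.le).trans hi.2.2.2.1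
  have hRA := ha.sqrtRem hs ra
  have hRB := hb.sqrtRem hs rb
  have hLA := ha.logRem hs ra
  have hLB := hb.logRem hs rb
  have hIA := ha.invSqrtRem hs ra
  have hIB := hb.invSqrtRem hs rb
  have h1 : KDBd 0 fun _ _ => 1 := .const 1
  have tA := ((h1.add hs ((ha.smul hs (1 / 2)).mono hs zero_le_one)).sub hs (((ha.pow hs 2).smul hs (1 / 8)).mono hs zero_le_two))
  have hSA := tA.add hs (hRA.mono hs (Nat.zero_le 3))
  have hSB := ((h1.add hs ((hb.smul hs (1 / 2)).mono hs zero_le_one)).sub hs (((hb.pow hs 2).smul hs (1 / 8)).mono hs zero_le_two)).add hs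
    (hRB.mono hs (Nat.zero_le 3))
  have hJA := h1.add hs (hIA.mono hs zero_le_one)
  have hJB := h1.add hs (hIB.mono hs zero_le_one)
  have hII := ((hIA.mul hs hJB).mono hs (l := 1) (by norm_num)).add hs hIB
  have hSS := (((((ha.mul hs (hb.pow hs 2)).mono hs (l := 3) (by simp)).add hs
    (((ha.pow hs 2).mul hs hb).mono hs (l := 3) (by simp))).smul hs (-(1 / 16))).add hs
    ((((ha.pow hs 2).mul hs (hb.pow hs 2)).mono hs (l := 3) (by simp)).smul hs (1 / 64))).add hs
    (((hRA.mul hs hSB).mono hs (l := 3) (by simp)).add hs ((tA.mul hs hRB).mono hs (l := 3) (by simp)))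
  have hA3 := hSS.add hs (((hd.mul hs hII).mono hs (l := 3) (by simp)).smul hs (3 / 16))
  have hA2 := (((((ha.sub hs hb).pow hs 2).mono hs (l := 2) (by norm_num)).smul hs (-(1 / 8))).add hs (hd.smul hs (3 / 16))).add hs
    (hA3.mono hs (l := 2) (by norm_num))
  have hA := (h1.add hs (((ha.add hs hb).smul hs (1 / 2)).mono hs zero_le_one)).add hs (hA2.mono hs zero_le_two)
  have hq : KDBd 2 kerArg := ((hd.mul hs (hJA.pow hs 2)).mul hs (hJB.pow hs 2)).mono hs (l := 2) (by norm_num)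
  have pos : ∀ i ∈ kerDom, 0 < 1 + i.1 * i.2.1.1 ∧ 0 < 1 + i.1 * (i.2.1.1 - i.2.2.1) := fun i hi =>
    ⟨by linarith [(abs_le.1 (ra i hi)).1], by linarith [(abs_le.1 (rb i hi)).1]⟩
  have hVp : ∀ i ∈ kerDom, 0 < i.1 ^ 2 * (i.2.2.1 ^ 2 + i.2.2.2 ^ 2) := fun i hi => by have := hi.1; have := sq_pos_of_ne_zero hi.2.2.2.2; positivity
  have qeq : ∀ i : ℝ × ℝ² × ℝ², ∀ X : ℝ², 0 < 1 + i.1 * X.1 → 0 < 1 + i.1 * (X.1 - i.2.2.1) →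
      kerArg i X = i.1 ^ 2 * (i.2.2.1 ^ 2 + i.2.2.2 ^ 2) / ((1 + i.1 * X.1) * (1 + i.1 * (X.1 - i.2.2.1))) := fun i X p q => by
    rw [kerArg, invSqrtRem, invSqrtRem, add_sub_cancel, add_sub_cancel, inv_pow, inv_pow, sq_sqrt p.le, sq_sqrt q.le]; field_simp
  have hqm : ∀ i ∈ kerDom, 0 < kerArg i i.2.1 ∧
      kerArg i i.2.1 ≤ 1 := fun i hi => by
    obtain ⟨p, q⟩ := pos i hi
    rw [qeq i _ p q]
    refine ⟨div_pos (hVp i hi) (mul_pos p q), (div_le_one (mul_pos p q)).2 ?_⟩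
    have h2 := rho_sub_le i.2.1 (i.2.1 - i.2.2)
    rw [sub_sub_cancel, show rho i.2.2 ^ 2 = i.2.2.1 ^ 2 + i.2.2.2 ^ 2 from rho_sq _] at h2
    have h3 : (i.1 * rho i.2.1) ^ 2 ≤ (1 / 4) ^ 2 := pow_le_pow_left₀ (mul_nonneg hi.1.le (rho_nonneg _)) hi.2.2.1 2
    have h4 : (i.1 * rho (i.2.1 - i.2.2)) ^ 2 ≤ (1 / 4) ^ 2 := pow_le_pow_left₀ (mul_nonneg hi.1.le (rho_nonneg _)) hi.2.2.2.1 2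
    have h5 := mul_le_mul_of_nonneg_left h2 (sq_nonneg i.1)
    have h6 := (abs_le.1 (ra i hi)).1
    have h7 := (abs_le.1 (rb i hi)).1
    nlinarith
  have hsq := Bd.sqrt hs hq.2.1
  have hE : KDBd 3 fun i X => kerE (kerArg i X) := by
    have hE' := (hsq.smul hs 4).of_abs_le (g := fun i => kerE' (kerArg i i.2.1)) fun i hi =>
      (abs_kerE'_le (hqm i hi).1 (hqm i hi).2).trans (le_abs_self _)
    exact .of_hasFDerivAt (fun i hi => hasFDerivAt_comp_lin (hq.1 i hi) (hasDerivAt_kerE (hqm i hi).1))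
      (((hsq.smul hs 4).mul hs hq.2.1).of_abs_le (g := fun i => kerE (kerArg i i.2.1)) fun i hi => (abs_kerE_le (hqm i hi).1 (hqm i hi).2).trans (le_abs_self _))
      (hE'.mul hs hq.2.2.1) (hE'.mul hs hq.2.2.2)
  have h22 := (ha.pow hs 2).add hs (hb.pow hs 2)
  have hB3 := (((((((hLA.add hs hLB).mul hs hA).mono hs (l := 3) (by simp)).smul hs (1 / 2)).add hs
    ((((((ha.add hs hb).mono hs (l := 1) le_rfl).sub hs ((h22.smul hs (1 / 2)).mono hs (l := 1) (by norm_num))).mul hs hA2).mono hs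
      (l := 3) (by simp)).smul hs (1 / 2))).sub hs
    (((h22.mul hs (ha.add hs hb)).mono hs (l := 3) (by simp)).smul hs (1 / 8))).sub hs (hSS.smul hs 2)).sub hs
    (((hd.mul hs hII).mono hs (l := 3) (by simp)).smul hs (1 / 16)) |>.add hs (((hSA.mul hs hSB).mul hs hE).mono hs (l := 3) (by simp))
  refine ⟨_, _, hA3, hB3, fun i hi => ?_⟩
  obtain ⟨p, q⟩ := pos i hi
  have n1 : ∀ᶠ X in nhds i.2.1, 0 < 1 + i.1 * X.1 := (show Continuous fun X : ℝ² => 1 + i.1 * X.1 by fun_prop).continuousAt.eventually_const_lt p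
  have n2 : ∀ᶠ X in nhds i.2.1, 0 < 1 + i.1 * (X.1 - i.2.2.1) :=
    (show Continuous fun X : ℝ² => 1 + i.1 * (X.1 - i.2.2.1) by fun_prop).continuousAt.eventually_const_lt q
  filter_upwards [n1, n2] with X p q
  have hε0 := hi.1
  have hw := hVp i hi
  have hv : 0 < i.2.2.1 ^ 2 + i.2.2.2 ^ 2 := by have := sq_pos_of_ne_zero hi.2.2.2.2; positivity
  rw [qeq i X p q, kerFull, kerTwo, kerF_eq (div_pos hw (mul_pos p q)), log_div hw.ne' (mul_pos p q).ne', log_mul p.ne' q.ne',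
    log_mul (by positivity) hv.ne', log_pow, lk_eq_of_ne hi.2.2.2.2, one_div i.1, log_inv, sqrt_mul p.le]
  simp only [polP, polQ, Prod.fst_sub, Prod.snd_sub, sqrtRem, logRem, invSqrtRem, kerE]
  have m1 := (sqrt_pos.2 p).ne'
  have m2 := (sqrt_pos.2 q).ne'
  have hys : √(1 + i.1 * X.1) * √(1 + i.1 * (X.1 - i.2.2.1)) * (i.1 ^ 2 * (i.2.2.1 ^ 2 + i.2.2.2 ^ 2) / ((1 + i.1 * X.1) * (1 + i.1 * (X.1 - i.2.2.1))))
      = i.1 ^ 2 * (i.2.2.1 ^ 2 + i.2.2.2 ^ 2) * (√(1 + i.1 * X.1))⁻¹ * (√(1 + i.1 * (X.1 - i.2.2.1)))⁻¹ := by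
    have w1 := sq_sqrt p.le
    have w2 := sq_sqrt q.le
    generalize √(1 + i.1 * X.1) = A at *
    generalize √(1 + i.1 * (X.1 - i.2.2.1)) = B at *
    rw [← w1, ← w2]; field_simp
  generalize √(1 + i.1 * X.1) = A at *
  generalize √(1 + i.1 * (X.1 - i.2.2.1)) = B at *
  generalize i.1 ^ 2 * (i.2.2.1 ^ 2 + i.2.2.2 ^ 2) / ((1 + i.1 * X.1) * (1 + i.1 * (X.1 - i.2.2.1))) = s at *
  push_cast
  linear_combination (3 / 16 * (log 8 - 1 / 2 * (2 * log i.1 + log (i.2.2.1 ^ 2 + i.2.2.2 ^ 2) - (log (1 + i.1 * X.1) + log (1 + i.1 * (X.1 - i.2.2.1))))) - 1 / 16) * hys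

/-! ### Integrals against the kernel, in a moving frame -/

/-- Size of `f` and of its gradient at a point. -/
def c1 (f : ℝ² → ℝ) (X : ℝ²) : ℝ := |f X| + |dR f X| + |dZ f X|

section
variable {X V : ℝ²}

lemma c1_nonneg (f : ℝ² → ℝ) (X : ℝ²) : 0 ≤ c1 f X := by unfold c1; positivity

lemma c1_of_hasFDerivAt {a b : ℝ} (h : HasFDerivAt f (lin a b) X) : c1 f X = |f X| + |a| + |b| := by rw [c1, dR_lin h, dZ_lin h]

lemma c1_congr (hg : DifferentiableAt ℝ g X) (h : f =ᶠ[nhds X] g) : DifferentiableAt ℝ f X ∧ c1 f X = c1 g X := by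
  have := (hasFDerivAt_lin hg).congr_of_eventuallyEq h
  exact ⟨this.differentiableAt, by rw [c1_of_hasFDerivAt this, h.eq_of_nhds, c1]⟩

lemma c1_zero (X : ℝ²) : c1 (fun _ => 0) X = 0 := by simp [c1, dR, dZ]

lemma c1_mul_le (hf : DifferentiableAt ℝ f X) (hg : DifferentiableAt ℝ g X) : c1 (fun X => f X * g X) X ≤ c1 f X * c1 g X := by
  rw [c1_of_hasFDerivAt (hasFDerivAt_mul_lin hf hg), c1, c1, abs_mul]
  have h1 := abs_add_le (f X * dR g X) (g X * dR f X)
  have h2 := abs_add_le (f X * dZ g X) (g X * dZ f X)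
  simp only [abs_mul] at h1 h2
  have h3 : 0 ≤ (|dR f X| + |dZ f X|) * (|dR g X| + |dZ g X|) := by positivity
  nlinarith

lemma c1_add_le (hf : DifferentiableAt ℝ f X) (hg : DifferentiableAt ℝ g X) : c1 (fun X => f X + g X) X ≤ c1 f X + c1 g X := by
  rw [c1_of_hasFDerivAt (hasFDerivAt_add_lin hf hg), c1, c1]
  linarith [abs_add_le (f X) (g X), abs_add_le (dR f X) (dR g X), abs_add_le (dZ f X) (dZ g X)]

lemma c1_comp_sub (hf : DifferentiableAt ℝ f (X - V)) :
    DifferentiableAt ℝ (fun X => f (X - V)) X ∧ c1 (fun X => f (X - V)) X = c1 f (X - V) := by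
  have h : HasFDerivAt (fun X => f (X - V)) (lin (dR f (X - V)) (dZ f (X - V))) X := by
    have := (hasFDerivAt_lin hf).comp X ((hasFDerivAt_id X).sub_const V)
    exact this
  exact ⟨h.differentiableAt, by rw [c1_of_hasFDerivAt h, c1]⟩

end

section
variable {ι : Type*} {S : Set ι} {e J : ι → ℝ} {x : ι → ℝ²} {F : ι → ℝ² → ℝ} {k l : ℕ}

lemma DBd.of_c1 (h : ∀ i ∈ S, DifferentiableAt ℝ (F i) (x i)) (hb : Bd S e J k fun i => c1 (F i) (x i)) : DBd S e J x k F := by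
  refine ⟨h, hb.of_abs_le fun i _ => ?_, hb.of_abs_le fun i _ => ?_, hb.of_abs_le fun i _ => ?_⟩ <;> rw [abs_of_nonneg (c1_nonneg _ _), c1]
  · linarith [abs_nonneg (dR (F i) (x i)), abs_nonneg (dZ (F i) (x i))]
  · linarith [abs_nonneg (F i (x i)), abs_nonneg (dZ (F i) (x i))]
  · linarith [abs_nonneg (dR (F i) (x i)), abs_nonneg (F i (x i))]

lemma DBd.c1 (hs : IsScale S e J) (h : DBd S e J x k F) : Bd S e J k fun i => c1 (F i) (x i) := by
  have ha : ∀ {f : ι → ℝ}, Bd S e J k f → Bd S e J k fun i => |f i| := fun h => h.of_abs_le fun i _ => by rw [abs_abs]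
  exact ((ha h.2.1).add hs (ha h.2.2.1)).add hs (ha h.2.2.2)

/-- Differentiation under the integral sign. -/
lemma integral_c1_le {F : ℝ² → ℝ² → ℝ} {W : ℝ² → ℝ} {X₀ : ℝ²} {s : Set ℝ²} (hW : Integrable W)
    (hm : ∀ X, AEStronglyMeasurable fun V => F V X) (hsn : s ∈ nhds X₀)
    (h : ∀ᵐ V, ∀ X ∈ s, DifferentiableAt ℝ (F V) X ∧ VortexRing.c1 (F V) X ≤ W V) :
    DifferentiableAt ℝ (fun X => ∫ V, F V X) X₀ ∧ VortexRing.c1 (fun X => ∫ V, F V X) X₀ ≤ 3 * ∫ V, W V ∧ ∀ X ∈ s, Integrable fun V => F V X := by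
  have h0 := mem_of_mem_nhds hsn
  have mk : ∀ (v : ℝ²), AEStronglyMeasurable fun V => fderiv ℝ (F V) X₀ v := fun v => by
    refine aestronglyMeasurable_of_tendsto_ae (u := Filter.atTop)
      (f := fun (n : ℕ) V => (1 / ((n : ℝ) + 1))⁻¹ • (F V (X₀ + (1 / ((n : ℝ) + 1)) • v) - F V X₀))
      (fun n => by
        have := ((hm (X₀ + (1 / ((n : ℝ) + 1)) • v)).sub (hm X₀)).const_smul ((1 / ((n : ℝ) + 1))⁻¹)
        exact this) ?_
    filter_upwards [h] with V hV
    exact ((hV X₀ h0).1.hasFDerivAt.hasLineDerivAt v).tendsto_slope_zero.comp (tendsto_nhdsWithin_iff.2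
      ⟨tendsto_one_div_add_atTop_nhds_zero_nat, .of_forall fun n => Nat.one_div_pos_of_nat.ne'⟩)
  have hb : ∀ X ∈ s, ∀ᵐ V, ‖F V X‖ ≤ W V := fun X hX => by
    filter_upwards [h] with V hV
    refine le_trans ?_ (hV X hX).2
    rw [VortexRing.c1, norm_eq_abs]; linarith [abs_nonneg (dR (F V) X), abs_nonneg (dZ (F V) X)]
  have key := hasFDerivAt_integral_of_dominated_of_fderiv_le (𝕜 := ℝ) (μ := volume) (F := fun X V => F V X)
    (F' := fun X V => fderiv ℝ (F V) X) (bound := W) hsn (.of_forall hm) (hW.mono' (hm X₀) (hb X₀ h0)) (by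
      have : (fun V => fderiv ℝ (F V) X₀) = fun V => lin (fderiv ℝ (F V) X₀ (1, 0)) (fderiv ℝ (F V) X₀ (0, 1)) := funext fun V => clm_eq_lin _
      rw [this]
      exact (((mk (1, 0)).smul_const _).add ((mk (0, 1)).smul_const _))) (by
      filter_upwards [h] with V hV X hX
      refine le_trans ?_ (hV X hX).2
      rw [(hasFDerivAt_lin (hV X hX).1).fderiv, VortexRing.c1]
      exact (norm_lin_le _ _).trans (by linarith [abs_nonneg (F V X)])) hW (by
      filter_upwards [h] with V hV X hX
      exact (hV X hX).1.hasFDerivAt)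
  refine ⟨key.differentiableAt, ?_, fun X hX => hW.mono' (hm X) (hb X hX)⟩
  have n1 : ‖∫ V, fderiv ℝ (F V) X₀‖ ≤ ∫ V, W V := norm_integral_le_of_norm_le hW (by
      filter_upwards [h] with V hV
      refine le_trans ?_ (hV X₀ h0).2
      rw [(hasFDerivAt_lin (hV X₀ h0).1).fderiv, VortexRing.c1]
      exact (norm_lin_le _ _).trans (by linarith [abs_nonneg (F V X₀)]))
  have n2 : ‖∫ V, F V X₀‖ ≤ ∫ V, W V := norm_integral_le_of_norm_le hW (hb X₀ h0)
  rw [clm_eq_lin (∫ V, fderiv ℝ (F V) X₀)] at key n1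
  have := abs_le_norm_lin ((∫ V, fderiv ℝ (F V) X₀) (1, 0)) ((∫ V, fderiv ℝ (F V) X₀) (0, 1))
  rw [c1_of_hasFDerivAt key, ← norm_eq_abs (∫ V, F V X₀)]
  linarith [this.1, this.2]

/-- Kernels of order `ε ^ k` with a logarithmic singularity, and polynomial growth. -/
def KerBd (T : Set (ℝ × ℝ² × ℝ²)) (k : ℕ) (K : ℝ → ℝ² → ℝ² → ℝ) : Prop :=
  (∀ ε X, Measurable fun V => K ε V X) ∧ ∃ (C : ℝ) (N : ℕ), 0 ≤ C ∧ ∀ i ∈ T, DifferentiableAt ℝ (K i.1 i.2.2) i.2.1 ∧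
    VortexRing.c1 (K i.1 i.2.2) i.2.1 ≤ C * i.1 ^ k * (⟪i.2.1⟫ * ⟪i.2.2⟫) ^ N * ((1 + |log (1 / i.1)|) * (1 + |lk i.2.2|))

/-- Families of functions of order `ε ^ l`, decaying rapidly together with their gradients. -/
def Decay (S : Set ι) (e : ι → ℝ) (l : ℕ) (η : ι → ℝ² → ℝ) : Prop := ∀ m : ℕ, ∃ (C : ℝ) (N : ℕ), 0 ≤ C ∧ ∀ i ∈ S, Differentiable ℝ (η i) ∧
    ∀ X, VortexRing.c1 (η i) X ≤ C * e i ^ l * (1 + |log (1 / e i)|) ^ N * (⟪X⟫ ^ m)⁻¹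

lemma DBd.of_kernel (hs : IsScale S e J) (hJ : ∀ i ∈ S, (1 + |log (1 / e i)|) * ⟪x i⟫ ≤ J i)
    {T : Set (ℝ × ℝ² × ℝ²)} {K : ℝ → ℝ² → ℝ² → ℝ} (hK : KerBd T k K) {η : ι → ℝ² → ℝ} (hη : Decay S e l η)
    (hT : ∀ i ∈ S, ∀ᶠ X in nhds (x i), ∀ V : ℝ², V.1 ≠ 0 → (e i, X, V) ∈ T ∨ η i =ᶠ[nhds (X - V)] fun _ => 0) :
    (DBd S e J x (k + l) fun i X => ∫ V, K (e i) V X * η i (X - V)) ∧ ∀ i ∈ S, ∀ᶠ X in nhds (x i), Integrable fun V => K (e i) V X * η i (X - V) := by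
  obtain ⟨hm, C, N, hC, hK⟩ := hK
  obtain ⟨C', N', hC', hη⟩ := hη (N + 5)
  have hW : Integrable fun V => (1 + |lk V|) * (⟪V⟫ ^ 5)⁻¹ := by
    have h1 : KI 5 fun _ => 1 := ki_one.mono aestronglyMeasurable_const (by norm_num) (.of_forall fun V => le_rfl)
    refine (h1.add (ki_lk.mono (k' := fun V => |lk V|) measurable_lk.abs.aestronglyMeasurable le_rfl (.of_forall fun V => by simp))).congr
      (.of_forall fun V => rfl)
  have main : ∀ i ∈ S, ∃ s ∈ nhds (x i), DifferentiableAt ℝ (fun X => ∫ V, K (e i) V X * η i (X - V)) (x i) ∧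
      VortexRing.c1 (fun X => ∫ V, K (e i) V X * η i (X - V)) (x i) ≤ 3 * ∫ V, (C * C' * 2 ^ (2 * N + 5) * e i ^ (k + l) *
        J i ^ (N' + 1 + (2 * N + 5))) * ((1 + |lk V|) * (⟪V⟫ ^ 5)⁻¹) ∧ ∀ X ∈ s, Integrable fun V => K (e i) V X * η i (X - V) := fun i hi => by
    have hd := (hη i hi).1
    have he := hs.nonneg i hi
    have hJ1 := hs.one_le i hi
    refine ⟨_, (hT i hi).and (Metric.ball_mem_nhds (x i) one_pos), integral_c1_le (hW.const_mul _) (fun X => ((hm _ X).mul (hd.continuous.comp (by fun_prop)).measurable).aestronglyMeasurable)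
      ((hT i hi).and (Metric.ball_mem_nhds (x i) one_pos)) ?_⟩
    filter_upwards [ae_fst_ne_zero] with V hV X hX
    rcases hX.1 V hV with h1 | h1
    · obtain ⟨d1, b1⟩ := hK _ h1
      obtain ⟨d2, b2⟩ := c1_comp_sub (hd (X - V))
      refine ⟨d1.mul d2, (c1_mul_le d1 d2).trans ?_⟩
      have hX1 : 1 + ‖X‖ ≤ 2 * ⟪x i⟫ := by
        have h2 := norm_sub_norm_le X (x i)
        have h3 : ‖X - x i‖ < 1 := mem_ball_iff_norm.1 hX.2
        linarith [norm_nonneg (x i)]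
      have b3 := (hη i hi).2 (X - V)
      rw [← b2] at b3
      simp only at b1
      have hβ := abs_nonneg (log (1 / e i))
      have q1 := pow_le_pow_left₀ (by positivity) hX1 (2 * N + 5)
      have q2 := pow_le_pow_left₀ (by positivity) ((le_mul_of_one_le_left (by positivity) (by linarith)).trans (hJ i hi)) (2 * N + 5)
      have q3 := pow_le_pow_left₀ (by positivity) ((le_mul_of_one_le_right (by positivity) (one_le_jb (x i))).trans (hJ i hi)) (N' + 1)
      rw [mul_pow] at q1
      calc _ ≤ (C * e i ^ k * (⟪X⟫ * ⟪V⟫) ^ N * ((1 + |log (1 / e i)|) * (1 + |lk V|))) *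
            (C' * e i ^ l * (1 + |log (1 / e i)|) ^ N' * (⟪X⟫ ^ (N + 5) * (⟪V⟫ ^ (N + 5))⁻¹)) := by
            refine mul_le_mul b1 (b3.trans ?_) (c1_nonneg _ _) (by positivity)
            exact mul_le_mul_of_nonneg_left (jb_inv_pow_le X V _) (by positivity)
        _ = (C * C' * e i ^ (k + l) * ((1 + |lk V|) * (⟪V⟫ ^ 5)⁻¹)) * ((1 + |log (1 / e i)|) ^ (N' + 1) * ⟪X⟫ ^ (2 * N + 5)) := by
            have : 0 < 1 + ‖V‖ := by positivity
            generalize 1 + ‖V‖ = b at *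
            generalize 1 + ‖X‖ = a at *
            generalize 1 + |log (1 / e i)| = c at *
            field_simp; ring
        _ ≤ (C * C' * e i ^ (k + l) * ((1 + |lk V|) * (⟪V⟫ ^ 5)⁻¹)) * (J i ^ (N' + 1) * (2 ^ (2 * N + 5) * J i ^ (2 * N + 5))) := by
            refine mul_le_mul_of_nonneg_left (mul_le_mul q3 (q1.trans ?_) (by positivity) (by positivity)) (by positivity)
            exact mul_le_mul_of_nonneg_left q2 (by positivity)
        _ = _ := by ring
    · have h2 : (fun X => K (e i) V X * η i (X - V)) =ᶠ[nhds X] fun _ => 0 := by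
        filter_upwards [(Continuous.tendsto (f := fun X : ℝ² => X - V) (by fun_prop) X).eventually h1] with Y hY
        rw [hY, mul_zero]
      obtain ⟨d, c⟩ := c1_congr (differentiableAt_const 0) h2
      exact ⟨d, by rw [c, c1_zero]; positivity⟩
  choose! s hs' h1 h2 h3 using main
  refine ⟨.of_c1 h1 ⟨3 * (C * C' * 2 ^ (2 * N + 5) * ∫ V, (1 + |lk V|) * (⟪V⟫ ^ 5)⁻¹), N' + 1 + (2 * N + 5),
    mul_nonneg zero_le_three (mul_nonneg (by positivity) (integral_nonneg fun V => by positivity)), fun i hi => ?_⟩, fun i hi => Filter.mem_of_superset (hs' i hi) (h3 i hi)⟩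
  rw [abs_of_nonneg (c1_nonneg _ _)]
  refine (h2 i hi).trans (le_of_eq ?_)
  rw [integral_const_mul]; ring

end

/-! ### The stream function of the approximate solution -/

section
variable {ι : Type*} {S : Set ι} {e J : ι → ℝ} {k l : ℕ} {η ξ w : ι → ℝ² → ℝ}

lemma Decay.add (hs : IsScale S e J) (hη : Decay S e l η) (hξ : Decay S e l ξ) : Decay S e l fun i X => η i X + ξ i X := fun m => by
  obtain ⟨C, N, hC, h⟩ := hη m
  obtain ⟨C', N', hC', h'⟩ := hξ m
  refine ⟨C + C', N + N', add_nonneg hC hC', fun i hi => ⟨(h i hi).1.add (h' i hi).1, fun X => ?_⟩⟩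
  have he := hs.nonneg i hi
  have hb : 1 ≤ 1 + |log (1 / e i)| := by linarith [abs_nonneg (log (1 / e i))]
  have e1 : (1 + |log (1 / e i)|) ^ N ≤ (1 + |log (1 / e i)|) ^ (N + N') := pow_le_pow_right₀ hb (by omega)
  have e2 : (1 + |log (1 / e i)|) ^ N' ≤ (1 + |log (1 / e i)|) ^ (N + N') := pow_le_pow_right₀ hb (by omega)
  refine (c1_add_le ((h i hi).1 X) ((h' i hi).1 X)).trans ?_
  rw [add_mul, add_mul, add_mul]
  refine add_le_add (((h i hi).2 X).trans ?_) (((h' i hi).2 X).trans ?_) <;> gcongr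

lemma Decay.mono (hs : IsScale S e J) (hη : Decay S e l η) (hk : k ≤ l) : Decay S e k η := fun m => by
  obtain ⟨C, N, hC, h⟩ := hη m
  refine ⟨C, N, hC, fun i hi => ⟨(h i hi).1, fun X => ((h i hi).2 X).trans ?_⟩⟩
  have := pow_le_pow_of_le_one (hs.nonneg i hi) (hs.le_one i hi) hk
  gcongr

lemma Decay.mul (hs : IsScale S e J) (hη : Decay S e l η) (hw : ∃ (C : ℝ) (K : ℕ), 0 ≤ C ∧ ∀ i ∈ S, Differentiable ℝ (w i) ∧
    ∀ X, c1 (w i) X ≤ C * e i ^ k * ⟪X⟫ ^ K) : Decay S e (k + l) fun i X => w i X * η i X := fun m => by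
  obtain ⟨C, K, hC, h⟩ := hw
  obtain ⟨C', N', hC', h'⟩ := hη (m + K)
  refine ⟨C * C', N', mul_nonneg hC hC', fun i hi => ⟨(h i hi).1.mul (h' i hi).1, fun X => ?_⟩⟩
  have he := hs.nonneg i hi
  refine (c1_mul_le ((h i hi).1 X) ((h' i hi).1 X)).trans
    ((mul_le_mul ((h i hi).2 X) ((h' i hi).2 X) (c1_nonneg _ _) (by positivity)).trans_eq ?_)
  have : 0 < 1 + ‖X‖ := by positivity
  generalize 1 + ‖X‖ = a at *
  field_simp; ring

lemma Decay.smul_pow (hs : IsScale S e J) (hη : Decay S e 0 η) (k : ℕ) : Decay S e k fun i X => e i ^ k * η i X :=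
  hη.mul hs ⟨1, 0, zero_le_one, fun i hi => ⟨differentiable_const _, fun X => by
    have := hs.nonneg i hi
    simp [c1, dR, dZ, abs_of_nonneg this]⟩⟩

lemma Decay.of_pf {G : ℝ → ℝ → ℝ² → ℝ} (hG : PF InZ G) {δ : ι → ℝ} (hδ : ∀ i ∈ S, |δ i| ≤ 1) :
    Decay S e 0 fun i => G (log (1 / e i)) (δ i) := fun m => by
  obtain ⟨C, N, hC, h⟩ := hG.dk m
  obtain ⟨C₁, N₁, hC₁, h₁⟩ := hG.dR.dk m
  obtain ⟨C₂, N₂, hC₂, h₂⟩ := hG.dZ.dk m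
  refine ⟨C + C₁ + C₂, N + N₁ + N₂, by positivity, fun i hi => ⟨(hG.mem isLin_inZ _ _).diff, fun X => ?_⟩⟩
  have hb : 1 ≤ 1 + |log (1 / e i)| := by linarith [abs_nonneg (log (1 / e i))]
  have a := h (log (1 / e i)) _ (hδ i hi) X
  have a₁ := h₁ (log (1 / e i)) _ (hδ i hi) X
  have a₂ := h₂ (log (1 / e i)) _ (hδ i hi) X
  have e0 : (1 + |log (1 / e i)|) ^ N ≤ (1 + |log (1 / e i)|) ^ (N + N₁ + N₂) := pow_le_pow_right₀ hb (by omega)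
  have e1 : (1 + |log (1 / e i)|) ^ N₁ ≤ (1 + |log (1 / e i)|) ^ (N + N₁ + N₂) := pow_le_pow_right₀ hb (by omega)
  have e2 : (1 + |log (1 / e i)|) ^ N₂ ≤ (1 + |log (1 / e i)|) ^ (N + N₁ + N₂) := pow_le_pow_right₀ hb (by omega)
  rw [c1, pow_zero, mul_one, add_mul, add_mul, add_mul, add_mul]
  refine add_le_add (add_le_add (a.trans ?_) (a₁.trans ?_)) (a₂.trans ?_) <;> gcongr

lemma decay_etaApp (hs : IsScale S e J) {δ : ι → ℝ} (hδ : ∀ i ∈ S, |δ i| ≤ 1) : Decay S e 0 fun i => etaApp (e i) (δ i) :=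
  ((((Decay.of_pf pf_eta0 hδ).add hs (((Decay.of_pf pf_eta1 hδ).smul_pow hs 1).mono hs (Nat.zero_le _))).add hs
    (((Decay.of_pf pf_eta2 hδ).smul_pow hs 2).mono hs (Nat.zero_le _))).add hs
    (((Decay.of_pf pf_eta3 hδ).smul_pow hs 3).mono hs (Nat.zero_le _))).add hs
    (((Decay.of_pf pf_eta4 hδ).smul_pow hs 4).mono hs (Nat.zero_le _)) |> fun h => by
    simp only [pow_one] at h; exact h

end

lemma hasFDerivAt_rho (h : 0 < rho X) : HasFDerivAt rho (lin (X.1 / rho X) (X.2 / rho X)) X := by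
  have h0 : X.1 ^ 2 + X.2 ^ 2 ≠ 0 := (sqrt_pos.1 h).ne'
  have := (((hasFDerivAt_cR X).pow 2).add ((hasFDerivAt_cZ X).pow 2)).sqrt h0
  refine this.congr_fderiv ?_
  have h' : √(X.1 ^ 2 + X.2 ^ 2) ≠ 0 := h.ne'
  ext <;> simp [lin_apply, rho] <;> field_simp

lemma abs_snd_le_rho (X : ℝ²) : |X.2| ≤ rho X := abs_le_sqrt (by nlinarith [sq_nonneg X.1])

/-- The complement of the cut-off is smaller than any power of `ε`. -/
lemma cutoff_compl_le {χ : ℝ → ℝ} (hχ : IsCutoff χ) {σ : ℝ} (hσ : 0 < σ) : ∃ (C : ℝ) (K : ℕ), 0 ≤ C ∧ ∀ ε, 0 < ε → ε ≤ 1 →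
    Differentiable ℝ (fun X => χ (ε ^ σ * rho X) - 1) ∧ ∀ X, c1 (fun X => χ (ε ^ σ * rho X) - 1) X ≤ C * ε ^ 3 * ⟪X⟫ ^ K := by
  obtain ⟨M, hM⟩ := (isCompact_Icc (a := (1 : ℝ)) (b := 2)).exists_bound_of_continuousOn
    (hχ.smooth.continuous_deriv (by norm_num)).continuousOn
  have hM0 : 0 ≤ M := (norm_nonneg _).trans (hM 1 (by norm_num))
  have hM' : ∀ r, 1 ≤ r → |deriv χ r| ≤ M := fun r hr => by
    rcases le_or_gt r 2 with h | h
    · exact hM r ⟨hr, h⟩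
    · rw [(show χ =ᶠ[nhds r] fun _ => 0 by filter_upwards [lt_mem_nhds h] with s hs using hχ.eq_zero s hs.le).deriv_eq]
      simpa using hM0
  set K := ⌈3 / σ⌉₊
  have main : ∀ ε, 0 < ε → ε ≤ 1 → ∀ X, DifferentiableAt ℝ (fun X => χ (ε ^ σ * rho X) - 1) X ∧
      c1 (fun X => χ (ε ^ σ * rho X) - 1) X ≤ (1 + 2 * M) * 2 ^ K * ε ^ 3 * ⟪X⟫ ^ K := fun ε h0 h1 X => by
    have ha := rpow_pos_of_pos h0 σ
    have ha1 := rpow_le_one h0.le h1 hσ.le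
    rcases lt_or_ge (ε ^ σ * rho X) 1 with h | h
    · obtain ⟨d, c⟩ := c1_congr (f := fun X => χ (ε ^ σ * rho X) - 1) (X := X) (differentiableAt_const 0) (by
        filter_upwards [(continuous_const.mul continuous_rho).continuousAt.eventually_lt_const h] with Y hY
        exact sub_eq_zero.2 (hχ.eq_one _ hY.le))
      exact ⟨d, by rw [c, c1_zero]; positivity⟩
    · have hr : 0 < rho X := by by_contra hr; nlinarith [rho_nonneg X]
      have hd := ((hχ.smooth.differentiable (by norm_num) (ε ^ σ * rho X)).hasDerivAt.comp_hasFDerivAt X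
        ((hasFDerivAt_rho hr).const_mul (ε ^ σ))).sub_const 1
      have hd' : HasFDerivAt (fun X => χ (ε ^ σ * rho X) - 1) (lin (deriv χ (ε ^ σ * rho X) * ε ^ σ * (X.1 / rho X))
        (deriv χ (ε ^ σ * rho X) * ε ^ σ * (X.2 / rho X))) X := hd.congr_fderiv (by ext <;> simp [lin_apply] <;> ring)
      refine ⟨hd'.differentiableAt, ?_⟩
      have q : ∀ a, |a| ≤ rho X → |deriv χ (ε ^ σ * rho X) * ε ^ σ * (a / rho X)| ≤ M := fun a ha' => by
        rw [abs_mul, abs_mul, abs_div, abs_of_pos ha, abs_of_pos hr]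
        calc _ ≤ M * 1 * 1 := mul_le_mul (mul_le_mul (hM' _ h) ha1 ha.le hM0) ((div_le_one hr).2 ha') (by positivity) (by positivity)
          _ = M := by ring
      have q0 : |χ (ε ^ σ * rho X) - 1| ≤ 1 := by
        obtain ⟨h2, h3⟩ := hχ.mem_Icc (ε ^ σ * rho X)
        rw [abs_le]; constructor <;> linarith
      have q1 : 1 ≤ ε ^ 3 * (2 ^ K * ⟪X⟫ ^ K) := by
        calc (1 : ℝ) ≤ (ε ^ σ * rho X) ^ K := one_le_pow₀ h
          _ = ε ^ (σ * K) * rho X ^ K := by rw [mul_pow, rpow_mul h0.le, rpow_natCast]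
          _ ≤ ε ^ (3 : ℝ) * (2 * ⟪X⟫) ^ K := by
            refine mul_le_mul (rpow_le_rpow_of_exponent_ge h0 h1 ?_) (pow_le_pow_left₀ hr.le ?_ _) (by positivity) (by positivity)
            · have := Nat.le_ceil (3 / σ)
              rw [div_le_iff₀ hσ] at this; linarith
            · exact (norm_sq_le X).trans (by linarith)
          _ = _ := by rw [mul_pow]; norm_cast
      rw [c1_of_hasFDerivAt hd']
      nlinarith [q _ (abs_fst_le_rho X), q _ (abs_snd_le_rho X)]
  exact ⟨(1 + 2 * M) * 2 ^ K, K, by positivity, fun ε h0 h1 => ⟨fun X => (main ε h0 h1 X).1, fun X => (main ε h0 h1 X).2⟩⟩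

lemma KerBd.of_expansion {T : Set (ℝ × ℝ² × ℝ²)} {k : ℕ} {K : ℝ → ℝ² → ℝ² → ℝ}
    (hs : IsScale T (fun i => i.1) fun i => ⟪i.2.1⟫ * ⟪i.2.2⟫) (hm : ∀ ε X, Measurable fun V => K ε V X)
    {A B : ℝ × ℝ² × ℝ² → ℝ² → ℝ} (hA : DBd T (fun i => i.1) (fun i => ⟪i.2.1⟫ * ⟪i.2.2⟫) (fun i => i.2.1) k A)
    (hB : DBd T (fun i => i.1) (fun i => ⟪i.2.1⟫ * ⟪i.2.2⟫) (fun i => i.2.1) k B)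
    (h : ∀ i ∈ T, K i.1 i.2.2 =ᶠ[nhds i.2.1] fun X => (log (1 / i.1) + lk i.2.2) * A i X + B i X) : KerBd T k K := by
  refine ⟨hm, ?_⟩
  obtain ⟨C, N, hC, hb⟩ := (hA.c1 hs).add hs (hB.c1 hs)
  refine ⟨C, N, hC, fun i hi => ?_⟩
  have dA := hA.1 i hi
  obtain ⟨d, c⟩ := c1_congr ((dA.const_mul _).add (hB.1 i hi)) (h i hi)
  refine ⟨d, ?_⟩
  have h1 := c1_add_le (dA.const_mul (log (1 / i.1) + lk i.2.2)) (hB.1 i hi)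
  have h2 := c1_mul_le (differentiableAt_const (log (1 / i.1) + lk i.2.2)) dA
  have h3 : c1 (fun _ => log (1 / i.1) + lk i.2.2) i.2.1 ≤ |log (1 / i.1)| + |lk i.2.2| := by
    simpa [c1, dR, dZ] using abs_add_le (log (1 / i.1)) (lk i.2.2)
  have h4 := hb i hi
  rw [abs_of_nonneg (add_nonneg (c1_nonneg _ _) (c1_nonneg _ _))] at h4
  have hβ := abs_nonneg (log (1 / i.1))
  have hl := abs_nonneg (lk i.2.2)
  have p1 := c1_nonneg (A i) i.2.1
  have p2 := c1_nonneg (B i) i.2.1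
  have p3 : 1 ≤ (1 + |log (1 / i.1)|) * (1 + |lk i.2.2|) := one_le_mul_of_one_le_of_one_le (by linarith) (by linarith)
  calc _ ≤ (c1 (A i) i.2.1 + c1 (B i) i.2.1) * ((1 + |log (1 / i.1)|) * (1 + |lk i.2.2|)) := by
        refine (c.trans_le h1).trans ?_
        rw [add_mul]
        refine add_le_add (h2.trans ?_) (le_mul_of_one_le_right p2 p3)
        rw [mul_comm]
        exact mul_le_mul_of_nonneg_left (h3.trans (by nlinarith)) p1
    _ ≤ _ := mul_le_mul_of_nonneg_right h4 (by positivity)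

lemma measurable_kerF : Measurable kerF := by
  have h : StronglyMeasurable (Function.uncurry fun s ψ : ℝ => (1 - 2 * sin ψ ^ 2) / √(sin ψ ^ 2 + s / 4)) :=
    Measurable.stronglyMeasurable (by unfold Function.uncurry; fun_prop)
  have := h.integral_prod_right (ν := volume.restrict (Ioc 0 (π / 2)))
  rw [show kerF = fun s => ∫ ψ in Ioc 0 (π / 2), (1 - 2 * sin ψ ^ 2) / √(sin ψ ^ 2 + s / 4) from
    funext fun s => intervalIntegral.integral_of_le (by positivity)]
  exact this.measurable

lemma measurable_kerTwo (ε : ℝ) (X : ℝ²) : Measurable fun V => kerTwo ε V X := by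
  have := measurable_lk
  simp only [kerTwo, polP, polQ, Prod.fst_sub, Prod.snd_sub]; fun_prop

lemma measurable_kerFull (ε : ℝ) (X : ℝ²) : Measurable fun V => kerFull ε V X := by
  have := measurable_kerF
  unfold kerFull
  fun_prop

lemma kerBd_sub : KerBd kerDom 3 fun ε V X => kerFull ε V X - kerTwo ε V X := by
  obtain ⟨A, B, hA, hB, h⟩ := kernel_expansion
  exact .of_expansion isScale_kerDom (fun ε X => (measurable_kerFull ε X).sub (measurable_kerTwo ε X)) hA hB h

lemma kerBd_kerTwo : KerBd {i | 0 < i.1 ∧ i.1 ≤ 1} 0 kerTwo := by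
  have hs : IsScale {i : ℝ × ℝ² × ℝ² | 0 < i.1 ∧ i.1 ≤ 1} (fun i => i.1) fun i => ⟪i.2.1⟫ * ⟪i.2.2⟫ :=
    ⟨fun _ h => h.1.le, fun _ h => h.2, fun _ _ => one_le_mul_of_one_le_of_one_le (one_le_jb _) (one_le_jb _)⟩
  have hV : ∀ {f : ℝ² → ℝ}, PB f → Bd {i : ℝ × ℝ² × ℝ² | 0 < i.1 ∧ i.1 ≤ 1} (fun i => i.1)
      (fun i => ⟪i.2.1⟫ * ⟪i.2.2⟫) 0 fun i => f i.2.2 := fun hf =>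
    Bd.of_pb hf fun i _ => by nlinarith [norm_nonneg i.2.1, norm_nonneg i.2.2]
  have hR : DBd {i : ℝ × ℝ² × ℝ² | 0 < i.1 ∧ i.1 ≤ 1} (fun i => i.1) (fun i => ⟪i.2.1⟫ * ⟪i.2.2⟫)
      (fun i => i.2.1) 0 fun _ X => X.1 := .of_tg TG.cR fun i _ => by nlinarith [norm_nonneg i.2.1, norm_nonneg i.2.2]
  have hε := DBd.param (x := fun i : ℝ × ℝ² × ℝ² => i.2.1) ((Bd.small hs).mono hs zero_le_one)
  have hr := DBd.param (x := fun i : ℝ × ℝ² × ℝ² => i.2.1) (hV TG.cR.pb)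
  have hz := DBd.param (x := fun i : ℝ × ℝ² × ℝ² => i.2.1) (hV TG.cZ.pb)
  have hR' := hR.sub hs hr
  have hε2 := (hε.mul hs hε)
  have p1 := (hR.add hs hR').smul hs (1 / 2)
  have p2 := ((hr.mul hs hr).smul hs (1 / 16)).add hs ((hz.mul hs hz).smul hs (3 / 16))
  have q2 := (((hR.mul hs hR).add hs (hR'.mul hs hR')).smul hs (1 / 4)).sub hs (((hr.mul hs hr).add hs (hz.mul hs hz)).smul hs (1 / 16))
  refine .of_expansion hs measurable_kerTwo (((DBd.const 1).add hs (hε.mul hs p1)).add hs (hε2.mul hs p2))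
    (((DBd.const (-2)).add hs (hε.mul hs (p1.neg hs))).add hs (hε2.mul hs q2)) fun i _ => .of_forall fun X => ?_
  simp only [kerTwo, polP, polQ, Prod.fst_sub, Prod.snd_sub, cR, cZ]
  ring

lemma BS_integrable (β : ℝ) (m : ℕ) (hf : InZ f) (X : ℝ²) :
    Integrable fun Y => ((β + log (8 / √(distSq X Y))) * polP m X Y + polQ m X Y) * f Y :=
  ((((sep_polP m).kerOp_integrable hf X).const_mul β).add (((sep_polP m).logOp_integrable hf X).add
    ((sep_polQ m).kerOp_integrable hf X))).congr (.of_forall fun Y => by simp only [Pi.add_apply]; ring)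

lemma integral_kerTwo (ε : ℝ) (hη : InZ η) (X : ℝ²) :
    1 / (2 * π) * ∫ V, kerTwo ε V X * η (X - V) = BS0 η X + ε * BS (log (1 / ε)) 1 η X + ε ^ 2 * BS (log (1 / ε)) 2 η X
      + (log (1 / ε) - 2) / (2 * π) * ∫ Y, η Y := by
  have h0 := (BS0_integrable hη.cont hη.rapid X)
  have h1 := (BS_integrable (log (1 / ε)) 1 hη X).const_mul ε
  have h2 := (BS_integrable (log (1 / ε)) 2 hη X).const_mul (ε ^ 2)
  have h3 : Integrable fun Y => (log (1 / ε) - 2) * η Y := ((Sep.const (log (1 / ε) - 2)).kerOp_integrable hη X)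
  have e : ∫ V, kerTwo ε V X * η (X - V) = ∫ Y, kerTwo ε (X - Y) X * η Y := by
    rw [← integral_sub_left_eq_self (fun Y => kerTwo ε (X - Y) X * η Y) _ X]; simp only [sub_sub_cancel]
  have e2 : ∀ Y, kerTwo ε (X - Y) X * η Y = log (8 / √(distSq X Y)) * η Y
      + ε * (((log (1 / ε) + log (8 / √(distSq X Y))) * polP 1 X Y + polQ 1 X Y) * η Y)
      + ε ^ 2 * (((log (1 / ε) + log (8 / √(distSq X Y))) * polP 2 X Y + polQ 2 X Y) * η Y) + (log (1 / ε) - 2) * η Y := fun Y => by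
    rw [kerTwo, sub_sub_cancel, show lk (X - Y) = log (8 / √(distSq X Y)) from rfl]; ring
  have s1 := integral_add ((h0.add h1).add h2) h3
  have s2 := integral_add (h0.add h1) h2
  have s3 := integral_add h0 h1
  simp only [Pi.add_apply] at s1 s2 s3
  simp only [e, e2, s1, s2, s3, integral_const_mul, BS0, BS]
  ring

/-- Parameters `(ε, δ)` and points `X` where the cut-off is not active. -/
def admissible (σ : ℝ) : Set (ℝ × ℝ × ℝ²) :=
  {i | 0 < i.1 ∧ i.1 ≤ 1 ∧ 0 ≤ i.2.1 ∧ i.2.1 ≤ 1 ∧ i.1 ^ (1 - σ) ≤ 1 / 16 ∧ i.1 ^ σ * rho i.2.2 < 1}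

/-- The weight for the error terms. -/
def wt (i : ℝ × ℝ × ℝ²) : ℝ := (1 + |log (1 / i.1)|) * ⟪i.2.2⟫

section
variable {S : Set (ℝ × ℝ × ℝ²)} {σ : ℝ}

lemma isScale_admissible (hS : S ⊆ admissible σ) : IsScale S (fun i => i.1) wt :=
  ⟨fun _ h => (hS h).1.le, fun _ h => (hS h).2.1, fun i _ => one_le_mul_of_one_le_of_one_le
    (by linarith [abs_nonneg (log (1 / i.1))]) (one_le_jb _)⟩

lemma PF.dbd_pow (hS : S ⊆ admissible σ) {G : ℝ → ℝ → ℝ² → ℝ} (hG : PF TG G) (n : ℕ) :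
    DBd S (fun i => i.1) wt (fun i => i.2.2) n fun i X => i.1 ^ n * G (log (1 / i.1)) i.2.1 X := by
  have hs := isScale_admissible hS
  have h1 : Bd S (fun i => i.1) wt 0 fun i => log (1 / i.1) := ⟨1, 1, zero_le_one, fun i hi => by
    rw [pow_zero, pow_one, one_mul, one_mul, wt]
    nlinarith [abs_nonneg (log (1 / i.1)), norm_nonneg i.2.2]⟩
  have h2 : Bd S (fun i => i.1) wt 0 fun i => i.2.1 := ⟨1, 0, zero_le_one, fun i hi => by
    simpa using abs_le.2 ⟨by linarith [(hS hi).2.2.1], (hS hi).2.2.2.1⟩⟩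
  have h3 := PF.dbd (x := fun i => i.2.2) hs h1 h2 (fun i _ => by rw [wt]; nlinarith [abs_nonneg (log (1 / i.1)), norm_nonneg i.2.2]) hG
  simpa using (DBd.param ((Bd.small hs).pow hs n)).mul hs h3

lemma mul_rho_le {ε σ : ℝ} (hε : 0 < ε) (h : ε ^ (1 - σ) ≤ 1 / 16) (X : ℝ²) : 16 * (ε * rho X) ≤ ε ^ σ * rho X := by
  have : ε = ε ^ (1 - σ) * ε ^ σ := by rw [← rpow_add hε]; simp
  have h2 := mul_le_mul_of_nonneg_right h (mul_nonneg (rpow_pos_of_pos hε σ).le (rho_nonneg X))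
  rw [← mul_assoc, ← this] at h2
  linarith

lemma phiStar_eq {χ : ℝ → ℝ} (hχ : IsCutoff χ) {ε δ : ℝ} (hε : 0 < ε) (h : ε ^ (1 - σ) ≤ 1 / 16) (X : ℝ²) :
    phiStar σ χ ε δ X = 1 / (2 * π) * ∫ V, kerFull ε V X * etaStar σ χ ε δ (X - V) := by
  rw [← integral_sub_left_eq_self _ _ X]
  simp only [sub_sub_cancel]
  simp only [phiStar, BSeps, kerFull, Prod.fst_sub, Prod.snd_sub, sub_sub_cancel, distSq]
  congr 1
  refine setIntegral_eq_integral_of_forall_compl_eq_zero ?_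
  intro Y hY
  have h1 : 1 + ε * Y.1 ≤ 0 := not_lt.1 hY
  have h2 := mul_rho_le hε h Y
  have h3 := mul_le_mul_of_nonneg_left ((neg_abs_le _).trans' (neg_le_neg (abs_fst_le_rho Y))) hε.le
  rw [etaStar, hχ.eq_zero _ (by linarith), zero_mul, mul_zero]

lemma inZ_etaApp (ε δ : ℝ) : InZ (etaApp ε δ) :=
  (((inZ_eta0.add ((pf_eta1.mem isLin_inZ 0 δ).smul ε)).add ((pf_eta2.mem isLin_inZ _ δ).smul _)).add
    ((pf_eta3.mem isLin_inZ _ δ).smul _)).add ((pf_eta4.mem isLin_inZ _ δ).smul _)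

lemma map_etaApp {T : (ℝ² → ℝ) → ℝ² → ℝ} (ha : ∀ {f g}, InZ f → InZ g → T (f + g) = T f + T g) (hs : ∀ (c : ℝ) f, T (c • f) = c • T f)
    {ε δ : ℝ} : T (etaApp ε δ) X = T eta0 X + ε * T (eta1 δ) X + ε ^ 2 * T (eta2 (log (1 / ε)) δ) X
      + ε ^ 3 * T (eta3 (log (1 / ε))) X + ε ^ 4 * T (eta4 (log (1 / ε))) X := by
  have z1 := (pf_eta1.mem isLin_inZ 0 δ).smul ε
  have z2 := (pf_eta2.mem isLin_inZ (log (1 / ε)) δ).smul (ε ^ 2)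
  have z3 := (pf_eta3.mem isLin_inZ (log (1 / ε)) δ).smul (ε ^ 3)
  have z4 := (pf_eta4.mem isLin_inZ (log (1 / ε)) δ).smul (ε ^ 4)
  have y1 := inZ_eta0.add z1
  have y2 := y1.add z2
  rw [etaApp, ha (y2.add z3) z4, ha y2 z3, ha y1 z2, ha inZ_eta0 z1, hs, hs, hs, hs]
  rfl

lemma phiStar_expansion (hS : S ⊆ admissible σ) (hσ : 0 < σ) {χ : ℝ → ℝ} (hχ : IsCutoff χ) :
    ∃ (G : ℝ × ℝ × ℝ² → ℝ² → ℝ) (c : ℝ × ℝ × ℝ² → ℝ), DBd S (fun i => i.1) wt (fun i => i.2.2) 3 G ∧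
      ∀ i ∈ S, phiStar σ χ i.1 i.2.1 =ᶠ[nhds i.2.2] fun X =>
        phi0 X + i.1 * phi1 (log (1 / i.1)) i.2.1 X + i.1 ^ 2 * phi2 (log (1 / i.1)) i.2.1 X + c i + G i X := by
  have hs := isScale_admissible hS
  have hδ : ∀ i ∈ S, |i.2.1| ≤ 1 := fun i hi => abs_le.2 ⟨by linarith [(hS hi).2.2.1], (hS hi).2.2.2.1⟩
  have hw := cutoff_compl_le hχ hσ
  have da := decay_etaApp hs hδ
  have d1 : Decay S (fun i => i.1) (3 + 0) fun i X => (χ (i.1 ^ σ * rho X) - 1) * etaApp i.1 i.2.1 X := da.mul hs (by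
    obtain ⟨C, K, hC, h⟩ := hw
    exact ⟨C, K, hC, fun i hi => h i.1 (hS hi).1 (hS hi).2.1⟩)
  have d0 : Decay S (fun i => i.1) 0 fun i => etaStar σ χ i.1 i.2.1 := by
    have := da.add hs (d1.mono hs (Nat.zero_le _))
    have e : (fun i : ℝ × ℝ × ℝ² => etaStar σ χ i.1 i.2.1) = fun i X => etaApp i.1 i.2.1 X + (χ (i.1 ^ σ * rho X) - 1) * etaApp i.1 i.2.1 X := by
      ext i X; rw [etaStar]; ring
    rwa [e]
  have near : ∀ i ∈ S, ∀ᶠ X in nhds i.2.2, i.1 ^ σ * rho X < 1 := fun i hi =>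
    (show Continuous fun X => i.1 ^ σ * rho X from continuous_const.mul continuous_rho).continuousAt.eventually_lt_const (hS hi).2.2.2.2.2
  obtain ⟨b1, i1⟩ := DBd.of_kernel hs (fun i _ => le_rfl) (x := fun i => i.2.2) kerBd_sub d0 fun i hi => by
    filter_upwards [near i hi] with X hX V hV
    have h5 := (hS hi).2.2.2.2.1
    have h1 := mul_rho_le (hS hi).1 h5 X
    rcases le_or_gt (i.1 * rho (X - V)) (1 / 4) with h | h
    · exact .inl ⟨(hS hi).1, (hS hi).2.1, by linarith, h, hV⟩
    · have h2 := mul_rho_le (hS hi).1 h5 (X - V)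
      right
      have : Continuous fun X => i.1 ^ σ * rho X := continuous_const.mul continuous_rho
      filter_upwards [this.continuousAt.eventually_const_lt (show 2 < i.1 ^ σ * rho (X - V) by linarith)] with Y hY
      rw [etaStar, hχ.eq_zero _ hY.le, zero_mul]
  obtain ⟨b2, i2⟩ := DBd.of_kernel hs (fun i _ => le_rfl) (x := fun i => i.2.2) kerBd_kerTwo d1 fun i hi =>
    .of_forall fun X V _ => .inl ⟨(hS hi).1, (hS hi).2.1⟩
  obtain ⟨-, i3⟩ := DBd.of_kernel hs (fun i _ => le_rfl) (x := fun i => i.2.2) kerBd_kerTwo da fun i hi =>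
    .of_forall fun X V _ => .inl ⟨(hS hi).1, (hS hi).2.1⟩
  have P := fun (n : ℕ) (hn : 3 ≤ n) {G : ℝ → ℝ → ℝ² → ℝ} (hG : PF TG G) => (hG.dbd_pow hS n).mono hs hn
  have p0 := (P 3 le_rfl pf_eta3.BS0).add hs (P 4 (by norm_num) pf_eta4.BS0)
  have p1 := ((P 3 le_rfl (pf_eta2.BS 1)).add hs (P 4 (by norm_num) (pf_eta3.BS 1))).add hs (P 5 (by norm_num) (pf_eta4.BS 1))
  have p2 := (((P 3 le_rfl (pf_eta1.BS 2)).add hs (P 4 (by norm_num) (pf_eta2.BS 2))).add hs (P 5 (by norm_num) (pf_eta3.BS 2))).add hs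
    (P 6 (by norm_num) (pf_eta4.BS 2))
  have bG := ((((b1.mono hs (l := 3) (by norm_num)).add hs (b2.mono hs (l := 3) (by norm_num))).smul hs (1 / (2 * π))).add hs p0).add hs
    (p1.add hs p2)
  refine ⟨_, fun i => (log (1 / i.1) - 2) / (2 * π) * ∫ Y, etaApp i.1 i.2.1 Y, bG, fun i hi => ?_⟩
  filter_upwards [i1 i hi, i2 i hi, i3 i hi] with X j1 j2 j3
  have s1 := integral_add (j1.add j2) j3
  have s2 := integral_add j1 j2
  simp only [Pi.add_apply] at s1 s2
  have e : ∀ V, kerFull i.1 V X * etaStar σ χ i.1 i.2.1 (X - V) = (kerFull i.1 V X - kerTwo i.1 V X) * etaStar σ χ i.1 i.2.1 (X - V)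
      + kerTwo i.1 V X * ((χ (i.1 ^ σ * rho (X - V)) - 1) * etaApp i.1 i.2.1 (X - V)) + kerTwo i.1 V X * etaApp i.1 i.2.1 (X - V) := fun V => by
    rw [etaStar]; ring
  rw [phiStar_eq hχ (hS hi).1 (hS hi).2.2.2.2.1]
  simp only [e]
  rw [s1, s2, mul_add, integral_kerTwo i.1 (inZ_etaApp _ _)]
  rw [map_etaApp BS0_add BS0_smul, map_etaApp (BS_add _ 1) (fun _ _ => BS_smul _ 1 _), map_etaApp (BS_add _ 2) (fun _ _ => BS_smul _ 2 _)]
  simp only [phi0, phi1, phi2, Pi.add_apply]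
  ring

end

/-! ### The potential vorticity relative to the Gaussian -/

/-- Multiplication by `e^{ρ²/4}`. -/
def expq (f : ℝ² → ℝ) : ℝ² → ℝ := fun X => exp (quarter X) * f X

lemma PF.expq {G : ℝ → ℝ → ℝ² → ℝ} (hG : PF InZ G) : PF TG fun β δ => expq (G β δ) :=
  hG.map isLin_inZ VortexRing.expq (fun h => h) (fun _ _ => by ext X; simp [VortexRing.expq]; ring)
    fun c _ => by ext X; simp [VortexRing.expq]; ring

/-- Expansion of the potential vorticity `η_app / (1 + ε R)`. -/
def pv1 (δ : ℝ) : ℝ² → ℝ := eta1 δ - cR * eta0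
def pv2 (β δ : ℝ) : ℝ² → ℝ := eta2 β δ - cR * eta1 δ + cR ^ 2 * eta0

lemma pf_pv1 : PF InZ fun _ δ => pv1 δ := pf_eta1.sub isLin_inZ (pf_eta0.mulc isLin_inZ (p := cR) fun h => h.mul_left TG.cR)
lemma pf_pv2 : PF InZ pv2 := (pf_eta2.sub isLin_inZ (pf_eta1.mulc isLin_inZ (p := cR) fun h => h.mul_left TG.cR)).add
    (pf_eta0.mulc isLin_inZ (p := cR ^ 2) fun h => h.mul_left (TG.cR.pow 2))

/-- Relative size of the corrections to the potential vorticity. -/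
def relPert (i : ℝ × ℝ × ℝ²) (X : ℝ²) : ℝ := etaApp i.1 i.2.1 X / (1 + i.1 * X.1) / eta0 X - 1

section
variable {S : Set (ℝ × ℝ × ℝ²)} {σ : ℝ}

lemma abs_mul_fst_le {i : ℝ × ℝ × ℝ²} (hi : i ∈ admissible σ) : |i.1 * i.2.2.1| ≤ 1 / 16 := by
  have h1 := mul_rho_le hi.1 hi.2.2.2.2.1 i.2.2
  have h2 := hi.2.2.2.2.2
  rw [abs_mul, abs_of_pos hi.1]
  have := mul_le_mul_of_nonneg_left (abs_fst_le_rho i.2.2) hi.1.le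
  linarith

lemma dbd_fst (hS : S ⊆ admissible σ) : DBd S (fun i => i.1) wt (fun i => i.2.2) 1 fun i X => i.1 * X.1 := by
  simpa [cR] using (PF.base TG.cR).dbd_pow hS 1

lemma relPert_expansion (hS : S ⊆ admissible σ) : ∃ H, DBd S (fun i => i.1) wt (fun i => i.2.2) 0 H ∧
    ∀ i ∈ S, relPert i =ᶠ[nhds i.2.2] fun X => i.1 * (4 * π * expq (pv1 i.2.1) X)
      + i.1 ^ 2 * (4 * π * expq (pv2 (log (1 / i.1)) i.2.1) X) + i.1 ^ 3 * H i X := by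
  have hs := isScale_admissible hS
  have hy := dbd_fst hS
  have hu : DBd S (fun i => i.1) wt (fun i => i.2.2) 1 fun i X => (1 + i.1 * X.1)⁻¹ - 1 := by
    refine hy.comp_of_deriv (g := fun y => (1 + y)⁻¹ - 1) hs (g' := fun y => -1 / (1 + y) ^ 2) two_pos.le 0
      (fun i hi => abs_mul_fst_le (hS hi)) (by simp) (fun y hy => ?_) fun y hy => ?_ <;> obtain ⟨h1, h2⟩ := abs_le.1 hy
    · exact (((hasDerivAt_id y).const_add 1).inv (by simp only [id]; linarith)).sub_const 1
    · rw [abs_div, abs_neg, abs_one, abs_of_nonneg (sq_nonneg (1 + y)), pow_zero, mul_one, div_le_iff₀ (by nlinarith)]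
      nlinarith
  have hu' := (DBd.const (S := S) (e := fun i => i.1) (J := wt) (x := fun i => i.2.2) 1).add hs (hu.mono hs zero_le_one)
  have mR : ∀ {G : ℝ → ℝ → ℝ² → ℝ} (n : ℕ), PF InZ G → PF InZ fun β δ => cR ^ n * G β δ := fun n h =>
    h.mulc isLin_inZ (p := cR ^ n) fun h => h.mul_left (TG.cR.pow n)
  have p3 := (((pf_eta3.sub isLin_inZ (mR 1 pf_eta2)).add (mR 2 pf_eta1)).sub isLin_inZ (mR 3 pf_eta0)).expq
  have hH := (hu'.mul hs ((p3.dbd_pow hS 0).add hs ((pf_eta4.expq.dbd_pow hS 1).mono hs zero_le_one))).smul hs (4 * π)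
  refine ⟨_, hH, fun i hi => ?_⟩
  have pos : ∀ᶠ X in nhds i.2.2, 0 < 1 + i.1 * X.1 := (show Continuous fun X : ℝ² => 1 + i.1 * X.1 by fun_prop).continuousAt.eventually_const_lt
      (by linarith [(abs_le.1 (abs_mul_fst_le (hS hi))).1])
  filter_upwards [pos] with X hX
  have hpi := pi_ne_zero
  have e0 : eta0 X = (4 * π * exp (quarter X))⁻¹ := by rw [eta0_apply, exp_neg]; field_simp
  simp only [relPert, etaApp, expq, pv1, pv2, Pi.add_apply, Pi.sub_apply, Pi.mul_apply, Pi.smul_apply, Pi.pow_apply, smul_eq_mul, cR, e0,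
    pow_zero, pow_one, one_mul]
  field_simp
  ring

lemma dbd_relPert (hS : S ⊆ admissible σ) : DBd S (fun i => i.1) wt (fun i => i.2.2) 1 relPert := by
  have hs := isScale_admissible hS
  obtain ⟨H, hH, h⟩ := relPert_expansion hS
  have h1 := (pf_pv1.expq.smul isLin_tg (4 * π)).dbd_pow hS 1
  have h2 := (pf_pv2.expq.smul isLin_tg (4 * π)).dbd_pow hS 2
  have h3 := (DBd.param (x := fun i => i.2.2) ((Bd.small hs).pow hs 3)).mul hs hH
  refine ((h1.add hs (h2.mono hs one_le_two)).add hs (h3.mono hs (l := 1) (by norm_num))).congr fun i hi => (h i hi).trans (.of_forall fun X => ?_)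
  simp

end

/-! ### Taylor expansion of `Ein` -/

lemma taylor_step {f f' : ℝ → ℝ} {a C : ℝ} {n : ℕ} (hC : 0 ≤ C) (ha : -1 ≤ a) (hf : ∀ y, HasDerivAt f (f' y) y) (h0 : f a = 0)
    (h : ∀ y, -1 ≤ y → |f' y| ≤ C * |y - a| ^ n) : ∀ y, -1 ≤ y → |f y| ≤ C * |y - a| ^ (n + 1) := fun y hy => by
  have key := (convex_uIcc a y).norm_image_sub_le_of_norm_hasDerivWithin_le (f := f) (f' := f') (C := C * |y - a| ^ n)
    (fun z _ => (hf z).hasDerivWithinAt) (fun z hz => ?_) left_mem_uIcc right_mem_uIcc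
  · rw [h0, sub_zero, norm_eq_abs, norm_eq_abs] at key
    rwa [pow_succ, ← mul_assoc]
  · have h1 := abs_sub_left_of_mem_uIcc hz
    have hz1 : -1 ≤ z := (le_min ha hy).trans hz.1
    exact (h z hz1).trans (mul_le_mul_of_nonneg_left (pow_le_pow_left₀ (abs_nonneg _) h1 n) hC)

lemma abs_EK_le (k : ℕ) {y : ℝ} (hy : -1 ≤ y) : |EK k y| ≤ exp 1 := by rw [abs_of_pos (EK_pos k y)]; exact EK_le_exp k zero_le_one hy

section
variable {a y : ℝ}

lemma EK_taylor_zero (k : ℕ) (ha : -1 ≤ a) : ∀ y, -1 ≤ y → |EK k y - EK k a| ≤ exp 1 * |y - a| ^ 1 :=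
  taylor_step (exp_pos 1).le ha (f' := fun y => -EK (k + 1) y) (fun y => (hasDerivAt_EK k y).sub_const _) (sub_self _)
    fun y hy => by rw [abs_neg, pow_zero, mul_one]; exact abs_EK_le _ hy

lemma EK_taylor_one (k : ℕ) (ha : -1 ≤ a) : ∀ y, -1 ≤ y → |EK k y - EK k a + EK (k + 1) a * (y - a)| ≤ exp 1 * |y - a| ^ 2 :=
  taylor_step (exp_pos 1).le ha (f' := fun y => -EK (k + 1) y + EK (k + 1) a * 1)
    (fun y => ((hasDerivAt_EK k y).sub_const _).add (((hasDerivAt_id y).sub_const a).const_mul _)) (by simp)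
    fun y hy => by
      have := EK_taylor_zero (k + 1) ha y hy
      rwa [← abs_neg, show -(-EK (k + 1) y + EK (k + 1) a * 1) = EK (k + 1) y - EK (k + 1) a by ring]

lemma EK_taylor_two (ha : -1 ≤ a) : ∀ y, -1 ≤ y →
    |EK 0 y - EK 0 a + EK 1 a * (y - a) - 1 / 2 * EK 2 a * (y - a) ^ 2| ≤ exp 1 * |y - a| ^ 3 :=
  taylor_step (exp_pos 1).le ha (f' := fun y => -EK 1 y + EK 1 a * 1 - 1 / 2 * EK 2 a * (2 * (y - a)))
    (fun y => ((((hasDerivAt_EK 0 y).sub_const _).add (((hasDerivAt_id y).sub_const a).const_mul _)).sub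
      ((((hasDerivAt_id y).sub_const a).pow 2).const_mul _)).congr_deriv (by simp)) (by simp)
    fun y hy => by
      have := EK_taylor_one 1 ha y hy
      rwa [← abs_neg, show -(-EK 1 y + EK 1 a * 1 - 1 / 2 * EK 2 a * (2 * (y - a))) = EK 1 y - EK 1 a + EK (1 + 1) a * (y - a) by norm_num; ring]

lemma Ein_taylor (ha : -1 ≤ a) : ∀ y, -1 ≤ y →
    |Ein y - Ein a - EK 0 a * (y - a) + 1 / 2 * EK 1 a * (y - a) ^ 2| ≤ exp 1 * |y - a| ^ 3 :=
  taylor_step (exp_pos 1).le ha (f' := fun y => EK 0 y - EK 0 a * 1 + 1 / 2 * EK 1 a * (2 * (y - a)))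
    (fun y => ((((hasDerivAt_Ein y).sub_const _).sub (((hasDerivAt_id y).sub_const a).const_mul _)).add
      ((((hasDerivAt_id y).sub_const a).pow 2).const_mul _)).congr_deriv (by simp)) (by simp)
    fun y hy => by
      have := EK_taylor_one 0 ha y hy
      rwa [show EK 0 y - EK 0 a * 1 + 1 / 2 * EK 1 a * (2 * (y - a)) = EK 0 y - EK 0 a + EK (0 + 1) a * (y - a) by norm_num; ring]

end

section
variable {ι : Type*} {S : Set ι} {e J : ι → ℝ} {x : ι → ℝ²} {L : ι → ℝ² → ℝ}

lemma DBd.ein_rem (hs : IsScale S e J) (hJ : ∀ i ∈ S, 1 + ‖x i‖ ≤ J i) (hL : DBd S e J x 1 L) (hL1 : ∀ i ∈ S, |L i (x i)| ≤ 1) :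
    DBd S e J x 3 fun i X => Ein (quarter X - L i X) - Ein (quarter X) + EKf 0 X * L i X + 1 / 2 * (EKf 1 X * L i X ^ 2) := by
  have q0 : ∀ i, -1 ≤ quarter (x i) := fun i => by linarith [quarter_nonneg (x i)]
  have q1 : ∀ i ∈ S, -1 ≤ quarter (x i) - L i (x i) := fun i hi => by linarith [quarter_nonneg (x i), (abs_le.1 (hL1 i hi)).2]
  have hp : ∀ n : ℕ, Bd S e J n fun i => exp 1 * |L i (x i)| ^ n := fun n => by
    simpa using ((hL.2.1.of_abs_le (g := fun i => |L i (x i)|) fun i _ => by rw [abs_abs]).pow hs n).smul hs (exp 1)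
  have b2 : Bd S e J 2 fun i => EK 0 (quarter (x i) - L i (x i)) - EK 0 (quarter (x i)) - EK 1 (quarter (x i)) * L i (x i) :=
    (hp 2).of_abs_le fun i hi => by
      have := EK_taylor_one 0 (q0 i) _ (q1 i hi)
      rw [abs_of_nonneg (a := exp 1 * _) (by positivity)]
      simpa [← sub_eq_add_neg] using this
  have b3 : Bd S e J 3 fun i => EK 0 (quarter (x i) - L i (x i)) - EK 0 (quarter (x i)) - EK 1 (quarter (x i)) * L i (x i)
      - 1 / 2 * EK 2 (quarter (x i)) * L i (x i) ^ 2 := (hp 3).of_abs_le fun i hi => by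
      have := EK_taylor_two (q0 i) _ (q1 i hi)
      rw [abs_of_nonneg (a := exp 1 * _) (by positivity)]
      simpa [← sub_eq_add_neg] using this
  have hq := DBd.of_tg (S := S) (e := e) tg_quarter hJ
  refine .of_hasFDerivAt (a := fun i => (EK 0 (quarter (x i) - L i (x i)) - EK 0 (quarter (x i)) - EK 1 (quarter (x i)) * L i (x i)
      - 1 / 2 * EK 2 (quarter (x i)) * L i (x i) ^ 2) * dR quarter (x i)
      - (EK 0 (quarter (x i) - L i (x i)) - EK 0 (quarter (x i)) - EK 1 (quarter (x i)) * L i (x i)) * dR (L i) (x i))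
    (b := fun i => (EK 0 (quarter (x i) - L i (x i)) - EK 0 (quarter (x i)) - EK 1 (quarter (x i)) * L i (x i)
      - 1 / 2 * EK 2 (quarter (x i)) * L i (x i) ^ 2) * dZ quarter (x i)
      - (EK 0 (quarter (x i) - L i (x i)) - EK 0 (quarter (x i)) - EK 1 (quarter (x i)) * L i (x i)) * dZ (L i) (x i))
    (fun i hi => ?_) ((hp 3).of_abs_le fun i hi => ?_) ((b3.mul hs hq.2.2.1).sub hs (b2.mul hs hL.2.2.1))
    ((b3.mul hs hq.2.2.2).sub hs (b2.mul hs hL.2.2.2))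
  · have d1 := hasFDerivAt_lin (hq.1 i hi)
    have d2 := hasFDerivAt_lin (hL.1 i hi)
    have d3 := (hasDerivAt_Ein _).comp_hasFDerivAt (x i) (d1.sub d2)
    have d4 := (hasDerivAt_Ein _).comp_hasFDerivAt (x i) d1
    have d5 := (hasDerivAt_EK 0 _).comp_hasFDerivAt (x i) d1
    have d6 := (hasDerivAt_EK 1 _).comp_hasFDerivAt (x i) d1
    refine (((d3.sub d4).add (d5.mul d2)).add ((d6.mul (d2.pow 2)).const_mul (1 / 2))).congr_fderiv ?_
    ext <;> simp [lin_apply] <;> ring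
  · have := Ein_taylor (q0 i) _ (q1 i hi)
    rw [abs_of_nonneg (a := exp 1 * _) (by positivity)]
    rw [sub_sub_cancel_left, abs_neg] at this
    convert this using 2
    simp only [EKf]; ring

end

/-! ### Relation between the stream function and the potential vorticity -/

/-- First order term in the relation, at order `δ`. -/
def relation1 : ℝ² → ℝ := BS0 eta11 - Aop eta11

lemma tg_relation1 : TG relation1 := (TG.BS0 (inZ_lamInv _)).sub (TG.Aop (inZ_lamInv _))

lemma relation1_eq (β δ : ℝ) : phi1 β δ - b0 β • cR - Aop (pv1 δ) = δ • relation1 := by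
  have h := phi1_zero β
  have z : InZ eta11 := inZ_lamInv _
  rw [phi1, eta1_zero, zeta1, Aop_sub] at h
  rw [phi1, pv1, eta1, BS0_add inZ_eta10 (z.smul δ), BS0_smul, Aop_sub, Aop_add, Aop_smul, relation1, smul_sub]
  linear_combination h

/-- Second order terms in the relation. -/
def relation2 (β δ : ℝ) : ℝ² → ℝ := phi2 β δ - (1 / 2 : ℝ) • (b0 β • cR ^ 2) - Aop (pv2 β δ)
  + (2 * π) • ((EKf 0 - EKf 1) * (expq (pv1 δ) * expq (pv1 δ)))

lemma pf_relation2 : PF TG relation2 :=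
  ((pf_phi2.sub isLin_tg ((PF.b0_smul isLin_tg (.base (TG.cR.pow 2))).smul isLin_tg (1 / 2))).sub isLin_tg pf_pv2.Aop).add
    (((pf_pv1.expq.mul pf_pv1.expq).mulc isLin_tg (p := EKf 0 - EKf 1) fun h => ((tg_EKf 0).sub (tg_EKf 1)).mul h).smul isLin_tg (2 * π))

lemma relation2_zero (β : ℝ) : relation2 β 0 = secondOrder β := by
  ext X
  obtain ⟨h1, h2⟩ := deriv_Phi0_eta0 β X
  rw [secondOrder, h1, h2]
  simp only [relation2, Aop, pv1, pv2, expq, Pi.add_apply, Pi.sub_apply, Pi.mul_apply, Pi.smul_apply, Pi.pow_apply, smul_eq_mul, cR]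
  ring

/-- Logarithm of the relative potential vorticity. -/
def relLog (i : ℝ × ℝ × ℝ²) (X : ℝ²) : ℝ := log (1 + relPert i X)

section
variable {S : Set (ℝ × ℝ × ℝ²)} {σ : ℝ}

lemma dbd_relLog_sub (hS : S ⊆ admissible σ) (hr : ∀ i ∈ S, |relPert i i.2.2| ≤ 1 / 4) :
    DBd S (fun i => i.1) wt (fun i => i.2.2) 2 fun i X => relLog i X - relPert i X := by
  have hs := isScale_admissible hS
  have h := dbd_relPert hS
  refine ((((h.pow hs 2).smul hs (-(1 / 2))).mono hs (l := 2) (by norm_num)).add hs ((h.logRem hs hr).mono hs (l := 2) (by norm_num))).congr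
    fun i hi => .of_forall fun X => ?_
  simp only [relLog, logRem]; ring

lemma dbd_relLog (hS : S ⊆ admissible σ) (hr : ∀ i ∈ S, |relPert i i.2.2| ≤ 1 / 4) :
    DBd S (fun i => i.1) wt (fun i => i.2.2) 1 relLog := by
  have hs := isScale_admissible hS
  refine (((dbd_relLog_sub hS hr).mono hs one_le_two).add hs (dbd_relPert hS)).congr fun i hi => .of_forall fun X => ?_
  simp

lemma abs_relLog_le {i : ℝ × ℝ × ℝ²} (hr : |relPert i i.2.2| ≤ 1 / 4) : |relLog i i.2.2| ≤ 1 := by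
  obtain ⟨h1, h2⟩ := abs_le.1 hr
  have h3 := log_le_sub_one_of_pos (show 0 < 1 + relPert i i.2.2 by linarith)
  have h4 := one_sub_inv_le_log_of_pos (show 0 < 1 + relPert i i.2.2 by linarith)
  have h5 : (1 + relPert i i.2.2)⁻¹ ≤ 2 := inv_le_of_inv_le₀ (by norm_num) (by linarith)
  rw [relLog, abs_le]
  constructor <;> linarith

lemma relation_expansion (hS : S ⊆ admissible σ) (hr : ∀ i ∈ S, |relPert i i.2.2| ≤ 1 / 4) :
    ∃ (H : ℝ → ℝ → ℝ² → ℝ) (G : ℝ × ℝ × ℝ² → ℝ² → ℝ), PF TG H ∧ DBd S (fun i => i.1) wt (fun i => i.2.2) 3 G ∧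
      ∀ i ∈ S, (fun X => phi0 X + i.1 * phi1 (log (1 / i.1)) i.2.1 X + i.1 ^ 2 * phi2 (log (1 / i.1)) i.2.1 X
          - (b0 (log (1 / i.1)) * (i.1 * X.1) + b0 (log (1 / i.1)) / 2 * (i.1 * X.1) ^ 2)
          + 1 / (4 * π) * Ein (quarter X - relLog i X)) =ᶠ[nhds i.2.2] fun X =>
        phi0 0 + i.1 * (i.2.1 * relation1 X) + i.1 ^ 2 * (secondOrder (log (1 / i.1)) X + i.2.1 * H (log (1 / i.1)) i.2.1 X) + G i X := by
  have hs := isScale_admissible hS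
  have hJ : ∀ i ∈ S, 1 + ‖i.2.2‖ ≤ wt i := fun i _ => by rw [wt]; nlinarith [abs_nonneg (log (1 / i.1)), norm_nonneg i.2.2]
  obtain ⟨H, hH, eH⟩ := pf_relation2.sub_zero isLin_tg
  obtain ⟨H₃, dH, eP⟩ := relPert_expansion hS
  have dL := dbd_relLog hS hr
  have dP := dbd_relPert hS
  have dM := dbd_relLog_sub hS hr
  have dR := dL.ein_rem hs hJ fun i hi => abs_relLog_le (hr i hi)
  have dlr := dP.logRem hs hr
  have E0 := DBd.of_tg (S := S) (e := fun i => i.1) (x := fun i => i.2.2) (tg_EKf 0) hJ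
  have E1 := DBd.of_tg (S := S) (e := fun i => i.1) (x := fun i => i.2.2) (tg_EKf 1) hJ
  have d1 := (pf_pv1.expq.smul isLin_tg (4 * π)).dbd_pow hS 1
  have d2 := (pf_pv2.expq.smul isLin_tg (4 * π)).dbd_pow hS 2
  have d3 := (DBd.param (x := fun i => i.2.2) ((Bd.small hs).pow hs 3)).mul hs dH
  have dk := d2.add hs (d3.mono hs (l := 2) (by norm_num))
  have g1 := (E0.mul hs dlr).mono hs (l := 3) (by norm_num)
  have g2 := (E1.mul hs (dM.mul hs ((dP.smul hs 2).add hs (dM.mono hs one_le_two)))).mono hs (l := 3) (by norm_num)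
  have g3 := (E0.mul hs d3).mono hs (l := 3) (by norm_num)
  have g4 := ((E0.sub hs E1).mul hs (dk.mul hs ((d1.smul hs 2).add hs (dk.mono hs one_le_two)))).mono hs (l := 3) (by norm_num)
  refine ⟨H, _, hH, ((((dR.sub hs g1).sub hs (g2.smul hs (1 / 2))).sub hs g3).add hs (g4.smul hs (1 / 2))).smul hs (1 / (4 * π)), fun i hi => ?_⟩
  filter_upwards [eP i hi] with X hX
  have r1 := congrFun (relation1_eq (log (1 / i.1)) i.2.1) X
  have r2 := congrFun (eH (log (1 / i.1)) i.2.1) X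
  rw [relation2_zero] at r2
  simp only [relation2, Aop, expq, Pi.add_apply, Pi.sub_apply, Pi.mul_apply, Pi.smul_apply, Pi.pow_apply, smul_eq_mul, cR] at r1 r2
  rw [phi0_eq X]
  simp only [expq, Pi.smul_apply, smul_eq_mul, pow_one]
  have hl : logRem (relPert i X) = relLog i X - relPert i X + relPert i X ^ 2 / 2 := by rw [logRem, relLog]; ring
  rw [hl]
  have hpi := pi_ne_zero
  simp only [expq] at hX
  generalize relLog i X = L
  rw [hX]
  have r1' := congrArg (fun y => i.1 * y) r1
  have r2' := congrArg (fun y => i.1 ^ 2 * y) r2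
  rw [← sub_eq_zero] at r1' r2' ⊢
  field_simp at r1' r2' ⊢
  linear_combination 4 * π * (2 * r1' + r2')

end

/-! ### Gradient of the remainder -/

lemma profile_growth {f κ κ₁ κ₂ : ℝ → ℝ} {C : ℝ} {N : ℕ} (hf : ContDiff ℝ 2 f) (h1 : ∀ x, HasDerivAt κ (κ₁ x) x)
    (h2 : ∀ x, HasDerivAt κ₁ (κ₂ x) x) (b1 : ∀ x, 0 ≤ x → |κ₁ x| ≤ C * (1 + x) ^ N) (b2 : ∀ x, 0 ≤ x → |κ₂ x| ≤ C * (1 + x) ^ N)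
    (hC : 0 ≤ C) (he : ∀ x, 0 ≤ x → f x = κ x) : ∃ M, 0 ≤ M ∧ ∀ y, -1 ≤ y →
      |deriv f y| ≤ M * (1 + |y|) ^ N ∧ |deriv (deriv f) y| ≤ M * (1 + |y|) ^ N := by
  have c1 := hf.continuous_deriv (by norm_num)
  have hf1 : ContDiff ℝ 1 (deriv f) := ((contDiff_succ_iff_deriv (n := 1)).1 (by exact_mod_cast hf)).2.2
  have c2 := hf1.continuous_deriv le_rfl
  obtain ⟨M₁, hM₁⟩ := (isCompact_Icc (a := (-1 : ℝ)) (b := 0)).exists_bound_of_continuousOn c1.continuousOn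
  obtain ⟨M₂, hM₂⟩ := (isCompact_Icc (a := (-1 : ℝ)) (b := 0)).exists_bound_of_continuousOn c2.continuousOn
  have n1 : 0 ≤ M₁ := (norm_nonneg _).trans (hM₁ 0 (by norm_num))
  have n2 : 0 ≤ M₂ := (norm_nonneg _).trans (hM₂ 0 (by norm_num))
  refine ⟨M₁ + M₂ + C, by positivity, fun y hy => ?_⟩
  have p1 : 1 ≤ (1 + |y|) ^ N := one_le_pow₀ (by linarith [abs_nonneg y])
  rcases le_or_gt y 0 with h | h
  · have a1 := hM₁ y ⟨hy, h⟩
    have a2 := hM₂ y ⟨hy, h⟩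
    rw [norm_eq_abs] at a1 a2
    constructor <;> nlinarith
  · have e1 : ∀ y, 0 < y → deriv f y = κ₁ y := fun y h => by
      rw [(show f =ᶠ[nhds y] κ by filter_upwards [lt_mem_nhds h] with z hz using he z hz.le).deriv_eq, (h1 y).deriv]
    have e2 : deriv (deriv f) y = κ₂ y := by
      rw [(show deriv f =ᶠ[nhds y] κ₁ by filter_upwards [lt_mem_nhds h] with z hz using e1 z hz).deriv_eq, (h2 y).deriv]
    have a1 := b1 y h.le
    have a2 := b2 y h.le
    rw [← e1 y h] at a1
    rw [← e2] at a2
    rw [abs_of_pos h] at p1 ⊢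
    constructor <;> nlinarith

lemma c1_profile_le {f : ℝ → ℝ} {M : ℝ} {N : ℕ} (hf : ContDiff ℝ 2 f) (hM : 0 ≤ M)
    (hb : ∀ y, -1 ≤ y → |deriv f y| ≤ M * (1 + |y|) ^ N ∧ |deriv (deriv f) y| ≤ M * (1 + |y|) ^ N)
    {L : ℝ² → ℝ} (hL : DifferentiableAt ℝ L X) (hL1 : |L X| ≤ 1) :
    DifferentiableAt ℝ (fun X => f (quarter X - L X) - f (quarter X)) X ∧
      c1 (fun X => f (quarter X - L X) - f (quarter X)) X ≤ M * ((2 + quarter X) ^ N * (c1 L X * (2 + c1 quarter X))) := by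
  have hf1 : ContDiff ℝ 1 (deriv f) := ((contDiff_succ_iff_deriv (n := 1)).1 (by exact_mod_cast hf)).2.2
  have d0 : ∀ y, HasDerivAt f (deriv f y) y := fun y => (hf.differentiable (by norm_num) y).hasDerivAt
  have d1 : ∀ y, HasDerivAt (deriv f) (deriv (deriv f) y) y := fun y => (hf1.differentiable (by norm_num) y).hasDerivAt
  have dq := hasFDerivAt_lin (tg_quarter.diff X)
  have dL := hasFDerivAt_lin hL
  have key : HasFDerivAt (fun X => f (quarter X - L X) - f (quarter X))
      (lin ((deriv f (quarter X - L X) - deriv f (quarter X)) * dR quarter X - deriv f (quarter X - L X) * dR L X)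
        ((deriv f (quarter X - L X) - deriv f (quarter X)) * dZ quarter X - deriv f (quarter X - L X) * dZ L X)) X := by
    refine (((d0 _).comp_hasFDerivAt X (dq.sub dL)).sub ((d0 _).comp_hasFDerivAt X dq)).congr_fderiv ?_
    ext <;> simp [lin_apply] <;> ring
  refine ⟨key.differentiableAt, ?_⟩
  have hq := quarter_nonneg X
  set B := M * (2 + quarter X) ^ N with hB
  have hB0 : 0 ≤ B := by positivity
  have seg : ∀ z ∈ uIcc (quarter X) (quarter X - L X), |deriv f z| ≤ B ∧ |deriv (deriv f) z| ≤ B := fun z hz => by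
    have h1 := abs_sub_left_of_mem_uIcc hz
    rw [sub_sub_cancel_left, abs_neg] at h1
    obtain ⟨h2, h3⟩ := abs_le.1 (h1.trans hL1)
    have h4 : 1 + |z| ≤ 2 + quarter X := by
      have : |z| ≤ quarter X + 1 := abs_le.2 ⟨by linarith, by linarith⟩
      linarith
    have h5 : M * (1 + |z|) ^ N ≤ B := mul_le_mul_of_nonneg_left (pow_le_pow_left₀ (by positivity) h4 N) hM
    have h6 := hb z (by linarith)
    exact ⟨h6.1.trans h5, h6.2.trans h5⟩
  have t0 := (convex_uIcc (quarter X) (quarter X - L X)).norm_image_sub_le_of_norm_hasDerivWithin_le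
    (fun z _ => (d0 z).hasDerivWithinAt) (fun z hz => (seg z hz).1) left_mem_uIcc right_mem_uIcc
  have t1 := (convex_uIcc (quarter X) (quarter X - L X)).norm_image_sub_le_of_norm_hasDerivWithin_le
    (fun z _ => (d1 z).hasDerivWithinAt) (fun z hz => (seg z hz).2) left_mem_uIcc right_mem_uIcc
  rw [sub_sub_cancel_left, norm_neg, norm_eq_abs, norm_eq_abs] at t0 t1
  have t2 := (seg _ (right_mem_uIcc (a := quarter X))).1
  have part : ∀ a b, |(deriv f (quarter X - L X) - deriv f (quarter X)) * a - deriv f (quarter X - L X) * b| ≤ B * |L X| * |a| + B * |b| :=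
    fun a b => (abs_sub _ _).trans (by
      rw [abs_mul, abs_mul]
      exact add_le_add (mul_le_mul_of_nonneg_right t1 (abs_nonneg _)) (mul_le_mul_of_nonneg_right t2 (abs_nonneg _)))
  rw [c1_of_hasFDerivAt key]
  have s1 := part (dR quarter X) (dR L X)
  have s2 := part (dZ quarter X) (dZ L X)
  have u1 : |L X| ≤ c1 L X := by rw [c1]; linarith [abs_nonneg (dR L X), abs_nonneg (dZ L X)]
  have u2 : |dR L X| + |dZ L X| ≤ c1 L X := by rw [c1]; linarith [abs_nonneg (L X)]
  have u3 : |dR quarter X| + |dZ quarter X| ≤ c1 quarter X := by rw [c1]; linarith [abs_nonneg (quarter X)]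
  calc _ ≤ B * (|L X| + |L X| * (|dR quarter X| + |dZ quarter X|) + (|dR L X| + |dZ L X|)) := by linarith
    _ ≤ B * (c1 L X + c1 L X * c1 quarter X + c1 L X) := by
        refine mul_le_mul_of_nonneg_left (add_le_add (add_le_add u1 ?_) u2) hB0
        exact mul_le_mul u1 u3 (by positivity) (c1_nonneg _ _)
    _ = _ := by rw [hB]; ring

lemma speed_bound : ∃ (ε₀ C : ℝ) (N : ℕ), 0 < ε₀ ∧ 0 ≤ C ∧ ∀ Γ r₀ ν T : ℝ, 0 < Γ → 0 < r₀ → 0 < ν → ∀ rbar : ℝ → ℝ,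
    IsRadius Γ r₀ ν T rbar → ∀ t ∈ Ioo 0 T, ∀ δ ε : ℝ, δ = ν / Γ → ε = √(ν * t) / rbar t → δ ≤ 1 → ε < ε₀ →
      |rbar t * zDotStar Γ r₀ δ ε / (2 * Γ) - b0 (log (1 / ε)) / 2| ≤ C * ε ^ 2 * (1 + |log (1 / ε)|) ^ N := by
  obtain ⟨ε₀, h0, h01, h⟩ := radius_bound
  obtain ⟨C, N, hC, hv⟩ := velocity_bounds
  refine ⟨ε₀, 1 + 2 * |cv| + 2 * C, N + 1, h0, by positivity, fun Γ r₀ ν T hΓ hr hν rbar hR t ht δ ε hδ hε hδ1 hε0 => ?_⟩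
  subst hδ hε
  have h1 := h Γ r₀ ν T hΓ hr hν rbar hR t ht hδ1 hε0
  set δ := ν / Γ
  set ε := √(ν * t) / rbar t
  set β := log (1 / ε)
  have h2 := (hv β δ (by positivity) hδ1).2
  have h3 : |b0 β| ≤ (1 + 2 * |cv|) * (1 + |β|) := by
    have hpi : 1 ≤ 4 * π := by linarith [pi_gt_three]
    rw [b0, abs_div, abs_of_pos (a := 4 * π) (by positivity), div_le_iff₀ (by positivity)]
    have h4 : |β - 1 + 2 * cv| ≤ |β| + 1 + 2 * |cv| := by
      refine (abs_add_le _ _).trans (add_le_add ((abs_sub _ _).trans (by simp)) (by simp [abs_mul]))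
    have h5 : 0 ≤ (1 + 2 * |cv|) * (1 + |β|) := by positivity
    nlinarith [abs_nonneg β, abs_nonneg cv]
  have hb : 1 ≤ 1 + |β| := by linarith [abs_nonneg β]
  have p1 : 1 + |β| ≤ (1 + |β|) ^ (N + 1) := le_self_pow₀ hb (by omega)
  have p2 : (1 + |β|) ^ N ≤ (1 + |β|) ^ (N + 1) := pow_le_pow_right₀ hb (by omega)
  have e : rbar t * zDotStar Γ r₀ δ ε / (2 * Γ) - b0 β / 2 = ((rbar t / r₀ - 1) * (b0 β + ε ^ 2 * b2 β δ) + ε ^ 2 * b2 β δ) / 2 := by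
    rw [zDotStar]; field_simp; ring
  have q : 0 ≤ ε ^ 2 := sq_nonneg ε
  have q1 : ε ^ 2 ≤ 1 := pow_le_one₀ (div_nonneg (sqrt_nonneg _) (hR.pos t ht).le) (hε0.le.trans h01)
  have h6 : |(rbar t / r₀ - 1) * (b0 β + ε ^ 2 * b2 β δ) + ε ^ 2 * b2 β δ| ≤ 2 * ε ^ 2 * (|b0 β| + 1 * |b2 β δ|) + ε ^ 2 * |b2 β δ| := by
    refine (abs_add_le _ _).trans (add_le_add ?_ (by rw [abs_mul, abs_of_nonneg q]))
    rw [abs_mul]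
    refine mul_le_mul h1 ((abs_add_le _ _).trans (add_le_add le_rfl ?_)) (abs_nonneg _) (by positivity)
    rw [abs_mul, abs_of_nonneg q]
    exact mul_le_mul_of_nonneg_right q1 (abs_nonneg _)
  have h7 : |b0 β| + 2 * |b2 β δ| ≤ (1 + 2 * |cv| + 2 * C) * (1 + |β|) ^ (N + 1) := by
    have := mul_le_mul_of_nonneg_left p1 (show 0 ≤ 1 + 2 * |cv| by positivity)
    have := mul_le_mul_of_nonneg_left p2 hC
    linarith
  rw [e, abs_div, abs_two]
  calc _ ≤ ε ^ 2 * (|b0 β| + 2 * |b2 β δ|) := by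
        rw [div_le_iff₀ two_pos]
        nlinarith [abs_nonneg (b2 β δ), abs_nonneg (b0 β)]
    _ ≤ ε ^ 2 * ((1 + 2 * |cv| + 2 * C) * (1 + |β|) ^ (N + 1)) := mul_le_mul_of_nonneg_left h7 q
    _ = _ := by ring

section
variable {S : Set (ℝ × ℝ × ℝ²)} {σ : ℝ}

lemma theta_expansion (hS : S ⊆ admissible σ) (hσ : 0 < σ) (hr : ∀ i ∈ S, |relPert i i.2.2| ≤ 1 / 4) {χ : ℝ → ℝ} (hχ : IsCutoff χ) :
    ∃ (H : ℝ → ℝ → ℝ² → ℝ) (G : ℝ × ℝ × ℝ² → ℝ² → ℝ), PF TG H ∧ DBd S (fun i => i.1) wt (fun i => i.2.2) 3 G ∧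
      ∀ Φa Φb, IsPhi2 Φa Φb → ∀ i ∈ S, ∀ Γ r₀ rb, ∃ c, Theta σ χ Φa Φb Γ r₀ i.2.1 i.1 rb =ᶠ[nhds i.2.2] fun X =>
        c + (i.1 * i.2.1 * relation1 X + i.1 ^ 2 * i.2.1 * H (log (1 / i.1)) i.2.1 X + G i X
          + -(rb * zDotStar Γ r₀ i.2.1 i.1 / (2 * Γ) - b0 (log (1 / i.1)) / 2) * (2 * (i.1 * X.1) + (i.1 * X.1) ^ 2)
          + -(i.1 ^ 2 * log (1 / i.1)) * (Φa (exp (-(quarter X - relLog i X)) / (4 * π)) - Φa (exp (-quarter X) / (4 * π)))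
          + -i.1 ^ 2 * (Φb (exp (-(quarter X - relLog i X)) / (4 * π)) - Φb (exp (-quarter X) / (4 * π)))) := by
  have hs := isScale_admissible hS
  obtain ⟨H, G, hH, hG, h⟩ := relation_expansion hS hr
  obtain ⟨G', c, hG', h'⟩ := phiStar_expansion hS hσ hχ
  refine ⟨H, _, hH, hG.add hs hG', fun Φa Φb hΦ i hi Γ r₀ rb => ⟨c i + b0 (log (1 / i.1)) / 2 - rb * zDotStar Γ r₀ i.2.1 i.1 / (2 * Γ), ?_⟩⟩
  have near : ∀ᶠ X in nhds i.2.2, i.1 ^ σ * rho X < 1 :=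
    (show Continuous fun X => i.1 ^ σ * rho X from continuous_const.mul continuous_rho).continuousAt.eventually_lt_const (hS hi).2.2.2.2.2
  have pos : ∀ᶠ X in nhds i.2.2, -1 < relPert i X := ((dbd_relPert hS).1 i hi).continuousAt.eventually_const_lt (by linarith [(abs_le.1 (hr i hi)).1])
  filter_upwards [h i hi, h' i hi, near, pos] with X e e' n p
  have w : etaStar σ χ i.1 i.2.1 X / (1 + i.1 * X.1) = exp (-(quarter X - relLog i X)) / (4 * π) := by
    rw [etaStar, hχ.eq_one _ n.le, one_mul, neg_sub, sub_eq_add_neg, exp_add, relLog, exp_log (by linarith), relPert, add_sub_cancel, eta0_apply]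
    have := exp_pos (-quarter X)
    field_simp
  have w2 : log (1 / (4 * π * (exp (-(quarter X - relLog i X)) / (4 * π)))) = quarter X - relLog i X := by
    rw [mul_div_cancel₀ _ (by positivity), one_div, ← exp_neg, neg_neg, log_exp]
  have e2 := hΦ.eq (log (1 / i.1)) X
  rw [angMean_secondOrder, show eta0 X = exp (-quarter X) / (4 * π) by rw [eta0_apply]; ring] at e2
  rw [Theta, e', PhiEps, w, Phi0, w2]
  rw [← e2] at e
  linear_combination e

end

lemma c1_const_mul_le (a : ℝ) (hf : DifferentiableAt ℝ f X) : c1 (fun X => a * f X) X ≤ |a| * c1 f X := by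
  simpa [c1, dR, dZ] using c1_mul_le (differentiableAt_const a) hf

lemma TG.c1_le (hf : TG f) : ∃ (C : ℝ) (N : ℕ), 0 ≤ C ∧ ∀ X, VortexRing.c1 f X ≤ C * ⟪X⟫ ^ N := by
  have hs : IsScale (univ : Set ℝ²) (fun _ => 1) fun X => 1 + ‖X‖ := ⟨fun _ _ => zero_le_one, fun _ _ => le_rfl, fun X _ => one_le_jb X⟩
  obtain ⟨C, N, hC, h⟩ := (DBd.of_tg (x := fun X => X) hf fun X _ => le_rfl).c1 hs
  exact ⟨C, N, hC, fun X => by simpa using (le_abs_self _).trans (h X trivial)⟩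

section
variable {Φa Φb : ℝ → ℝ}

lemma IsPhi2.contDiff {Φ : ℝ → ℝ} (h : ContDiffOn ℝ 2 Φ (Ioi 0)) : ContDiff ℝ 2 fun y => Φ (exp (-y) / (4 * π)) := by
  refine contDiffOn_univ.1 (h.comp (contDiff_neg.exp.div_const _).contDiffOn fun y _ => ?_)
  exact div_pos (exp_pos _) (by positivity)

lemma IsPhi2.eq_profile (hΦ : IsPhi2 Φa Φb) {κ : ℝ → ℝ} (hκ : ∀ β X, secondOrder β X = β * (1 / (4 * π)) + κ (quarter X)) (y : ℝ) (hy : 0 ≤ y) :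
    Φa (exp (-y) / (4 * π)) = 1 / (4 * π) ∧ Φb (exp (-y) / (4 * π)) = κ y := by
  have hq : quarter (2 * √y, 0) = y := by rw [quarter, mul_pow, sq_sqrt hy]; ring
  have e : ∀ β, β * Φa (exp (-y) / (4 * π)) + Φb (exp (-y) / (4 * π)) = β * (1 / (4 * π)) + κ y := fun β => by
    have := hΦ.eq β (2 * √y, 0)
    rwa [angMean_secondOrder, hκ, eta0_apply, hq, show 1 / (4 * π) * exp (-y) = exp (-y) / (4 * π) by ring] at this
  have h0 := e 0
  have h1 := e 1
  constructor <;> linarith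

end

set_option maxHeartbeats 1200000 in
lemma theta_gradient {S : Set (ℝ × ℝ × ℝ²)} {σ : ℝ} (hS : S ⊆ admissible σ) (hσ : 0 < σ)
    (hr : ∀ i ∈ S, |relPert i i.2.2| ≤ 1 / 4) {χ : ℝ → ℝ} (hχ : IsCutoff χ) :
    ∃ (C : ℝ) (N : ℕ), 0 ≤ C ∧ ∀ Φa Φb, IsPhi2 Φa Φb → ∃ M, 0 ≤ M ∧ ∀ i ∈ S, ∀ Γ r₀ rb W,
      |rb * zDotStar Γ r₀ i.2.1 i.1 / (2 * Γ) - b0 (log (1 / i.1)) / 2| ≤ W → DifferentiableAt ℝ (Theta σ χ Φa Φb Γ r₀ i.2.1 i.1 rb) i.2.2 ∧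
        |dR (Theta σ χ Φa Φb Γ r₀ i.2.1 i.1 rb) i.2.2| + |dZ (Theta σ χ Φa Φb Γ r₀ i.2.1 i.1 rb) i.2.2| ≤
          i.1 * i.2.1 * (C * ⟪i.2.2⟫ ^ N) + i.1 ^ 2 * i.2.1 * (C * wt i ^ N) + i.1 ^ 3 * (C * wt i ^ N)
            + W * (7 * i.1 * ⟪i.2.2⟫ ^ 2) + M * (i.1 ^ 3 * (C * wt i ^ N)) := by
  have hs := isScale_admissible hS
  have hJ : ∀ i ∈ S, 1 + ‖i.2.2‖ ≤ wt i := fun i _ => by rw [wt]; nlinarith [abs_nonneg (log (1 / i.1)), norm_nonneg i.2.2]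
  obtain ⟨κ, κ₁, κ₂, -, k1, k2, ⟨Ca, Na, hCa, ba⟩, ⟨Cb, Nb, hCb, bb⟩, hκ⟩ := exists_secondOrder_profile
  obtain ⟨H, G, hH, hG, hΘ⟩ := theta_expansion hS hσ hr hχ
  obtain ⟨C₁, N₁, hC₁, g1⟩ := tg_relation1.c1_le
  obtain ⟨C₂, N₂, hC₂, g2⟩ := (hH.dbd_pow hS 0).c1 hs
  obtain ⟨C₃, N₃, hC₃, g3⟩ := hG.c1 hs
  have dq := DBd.of_tg (S := S) (e := fun i => i.1) (x := fun i => i.2.2) tg_quarter hJ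
  have dL := dbd_relLog hS hr
  have two : Bd S (fun i => i.1) wt 0 fun _ => 2 := .const 2
  have bβ : Bd S (fun i => i.1) wt 0 fun i => 1 + |log (1 / i.1)| := (Bd.weight hs).of_abs_le fun i _ => by
    have := abs_nonneg (log (1 / i.1))
    have := norm_nonneg i.2.2
    rw [abs_of_nonneg (a := 1 + |log (1 / i.1)|) (by positivity), abs_of_nonneg (a := wt i) (by rw [wt]; positivity), wt]
    nlinarith
  have bQ := (((bβ.mul hs ((two.add hs dq.2.1).pow hs (Na + Nb))).mul hs ((dL.c1 hs).mul hs (two.add hs (dq.c1 hs))))).mono hs (l := 1) (by norm_num)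
  obtain ⟨C₄, N₄, hC₄, g4⟩ := bQ
  have lift : ∀ {C : ℝ} {n : ℕ} {w : ℝ}, 0 ≤ C → 1 ≤ w → C ≤ C₁ + C₂ + C₃ + C₄ → n ≤ N₁ + N₂ + N₃ + N₄ →
      C * w ^ n ≤ (C₁ + C₂ + C₃ + C₄) * w ^ (N₁ + N₂ + N₃ + N₄) := fun h0 hw h1 h2 =>
    mul_le_mul h1 (pow_le_pow_right₀ hw h2) (by positivity) (h0.trans h1)
  refine ⟨C₁ + C₂ + C₃ + C₄, N₁ + N₂ + N₃ + N₄, by positivity, fun Φa Φb hΦ => ?_⟩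
  have e := hΦ.eq_profile hκ
  have fa := IsPhi2.contDiff hΦ.regA
  have fb := IsPhi2.contDiff hΦ.regB
  obtain ⟨Ma, hMa, ma⟩ := profile_growth (κ := fun _ => 1 / (4 * π)) (κ₁ := fun _ => 0) (κ₂ := fun _ => 0) (C := 0) (N := Na + Nb) fa
    (fun x => hasDerivAt_const x _) (fun x => hasDerivAt_const x _) (by simp) (by simp) le_rfl fun x hx => (e x hx).1
  obtain ⟨Mb, hMb, mb⟩ := profile_growth (C := Ca + Cb) (N := Na + Nb) fb k1 k2
    (fun x hx => (ba x hx).trans (mul_le_mul (by linarith) (pow_le_pow_right₀ (by linarith) (by omega)) (by positivity) (by positivity)))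
    (fun x hx => (bb x hx).trans (mul_le_mul (by linarith) (pow_le_pow_right₀ (by linarith) (by omega)) (by positivity) (by positivity)))
    (by positivity) fun x hx => (e x hx).2
  refine ⟨Ma + Mb, by positivity, fun i hi Γ r₀ rb W hW => ?_⟩
  obtain ⟨c, hc⟩ := hΘ Φa Φb hΦ i hi Γ r₀ rb
  have h0 := (hS hi).1
  have h1 := (hS hi).2.1
  have hδ := (hS hi).2.2.1
  have w1 := hs.one_le i hi
  have s1 := one_le_jb i.2.2
  have hL1 := abs_relLog_le (hr i hi)
  obtain ⟨da, qa⟩ := c1_profile_le fa hMa ma (dL.1 i hi) hL1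
  obtain ⟨db, qb⟩ := c1_profile_le fb hMb mb (dL.1 i hi) hL1
  have dH : DifferentiableAt ℝ (H (log (1 / i.1)) i.2.1) i.2.2 := (hH.mem isLin_tg _ _).diff _
  have dG := hG.1 i hi
  have dr := tg_relation1.diff i.2.2
  have hy : HasFDerivAt (fun X : ℝ² => i.1 * X.1) (lin i.1 0) i.2.2 :=
    ((hasFDerivAt_cR i.2.2).const_mul i.1).congr_fderiv (by ext <;> simp [lin_apply])
  have dV : HasFDerivAt (fun X : ℝ² => 2 * (i.1 * X.1) + (i.1 * X.1) ^ 2) (lin (2 * i.1 + 2 * (i.1 * i.2.2.1) * i.1) 0) i.2.2 :=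
    ((hy.const_mul 2).add (hy.pow 2)).congr_fderiv (by ext <;> simp [lin_apply])
  have cV : c1 (fun X : ℝ² => 2 * (i.1 * X.1) + (i.1 * X.1) ^ 2) i.2.2 ≤ 7 * i.1 * ⟪i.2.2⟫ ^ 2 := by
    rw [c1_of_hasFDerivAt dV, abs_zero, add_zero]
    have a1 : |i.2.2.1| ≤ ‖i.2.2‖ := norm_fst_le i.2.2
    have a2 : |i.1 * i.2.2.1| ≤ i.1 * ‖i.2.2‖ := by rw [abs_mul, abs_of_pos h0]; exact mul_le_mul_of_nonneg_left a1 h0.le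
    have a3 := abs_add_le (2 * (i.1 * i.2.2.1)) ((i.1 * i.2.2.1) ^ 2)
    have a4 := abs_add_le (2 * i.1) (2 * (i.1 * i.2.2.1) * i.1)
    rw [abs_mul, abs_two, abs_pow] at a3
    rw [abs_mul 2 i.1, abs_mul, abs_mul, abs_two, abs_of_pos h0] at a4
    have a5 : |i.1 * i.2.2.1| ^ 2 ≤ i.1 * ‖i.2.2‖ ^ 2 := by
      calc _ ≤ (i.1 * ‖i.2.2‖) ^ 2 := pow_le_pow_left₀ (abs_nonneg _) a2 2
        _ = i.1 * (i.1 * ‖i.2.2‖ ^ 2) := by ring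
        _ ≤ i.1 * ‖i.2.2‖ ^ 2 := mul_le_mul_of_nonneg_left (mul_le_of_le_one_left (sq_nonneg _) h1) h0.le
    have a6 : |i.1 * i.2.2.1| * i.1 ≤ i.1 * ‖i.2.2‖ := (mul_le_of_le_one_right (abs_nonneg _) h1).trans a2
    have a7 : 0 ≤ i.1 * ‖i.2.2‖ := by positivity
    nlinarith [mul_nonneg h0.le (sq_nonneg ‖i.2.2‖)]
  have u₁ := dr.const_mul (i.1 * i.2.1)
  have u₂ := dH.const_mul (i.1 ^ 2 * i.2.1)
  have u₄ := dV.differentiableAt.const_mul (-(rb * zDotStar Γ r₀ i.2.1 i.1 / (2 * Γ) - b0 (log (1 / i.1)) / 2))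
  have u₅ := da.const_mul (-(i.1 ^ 2 * log (1 / i.1)))
  have u₆ := db.const_mul (-i.1 ^ 2)
  have D := hasFDerivAt_lin (((((u₁.add u₂).add dG).add u₄).add u₅).add u₆)
  have D' := (D.const_add c).congr_of_eventuallyEq hc
  refine ⟨D'.differentiableAt, ?_⟩
  rw [dR_lin D', dZ_lin D']
  have hW0 : 0 ≤ W := (abs_nonneg _).trans hW
  have b1 := (c1_const_mul_le (i.1 * i.2.1) dr).trans (mul_le_mul_of_nonneg_left
    ((g1 i.2.2).trans (lift hC₁ s1 (by linarith) (by omega))) (abs_nonneg _))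
  have b2 : c1 (H (log (1 / i.1)) i.2.1) i.2.2 ≤ C₂ * wt i ^ N₂ := by simpa only [pow_zero, one_mul, mul_one] using (le_abs_self _).trans (g2 i hi)
  replace b2 := (c1_const_mul_le (i.1 ^ 2 * i.2.1) dH).trans (mul_le_mul_of_nonneg_left (b2.trans (lift hC₂ w1 (by linarith) (by omega))) (abs_nonneg _))
  have b3 : c1 (G i) i.2.2 ≤ i.1 ^ 3 * (C₃ * wt i ^ N₃) := ((le_abs_self _).trans (g3 i hi)).trans_eq (by ring)
  replace b3 := b3.trans (mul_le_mul_of_nonneg_left (lift hC₃ w1 (by linarith) (by omega)) (by positivity))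
  have b4 := (c1_const_mul_le (-(rb * zDotStar Γ r₀ i.2.1 i.1 / (2 * Γ) - b0 (log (1 / i.1)) / 2)) dV.differentiableAt).trans
    (mul_le_mul (by rwa [abs_neg]) cV (c1_nonneg _ _) hW0)
  have bq : (1 + |log (1 / i.1)|) * ((2 + quarter i.2.2) ^ (Na + Nb) * (c1 (relLog i) i.2.2 * (2 + c1 quarter i.2.2)))
      ≤ i.1 * ((C₁ + C₂ + C₃ + C₄) * wt i ^ (N₁ + N₂ + N₃ + N₄)) := by
    refine le_trans ?_ (mul_le_mul_of_nonneg_left (lift hC₄ w1 (by linarith) (le_add_self : N₄ ≤ _)) h0.le)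
    calc _ = _ := by rw [← mul_assoc]
      _ ≤ _ := (le_abs_self _).trans (g4 i hi)
      _ = _ := by ring
  have b5 := (c1_const_mul_le (-(i.1 ^ 2 * log (1 / i.1))) da).trans (mul_le_mul_of_nonneg_left qa (abs_nonneg _))
  have b6 := (c1_const_mul_le (-i.1 ^ 2) db).trans (mul_le_mul_of_nonneg_left qb (abs_nonneg _))
  have tot := (c1_add_le ((((u₁.add u₂).add dG).add u₄).add u₅) u₆).trans (add_le_add
    ((c1_add_le (((u₁.add u₂).add dG).add u₄) u₅).trans (add_le_add ((c1_add_le ((u₁.add u₂).add dG) u₄).trans (add_le_add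
    ((c1_add_le (u₁.add u₂) dG).trans (add_le_add ((c1_add_le u₁ u₂).trans (add_le_add b1 b2)) b3)) b4)) b5)) b6)
  rw [abs_of_nonneg (mul_nonneg h0.le hδ), abs_of_nonneg (a := i.1 ^ 2 * i.2.1) (by positivity), abs_neg, abs_neg, abs_mul,
    abs_of_nonneg (a := i.1 ^ 2) (by positivity)] at tot
  set Q := (2 + quarter i.2.2) ^ (Na + Nb) * (c1 (relLog i) i.2.2 * (2 + c1 quarter i.2.2))
  have hQ0 : 0 ≤ Q := by
    have := quarter_nonneg i.2.2
    have := c1_nonneg (relLog i) i.2.2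
    have := c1_nonneg quarter i.2.2
    positivity
  set E := (C₁ + C₂ + C₃ + C₄) * wt i ^ (N₁ + N₂ + N₃ + N₄)
  have last : i.1 ^ 2 * |log (1 / i.1)| * (Ma * Q) + i.1 ^ 2 * (Mb * Q) ≤ (Ma + Mb) * (i.1 ^ 3 * E) := by
    have m0 : 0 ≤ (Ma + Mb) * i.1 ^ 2 := by positivity
    have p1 : 0 ≤ i.1 ^ 2 * Ma * Q := by positivity
    have p2 : 0 ≤ i.1 ^ 2 * |log (1 / i.1)| * (Mb * Q) := by positivity
    calc _ ≤ (Ma + Mb) * i.1 ^ 2 * ((1 + |log (1 / i.1)|) * Q) := by nlinarith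
      _ ≤ (Ma + Mb) * i.1 ^ 2 * (i.1 * E) := mul_le_mul_of_nonneg_left bq m0
      _ = _ := by ring
  have drop : ∀ f : ℝ² → ℝ, |dR f i.2.2| + |dZ f i.2.2| ≤ c1 f i.2.2 := fun f => by rw [c1]; linarith [abs_nonneg (f i.2.2)]
  refine (drop _).trans (le_trans tot ?_)
  linarith

lemma exists_rpow_le {a c : ℝ} (ha : 0 < a) (hc : 0 < c) : ∃ ε₀, 0 < ε₀ ∧ ∀ ε, 0 < ε → ε < ε₀ → ε ^ a ≤ c :=
  ⟨c ^ a⁻¹, rpow_pos_of_pos hc _, fun ε h0 h => by simpa [← rpow_mul hc.le, inv_mul_cancel₀ ha.ne'] using rpow_le_rpow h0.le h.le ha.le⟩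

lemma exists_region {σ₀ : ℝ} (h0 : 0 < σ₀) (h1 : σ₀ < 1) : ∃ σ₁, 0 < σ₁ ∧ σ₁ < σ₀ ∧ ∃ ε₀, 0 < ε₀ ∧ ε₀ ≤ 1 ∧
    ∀ (ε δ : ℝ) (X : ℝ²), 0 < ε → ε < ε₀ → 0 ≤ δ → δ ≤ 1 → rho X ≤ ε ^ (-σ₁) → (ε, δ, X) ∈ {i ∈ admissible σ₀ | |relPert i i.2.2| ≤ 1 / 4} := by
  obtain ⟨C, N, hC, h⟩ := (dbd_relPert (S := admissible σ₀) subset_rfl).2.1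
  obtain ⟨K, hK, hl⟩ := exists_log_bound N (show (0 : ℝ) < 1 / 4 by norm_num)
  obtain ⟨σ₁, s0, s1, s2⟩ : ∃ σ₁, 0 < σ₁ ∧ σ₁ < σ₀ ∧ σ₁ * N ≤ 1 / 2 := by
    refine ⟨min (σ₀ / 2) (1 / (2 * (N + 1))), lt_min (by positivity) (by positivity), (min_le_left _ _).trans_lt (by linarith), ?_⟩
    refine (mul_le_mul_of_nonneg_right (min_le_right _ _) N.cast_nonneg).trans ?_
    rw [div_mul_eq_mul_div, div_le_iff₀ (by positivity)]; linarith
  obtain ⟨e₁, p₁, q₁⟩ := exists_rpow_le (sub_pos.2 h1) (show (0 : ℝ) < 1 / 16 by norm_num)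
  obtain ⟨e₂, p₂, q₂⟩ := exists_rpow_le (show (0 : ℝ) < 1 / 4 by norm_num) (show 0 < 1 / (4 * (C * 2 ^ N * K + 1)) by positivity)
  refine ⟨σ₁, s0, s1, min 1 (min e₁ e₂), lt_min one_pos (lt_min p₁ p₂), min_le_left _ _, fun ε δ X hε hε0 hδ hδ1 hX => ?_⟩
  obtain ⟨l0, l12⟩ := lt_min_iff.1 hε0
  obtain ⟨l1, l2⟩ := lt_min_iff.1 l12
  have adm : (ε, δ, X) ∈ admissible σ₀ := by
    refine ⟨hε, l0.le, hδ, hδ1, q₁ ε hε l1, ?_⟩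
    calc ε ^ σ₀ * rho X ≤ ε ^ σ₀ * ε ^ (-σ₁) := mul_le_mul_of_nonneg_left hX (rpow_nonneg hε.le _)
      _ = ε ^ (σ₀ - σ₁) := by rw [← rpow_add hε, sub_eq_add_neg]
      _ < 1 := rpow_lt_one hε.le l0 (by linarith)
  refine ⟨adm, ?_⟩
  have t1 : 1 ≤ ε ^ (-σ₁) := one_le_rpow_of_pos_of_le_one_of_nonpos hε l0.le (by linarith)
  have t2 : 1 + ‖X‖ ≤ 2 * ε ^ (-σ₁) := by linarith [show ‖X‖ ≤ rho X from norm_le_rho X]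
  set b := 1 + |log (1 / ε)| with hb
  calc |relPert (ε, δ, X) X| ≤ C * ε ^ 1 * (b * ⟪X⟫) ^ N := h _ adm
    _ ≤ C * ε ^ 1 * (b * (2 * ε ^ (-σ₁))) ^ N := by gcongr
    _ = C * 2 ^ N * (ε * (ε ^ (-σ₁)) ^ N * b ^ N) := by rw [mul_pow, mul_pow]; ring
    _ ≤ C * 2 ^ N * (ε ^ (1 / 4 : ℝ) * K) := by
      refine mul_le_mul_of_nonneg_left ?_ (by positivity)
      have e : ε * (ε ^ (-σ₁)) ^ N ≤ ε ^ (1 / 4 : ℝ) * ε ^ (1 / 4 : ℝ) := by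
        rw [← rpow_mul_natCast hε.le, ← rpow_add hε]
        nth_rewrite 1 [← rpow_one ε]
        rw [← rpow_add hε]
        exact rpow_le_rpow_of_exponent_ge hε l0.le (by linarith)
      calc _ ≤ ε ^ (1 / 4 : ℝ) * ε ^ (1 / 4 : ℝ) * b ^ N := mul_le_mul_of_nonneg_right e (by positivity)
        _ = ε ^ (1 / 4 : ℝ) * (ε ^ (1 / 4 : ℝ) * b ^ N) := by ring
        _ ≤ _ := mul_le_mul_of_nonneg_left (hl ε hε l0.le) (rpow_nonneg hε.le _)
    _ ≤ C * 2 ^ N * (1 / (4 * (C * 2 ^ N * K + 1)) * K) := mul_le_mul_of_nonneg_left (mul_le_mul_of_nonneg_right (q₂ ε hε l2) hK) (by positivity)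
    _ ≤ 1 / 4 := by
      have : 0 ≤ C * 2 ^ N * K := by positivity
      rw [div_mul_eq_mul_div, mul_div_assoc', div_le_iff₀ (by positivity)]
      linarith

lemma collect_errors {ε δ γ b j J C M D K L : ℝ} {N P : ℕ} (hε : 0 < ε) (hδ : 0 ≤ δ) (hb : 1 ≤ b) (hj : 1 ≤ j) (hJ : j ≤ J)
    (hC : 0 ≤ C) (hM : 0 ≤ M) (hD : 0 ≤ D) (hK : ε ^ (3 - γ) * b ^ (N + P + 2) ≤ K) (hL : ε * b ^ (N + P + 2) ≤ L) :
    ε * δ * (C * j ^ N) + ε ^ 2 * δ * (C * (b * j) ^ N) + ε ^ 3 * (C * (b * j) ^ N) + D * ε ^ 2 * b ^ P * (7 * ε * j ^ 2)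
      + M * (ε ^ 3 * (C * (b * j) ^ N)) ≤
    (C + C * L + K * (C + M * C + 7 * D) + 1) * (ε * δ + ε ^ γ) * J ^ (N + P + 2) := by
  have hj0 : 0 ≤ j := by linarith
  have hγ := rpow_pos_of_pos hε γ
  have e3 : ε ^ 3 * b ^ (N + P + 2) ≤ ε ^ γ * K := by
    rw [show ε ^ 3 = ε ^ γ * ε ^ (3 - γ) by rw [← rpow_add hε, add_sub_cancel]; norm_cast, mul_assoc]
    exact mul_le_mul_of_nonneg_left hK hγ.le
  have jJ : ∀ m ≤ N + P + 2, j ^ m ≤ J ^ (N + P + 2) := fun m hm => (pow_le_pow_left₀ hj0 hJ m).trans (pow_le_pow_right₀ (hj.trans hJ) hm)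
  have bb : ∀ m ≤ N + P + 2, b ^ m ≤ b ^ (N + P + 2) := fun m hm => pow_le_pow_right₀ hb hm
  have bj : (b * j) ^ N ≤ b ^ (N + P + 2) * J ^ (N + P + 2) := by
    rw [mul_pow]; exact mul_le_mul (bb N (by omega)) (jJ N (by omega)) (by positivity) (by positivity)
  set B := b ^ (N + P + 2)
  have hJ0 : 0 ≤ J ^ (N + P + 2) := pow_nonneg (hj0.trans hJ) _
  set Y := J ^ (N + P + 2)
  have hB : 0 ≤ B := by positivity
  have hL0 : 0 ≤ L := le_trans (by positivity) hL
  have hK0 : 0 ≤ K := le_trans (mul_nonneg (rpow_nonneg hε.le _) hB) hK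
  have t1 : ε * δ * (C * j ^ N) ≤ C * (ε * δ) * Y := by
    calc _ = C * (ε * δ) * j ^ N := by ring
      _ ≤ _ := mul_le_mul_of_nonneg_left (jJ N (by omega)) (by positivity)
  have t2 : ε ^ 2 * δ * (C * (b * j) ^ N) ≤ C * L * (ε * δ) * Y := by
    calc _ ≤ ε ^ 2 * δ * (C * (B * Y)) := by gcongr
      _ = C * (ε * δ) * Y * (ε * B) := by ring
      _ ≤ C * (ε * δ) * Y * L := mul_le_mul_of_nonneg_left hL (by positivity)
      _ = _ := by ring
  have t3 : ε ^ 3 * (C * (b * j) ^ N) ≤ K * C * ε ^ γ * Y := by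
    calc _ ≤ ε ^ 3 * (C * (B * Y)) := by gcongr
      _ = C * Y * (ε ^ 3 * B) := by ring
      _ ≤ C * Y * (ε ^ γ * K) := mul_le_mul_of_nonneg_left e3 (by positivity)
      _ = _ := by ring
  have t4 : D * ε ^ 2 * b ^ P * (7 * ε * j ^ 2) ≤ K * (7 * D) * ε ^ γ * Y := by
    calc _ ≤ D * ε ^ 2 * B * (7 * ε * Y) := by
          have := bb P (by omega)
          have := jJ 2 (by omega)
          gcongr
      _ = 7 * D * Y * (ε ^ 3 * B) := by ring
      _ ≤ 7 * D * Y * (ε ^ γ * K) := mul_le_mul_of_nonneg_left e3 (by positivity)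
      _ = _ := by ring
  have t5 := mul_le_mul_of_nonneg_left t3 hM
  have r1 : 0 ≤ (C * L + C + 1) * ε ^ γ * Y := by positivity
  have r2 : 0 ≤ (K * (C + M * C + 7 * D) + 1) * (ε * δ) * Y := by positivity
  nlinarith

lemma theta_bound (σ₀ : ℝ) (hσ₀ : 0 < σ₀) (hσ₀' : σ₀ < 1) (χ₀ : ℝ → ℝ) (hχ₀ : IsCutoff χ₀) :
    ∃ σ₁ : ℝ, 0 < σ₁ ∧ σ₁ < σ₀ ∧ ∃ N : ℕ, ∀ Φa Φb : ℝ → ℝ, IsPhi2 Φa Φb → ∀ γ₃ : ℝ, γ₃ < 3 → ∃ C : ℝ, 0 < C ∧ ∃ ε₀ : ℝ, 0 < ε₀ ∧ ∃ δ₀ : ℝ, 0 < δ₀ ∧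
        ∀ Γ r₀ ν T : ℝ, 0 < Γ → 0 < r₀ → 0 < ν →
        ∀ rbar : ℝ → ℝ, IsRadius Γ r₀ ν T rbar →
        ∀ t ∈ Set.Ioo 0 T, ∀ δ ε : ℝ, δ = ν / Γ → ε = √(ν * t) / rbar t → δ < δ₀ → ε < ε₀ → ∀ X : ℝ², rho X ≤ ε ^ (-σ₁) →
            DifferentiableAt ℝ (Theta σ₀ χ₀ Φa Φb Γ r₀ δ ε (rbar t)) X ∧
            |dR (Theta σ₀ χ₀ Φa Φb Γ r₀ δ ε (rbar t)) X| + |dZ (Theta σ₀ χ₀ Φa Φb Γ r₀ δ ε (rbar t)) X| ≤ C * (ε * δ + ε ^ γ₃) * (1 + rho X) ^ N := by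
  obtain ⟨σ₁, s0, s1, e₁, p₁, p₁', reg⟩ := exists_region hσ₀ hσ₀'
  obtain ⟨C, N, hC, hg⟩ := theta_gradient (S := {i ∈ admissible σ₀ | |relPert i i.2.2| ≤ 1 / 4}) (sep_subset _ _) hσ₀
    (fun i hi => hi.2) hχ₀
  obtain ⟨e₂, D, P, p₂, hD, hv⟩ := speed_bound
  refine ⟨σ₁, s0, s1, N + P + 2, fun Φa Φb hΦ γ hγ => ?_⟩
  obtain ⟨M, hM, hT⟩ := hg Φa Φb hΦ
  obtain ⟨K, hK, hk⟩ := exists_log_bound (N + P + 2) (sub_pos.2 hγ)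
  obtain ⟨L, hL, hl⟩ := exists_log_bound (N + P + 2) one_pos
  refine ⟨C + C * L + K * (C + M * C + 7 * D) + 1, by positivity, min e₁ e₂, lt_min p₁ p₂, 1, one_pos, ?_⟩
  intro Γ r₀ ν T hΓ hr hν rbar hR t ht δ ε hδ hε hδ1 hε0 X hX
  have ε0 : 0 < ε := by rw [hε]; exact div_pos (sqrt_pos.2 (mul_pos hν ht.1)) (hR.pos t ht)
  have δ0 : 0 ≤ δ := by rw [hδ]; positivity
  obtain ⟨l1, l2⟩ := lt_min_iff.1 hε0
  have ε1 : ε ≤ 1 := l1.le.trans p₁'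
  obtain ⟨d, h⟩ := hT (ε, δ, X) (reg ε δ X ε0 l1 δ0 hδ1.le hX) Γ r₀ (rbar t) _
    (hv Γ r₀ ν T hΓ hr hν rbar hR t ht δ ε hδ hε hδ1.le l2)
  refine ⟨d, h.trans (collect_errors ε0 δ0 (by linarith [abs_nonneg (log (1 / ε))]) (one_le_jb X)
    (by linarith [show ‖X‖ ≤ rho X from norm_le_rho X]) hC hM hD (hk ε ε0 ε1) ?_)⟩
  simpa using hl ε ε0 ε1

end VortexRing

end

theorem proposition3p10 (σ₀ : ℝ) (hσ₀ : 0 < σ₀) (hσ₀' : σ₀ < 1)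
    (χ₀ : ℝ → ℝ) (hχ₀ : VortexRing.IsCutoff χ₀) :
    (∃ Φa Φb : ℝ → ℝ, VortexRing.IsPhi2 Φa Φb) ∧
    ∃ σ₁ : ℝ, 0 < σ₁ ∧ σ₁ < σ₀ ∧ ∃ N : ℕ,
      ∀ Φa Φb : ℝ → ℝ, VortexRing.IsPhi2 Φa Φb →
      ∀ γ₃ : ℝ, γ₃ < 3 →
      ∃ C : ℝ, 0 < C ∧ ∃ ε₀ : ℝ, 0 < ε₀ ∧ ∃ δ₀ : ℝ, 0 < δ₀ ∧
        ∀ Γ r₀ ν T : ℝ, 0 < Γ → 0 < r₀ → 0 < ν →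
        ∀ rbar : ℝ → ℝ, VortexRing.IsRadius Γ r₀ ν T rbar →
        ∀ t ∈ Set.Ioo 0 T, ∀ δ ε : ℝ, δ = ν / Γ → ε = √(ν * t) / rbar t →
          δ < δ₀ → ε < ε₀ →
          ∀ X : ℝ × ℝ, VortexRing.rho X ≤ ε ^ (-σ₁) →
            DifferentiableAt ℝ (VortexRing.Theta σ₀ χ₀ Φa Φb Γ r₀ δ ε (rbar t)) X ∧
            |VortexRing.dR (VortexRing.Theta σ₀ χ₀ Φa Φb Γ r₀ δ ε (rbar t)) X|
                + |VortexRing.dZ (VortexRing.Theta σ₀ χ₀ Φa Φb Γ r₀ δ ε (rbar t)) X|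
              ≤ C * (ε * δ + ε ^ γ₃) * (1 + VortexRing.rho X) ^ N :=
  ⟨VortexRing.exists_isPhi2, VortexRing.theta_bound σ₀ hσ₀ hσ₀' χ₀ hχ₀⟩
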